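/- **Setting.** Let $E$ be a product of a position space and a velocity space, with a $\sigma$-finite product reference measure $dz$, and let $\pi$ be a probability measure on $E$ with density $\pi(z)$. The exact process is a PDMP on $E$ with flow $(\Phi_t)_{t\in\mathbb R}$, event rate $\lambda$ (integrable over bounded times along the flow) and jumps $z\mapsto \xi_z(v)$, where $\xi_z:V\to E$ is injective and the mark $v$ has a probability density $\nu_z$ with respect to a $\sigma$-finite measure $\lambda_V$ on $V$. The backward process has flow $\Phi_{-t}$, rate $\lambda^r$, and jumps $\xi^r_z$ with mark densities $\nu^r_z$ on $(V^r,\lambda_{V^r})$. A path on $[0,t]$ is a skeleton $(z_0,(\tau_1,v_1),\dots,(\tau_k,v_k))$ (initial state, event times, marks), and path spaces carry the sum over $k$ of the product measures. Every forward jump is undone by a backward jump and conversely, so that running a path on $[0,t]$ backwards is a bijection $R_t$ from forward paths to backward paths. Assume that $R_t$ has a volume change $\psi_t>0$, i.e. $\int f(R_t w)\,dw=\int f(w')\psi_t(w')\,dw'$, and that for each fixed path $t\mapsto R_t(w)$ and $t\mapsto\psi_t(w')$ are continuous for $t$ from the last event time of the path (included) on. Put $\Psi_t(w)=1/\psi_t(R_t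 w)$. The approximate forward and backward processes have the same flows, jumps and mark densities, but their event rate at time $s$ after the last event is an arbitrary measurable function of $s$, of the state at time $0$ and of the events since time $0$, with finite integral over bounded times. Let $q_{[0,t]}(\cdot\mid z)$ and $q^r_{[-t,0]}(\cdot\mid z)$ be the densities of the approximate forward and backward paths of duration $t$ from $z$. The stopping criterion is a measurable property of finite paths that passes from an interval to its subintervals and that depends only on the points where events occur (up to a time shift, and on whether an extremity of the interval is an event). **Algorithm.** From $z=(x,v)$: (1) Refresh the velocity: replace $v$ by a random velocity by means of a Markov kernel that keeps $x$ and leaves $\pi$ invariant (for example, draw $v$ from its conditional law given $x$). (2) Draw $\alpha\sim\mathrm{Unif}(0,1)$. (3) Simulate the approximate process from the current state $Z_0$ forward and, independently, backward in time, giving $(Z_t)_{t\in\mathbb R}$. Let $T=\sup\{t\ge 0:\ (Z_s)_{s\in[-\alpha t,(1-\alpha)t]}\text{ is valid}\}$, $X=(Z_{t-\alpha T})_{t\in[0,T]}$ and $l=\alpha T$. (4) Propose $l'\in[0,T]$ with density proportional to $(T-t)/T^2$ if the criterion was hit going forward and to $t/T^2$ otherwise. (5) Accept $l'$ with probability $1\wedge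 \dfrac{r(l')}{r(l)}$, where $$r(l)=\pi(X_{l})\,q^r_{[-l,0]}\big((X_{t+l})_{t\in[-l,0]}\mid X_{l}\big)\,q_{[0,T-l]}\big((X_{t+l})_{t\in[0,T-l]}\mid X_{l}\big)\,\Psi_{l}(X_{[0,l]}),$$ and otherwise set $l'=l$. (6) Output $X_{l'}$. (By convention the output is the refreshed state if there is no finite $T>0$ as above, or the simulated trajectory is not defined on $[-\alpha T,(1-\alpha)T]$.) **Theorem.** 1. The algorithm defines a Markov chain on $E$ with $\pi$ as an invariant distribution. (Neither invariance of $\pi$ for the exact process nor closeness of the approximation is assumed.) 2. Suppose moreover that $\pi$ is invariant for the exact process, that the backward process is its time-reversal (for each $t>0$, the image under $R_t$ of the law of the exact forward path on $[0,t]$ started from $\pi$ is the law of the backward path on $[0,t]$ started from $\pi$), and that the approximate rates are those of the exact forward process and of its time-reversal. Then the acceptance probability is $1$: for $\pi$-almost every input state, almost surely, if the construction of the path stops then $l'$ is accepted with probability $1$. -/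

import Mathlib

open MeasureTheory ProbabilityTheory Set
open scoped ENNReal NNReal

namespace PathSampler

noncomputable section

/-! ## Finite sequences of arbitrary length as a measurable space -/

/-- The disjoint-union sigma-algebra on finite lists: a set of lists is measurable when, for each
length `n`, its trace on `n`-tuples is measurable. -/
instance listMeasurableSpace {α : Type*} [MeasurableSpace α] : MeasurableSpace (List α) :=
  ⨅ n : ℕ, MeasurableSpace.map (fun e : Fin n → α => List.ofFn e) inferInstance

section Lists

variable {E α β S : Type*} [MeasurableSpace E] [MeasurableSpace α] [MeasurableSpace β]
  [MeasurableSpace S]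

theorem measurableSet_list {A : Set (List α)} :
    MeasurableSet A ↔ ∀ n : ℕ, MeasurableSet ((fun e : Fin n → α => List.ofFn e) ⁻¹' A) := by
  simp only [MeasurableSpace.measurableSet_iInf, MeasurableSpace.map_def]

theorem measurable_ofFn (n : ℕ) : Measurable (fun e : Fin n → α => List.ofFn e) :=
  fun _ hA => measurableSet_list.1 hA n

theorem measurableEmbedding_ofFn (n : ℕ) :
    MeasurableEmbedding (fun e : Fin n → α => List.ofFn e) where
  injective := List.ofFn_injective
  measurable := measurable_ofFn n
  measurableSet_image' := by
    intro A hA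
    rw [measurableSet_list]
    intro m
    by_cases h : m = n
    · subst h
      rwa [Set.preimage_image_eq _ List.ofFn_injective]
    · convert MeasurableSet.empty
      ext e
      simp only [Set.mem_preimage, Set.mem_image, Set.mem_empty_iff_false, iff_false, not_exists,
        not_and]
      intro e' _ he
      have := congrArg List.length he
      simp only [List.length_ofFn] at this
      exact h this.symm

theorem measurable_of_ofFn {f : E × List α → β}
    (hf : ∀ n : ℕ, Measurable fun p : E × (Fin n → α) => f (p.1, List.ofFn p.2)) :
    Measurable f := by
  intro A hA
  have key : f ⁻¹' A = ⋃ n : ℕ, Prod.map id (fun e : Fin n → α => List.ofFn e) ''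
      ((fun p : E × (Fin n → α) => f (p.1, List.ofFn p.2)) ⁻¹' A) := by
    ext ⟨z, l⟩
    simp only [Set.mem_preimage, Set.mem_iUnion, Set.mem_image, Prod.exists, Prod.map_apply, id,
      Prod.mk.injEq]
    constructor
    · intro h
      exact ⟨l.length, z, l.get, by simpa using h, rfl, by simp⟩
    · rintro ⟨n, z', e, h, rfl, rfl⟩
      exact h
  rw [key]
  exact MeasurableSet.iUnion fun n =>
    (MeasurableEmbedding.id.prodMap (measurableEmbedding_ofFn n)).measurableSet_image.2 (hf n hA)

theorem measurable_foldl {g : S → α → S} (hg : Measurable (Function.uncurry g)) :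
    Measurable fun p : S × List α => p.2.foldl g p.1 := by
  apply measurable_of_ofFn
  intro n
  induction n with
  | zero => simpa using measurable_fst
  | succ n ih =>
    simp only [List.ofFn_succ, List.foldl_cons]
    have h1 : Measurable fun p : S × (Fin (n + 1) → α) =>
        (g p.1 (p.2 0), fun i : Fin n => p.2 i.succ) := by
      refine Measurable.prodMk ?_ ?_
      · exact hg.comp (measurable_fst.prodMk ((measurable_pi_apply 0).comp measurable_snd))
      · exact measurable_pi_lambda _ fun i => (measurable_pi_apply _).comp measurable_snd
    exact ih.comp h1

theorem measurable_append_singleton :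
    Measurable fun p : List α × α => p.1 ++ [p.2] := by
  have : Measurable fun p : α × List α => p.2 ++ [p.1] := by
    apply measurable_of_ofFn
    intro n
    have h : (fun p : α × (Fin n → α) => List.ofFn p.2 ++ [p.1]) =
        fun p => List.ofFn (Fin.snoc (α := fun _ => α) p.2 p.1) := by
      funext p
      rw [List.ofFn_succ']
      simp
    rw [h]
    refine (measurable_ofFn (n + 1)).comp (measurable_pi_lambda _ fun i => ?_)
    refine Fin.lastCases ?_ (fun j => ?_) i
    · simpa using measurable_fst
    · simp only [Fin.snoc_castSucc]
      exact (measurable_pi_apply j).comp measurable_snd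
  exact this.comp measurable_swap

end Lists

/-! ## Path space -/

/-- A skeleton: the initial state, and the successive events `(time, mark)`. -/
abbrev Skeleton (E V : Type*) := E × List (ℝ × V)

/-- The canonical measure on the path space `E × ⋃ₖ (ℝ × V)ᵏ`: on each piece, the product of the
canonical measures of `E` and `V` and of Lebesgue measure on the event times. -/
def canonicalMeasure {E V : Type*} [MeasurableSpace E] [MeasurableSpace V]
    (μE : Measure E) (μV : Measure V) : Measure (Skeleton E V) :=
  Measure.sum fun k : ℕ =>
    (μE.prod (Measure.pi fun _ : Fin k => (volume : Measure ℝ).prod μV)).map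
      fun p => (p.1, List.ofFn p.2)

/-- The time of the last event (`0` if there is none). -/
def lastTime {V : Type*} (es : List (ℝ × V)) : ℝ := es.foldl (fun _ e => e.1) 0

/-- The paths with all their events, in increasing order of time, in a set `I` of times. -/
def pathsIn (E V : Type*) (I : Set ℝ) : Set (Skeleton E V) :=
  {w | (w.2.map Prod.fst).Pairwise (· < ·) ∧ ∀ e ∈ w.2, e.1 ∈ I}

/-- The events of a list in a set of times, with the clock reset so that time `c` becomes `0`. -/
def eventsIn {V : Type*} (I : Set ℝ) (c : ℝ) (es : List (ℝ × V)) : List (ℝ × V) :=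
  open Classical in (es.filter fun e => decide (e.1 ∈ I)).map fun e => (e.1 - c, e.2)

/-! ## Piecewise-deterministic processes -/

/-- The characteristics of a piecewise-deterministic Markov process on `E` whose jump kernel is
parametrised by marks in `V`: a jump from `z` goes to `jump z v`, where `v` has density `markDensity z`
with respect to `μV` and `jump z` is injective. -/
structure PDMP (E V : Type*) [MeasurableSpace E] [MeasurableSpace V] (μV : Measure V) where
  flow : ℝ → E → E
  flow_zero : ∀ z, flow 0 z = z
  flow_add : ∀ s t z, flow (s + t) z = flow s (flow t z)
  measurable_flow : Measurable fun p : ℝ × E => flow p.1 p.2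
  rate : E → ℝ≥0
  measurable_rate : Measurable rate
  rate_finite : ∀ z t, ∫⁻ s in Ioc 0 t, (rate (flow s z) : ℝ≥0∞) < ∞
  jump : E → V → E
  measurable_jump : Measurable fun p : E × V => jump p.1 p.2
  injective_jump : ∀ z, Function.Injective (jump z)
  markDensity : E → V → ℝ≥0
  measurable_markDensity : Measurable fun p : E × V => markDensity p.1 p.2
  lintegral_markDensity : ∀ z, ∫⁻ v, (markDensity z v : ℝ≥0∞) ∂μV = 1

/-- An event rate to simulate with: `rate w s` is the rate at time `s` after the last event of
`w`, where `w` records the initial state and the events since time `0`. It may depend on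
everything that has been simulated since time `0`, but on nothing else. -/
structure SimRate (E V : Type*) [MeasurableSpace E] [MeasurableSpace V] where
  rate : Skeleton E V → ℝ → ℝ≥0
  measurable_rate : Measurable fun p : Skeleton E V × ℝ => rate p.1 p.2
  rate_finite : ∀ w s, ∫⁻ u in Ioc 0 s, (rate w u : ℝ≥0∞) < ∞

namespace SimRate

variable {E V : Type*} [MeasurableSpace E] [MeasurableSpace V]

/-- The probability of no event within time `s` after the last event of `w`. -/
def survival (A : SimRate E V) (w : Skeleton E V) (s : ℝ) : ℝ≥0∞ :=
  ENNReal.ofReal (Real.exp (-(∫⁻ u in Ioc 0 s, (A.rate w u : ℝ≥0∞)).toReal))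

theorem measurable_survival (A : SimRate E V) :
    Measurable fun p : Skeleton E V × ℝ => A.survival p.1 p.2 := by
  have h : Measurable fun p : Skeleton E V × ℝ =>
      ∫⁻ u in Ioc 0 p.2, (A.rate p.1 u : ℝ≥0∞) := by
    have h2 : (fun p : Skeleton E V × ℝ => ∫⁻ u in Ioc 0 p.2, (A.rate p.1 u : ℝ≥0∞)) =
        fun p => ∫⁻ u, ({q : (Skeleton E V × ℝ) × ℝ | 0 < q.2 ∧ q.2 ≤ q.1.2}.indicator
          (fun q => (A.rate q.1.1 q.2 : ℝ≥0∞))) (p, u) := by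
      funext p
      rw [← lintegral_indicator measurableSet_Ioc]
      rfl
    rw [h2]
    refine Measurable.lintegral_prod_right' (Measurable.indicator ?_ ?_)
    · exact (A.measurable_rate.comp
        ((measurable_fst.comp measurable_fst).prodMk measurable_snd)).coe_nnreal_ennreal
    · exact (measurableSet_lt measurable_const measurable_snd).inter
        (measurableSet_le measurable_snd (measurable_snd.comp measurable_fst))
  exact (h.ennreal_toReal.neg.exp).ennreal_ofReal

/-- The waiting time until the next event has total mass at most one. -/
theorem lintegral_waiting_le_one (A : SimRate E V) (w : Skeleton E V) :
    ∫⁻ s in Ioi (0 : ℝ), (A.rate w s : ℝ≥0∞) * A.survival w s ≤ 1 := by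
  set L : ℝ → ℝ := fun s => (∫⁻ u in Ioc 0 s, (A.rate w u : ℝ≥0∞)).toReal with hL
  have hrm : Measurable fun s => (A.rate w s : ℝ≥0∞) :=
    (A.measurable_rate.comp (measurable_const.prodMk measurable_id)).coe_nnreal_ennreal
  have hmono : Monotone L := fun s t hst =>
    ENNReal.toReal_mono (A.rate_finite w t).ne
      (lintegral_mono_set (Ioc_subset_Ioc_right hst))
  have hL0 : ∀ s, 0 ≤ L s := fun s => ENNReal.toReal_nonneg
  have hexp : ∀ s, A.survival w s =
      ∫⁻ u in Ioi (0 : ℝ), (Ioi (L s)).indicator (fun u => ENNReal.ofReal (Real.exp (-u))) u := by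
    intro s
    rw [lintegral_indicator measurableSet_Ioi, Measure.restrict_restrict measurableSet_Ioi,
      inter_eq_left.2 (Ioi_subset_Ioi (hL0 s)),
      ← ofReal_integral_eq_lintegral_ofReal (integrableOn_exp_neg_Ioi (L s))
        (Filter.Eventually.of_forall fun _ => (Real.exp_pos _).le), integral_exp_neg_Ioi]
    rfl
  have hset : ∀ u : ℝ, ∫⁻ s in Ioi (0 : ℝ), {s | L s < u}.indicator
      (fun s => (A.rate w s : ℝ≥0∞)) s ≤ ENNReal.ofReal u := by
    intro u
    have hm : MeasurableSet {s | L s < u} := measurableSet_lt hmono.measurable measurable_const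
    rw [lintegral_indicator hm, Measure.restrict_restrict hm]
    have hord : {s | L s < u}.OrdConnected := ⟨fun a _ b hb c hc => (hmono hc.2).trans_lt hb⟩
    by_cases hbdd : ∀ s : ℝ, L s < u
    · have hU : {s | L s < u} ∩ Ioi 0 = ⋃ n : ℕ, Ioc (0 : ℝ) n := by
        ext s
        simp only [mem_inter_iff, mem_ofPred_eq, mem_Ioi, mem_iUnion, mem_Ioc]
        constructor
        · rintro ⟨_, h⟩
          obtain ⟨n, hn⟩ := exists_nat_ge s
          exact ⟨n, h, hn⟩
        · rintro ⟨n, h, _⟩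
          exact ⟨hbdd s, h⟩
      rw [hU, setLIntegral_iUnion_of_directed]
      · refine iSup_le fun n => ?_
        rw [← ENNReal.ofReal_toReal (A.rate_finite w n).ne]
        exact ENNReal.ofReal_le_ofReal (hbdd n).le
      · exact (monotone_nat_of_le_succ fun n => Ioc_subset_Ioc_right (by simp)).directed_le
    · push Not at hbdd
      obtain ⟨b, hb⟩ := hbdd
      by_cases hne : ({s | L s < u} ∩ Ioi 0).Nonempty
      swap
      · rw [not_nonempty_iff_eq_empty.1 hne]; simp
      have hub : ∀ s ∈ {s | L s < u}, s ≤ b := fun s hs => by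
        by_contra h
        exact absurd ((hb.trans (hmono (not_le.1 h).le)).trans_lt hs) (lt_irrefl _)
      set c := sSup {s | L s < u} with hc
      have hBA : BddAbove {s | L s < u} := ⟨b, hub⟩
      obtain ⟨s0, hs0, hs0'⟩ := hne
      have hNE : {s | L s < u}.Nonempty := ⟨s0, hs0⟩
      obtain ⟨v, hvm, -, hvt, hv⟩ := exists_seq_tendsto_sSup hNE hBA |>.imp fun v hv =>
        (show Monotone v ∧ True ∧ Filter.Tendsto v Filter.atTop (nhds c) ∧
          ∀ n, v n ∈ {s | L s < u} from ⟨hv.1, trivial, hv.2.1, hv.2.2⟩)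
      have hae : ({s | L s < u} ∩ Ioi 0 : Set ℝ) ≤ᵐ[volume] ⋃ n : ℕ, Ioc (0 : ℝ) (v n) := by
        have hcne : ∀ᵐ s : ℝ ∂volume, s ≠ c := by
          simp [ae_iff]
        filter_upwards [hcne] with s hs hsm
        have hlt : s < c := lt_of_le_of_ne (le_csSup hBA hsm.1) hs
        obtain ⟨n, hn⟩ := (hvt.eventually (lt_mem_nhds hlt)).exists
        exact mem_iUnion.2 ⟨n, hsm.2, hn.le⟩
      calc ∫⁻ s in {s | L s < u} ∩ Ioi 0, (A.rate w s : ℝ≥0∞)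
          ≤ ∫⁻ s in ⋃ n : ℕ, Ioc (0 : ℝ) (v n), (A.rate w s : ℝ≥0∞) :=
            lintegral_mono' (Measure.restrict_mono_ae hae) le_rfl
        _ = ⨆ n, ∫⁻ s in Ioc (0 : ℝ) (v n), (A.rate w s : ℝ≥0∞) :=
            setLIntegral_iUnion_of_directed _
              (Monotone.directed_le fun m n h => Ioc_subset_Ioc_right (hvm h))
        _ ≤ ENNReal.ofReal u := by
            refine iSup_le fun n => ?_
            rw [← ENNReal.ofReal_toReal (A.rate_finite w (v n)).ne]
            exact ENNReal.ofReal_le_ofReal (hv n).le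
  have hJ : Measurable fun p : ℝ × ℝ => (A.rate w p.1 : ℝ≥0∞) *
      (Ioi (L p.1)).indicator (fun u => ENNReal.ofReal (Real.exp (-u))) p.2 := by
    refine (hrm.comp measurable_fst).mul ?_
    have : (fun p : ℝ × ℝ => (Ioi (L p.1)).indicator
        (fun u => ENNReal.ofReal (Real.exp (-u))) p.2) =
        {p : ℝ × ℝ | L p.1 < p.2}.indicator fun p => ENNReal.ofReal (Real.exp (-p.2)) := by
      funext p; rfl
    rw [this]
    exact Measurable.indicator (measurable_snd.neg.exp.ennreal_ofReal)
      (measurableSet_lt (hmono.measurable.comp measurable_fst) measurable_snd)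
  calc ∫⁻ s in Ioi (0 : ℝ), (A.rate w s : ℝ≥0∞) * A.survival w s
      = ∫⁻ s in Ioi (0 : ℝ), ∫⁻ u in Ioi (0 : ℝ), (A.rate w s : ℝ≥0∞) *
          (Ioi (L s)).indicator (fun u => ENNReal.ofReal (Real.exp (-u))) u := by
        refine lintegral_congr fun s => ?_
        rw [hexp s, lintegral_const_mul]
        exact (measurable_neg.exp.ennreal_ofReal).indicator measurableSet_Ioi
    _ = ∫⁻ u in Ioi (0 : ℝ), ∫⁻ s in Ioi (0 : ℝ), (A.rate w s : ℝ≥0∞) *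
          (Ioi (L s)).indicator (fun u => ENNReal.ofReal (Real.exp (-u))) u :=
        lintegral_lintegral_swap hJ.aemeasurable
    _ ≤ ∫⁻ u in Ioi (0 : ℝ), ENNReal.ofReal (Real.exp (-u)) * ENNReal.ofReal u := by
        refine lintegral_mono fun u => ?_
        have : (fun s => (A.rate w s : ℝ≥0∞) *
            (Ioi (L s)).indicator (fun u => ENNReal.ofReal (Real.exp (-u))) u) =
            fun s => ENNReal.ofReal (Real.exp (-u)) *
              {s | L s < u}.indicator (fun s => (A.rate w s : ℝ≥0∞)) s := by
          funext s
          by_cases h : L s < u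
          · simp [indicator, h, mul_comm]
          · simp [indicator, h]
        rw [this, lintegral_const_mul' _ _ ENNReal.ofReal_ne_top]
        gcongr
        exact hset u
    _ = 1 := by
        have hG := Real.GammaIntegral_convergent (s := 2) (by norm_num)
        have h1 : ∫⁻ u in Ioi (0 : ℝ), ENNReal.ofReal (Real.exp (-u)) * ENNReal.ofReal u =
            ∫⁻ u in Ioi (0 : ℝ), ENNReal.ofReal (Real.exp (-u) * u ^ ((2 : ℝ) - 1)) := by
          refine lintegral_congr fun u => ?_
          rw [← ENNReal.ofReal_mul (Real.exp_pos _).le]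
          norm_num
        rw [h1, ← ofReal_integral_eq_lintegral_ofReal hG, ← Real.Gamma_eq_integral (by norm_num)]
        · simp
        · filter_upwards [ae_restrict_mem measurableSet_Ioi] with u hu
          exact mul_nonneg (Real.exp_pos _).le (Real.rpow_nonneg (le_of_lt hu) _)

end SimRate

namespace PDMP

variable {E V : Type*} [MeasurableSpace E] [MeasurableSpace V] {μV : Measure V}

/-- From the state `p.1` at time `p.2`: follow the flow until the event `e`, then jump. -/
def afterEvent (X : PDMP E V μV) (p : E × ℝ) (e : ℝ × V) : E × ℝ :=
  (X.jump (X.flow (e.1 - p.2) p.1) e.2, e.1)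

/-- The state just after the last event of a skeleton, with the time of that event. -/
def last (X : PDMP E V μV) (w : Skeleton E V) : E × ℝ := w.2.foldl X.afterEvent (w.1, 0)

/-- The state at a time `t` that no event of `w` exceeds. -/
def stateAt (X : PDMP E V μV) (w : Skeleton E V) (t : ℝ) : E :=
  X.flow (t - (X.last w).2) (X.last w).1

/-- The state at time `t` of a path that may continue beyond `t`. -/
def position (X : PDMP E V μV) (w : Skeleton E V) (t : ℝ) : E :=
  X.stateAt (w.1, eventsIn (Iic t) 0 w.2) t

/-- The events `(time, mark)` together with the state just before each of them, starting in the
state `p.1` at time `p.2`. -/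
def trace (X : PDMP E V μV) : E × ℝ → List (ℝ × V) → List ((ℝ × V) × E)
  | _, [] => []
  | p, e :: es => (e, X.flow (e.1 - p.2) p.1) :: trace X (X.afterEvent p e) es

/-- The points of a path where events occur: `(time, state before, state after)`. -/
def eventPoints (X : PDMP E V μV) (w : Skeleton E V) : List (ℝ × E × E) :=
  (X.trace (w.1, 0) w.2).map fun a => (a.1.1, a.2, X.jump a.2 a.1.2)

/-- The part of a path on the closed time interval `[c, d]`, as a path on `[0, d - c]`. -/
def subPath (X : PDMP E V μV) (w : Skeleton E V) (c d : ℝ) : Skeleton E V :=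
  (X.stateAt (w.1, eventsIn (Iio c) 0 w.2) c, eventsIn (Icc c d) c w.2)

/-- The density of the next event `e` given the past `w`, when simulating with the rate `A`. -/
def eventDensity (X : PDMP E V μV) (A : SimRate E V) (w : Skeleton E V) (e : ℝ × V) : ℝ≥0∞ :=
  if (X.last w).2 < e.1 then
    A.rate w (e.1 - (X.last w).2) * A.survival w (e.1 - (X.last w).2) *
      X.markDensity (X.stateAt w e.1) e.2
  else 0

/-- The density of having exactly the further events `es` until time `T`, given the past. -/
def futureDensity (X : PDMP E V μV) (A : SimRate E V) (T : ℝ) (z : E) :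
    List (ℝ × V) → List (ℝ × V) → ℝ≥0∞
  | past, [] => A.survival (z, past) (T - (X.last (z, past)).2)
  | past, e :: es =>
      X.eventDensity A (z, past) e * futureDensity X A T z (past ++ [e]) es

/-- The conditional density `q_{[0,T]}(w | w₀)` of a path on `[0, T]` given its initial state. -/
def pathDensity (X : PDMP E V μV) (A : SimRate E V) (T : ℝ) (w : Skeleton E V) : ℝ≥0∞ :=
  X.futureDensity A T w.1 [] w.2

theorem measurable_last (X : PDMP E V μV) : Measurable X.last := by
  have hg : Measurable (Function.uncurry X.afterEvent) := by
    refine Measurable.prodMk ?_ (measurable_fst.comp measurable_snd)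
    have hf : Measurable fun q : (E × ℝ) × (ℝ × V) => X.flow (q.2.1 - q.1.2) q.1.1 :=
      X.measurable_flow.comp (((measurable_fst.comp measurable_snd).sub
        (measurable_snd.comp measurable_fst)).prodMk (measurable_fst.comp measurable_fst))
    exact X.measurable_jump.comp (hf.prodMk (measurable_snd.comp measurable_snd))
  exact (measurable_foldl hg).comp
    ((measurable_fst.prodMk measurable_const).prodMk measurable_snd)

theorem measurable_stateAt (X : PDMP E V μV) :
    Measurable fun p : Skeleton E V × ℝ => X.stateAt p.1 p.2 :=
  X.measurable_flow.comp
    ((measurable_snd.sub (measurable_snd.comp (X.measurable_last.comp measurable_fst))).prodMk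
      (measurable_fst.comp (X.measurable_last.comp measurable_fst)))

theorem measurable_eventDensity (X : PDMP E V μV) (A : SimRate E V) :
    Measurable fun p : Skeleton E V × (ℝ × V) => X.eventDensity A p.1 p.2 := by
  have ht : Measurable fun p : Skeleton E V × (ℝ × V) => p.2.1 :=
    measurable_fst.comp measurable_snd
  have hl : Measurable fun p : Skeleton E V × (ℝ × V) => (X.last p.1).2 :=
    measurable_snd.comp (X.measurable_last.comp measurable_fst)
  have hs : Measurable fun p : Skeleton E V × (ℝ × V) => (p.1, p.2.1 - (X.last p.1).2) :=
    measurable_fst.prodMk (ht.sub hl)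
  refine Measurable.ite (measurableSet_lt hl ht) ?_ measurable_const
  refine Measurable.mul (Measurable.mul ?_ (A.measurable_survival.comp hs)) ?_
  · exact (A.measurable_rate.comp hs).coe_nnreal_ennreal
  · exact (X.measurable_markDensity.comp ((X.measurable_stateAt.comp
      (measurable_fst.prodMk ht)).prodMk (measurable_snd.comp measurable_snd))).coe_nnreal_ennreal

section Simulation

variable [SigmaFinite μV]

/-- The law of the next event; the missing mass is the probability that there is none. -/
def nextEvent (X : PDMP E V μV) (A : SimRate E V) : Kernel (Skeleton E V) (ℝ × V) :=
  Kernel.withDensity (Kernel.const _ ((volume : Measure ℝ).prod μV)) (X.eventDensity A)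

theorem nextEvent_le_one (X : PDMP E V μV) (A : SimRate E V) (w : Skeleton E V) :
    X.nextEvent A w univ ≤ 1 := by
  have hm := X.measurable_eventDensity A
  have hw : Measurable (X.eventDensity A w) := hm.comp (measurable_const.prodMk measurable_id)
  rw [nextEvent, Kernel.withDensity_apply' _ hm, Measure.restrict_univ, Kernel.const_apply,
    lintegral_prod _ hw.aemeasurable]
  have hin : ∀ t : ℝ, ∫⁻ v, X.eventDensity A w (t, v) ∂μV =
      (Ioi (0 : ℝ)).indicator (fun s => (A.rate w s : ℝ≥0∞) * A.survival w s)
        (t - (X.last w).2) := by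
    intro t
    by_cases h : (X.last w).2 < t
    · have hm2 : Measurable fun v => (X.markDensity (X.stateAt w t) v : ℝ≥0∞) :=
        (X.measurable_markDensity.comp
          (measurable_const.prodMk measurable_id)).coe_nnreal_ennreal
      simp only [eventDensity, h, if_true]
      rw [lintegral_const_mul _ hm2, X.lintegral_markDensity, mul_one,
        indicator_of_mem (by simpa using h)]
    · simp only [eventDensity, h, if_false, lintegral_zero]
      rw [indicator_of_notMem (by simpa using h)]
  simp_rw [hin]
  rw [lintegral_sub_right_eq_self (fun t => (Ioi (0 : ℝ)).indicator
    (fun s => (A.rate w s : ℝ≥0∞) * A.survival w s) t), lintegral_indicator measurableSet_Ioi]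
  exact A.lintegral_waiting_le_one w

/-- One step of the simulation. The state is the skeleton simulated so far, with a flag telling
whether further events may come: either the next event is appended, or there is none. -/
def simStep (X : PDMP E V μV) (A : SimRate E V) :
    Kernel (Skeleton E V × Bool) (Skeleton E V × Bool) where
  toFun p := if p.2 = true then
      (X.nextEvent A p.1).map (fun e => ((p.1.1, p.1.2 ++ [e]), true)) +
        (1 - X.nextEvent A p.1 univ) • Measure.dirac (p.1, false)
    else Measure.dirac p
  measurable' := by
    have happ : Measurable fun q : Skeleton E V × (ℝ × V) =>
        (((q.1.1, q.1.2 ++ [q.2]), true) : Skeleton E V × Bool) :=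
      ((measurable_fst.comp measurable_fst).prodMk (measurable_append_singleton.comp
        ((measurable_snd.comp measurable_fst).prodMk measurable_snd))).prodMk measurable_const
    refine Measure.measurable_of_measurable_coe _ fun S hS => ?_
    have h1 : Measurable fun p : Skeleton E V × Bool =>
        X.nextEvent A p.1 ((fun e => ((p.1.1, p.1.2 ++ [e]), true)) ⁻¹' S) := by
      have hfin : IsFiniteKernel (X.nextEvent A) :=
        ⟨1, ENNReal.one_lt_top, X.nextEvent_le_one A⟩
      exact (Kernel.measurable_kernel_prodMk_left (κ := X.nextEvent A) (happ hS)).comp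
        measurable_fst
    have h2 : Measurable fun p : Skeleton E V × Bool =>
        (1 - X.nextEvent A p.1 univ) * S.indicator (fun _ => (1 : ℝ≥0∞)) (p.1, false) := by
      refine Measurable.mul (measurable_const.sub
        (((X.nextEvent A).measurable_coe MeasurableSet.univ).comp measurable_fst)) ?_
      exact (measurable_const.indicator hS).comp (measurable_fst.prodMk measurable_const)
    have h3 : Measurable fun p : Skeleton E V × Bool => S.indicator (fun _ => (1 : ℝ≥0∞)) p :=
      measurable_const.indicator hS
    have hset : MeasurableSet {p : Skeleton E V × Bool | p.2 = true} :=
      measurable_snd (measurableSet_singleton true)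
    have hite : Measurable fun p : Skeleton E V × Bool => if p.2 = true then
        X.nextEvent A p.1 ((fun e => ((p.1.1, p.1.2 ++ [e]), true)) ⁻¹' S) +
          (1 - X.nextEvent A p.1 univ) * S.indicator (fun _ => (1 : ℝ≥0∞)) (p.1, false)
        else S.indicator (fun _ => (1 : ℝ≥0∞)) p := Measurable.ite hset (h1.add h2) h3
    refine (congrArg Measurable (funext fun p => ?_)).mpr hite
    have happ' : Measurable fun e : ℝ × V =>
        (((p.1.1, p.1.2 ++ [e]), true) : Skeleton E V × Bool) :=
      happ.comp (measurable_const.prodMk measurable_id)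
    by_cases hp : p.2 = true
    · simp only [hp, if_true, Measure.add_apply, Measure.smul_apply, smul_eq_mul,
        Measure.map_apply happ' hS, Measure.dirac_apply' _ hS]
      rfl
    · simp only [hp, if_false, Bool.false_eq_true, Measure.dirac_apply' _ hS]
      rfl

instance isMarkovKernel_simStep (X : PDMP E V μV) (A : SimRate E V) :
    IsMarkovKernel (X.simStep A) := by
  refine ⟨fun p => ⟨?_⟩⟩
  have happ' : Measurable fun e : ℝ × V =>
      (((p.1.1, p.1.2 ++ [e]), true) : Skeleton E V × Bool) :=
    (measurable_const.prodMk (measurable_append_singleton.comp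
      (measurable_const.prodMk measurable_id))).prodMk measurable_const
  change (if p.2 = true then
      (X.nextEvent A p.1).map (fun e => ((p.1.1, p.1.2 ++ [e]), true)) +
        (1 - X.nextEvent A p.1 univ) • Measure.dirac (p.1, false)
    else Measure.dirac p) univ = 1
  by_cases hp : p.2 = true
  · simp only [hp, if_true, Measure.add_apply, Measure.smul_apply, smul_eq_mul, measure_univ,
      mul_one, Measure.map_apply happ' MeasurableSet.univ, preimage_univ]
    exact add_tsub_cancel_of_le (X.nextEvent_le_one A p.1)
  · simp only [hp]
    simp

end Simulation

end PDMP

/-- The successive states of the simulation of a trajectory on `[0, ∞)`. -/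
abbrev Trajectory (E V : Type*) := ℕ → Skeleton E V × Bool

namespace Trajectory

variable {E V : Type*}

/-- After `n` steps, all the events up to time `T` have been simulated. -/
def Covers (ω : Trajectory E V) (T : ℝ) (n : ℕ) : Prop :=
  (ω n).2 = false ∨ ∃ e ∈ (ω n).1.2, T < e.1

/-- The trajectory is defined up to time `T` included (the events do not accumulate before). -/
def Reaches (ω : Trajectory E V) (T : ℝ) : Prop := ∃ n, ω.Covers T n

/-- The events up to time `T` included. -/
def eventsUpTo (ω : Trajectory E V) (T : ℝ) : List (ℝ × V) :=
  eventsIn (Iic T) 0 (ω (sInf {n | ω.Covers T n})).1.2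

end Trajectory

namespace PDMP

variable {E V : Type*} [MeasurableSpace E] [MeasurableSpace V] {μV : Measure V}

/-- The law of the trajectory simulated with the event rate `A`, as a function of its initial
state. -/
def trajectoryLaw [SigmaFinite μV] (X : PDMP E V μV) (A : SimRate E V) :
    Kernel E (Trajectory E V) :=
  (Kernel.traj (X := fun _ => Skeleton E V × Bool)
    (fun n => (X.simStep A).comap (fun h => h ⟨n, Finset.mem_Iic.2 le_rfl⟩)
      (measurable_pi_apply _)) 0).comap
    (fun z _ => ((z, []), true))
    (measurable_pi_lambda _ fun _ =>
      (measurable_id.prodMk measurable_const).prodMk measurable_const)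

/-- The law of the path on `[0, T]` simulated with the rate `A`, on the event that the trajectory
is defined up to `T`. -/
def pathLaw [SigmaFinite μV] (X : PDMP E V μV) (A : SimRate E V) (T : ℝ) (z : E) :
    Measure (Skeleton E V) :=
  ((X.trajectoryLaw A z).restrict {ω | ω.Reaches T}).map fun ω => (z, ω.eventsUpTo T)

/-- The event rate of the exact process: `rate` evaluated along the flow since the last event. -/
def exactRate (X : PDMP E V μV) : SimRate E V where
  rate w s := X.rate (X.flow s (X.last w).1)
  measurable_rate := X.measurable_rate.comp (X.measurable_flow.comp
    (measurable_snd.prodMk (measurable_fst.comp (X.measurable_last.comp measurable_fst))))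
  rate_finite _ _ := X.rate_finite _ _

/-- `π` is an invariant distribution of the exact process: `Z₀ ∼ π` implies `Z_t ∼ π`. -/
def IsInvariant [SigmaFinite μV] (X : PDMP E V μV) (π : Measure E) : Prop :=
  ∀ t, 0 ≤ t → (π.bind fun z => (X.pathLaw X.exactRate t z).map fun w => X.stateAt w t) = π

/-- The simulation rate `A` is that of the exact process. -/
def IsExact (X : PDMP E V μV) (A : SimRate E V) : Prop :=
  ∀ w s, 0 ≤ s → A.rate w s = X.exactRate.rate w s

/-- Consistency of a stopping criterion, `crit w L` meaning that the path `w` on `[0, L]` is valid: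
the restriction of a valid path to a smaller interval is valid. -/
def IsConsistent (X : PDMP E V μV) (crit : Skeleton E V → ℝ → Prop) : Prop :=
  ∀ w L c d, w ∈ pathsIn E V (Icc 0 L) → 0 ≤ c → c ≤ d → d ≤ L →
    crit w L → crit (X.subPath w c d) (d - c)

/-- The validity of a path depends only on the points where events occur: two paths with the same
event points up to a shift of time, and with the same extremities (if any) at an event, are both
valid or both invalid. -/
def DependsOnlyOnEvents (X : PDMP E V μV) (crit : Skeleton E V → ℝ → Prop) : Prop :=
  ∀ w L w' L' c, 0 ≤ L → 0 ≤ L' →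
    w ∈ pathsIn E V (Icc 0 L) → w' ∈ pathsIn E V (Icc 0 L') →
    X.eventPoints w' = (X.eventPoints w).map (fun a => (a.1 - c, a.2)) →
    ((0 : ℝ) ∈ w.2.map Prod.fst ↔ (0 : ℝ) ∈ w'.2.map Prod.fst) →
    (L ∈ w.2.map Prod.fst ↔ L' ∈ w'.2.map Prod.fst) →
    (crit w L ↔ crit w' L')

end PDMP

/-! ## Reversal of paths -/

section Reversal

variable {E V Vr : Type*} [MeasurableSpace E] [MeasurableSpace V] [MeasurableSpace Vr]
  {μV : Measure V} {μVr : Measure Vr}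

/-- The path on `[0, T]` run backwards: it starts at the final state, and its events are those of
the path in reverse order, with marks translated by `mark` (a function of the state before the
event and of the mark). -/
def reversePath (X : PDMP E V μV) (mark : E → V → Vr) (T : ℝ) (w : Skeleton E V) :
    Skeleton E Vr :=
  (X.stateAt w T, ((X.trace (w.1, 0) w.2).map fun a => (T - a.1.1, mark a.2 a.1.2)).reverse)

/-- The paths of `X`, run backwards, are paths of `Y` and conversely: the flow of `Y` is that of `X`
in the opposite direction, and each jump of one is undone by a jump of the other, whose mark
(unique since jumps are injective in the mark) is `revMark` resp. `fwdMark`. -/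
structure Reversal (X : PDMP E V μV) (Y : PDMP E Vr μVr) where
  flow_eq : ∀ t z, Y.flow t z = X.flow (-t) z
  revMark : E → V → Vr
  measurable_revMark : Measurable fun p : E × V => revMark p.1 p.2
  fwdMark : E → Vr → V
  measurable_fwdMark : Measurable fun p : E × Vr => fwdMark p.1 p.2
  jump_revMark : ∀ z v, Y.jump (X.jump z v) (revMark z v) = z
  jump_fwdMark : ∀ z u, X.jump (Y.jump z u) (fwdMark z u) = z

namespace Reversal

variable {X : PDMP E V μV} {Y : PDMP E Vr μVr}

/-- The map `R_T` from paths of `X` on `[0, T]` to paths of `Y` on `[0, T]`. -/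
def toRev (R : Reversal X Y) (T : ℝ) : Skeleton E V → Skeleton E Vr :=
  reversePath X R.revMark T

/-- The inverse of `R_T`, from paths of `Y` on `[0, T]` to paths of `X` on `[0, T]`. -/
def toFwd (R : Reversal X Y) (T : ℝ) : Skeleton E Vr → Skeleton E V :=
  reversePath Y R.fwdMark T

/-- `ψ_T` is the volume change of `R_T`, for each `T ≥ 0`: `∫ f(R_T w) dw = ∫ f(w') ψ_T(w') dw'`. -/
def IsVolumeChange (R : Reversal X Y) (μE : Measure E) (ψ : ℝ → Skeleton E Vr → ℝ≥0) : Prop :=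
  ∀ T, 0 ≤ T → ∀ f : Skeleton E Vr → ℝ≥0∞, Measurable f →
    ∫⁻ w in pathsIn E V (Ioo 0 T), f (R.toRev T w) ∂(canonicalMeasure μE μV) =
      ∫⁻ w' in pathsIn E Vr (Ioo 0 T), f w' * ψ T w' ∂(canonicalMeasure μE μVr)

/-- `Y` is the time-reversal of `X` started from `π`: for each `T > 0`, the law of the path of the
exact process `X` on `[0, T]`, run backwards, is that of the path of the exact process `Y`. -/
def IsTimeReversal [SigmaFinite μV] [SigmaFinite μVr] (R : Reversal X Y) (π : Measure E) : Prop :=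
  ∀ T, 0 < T → (π.bind (X.pathLaw X.exactRate T)).map (R.toRev T) =
    π.bind (Y.pathLaw Y.exactRate T)

end Reversal

end Reversal

/-! ## The doubly-adaptive sampler -/

/-- The inputs of the algorithm: the path reversal between the forward and backward processes, its
volume change, the target density, the approximate forward and backward event rates, and the
stopping criterion (`criterion w L` means that the path `w` on `[0, L]` is valid). -/
structure Sampler {E V Vr : Type*} [MeasurableSpace E] [MeasurableSpace V] [MeasurableSpace Vr]
    {μV : Measure V} {μVr : Measure Vr} (X : PDMP E V μV) (Y : PDMP E Vr μVr) where
  reversal : Reversal X Y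
  volumeChange : ℝ → Skeleton E Vr → ℝ≥0
  target : E → ℝ≥0
  fwdRate : SimRate E V
  bwdRate : SimRate E Vr
  criterion : Skeleton E V → ℝ → Prop

/-- The random inputs of one iteration after the refreshment: the state `z`, the number `α`, and
the trajectory through `z` in both directions of time. -/
abbrev Draw (E V Vr : Type*) := E × ℝ × Trajectory E Vr × Trajectory E V

namespace Sampler

variable {E V Vr : Type*} [MeasurableSpace E] [MeasurableSpace V] [MeasurableSpace Vr]
  {μV : Measure V} {μVr : Measure Vr} {X : PDMP E V μV} {Y : PDMP E Vr μVr}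

/-- The law of the draw: given `z`, the number `α` is uniform on `(0, 1)` and the backward and
forward parts of the trajectory are simulated independently with the approximate rates. -/
def drawLaw [SigmaFinite μV] [SigmaFinite μVr] (S : Sampler X Y) : Kernel E (Draw E V Vr) :=
  Kernel.id ×ₖ (Kernel.const E (volume.restrict (Ioo (0 : ℝ) 1)) ×ₖ
    (Y.trajectoryLaw S.bwdRate ×ₖ X.trajectoryLaw S.fwdRate))

/-- The trajectory is defined on `[-αt, (1 - α)t]`. -/
def Defined (s : Draw E V Vr) (t : ℝ) : Prop :=
  s.2.2.1.Reaches (s.2.1 * t) ∧ s.2.2.2.Reaches ((1 - s.2.1) * t)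

/-- The trajectory on `[-αt, (1 - α)t]`, as a path on `[0, t]`. -/
def window (S : Sampler X Y) (s : Draw E V Vr) (t : ℝ) : Skeleton E V :=
  ((S.reversal.toFwd (s.2.1 * t) (s.1, s.2.2.1.eventsUpTo (s.2.1 * t))).1,
    (S.reversal.toFwd (s.2.1 * t) (s.1, s.2.2.1.eventsUpTo (s.2.1 * t))).2 ++
      eventsIn univ (-(s.2.1 * t)) (s.2.2.2.eventsUpTo ((1 - s.2.1) * t)))

/-- The times `t` for which the criterion is valid on `[-αt, (1 - α)t]`. -/
def validTimes (S : Sampler X Y) (s : Draw E V Vr) : Set ℝ :=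
  {t | 0 ≤ t ∧ Defined s t ∧ S.criterion (S.window s t) t}

/-- The length `T` of the stopped path. -/
def length (S : Sampler X Y) (s : Draw E V Vr) : ℝ := sSup (S.validTimes s)

/-- The construction of the path stops: `T` exists, and the trajectory is defined until then. -/
def Stops (S : Sampler X Y) (s : Draw E V Vr) : Prop :=
  BddAbove (S.validTimes s) ∧ 0 < S.length s ∧ Defined s (S.length s)

/-- The stopped path, as a path on `[0, T]`. -/
def path (S : Sampler X Y) (s : Draw E V Vr) : Skeleton E V := S.window s (S.length s)

/-- The position `l = αT` of the starting point on the stopped path. -/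
def offset (S : Sampler X Y) (s : Draw E V Vr) : ℝ := s.2.1 * S.length s

/-- The criterion was hit going forward: there is an event at the forward extremity. -/
def HitForward (S : Sampler X Y) (s : Draw E V Vr) : Prop :=
  (1 - s.2.1) * S.length s ∈
    (s.2.2.2.eventsUpTo ((1 - s.2.1) * S.length s)).map Prod.fst

/-- The law `ν` of the proposed offset `l'`, on `[0, T]`, with density proportional to
`(T - t) / T²` if the criterion was hit going forward, and to `t / T²` otherwise. -/
def proposal (S : Sampler X Y) (s : Draw E V Vr) : Measure ℝ :=
  open Classical in
  (volume.restrict (Icc 0 (S.length s))).withDensity fun t =>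
    ENNReal.ofReal (2 * (if S.HitForward s then S.length s - t else t) / S.length s ^ 2)

/-- For a path `w` on `[0, T]` and an offset `l`:
`π(w_l) q^r(w on [0, l], backwards from w_l) q(w on [l, T], from w_l) Ψ_l(w on [0, l])`,
where `Ψ_l` is the volume change `1 / ψ_l ∘ R_l` of the inverse of `R_l`. -/
def weight (S : Sampler X Y) (w : Skeleton E V) (T l : ℝ) : ℝ≥0∞ :=
  S.target (X.position w l) *
    Y.pathDensity S.bwdRate l (S.reversal.toRev l (w.1, eventsIn (Iic l) 0 w.2)) *
    X.pathDensity S.fwdRate (T - l) (X.position w l, eventsIn (Ioi l) l w.2) *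
    (S.volumeChange l (S.reversal.toRev l (w.1, eventsIn (Iic l) 0 w.2)) : ℝ≥0∞)⁻¹

/-- The probability of accepting the proposed offset `l'`. -/
def acceptance (S : Sampler X Y) (s : Draw E V Vr) (l' : ℝ) : ℝ≥0∞ :=
  min 1 (S.weight (S.path s) (S.length s) l' / S.weight (S.path s) (S.length s) (S.offset s))

/-- The law of the output given the draw. If the construction of the path does not stop, the
output is the current state. -/
def outputLaw (S : Sampler X Y) (s : Draw E V Vr) : Measure E :=
  open Classical in
  if S.Stops s then
    (S.proposal s).bind fun l' =>
      S.acceptance s l' • Measure.dirac (X.position (S.path s) l') +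
        (1 - S.acceptance s l') • Measure.dirac (X.position (S.path s) (S.offset s))
  else Measure.dirac s.1

end Sampler

/-! ## Refreshment of the velocity, and the whole iteration -/

section Refresh

variable {P U : Type*} [MeasurableSpace P] [MeasurableSpace U]

/-- Keep the position `x`, and replace the velocity `v` by a random one of law `ρ (x, v)`. -/
def refreshKernel (ρ : Kernel (P × U) U) : Kernel (P × U) (P × U) :=
  Kernel.deterministic Prod.fst measurable_fst ×ₖ ρ

/-- A refreshment of the velocity leaves the target `π` invariant. -/
def IsRefreshment (ρ : Kernel (P × U) U) (π : Measure (P × U)) : Prop :=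
  (refreshKernel ρ).Invariant π

theorem measurableSet_refreshable (μU : Measure U) [SigmaFinite μU] (ϖ : P × U → ℝ≥0)
    (hϖ : Measurable ϖ) : MeasurableSet {z : P × U |
      ∫⁻ u, (ϖ (z.1, u) : ℝ≥0∞) ∂μU ≠ 0 ∧ ∫⁻ u, (ϖ (z.1, u) : ℝ≥0∞) ∂μU ≠ ∞} := by
  have h : Measurable fun z : P × U => ∫⁻ u, (ϖ (z.1, u) : ℝ≥0∞) ∂μU :=
    (Measurable.lintegral_prod_right' hϖ.coe_nnreal_ennreal).comp measurable_fst
  exact (h (measurableSet_singleton 0).compl).inter (h (measurableSet_singleton ∞).compl)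

/-- The full refreshment: the new velocity is drawn from its conditional law given the position,
of density `v ↦ ϖ (x, v) / ∫ ϖ (x, u) du`. (At a position where this is not defined, the velocity is
kept.) -/
def fullRefresh (μU : Measure U) [SigmaFinite μU] (ϖ : P × U → ℝ≥0) (hϖ : Measurable ϖ) :
    Kernel (P × U) U :=
  open Classical in
  Kernel.piecewise
    (s := {z : P × U | ∫⁻ u, (ϖ (z.1, u) : ℝ≥0∞) ∂μU ≠ 0 ∧ ∫⁻ u, (ϖ (z.1, u) : ℝ≥0∞) ∂μU ≠ ∞})
    (measurableSet_refreshable μU ϖ hϖ)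
    (Kernel.withDensity (Kernel.const _ μU)
      fun z v => (ϖ (z.1, v) : ℝ≥0∞) / ∫⁻ u, (ϖ (z.1, u) : ℝ≥0∞) ∂μU)
    (Kernel.deterministic Prod.snd measurable_snd)

theorem isMarkovKernel_fullRefresh (μU : Measure U) [SigmaFinite μU] (ϖ : P × U → ℝ≥0)
    (hϖ : Measurable ϖ) : IsMarkovKernel (fullRefresh μU ϖ hϖ) := by
  classical
  have hm : Measurable fun z : P × U => ∫⁻ u, (ϖ (z.1, u) : ℝ≥0∞) ∂μU :=
    (Measurable.lintegral_prod_right' hϖ.coe_nnreal_ennreal).comp measurable_fst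
  have hf : Measurable (Function.uncurry fun (z : P × U) v =>
      (ϖ (z.1, v) : ℝ≥0∞) / ∫⁻ u, (ϖ (z.1, u) : ℝ≥0∞) ∂μU) :=
    ((hϖ.comp ((measurable_fst.comp measurable_fst).prodMk measurable_snd)).coe_nnreal_ennreal).div
      (hm.comp measurable_fst)
  refine ⟨fun z => ⟨?_⟩⟩
  rw [fullRefresh, Kernel.piecewise_apply]
  split_ifs with h
  · rw [Kernel.withDensity_apply' _ hf, Measure.restrict_univ, Kernel.const_apply]
    have h' : ∀ v, (ϖ (z.1, v) : ℝ≥0∞) / ∫⁻ u, (ϖ (z.1, u) : ℝ≥0∞) ∂μU =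
        (∫⁻ u, (ϖ (z.1, u) : ℝ≥0∞) ∂μU)⁻¹ * ϖ (z.1, v) := fun v => by
      rw [div_eq_mul_inv, mul_comm]
    simp_rw [h']
    have hz : Measurable fun v => (ϖ (z.1, v) : ℝ≥0∞) :=
      (hϖ.comp (measurable_const.prodMk measurable_id)).coe_nnreal_ennreal
    rw [lintegral_const_mul _ hz]
    exact ENNReal.inv_mul_cancel h.1 h.2
  · simp

theorem isRefreshment_fullRefresh (μP : Measure P) (μU : Measure U) [SigmaFinite μP]
    [SigmaFinite μU] (ϖ : P × U → ℝ≥0) (hϖ : Measurable ϖ)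
    (hfin : ∫⁻ z, (ϖ z : ℝ≥0∞) ∂(μP.prod μU) = 1) :
    IsRefreshment (fullRefresh μU ϖ hϖ) ((μP.prod μU).withDensity fun z => (ϖ z : ℝ≥0∞)) := by
  classical
  have := isMarkovKernel_fullRefresh μU ϖ hϖ
  have hc : Measurable fun z => (ϖ z : ℝ≥0∞) := hϖ.coe_nnreal_ennreal
  set m : P → ℝ≥0∞ := fun x => ∫⁻ u, (ϖ (x, u) : ℝ≥0∞) ∂μU with hm_def
  have hm : Measurable m := Measurable.lintegral_prod_right' hc
  have hf : Measurable (Function.uncurry fun (z : P × U) v => (ϖ (z.1, v) : ℝ≥0∞) / m z.1) :=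
    ((hϖ.comp ((measurable_fst.comp measurable_fst).prodMk measurable_snd)).coe_nnreal_ennreal).div
      ((hm.comp measurable_fst).comp measurable_fst)
  have hmfin : ∀ᵐ x ∂μP, m x < ∞ := by
    refine ae_lt_top hm ?_
    rw [hm_def, ← lintegral_prod _ hc.aemeasurable, hfin]
    exact ENNReal.one_ne_top
  rw [IsRefreshment, Kernel.Invariant]
  ext A hA
  have hsec : ∀ x, Measurable fun v => (ϖ (x, v) : ℝ≥0∞) := fun x =>
    hc.comp (measurable_const.prodMk measurable_id)
  have hAsec : ∀ x : P, MeasurableSet {v | (x, v) ∈ A} := fun x =>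
    (measurable_const.prodMk measurable_id) hA
  have hap : ∀ z : P × U, refreshKernel (fullRefresh μU ϖ hϖ) z A =
      fullRefresh μU ϖ hϖ z {v | (z.1, v) ∈ A} := by
    intro z
    rw [refreshKernel, Kernel.prod_apply, Kernel.deterministic_apply, Measure.dirac_prod,
      Measure.map_apply measurable_prodMk_left hA]
    rfl
  have hmeas := (refreshKernel (fullRefresh μU ϖ hϖ)).measurable_coe hA
  rw [Measure.bind_apply hA (Kernel.aemeasurable _),
    lintegral_withDensity_eq_lintegral_mul _ hc hmeas, withDensity_apply _ hA,
    ← lintegral_indicator hA, lintegral_prod _ (hc.mul hmeas).aemeasurable,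
    lintegral_prod _ (hc.indicator hA).aemeasurable]
  refine lintegral_congr_ae ?_
  filter_upwards [hmfin] with x hx
  have hR : ∫⁻ v, A.indicator (fun z => (ϖ z : ℝ≥0∞)) (x, v) ∂μU =
      ∫⁻ v in {v | (x, v) ∈ A}, (ϖ (x, v) : ℝ≥0∞) ∂μU := by
    rw [← lintegral_indicator (hAsec x)]
    rfl
  rw [hR]
  simp only [Pi.mul_apply, hap]
  by_cases h0 : m x = 0
  · have hz : ∀ᵐ v ∂μU, (ϖ (x, v) : ℝ≥0∞) = 0 := (lintegral_eq_zero_iff (hsec x)).1 h0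
    have e1 : ∫⁻ v, (ϖ (x, v) : ℝ≥0∞) * fullRefresh μU ϖ hϖ (x, v) {v | (x, v) ∈ A} ∂μU = 0 := by
      rw [← lintegral_zero (μ := μU)]
      refine lintegral_congr_ae ?_
      filter_upwards [hz] with v hv
      rw [hv, zero_mul]
    have e2 : ∫⁻ v in {v | (x, v) ∈ A}, (ϖ (x, v) : ℝ≥0∞) ∂μU = 0 :=
      le_antisymm ((setLIntegral_le_lintegral _ _).trans h0.le) bot_le
    rw [e1, e2]
  · have hK : ∀ v, fullRefresh μU ϖ hϖ (x, v) {v | (x, v) ∈ A} =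
        (m x)⁻¹ * ∫⁻ v in {v | (x, v) ∈ A}, (ϖ (x, v) : ℝ≥0∞) ∂μU := by
      intro v
      rw [fullRefresh, Kernel.piecewise_apply,
        if_pos (show (x, v) ∈ {z : P × U | m z.1 ≠ 0 ∧ m z.1 ≠ ∞} from ⟨h0, hx.ne⟩),
        Kernel.withDensity_apply' _ hf, Kernel.const_apply, ← lintegral_const_mul _ (hsec x)]
      refine lintegral_congr fun v => ?_
      rw [div_eq_mul_inv, mul_comm]
    simp only [hK]
    rw [lintegral_mul_const _ (hsec x), ← mul_assoc]
    change m x * (m x)⁻¹ * _ = _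
    rw [ENNReal.mul_inv_cancel h0 hx.ne, one_mul]

/-- The transition law of the algorithm: refresh the velocity, draw the trajectory, stop it, and
move along it. -/
def doublyAdaptive {V Vr : Type*} [MeasurableSpace V] [MeasurableSpace Vr] {μV : Measure V}
    {μVr : Measure Vr} [SigmaFinite μV] [SigmaFinite μVr] {X : PDMP (P × U) V μV}
    {Y : PDMP (P × U) Vr μVr} (S : Sampler X Y) (ρ : Kernel (P × U) U) (z : P × U) :
    Measure (P × U) :=
  ((S.drawLaw ∘ₖ refreshKernel ρ) z).bind S.outputLaw

end Refresh

end

end PathSampler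

open MeasureTheory ProbabilityTheory Set
open scoped ENNReal NNReal

namespace PathSampler

noncomputable section

/-! Invariance. The stopped path has an event at one of its extremities, since otherwise the
criterion would see the same events just before and just after the length T and could not change
value. Suppose that this event is at the forward end, at time u after the current state z. The
backward duration is then l = αu/(1 - α), and the substitution α = l/(l + u) gives dα = u/(l + u)²
dl = (T - l)/T² dl with T = l + u (`lintegral_ratio`). Started from π, the data (z, backward events
b, forward events f, l) therefore have density π(z) qʳ(b) q(f) (T - l)/T². For fixed l the reversal
R_l replaces (z, b) by the first state y of the path and its events a before l, at the price of the
factor 1/ψ_l, and the pair (a, f) amounts to the single list of the events of the path. So the pair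
(whole path w, offset l) has density r(l)(T - l)/T², on a set of paths that does not involve l:
whether w stops at its last event is a property of w alone, because the criterion is consistent and
sees only event points (`stopsAt_iff`, `lintegral_stopped_forward`).

Given w, the offset l thus has a law proportional to r(l)(T - l)/T², and steps (4) and (5) are a
Metropolis–Hastings step for this law, with independent proposals of density proportional to (T -
l)/T² (`lintegral_metropolis`). Hence l' has the conditional law of l, and X_{l'} has the law of X_l
= z. The backward case is symmetric, with l/T² instead, and draws that do not stop do not move;
summing the three cases gives `invariant_outputKernel`.

The asymmetry is in the measure on whole paths. A path stopped by a backward event starts with an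
event at time 0. Such paths are null for the path measure and are parametrised by the mark and the
state of the initial event, the later events, and the now free duration T. The volume change of R_T
on them is not given; it is obtained in `boundaryMeasure_eq_withDensity` by inserting a time t
before the initial event, which yields an ordinary path, and letting t tend to 0. This uses the
continuity of ψ down to the last event time included. The same argument gives the cocycle relation
`ae_volumeChange_mul`.

Acceptance. In terms of densities, time reversal says that π times the density of the backward path
R_l w is ψ_l times π(w₀) times the density of w (`ae_isDensityReversal`). So r(l) is π(w₀) times the
density of w on [0, l] times that of w on [l, T], which by the Markov property of the exact process
is π(w₀) times the density of w on [0, T]: it does not depend on l, and the ratio is 1. For paths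
that start with an event, the density identity is again reached by inserting a time t, and the
factors due to that time cancel (`boundaryMap_density`).

Null sets need care. As E is an arbitrary measurable space, the statement that a simulated
trajectory grows by appending events to its previous state need not define a measurable set; it is
replaced by indistinguishability from a trajectory that does so (`IsSimulation.indist`). The length
T is a supremum over an uncountable set of times, and is replaced by a supremum over the rationals
(`ratLength`). -/

set_option linter.unusedSectionVars false

/-! ### Measurability and product measures on finite lists. -/

section ListMeasure

variable {α β S : Type*} [MeasurableSpace α] [MeasurableSpace β] [MeasurableSpace S]

/-- A function of a parameter and a list, defined by recursion on the list with measurable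
ingredients, is measurable. -/
theorem measurable_list_rec {b : S → β} {g : S → α → S} {h : S → α → β → β}
    {F : S → List α → β} (hb : Measurable b) (hg : Measurable (Function.uncurry g))
    (hh : Measurable fun p : S × α × β => h p.1 p.2.1 p.2.2)
    (h0 : ∀ s, F s [] = b s) (h1 : ∀ s e es, F s (e :: es) = h s e (F (g s e) es)) :
    Measurable fun p : S × List α => F p.1 p.2 := by
  apply measurable_of_ofFn
  intro n
  induction n with
  | zero =>
    simp only [List.ofFn_zero, h0]
    exact hb.comp measurable_fst
  | succ n ih =>
    simp only [List.ofFn_succ, h1]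
    have e0 : Measurable fun p : S × (Fin (n + 1) → α) => p.2 0 :=
      (measurable_pi_apply 0).comp measurable_snd
    have e1 : Measurable fun p : S × (Fin (n + 1) → α) =>
        (g p.1 (p.2 0), fun i : Fin n => p.2 i.succ) :=
      (hg.comp (measurable_fst.prodMk e0)).prodMk
        (measurable_pi_lambda _ fun i => (measurable_pi_apply _).comp measurable_snd)
    exact hh.comp (measurable_fst.prodMk (e0.prodMk (ih.comp e1)))

theorem measurable_cons : Measurable fun p : α × List α => p.1 :: p.2 := by
  apply measurable_of_ofFn
  intro n
  have h : (fun p : α × (Fin n → α) => p.1 :: List.ofFn p.2) =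
      fun p => List.ofFn (Fin.cons (α := fun _ => α) p.1 p.2) := by
    funext p
    rw [List.ofFn_succ]
    simp
  rw [h]
  refine (measurable_ofFn (n + 1)).comp (measurable_pi_lambda _ fun i => ?_)
  refine Fin.cases ?_ (fun j => ?_) i
  · simpa using measurable_fst
  · simp only [Fin.cons_succ]
    exact (measurable_pi_apply j).comp measurable_snd

/-- A version of `measurable_list_rec` in which the parameter does not change. -/
theorem measurable_list_rec' {b : S → β} {h : S → α → β → β}
    {F : S → List α → β} (hb : Measurable b)
    (hh : Measurable fun p : S × α × β => h p.1 p.2.1 p.2.2)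
    (h0 : ∀ s, F s [] = b s) (h1 : ∀ s e es, F s (e :: es) = h s e (F s es)) :
    Measurable fun p : S × List α => F p.1 p.2 :=
  measurable_list_rec (g := fun s _ => s) hb measurable_fst hh h0 h1

theorem measurable_append : Measurable fun p : List α × List α => p.1 ++ p.2 := by
  have := measurable_list_rec' (S := List α) (α := α) (β := List α)
    (b := fun s => s) (h := fun _ e r => e :: r) (F := fun s l => l ++ s) measurable_id
    (measurable_cons.comp measurable_snd) (by simp) (by simp)
  exact this.comp measurable_swap

theorem measurable_list_map {φ : S → α → β} (hφ : Measurable (Function.uncurry φ)) :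
    Measurable fun p : S × List α => p.2.map (φ p.1) :=
  measurable_list_rec' (b := fun _ => []) (h := fun s e r => φ s e :: r)
    (F := fun s l => l.map (φ s)) measurable_const
    (measurable_cons.comp ((hφ.comp (measurable_fst.prodMk
      (measurable_fst.comp measurable_snd))).prodMk (measurable_snd.comp measurable_snd)))
    (by simp) (by simp)

theorem measurableSet_forall_mem {p : S → α → Prop}
    (hp : MeasurableSet {q : S × α | p q.1 q.2}) :
    MeasurableSet {q : S × List α | ∀ e ∈ q.2, p q.1 e} := by
  apply measurableSet_setOfPred.2
  exact measurable_list_rec' (b := fun _ => True) (h := fun s e r => p s e ∧ r)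
    (F := fun s (l : List α) => ∀ e ∈ l, p s e) measurable_const
    (Measurable.and ((measurableSet_setOfPred.1 hp).comp
      (measurable_fst.prodMk (measurable_fst.comp measurable_snd)))
      (measurable_snd.comp measurable_snd))
    (by simp) (by simp)

/-- The recursion carries the list along with the truth value, because the clause added by a new
head compares it with the whole tail. -/
theorem measurableSet_pairwise {r : α → α → Prop} (hr : MeasurableSet {q : α × α | r q.1 q.2}) :
    MeasurableSet {l : List α | l.Pairwise r} := by
  have h1 := measurableSet_forall_mem (S := α) (p := r) hr
  have := measurable_list_rec' (S := Unit) (α := α) (β := List α × Prop)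
    (b := fun _ => ([], True)) (h := fun _ e q => (e :: q.1, (∀ a ∈ q.1, r e a) ∧ q.2))
    (F := fun _ l => (l, l.Pairwise r)) measurable_const
    (by
      refine Measurable.prodMk (measurable_cons.comp ((measurable_fst.comp measurable_snd).prodMk
        (measurable_fst.comp (measurable_snd.comp measurable_snd)))) (Measurable.and ?_ ?_)
      · exact (measurableSet_setOfPred.1 h1).comp ((measurable_fst.comp measurable_snd).prodMk
          (measurable_fst.comp (measurable_snd.comp measurable_snd)))
      · exact measurable_snd.comp (measurable_snd.comp measurable_snd))
    (by simp) (by simp)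
  exact measurableSet_setOfPred.2 (measurable_snd.comp (this.comp
    (measurable_prodMk_left (x := ()))))

theorem measurable_take_drop (m : ℕ) :
    Measurable fun l : List α => (l.take m, l.drop m) := by
  induction m with
  | zero => simpa using measurable_const.prodMk measurable_id
  | succ m ih =>
    have h0 : Measurable fun q : Unit × List α => (q.2.take (m + 1), q.2.drop (m + 1)) := by
      apply measurable_of_ofFn
      intro n
      cases n with
      | zero => simp
      | succ n =>
        simp only [List.ofFn_succ, List.take_succ_cons, List.drop_succ_cons]
        have e0 : Measurable fun p : Unit × (Fin (n + 1) → α) => p.2 0 :=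
          (measurable_pi_apply 0).comp measurable_snd
        have e1 : Measurable fun p : Unit × (Fin (n + 1) → α) =>
            List.ofFn fun i : Fin n => p.2 i.succ :=
          (measurable_ofFn n).comp
            (measurable_pi_lambda _ fun i => (measurable_pi_apply _).comp measurable_snd)
        have e2 := ih.comp e1
        exact (measurable_cons.comp (e0.prodMk (measurable_fst.comp e2))).prodMk
          (measurable_snd.comp e2)
    exact h0.comp (measurable_prodMk_left (x := ()))

theorem measurable_length : Measurable fun l : List α => l.length := by
  have := measurable_list_rec' (S := Unit) (α := α) (β := ℕ)
    (b := fun _ => 0) (h := fun _ _ r => r + 1) (F := fun _ l => l.length) measurable_const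
    (by fun_prop) (by simp) (by simp)
  exact this.comp (measurable_prodMk_left (x := ()))

/-- The product measure on lists of length `n`. -/
def listMeasure (μ : Measure α) : ℕ → Measure (List α)
  | 0 => Measure.dirac []
  | n + 1 => (μ.prod (listMeasure μ n)).map fun p => p.1 :: p.2

/-- The sum of the product measures on lists of all lengths. -/
def listSum (μ : Measure α) : Measure (List α) := Measure.sum (listMeasure μ)

variable (μ : Measure α)

instance sFinite_listMeasure [SFinite μ] (n : ℕ) : SFinite (listMeasure μ n) := by
  induction n with
  | zero => rw [listMeasure]; infer_instance
  | succ n ih => rw [listMeasure]; infer_instance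

instance sFinite_listSum [SFinite μ] : SFinite (listSum μ) := by
  rw [listSum]; infer_instance

theorem lintegral_listSum {g : List α → ℝ≥0∞} :
    ∫⁻ l, g l ∂listSum μ = ∑' n, ∫⁻ l, g l ∂listMeasure μ n := by
  rw [listSum, lintegral_sum_measure]

variable [SigmaFinite μ]

/-- Links the product over `Fin n` used by `canonicalMeasure` to the recursive `listMeasure`, so
that integrals can be unrolled from the head of the list. -/
theorem map_pi_ofFn (n : ℕ) :
    (Measure.pi fun _ : Fin n => μ).map (fun e => List.ofFn e) = listMeasure μ n := by
  induction n with
  | zero =>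
    rw [listMeasure, Measure.pi_of_empty _ (fun i => i.elim0), Measure.map_dirac' (measurable_ofFn 0)]
    simp
  | succ n ih =>
    have h := measurePreserving_piFinSuccAbove (fun _ : Fin (n + 1) => μ) 0
    have h2 : (fun e : Fin (n + 1) → α => List.ofFn e) =
        (fun p : α × (Fin n → α) => p.1 :: List.ofFn p.2) ∘
          (MeasurableEquiv.piFinSuccAbove (fun _ : Fin (n + 1) => α) 0) := by
      funext e
      simp [List.ofFn_succ, MeasurableEquiv.piFinSuccAbove, Fin.insertNthEquiv]
      rfl
    have h3 : (fun p : α × (Fin n → α) => p.1 :: List.ofFn p.2) =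
        (fun p : α × List α => p.1 :: p.2) ∘ Prod.map id (fun e : Fin n → α => List.ofFn e) := rfl
    have h4 : Measurable fun p : α × (Fin n → α) => p.1 :: List.ofFn p.2 :=
      measurable_cons.comp (measurable_fst.prodMk ((measurable_ofFn n).comp measurable_snd))
    rw [h2, ← Measure.map_map h4 (MeasurableEquiv.measurable _), h.map_eq, h3,
      ← Measure.map_map measurable_cons (measurable_id.prodMap (measurable_ofFn n)),
      ← Measure.map_prod_map _ _ measurable_id (measurable_ofFn n), ih, Measure.map_id, listMeasure]

theorem ae_length_listMeasure (n : ℕ) : ∀ᵐ l ∂listMeasure μ n, l.length = n := by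
  have hm : MeasurableSet {l : List α | l.length = n} :=
    measurable_length (measurableSet_singleton n)
  rw [← map_pi_ofFn, ae_map_iff (measurable_ofFn n).aemeasurable hm]
  simp

theorem listSum_restrict_length_lt_top (n : ℕ) {A : Set (Fin n → α)} (hA : MeasurableSet A) :
    listSum μ ((fun e => List.ofFn e) '' A) = Measure.pi (fun _ : Fin n => μ) A := by
  have hm := (measurableEmbedding_ofFn (α := α) n).measurableSet_image.2 hA
  rw [listSum, Measure.sum_apply _ hm, tsum_eq_single n]
  · rw [← map_pi_ofFn, Measure.map_apply (measurable_ofFn n) hm,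
      preimage_image_eq _ List.ofFn_injective]
  · intro k hk
    refine measure_mono_null ?_ (ae_length_listMeasure μ k)
    rintro _ ⟨e, -, rfl⟩ h
    exact hk (by simpa using h.symm)

/-- A countable sum of sigma-finite measures need not be sigma-finite. Here the summands live on
lists of different lengths, so spanning sets of each can be put together. Sigma-finiteness is what
makes densities on path space unique. -/
instance sigmaFinite_listSum : SigmaFinite (listSum μ) := by
  let s : ℕ × ℕ → Set (List α) := fun p =>
    (fun e => List.ofFn e) '' spanningSets (Measure.pi fun _ : Fin p.1 => μ) p.2
  obtain ⟨f, hf⟩ := exists_surjective_nat (ℕ × ℕ)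
  refine ⟨⟨fun k => s (f k), fun _ => trivial, fun k => ?_, ?_⟩⟩
  · rw [listSum_restrict_length_lt_top _ _ (measurableSet_spanningSets _ _)]
    exact measure_spanningSets_lt_top _ _
  · refine eq_univ_of_forall fun l => ?_
    obtain ⟨k, hk⟩ := hf (l.length, spanningSetsIndex (Measure.pi fun _ : Fin l.length => μ) l.get)
    refine mem_iUnion.2 ⟨k, ?_⟩
    simp only [s, hk]
    exact ⟨l.get, mem_spanningSetsIndex _ _, by simp⟩

theorem lintegral_listMeasure_succ (n : ℕ) {g : List α → ℝ≥0∞} (hg : Measurable g) :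
    ∫⁻ l, g l ∂listMeasure μ (n + 1) = ∫⁻ e, ∫⁻ l, g (e :: l) ∂listMeasure μ n ∂μ := by
  rw [listMeasure, lintegral_map hg measurable_cons,
    lintegral_prod (fun p : α × List α => g (p.1 :: p.2)) (hg.comp measurable_cons).aemeasurable]

/-- Separates the eventless path from the paths with a first event. -/
theorem lintegral_listSum_eq {g : List α → ℝ≥0∞} (hg : Measurable g) :
    ∫⁻ l, g l ∂listSum μ = g [] + ∫⁻ e, ∫⁻ l, g (e :: l) ∂listSum μ ∂μ := by
  have h : ∀ n, Measurable fun e => ∫⁻ l, g (e :: l) ∂listMeasure μ n := fun n =>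
    Measurable.lintegral_prod_right' (hg.comp measurable_cons)
  simp_rw [lintegral_listSum]
  rw [tsum_eq_zero_add' ENNReal.summable, lintegral_tsum fun n => (h n).aemeasurable]
  simp_rw [lintegral_listMeasure_succ μ _ hg]
  rw [listMeasure, lintegral_dirac' _ hg]

theorem lintegral_listMeasure_add (m n : ℕ) {h : List α × List α → ℝ≥0∞} (hh : Measurable h) :
    ∫⁻ w, h (w.take m, w.drop m) ∂listMeasure μ (m + n) =
      ∫⁻ a, ∫⁻ b, h (a, b) ∂listMeasure μ n ∂listMeasure μ m := by
  induction m generalizing h with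
  | zero =>
    have : Measurable fun a => ∫⁻ b, h (a, b) ∂listMeasure μ n :=
      Measurable.lintegral_prod_right' hh
    simp only [List.take_zero, List.drop_zero, zero_add]
    conv_rhs => rw [listMeasure, lintegral_dirac' _ this]
  | succ m ih =>
    have hc : Measurable fun a => ∫⁻ b, h (a, b) ∂listMeasure μ n :=
      Measurable.lintegral_prod_right' hh
    rw [show m + 1 + n = (m + n) + 1 by ring, lintegral_listMeasure_succ
      (g := fun w => h (w.take (m + 1), w.drop (m + 1))) _ _ (hh.comp (measurable_take_drop (m + 1))), lintegral_listMeasure_succ _ _ hc]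
    refine lintegral_congr fun e => ?_
    simp only [List.take_succ_cons, List.drop_succ_cons]
    refine ih (h := fun p => h (e :: p.1, p.2)) (hh.comp ?_)
    exact (measurable_cons.comp (measurable_const.prodMk measurable_fst)).prodMk measurable_snd

/-- Cutting a list in two at an arbitrary place. -/
theorem lintegral_listSum_split {h : List α × List α → ℝ≥0∞} (hh : Measurable h) :
    ∫⁻ a, ∫⁻ b, h (a, b) ∂listSum μ ∂listSum μ =
      ∫⁻ w, ∑ m ∈ Finset.range (w.length + 1), h (w.take m, w.drop m) ∂listSum μ := by
  have hc : ∀ n, Measurable fun a => ∫⁻ b, h (a, b) ∂listMeasure μ n := fun n =>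
    Measurable.lintegral_prod_right' hh
  have h1 : ∀ a, ∫⁻ b, h (a, b) ∂listSum μ = ∑' n, ∫⁻ b, h (a, b) ∂listMeasure μ n := fun a =>
    lintegral_listSum μ
  have h2 : ∀ m, ∫⁻ a, ∑' n, ∫⁻ b, h (a, b) ∂listMeasure μ n ∂listMeasure μ m =
      ∑' n, ∫⁻ w, h (w.take m, w.drop m) ∂listMeasure μ (m + n) := fun m => by
    rw [lintegral_tsum fun n => (hc n).aemeasurable]
    exact tsum_congr fun n => (lintegral_listMeasure_add μ m n hh).symm
  have h3 : ∀ N, ∫⁻ w, ∑ m ∈ Finset.range (w.length + 1), h (w.take m, w.drop m) ∂listMeasure μ N =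
      ∑ m ∈ Finset.range (N + 1), ∫⁻ w, h (w.take m, w.drop m) ∂listMeasure μ N := fun N => by
    rw [← lintegral_finsetSum (f := fun m (w : List α) => h (w.take m, w.drop m)) _
      fun m _ => hh.comp (measurable_take_drop m)]
    refine lintegral_congr_ae ?_
    filter_upwards [ae_length_listMeasure μ N] with w hw
    rw [hw]
  simp_rw [h1]
  rw [lintegral_listSum, lintegral_listSum]
  simp_rw [h2, h3]
  -- Pairs of lengths (m, n) are regrouped by their sum N: on the lists of length N, each m ≤ N is
  -- one place to cut.
  rw [← ENNReal.tsum_prod (f := fun m n =>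
      ∫⁻ w, h (w.take m, w.drop m) ∂listMeasure μ (m + n)),
    ← (Finset.HasAntidiagonal.sigmaAntidiagonalEquivProd (A := ℕ)).tsum_eq (fun p : ℕ × ℕ =>
      ∫⁻ w, h (w.take p.1, w.drop p.1) ∂listMeasure μ (p.1 + p.2)), ENNReal.tsum_sigma']
  refine tsum_congr fun N => ?_
  refine (Finset.tsum_subtype (Finset.HasAntidiagonal.antidiagonal N) (fun p : ℕ × ℕ =>
    ∫⁻ w, h (w.take p.1, w.drop p.1) ∂listMeasure μ (p.1 + p.2))).trans ?_
  rw [Finset.Nat.sum_antidiagonal_eq_sum_range_succ_mk]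
  refine Finset.sum_congr rfl fun m hm => ?_
  have : m + (N - m) = N := by have := Finset.mem_range.1 hm; omega
  simp only [this]

/-- Used for time shifts: Lebesgue measure is translation invariant, so delaying all the events
preserves the measure. -/
theorem map_listSum {φ : α → α} (hφ : MeasurePreserving φ μ μ) :
    (listSum μ).map (List.map φ) = listSum μ := by
  have hm : Measurable (List.map φ) := by
    have := measurable_list_map (S := Unit) (φ := fun _ => φ) (hφ.measurable.comp measurable_snd)
    exact this.comp (measurable_prodMk_left (x := ()))
  have : ∀ n, (listMeasure μ n).map (List.map φ) = listMeasure μ n := by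
    intro n
    induction n with
    | zero => rw [listMeasure, Measure.map_dirac' hm, List.map_nil]
    | succ n ih =>
      rw [listMeasure, Measure.map_map hm measurable_cons]
      have : List.map φ ∘ (fun p : α × List α => p.1 :: p.2) =
          (fun p : α × List α => p.1 :: p.2) ∘ Prod.map φ (List.map φ) := by
        funext p; simp
      rw [this, ← Measure.map_map measurable_cons (hφ.measurable.prodMap hm),
        ← Measure.map_prod_map _ _ hφ.measurable hm, ih, hφ.map_eq]
  rw [listSum, Measure.map_sum hm.aemeasurable]
  simp_rw [this]

/-- Makes path space a product, so that Fubini separates the initial state from the events. -/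
theorem canonicalMeasure_eq {E V : Type*} [MeasurableSpace E] [MeasurableSpace V]
    (μE : Measure E) (μV : Measure V) [SigmaFinite μE] [SigmaFinite μV] :
    canonicalMeasure μE μV = μE.prod (listSum ((volume : Measure ℝ).prod μV)) := by
  rw [canonicalMeasure, listSum, Measure.prod_sum_right]
  congr 1
  funext k
  rw [← map_pi_ofFn]
  conv_rhs => rw [← Measure.map_id (μ := μE)]
  rw [Measure.map_prod_map _ _ measurable_id (measurable_ofFn k)]
  rfl

end ListMeasure

/-! ### Lists of timed events: delays, order, restriction to a set of times. -/

section Events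

variable {V : Type*}

/-- The events of a list, delayed by `c`. -/
def delay (c : ℝ) (es : List (ℝ × V)) : List (ℝ × V) := es.map fun e => (e.1 + c, e.2)

@[simp] theorem delay_nil (c : ℝ) : delay c ([] : List (ℝ × V)) = [] := rfl

@[simp] theorem delay_cons (c : ℝ) (e : ℝ × V) (es : List (ℝ × V)) :
    delay c (e :: es) = (e.1 + c, e.2) :: delay c es := rfl

@[simp] theorem delay_append (c : ℝ) (a b : List (ℝ × V)) :
    delay c (a ++ b) = delay c a ++ delay c b := List.map_append

@[simp] theorem delay_zero (es : List (ℝ × V)) : delay 0 es = es := by simp [delay]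

@[simp] theorem delay_delay (c d : ℝ) (es : List (ℝ × V)) :
    delay c (delay d es) = delay (d + c) es := by
  simp [delay, Function.comp_def, add_assoc]

theorem mem_delay {c : ℝ} {es : List (ℝ × V)} {e : ℝ × V} :
    e ∈ delay c es ↔ (e.1 - c, e.2) ∈ es := by
  simp only [delay, List.mem_map]
  constructor
  · rintro ⟨a, ha, rfl⟩
    simpa using ha
  · intro h
    exact ⟨_, h, by simp⟩

@[simp] theorem delay_eq_nil {c : ℝ} {es : List (ℝ × V)} : delay c es = [] ↔ es = [] := by
  simp [delay]

/-- The events of a list are in increasing order of time. -/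
def Increasing (es : List (ℝ × V)) : Prop := (es.map Prod.fst).Pairwise (· < ·)

theorem increasing_iff {es : List (ℝ × V)} :
    Increasing es ↔ es.Pairwise fun a b => a.1 < b.1 := by
  rw [Increasing, List.pairwise_map]

@[simp] theorem increasing_nil : Increasing ([] : List (ℝ × V)) := by simp [Increasing]

theorem increasing_cons {e : ℝ × V} {es : List (ℝ × V)} :
    Increasing (e :: es) ↔ (∀ a ∈ es, e.1 < a.1) ∧ Increasing es := by
  simp [increasing_iff]

theorem increasing_append {a b : List (ℝ × V)} :
    Increasing (a ++ b) ↔ Increasing a ∧ Increasing b ∧ ∀ x ∈ a, ∀ y ∈ b, x.1 < y.1 := by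
  simp [increasing_iff, List.pairwise_append]

@[simp] theorem increasing_delay {c : ℝ} {es : List (ℝ × V)} :
    Increasing (delay c es) ↔ Increasing es := by
  simp [increasing_iff, delay, List.pairwise_map]

theorem mem_pathsIn {E : Type*} {I : Set ℝ} {w : Skeleton E V} :
    w ∈ pathsIn E V I ↔ Increasing w.2 ∧ ∀ e ∈ w.2, e.1 ∈ I := Iff.rfl

@[simp] theorem lastTime_nil : lastTime ([] : List (ℝ × V)) = 0 := rfl

@[simp] theorem lastTime_concat (es : List (ℝ × V)) (e : ℝ × V) :
    lastTime (es ++ [e]) = e.1 := by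
  simp [lastTime]

theorem lastTime_append_of_ne_nil (a : List (ℝ × V)) {b : List (ℝ × V)} (h : b ≠ []) :
    lastTime (a ++ b) = lastTime b := by
  rw [← List.dropLast_append_getLast h, ← List.append_assoc, lastTime_concat, lastTime_concat]

theorem lastTime_delay (c : ℝ) {es : List (ℝ × V)} (h : es ≠ []) :
    lastTime (delay c es) = lastTime es + c := by
  rw [← List.dropLast_append_getLast h, delay_append]
  simp

theorem exists_mem_lastTime {es : List (ℝ × V)} (h : es ≠ []) : ∃ e ∈ es, e.1 = lastTime es :=
  ⟨es.getLast h, List.getLast_mem h, by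
    conv_rhs => rw [← List.dropLast_append_getLast h]
    simp⟩

theorem le_lastTime {es : List (ℝ × V)} (hs : Increasing es) {e : ℝ × V} (he : e ∈ es) :
    e.1 ≤ lastTime es := by
  induction es using List.reverseRecOn with
  | nil => simp at he
  | append_singleton a b _ =>
    rw [lastTime_concat]
    rw [increasing_append] at hs
    rcases List.mem_append.1 he with h | h
    · exact (hs.2.2 e h b (by simp)).le
    · rw [List.mem_singleton.1 h]

theorem lastTime_nonneg {es : List (ℝ × V)} (h : ∀ e ∈ es, 0 < e.1) : 0 ≤ lastTime es := by
  rcases eq_or_ne es [] with rfl | hne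
  · simp
  · obtain ⟨e, he, h'⟩ := exists_mem_lastTime hne
    exact h' ▸ (h e he).le

theorem lastTime_pos {es : List (ℝ × V)} (hne : es ≠ []) (h : ∀ e ∈ es, 0 < e.1) :
    0 < lastTime es := by
  obtain ⟨e, he, h'⟩ := exists_mem_lastTime hne
  exact h' ▸ h e he

theorem eventsIn_eq {I : Set ℝ} {c : ℝ} {es : List (ℝ × V)} :
    eventsIn I c es = delay (-c) (open Classical in es.filter fun e => decide (e.1 ∈ I)) := rfl

theorem eventsIn_univ (c : ℝ) (es : List (ℝ × V)) : eventsIn univ (-c) es = delay c es := by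
  simp [eventsIn_eq]

theorem eventsIn_eq_self {I : Set ℝ} {es : List (ℝ × V)} (h : ∀ e ∈ es, e.1 ∈ I) :
    eventsIn I 0 es = es := by
  rw [eventsIn_eq, List.filter_eq_self.2 (by simpa using h)]
  simp

theorem eventsIn_append {I : Set ℝ} {c : ℝ} {a b : List (ℝ × V)} :
    eventsIn I c (a ++ b) = eventsIn I c a ++ eventsIn I c b := by
  simp [eventsIn_eq]

theorem eventsIn_eq_nil {I : Set ℝ} {c : ℝ} {es : List (ℝ × V)} (h : ∀ e ∈ es, e.1 ∉ I) :
    eventsIn I c es = [] := by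
  rw [eventsIn_eq, List.filter_eq_nil_iff.2 (by simpa using h)]
  simp

theorem eventsIn_eq_delay {I : Set ℝ} {c : ℝ} {es : List (ℝ × V)} (h : ∀ e ∈ es, e.1 ∈ I) :
    eventsIn I c es = delay (-c) es := by
  rw [eventsIn_eq, List.filter_eq_self.2 (by simpa using h)]

theorem mem_eventsIn_zero {I : Set ℝ} {es : List (ℝ × V)} {e : ℝ × V} :
    e ∈ eventsIn I 0 es ↔ e ∈ es ∧ e.1 ∈ I := by
  rw [eventsIn_eq]
  simp

end Events

/-! ### Paths in coordinates extrapolated to time 0 along the flow. -/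

namespace PDMP

variable {E V : Type*} [MeasurableSpace E] [MeasurableSpace V] {μV : Measure V}

theorem flow_flow (X : PDMP E V μV) (s t : ℝ) (z : E) :
    X.flow s (X.flow t z) = X.flow (s + t) z := (X.flow_add s t z).symm

@[simp] theorem flow_neg_flow (X : PDMP E V μV) (t : ℝ) (z : E) :
    X.flow (-t) (X.flow t z) = z := by rw [flow_flow, neg_add_cancel, flow_zero]

@[simp] theorem flow_flow_neg (X : PDMP E V μV) (t : ℝ) (z : E) :
    X.flow t (X.flow (-t) z) = z := by rw [flow_flow, add_neg_cancel, flow_zero]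

/-- The effect of an event on the state extrapolated to time `0` along the flow. -/
def hop (X : PDMP E V μV) (z : E) (e : ℝ × V) : E := X.flow (-e.1) (X.jump (X.flow e.1 z) e.2)

/-- The state after some events, extrapolated to time `0` along the flow. -/
def run (X : PDMP E V μV) (z : E) (es : List (ℝ × V)) : E := es.foldl X.hop z

@[simp] theorem run_nil (X : PDMP E V μV) (z : E) : X.run z [] = z := rfl

@[simp] theorem run_cons (X : PDMP E V μV) (z : E) (e : ℝ × V) (es : List (ℝ × V)) :
    X.run z (e :: es) = X.run (X.hop z e) es := rfl

@[simp] theorem run_append (X : PDMP E V μV) (z : E) (a b : List (ℝ × V)) :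
    X.run z (a ++ b) = X.run (X.run z a) b := List.foldl_append

/-- In extrapolated coordinates a delay is a conjugation by the flow. The shift rules for `run`,
`points` and `revEvents` follow by induction. -/
theorem hop_delay (X : PDMP E V μV) (c : ℝ) (z : E) (e : ℝ × V) :
    X.hop z (e.1 + c, e.2) = X.flow (-c) (X.hop (X.flow c z) e) := by
  simp only [hop, flow_flow]
  rw [neg_add_rev]

theorem run_delay (X : PDMP E V μV) (c : ℝ) (z : E) (es : List (ℝ × V)) :
    X.run z (delay c es) = X.flow (-c) (X.run (X.flow c z) es) := by
  induction es generalizing z with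
  | nil => simp
  | cons e es ih => simp [ih, hop_delay]

/-- Between events the extrapolated state is constant, so the pair (state, time of the last event)
is recovered by flowing it for the time of the last event. Afterwards the fold over pairs is no
longer needed. -/
theorem foldl_afterEvent (X : PDMP E V μV) (x : E) (s : ℝ) (es : List (ℝ × V)) :
    es.foldl X.afterEvent (x, s) = (X.flow (es.foldl (fun _ e => e.1) s)
      (X.run (X.flow (-s) x) es), es.foldl (fun _ e => e.1) s) := by
  induction es generalizing x s with
  | nil => simp
  | cons e es ih =>
    simp only [List.foldl_cons, run_cons, afterEvent]
    rw [ih]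
    simp only [hop, flow_flow]
    rfl

theorem last_eq (X : PDMP E V μV) (w : Skeleton E V) :
    X.last w = (X.flow (lastTime w.2) (X.run w.1 w.2), lastTime w.2) := by
  rw [last, foldl_afterEvent]
  simp [lastTime, X.flow_zero]

theorem stateAt_eq (X : PDMP E V μV) (w : Skeleton E V) (t : ℝ) :
    X.stateAt w t = X.flow t (X.run w.1 w.2) := by
  rw [stateAt, last_eq, flow_flow, sub_add_cancel]

/-- The events with the state just before each of them, from a state extrapolated to time `0`. -/
def marks (X : PDMP E V μV) : E → List (ℝ × V) → List ((ℝ × V) × E)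
  | _, [] => []
  | z, e :: es => (e, X.flow e.1 z) :: marks X (X.hop z e) es

@[simp] theorem marks_nil (X : PDMP E V μV) (z : E) : X.marks z [] = [] := rfl

@[simp] theorem marks_cons (X : PDMP E V μV) (z : E) (e : ℝ × V) (es : List (ℝ × V)) :
    X.marks z (e :: es) = (e, X.flow e.1 z) :: X.marks (X.hop z e) es := rfl

theorem trace_eq (X : PDMP E V μV) (x : E) (s : ℝ) (es : List (ℝ × V)) :
    X.trace (x, s) es = X.marks (X.flow (-s) x) es := by
  induction es generalizing x s with
  | nil => rfl
  | cons e es ih =>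
    simp only [trace, marks_cons, afterEvent, ih, hop, flow_flow]
    rfl

/-- The points where events occur, from a state extrapolated to time `0`. -/
def points (X : PDMP E V μV) (z : E) (es : List (ℝ × V)) : List (ℝ × E × E) :=
  (X.marks z es).map fun a => (a.1.1, a.2, X.jump a.2 a.1.2)

@[simp] theorem points_nil (X : PDMP E V μV) (z : E) : X.points z [] = [] := rfl

@[simp] theorem points_cons (X : PDMP E V μV) (z : E) (e : ℝ × V) (es : List (ℝ × V)) :
    X.points z (e :: es) =
      (e.1, X.flow e.1 z, X.jump (X.flow e.1 z) e.2) :: X.points (X.hop z e) es := rfl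

theorem points_delay (X : PDMP E V μV) (c : ℝ) (z : E) (es : List (ℝ × V)) :
    X.points z (delay c es) = (X.points (X.flow c z) es).map fun a => (a.1 + c, a.2) := by
  induction es generalizing z with
  | nil => rfl
  | cons e es ih => simp [ih, hop_delay, flow_flow, X.flow_zero]

theorem eventPoints_eq (X : PDMP E V μV) (w : Skeleton E V) :
    X.eventPoints w = X.points w.1 w.2 := by
  rw [eventPoints, trace_eq, neg_zero, X.flow_zero, points]

end PDMP

/-! ### Algebra of the path reversal. -/

namespace Reversal

variable {E V Vr : Type*} [MeasurableSpace E] [MeasurableSpace V] [MeasurableSpace Vr]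
  {μV : Measure V} {μVr : Measure Vr} {X : PDMP E V μV} {Y : PDMP E Vr μVr}

/-- The reversal of the backward process. -/
def symm (R : Reversal X Y) : Reversal Y X where
  flow_eq t z := by rw [R.flow_eq, neg_neg]
  revMark := R.fwdMark
  measurable_revMark := R.measurable_fwdMark
  fwdMark := R.revMark
  measurable_fwdMark := R.measurable_revMark
  jump_revMark := R.jump_fwdMark
  jump_fwdMark := R.jump_revMark

theorem toFwd_eq (R : Reversal X Y) (T : ℝ) (w : Skeleton E Vr) :
    R.toFwd T w = R.symm.toRev T w := rfl

/-- The events of a path run backwards, time `t` becoming `-t`. -/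
def revEvents (R : Reversal X Y) (z : E) (es : List (ℝ × V)) : List (ℝ × Vr) :=
  ((X.marks z es).map fun a => (-a.1.1, R.revMark a.2 a.1.2)).reverse

@[simp] theorem revEvents_nil (R : Reversal X Y) (z : E) : R.revEvents z [] = [] := rfl

theorem revEvents_cons (R : Reversal X Y) (z : E) (e : ℝ × V) (es : List (ℝ × V)) :
    R.revEvents z (e :: es) =
      R.revEvents (X.hop z e) es ++ [(-e.1, R.revMark (X.flow e.1 z) e.2)] := by
  simp [revEvents]

theorem revEvents_append (R : Reversal X Y) (z : E) (a b : List (ℝ × V)) :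
    R.revEvents z (a ++ b) = R.revEvents (X.run z a) b ++ R.revEvents z a := by
  induction a generalizing z with
  | nil => simp
  | cons e es ih => simp [revEvents_cons, ih]

theorem revEvents_delay (R : Reversal X Y) (c : ℝ) (z : E) (es : List (ℝ × V)) :
    R.revEvents z (delay c es) = delay (-c) (R.revEvents (X.flow c z) es) := by
  induction es generalizing z with
  | nil => rfl
  | cons e es ih =>
    simp [revEvents_cons, ih, PDMP.hop_delay, PDMP.flow_flow, X.flow_zero, add_comm (-c)]

/-- The duration enters `toRev` only through a flow and a shift: the reversal itself is done with
time t becoming -t, and does not involve T. -/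
theorem toRev_eq (R : Reversal X Y) (T : ℝ) (w : Skeleton E V) :
    R.toRev T w = (X.flow T (X.run w.1 w.2), delay T (R.revEvents w.1 w.2)) := by
  rw [toRev, reversePath, PDMP.stateAt_eq, PDMP.trace_eq, neg_zero, X.flow_zero, revEvents, delay,
    List.map_reverse, List.map_map]
  congr 3
  funext a
  simp [sub_eq_add_neg, add_comm]

/-- The reversed event is the inverse of the event: as the flow of `Y` is opposite, going to time
`-e.1` reaches the state just after the jump, which `jump_revMark` undoes. -/
theorem hop_rev (R : Reversal X Y) (z : E) (e : ℝ × V) :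
    Y.hop (X.hop z e) (-e.1, R.revMark (X.flow e.1 z) e.2) = z := by
  simp only [PDMP.hop, R.flow_eq, neg_neg, PDMP.flow_flow_neg, R.jump_revMark,
    PDMP.flow_neg_flow]

theorem run_revEvents (R : Reversal X Y) (z : E) (es : List (ℝ × V)) :
    Y.run (X.run z es) (R.revEvents z es) = z := by
  induction es generalizing z with
  | nil => rfl
  | cons e es ih => simp [revEvents_cons, ih, hop_rev]

/-- Both marks make `X` jump from `z` to the same state, so they agree by injectivity of the jump in
its mark. -/
theorem fwdMark_revMark (R : Reversal X Y) (z : E) (v : V) :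
    R.fwdMark (X.jump z v) (R.revMark z v) = v := by
  apply X.injective_jump z
  have := R.jump_fwdMark (X.jump z v) (R.revMark z v)
  rwa [R.jump_revMark] at this

/-- The head is reversed into the last event, which is met by the second reversal in the state just
after the original jump; there `fwdMark_revMark` applies. -/
theorem revEvents_revEvents (R : Reversal X Y) (z : E) (es : List (ℝ × V)) :
    R.symm.revEvents (X.run z es) (R.revEvents z es) = es := by
  induction es generalizing z with
  | nil => rfl
  | cons e es ih =>
    rw [revEvents_cons, revEvents_append, PDMP.run_cons, ih, run_revEvents, revEvents_cons]
    have : Y.flow (-e.1) (X.hop z e) = X.jump (X.flow e.1 z) e.2 := by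
      simp [R.flow_eq, PDMP.hop]
    simp only [revEvents_nil, List.nil_append, this, neg_neg]
    change [(e.1, R.fwdMark _ _)] ++ es = _
    rw [fwdMark_revMark]
    rfl

theorem toFwd_toRev (R : Reversal X Y) (T : ℝ) (w : Skeleton E V) :
    R.toFwd T (R.toRev T w) = w := by
  have h : Y.flow T (X.flow T (X.run w.1 w.2)) = X.run w.1 w.2 := by simp [R.flow_eq]
  rw [toFwd_eq, toRev_eq, toRev_eq, PDMP.run_delay, revEvents_delay, h, run_revEvents,
    revEvents_revEvents, PDMP.flow_flow_neg]
  simp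

theorem mem_revEvents (R : Reversal X Y) (z : E) (es : List (ℝ × V)) :
    (R.revEvents z es).map Prod.fst = ((es.map fun e => -e.1)).reverse := by
  induction es generalizing z with
  | nil => rfl
  | cons e es ih => simp [revEvents_cons, ih]

theorem increasing_revEvents (R : Reversal X Y) (z : E) {es : List (ℝ × V)} :
    Increasing (R.revEvents z es) ↔ Increasing es := by
  rw [Increasing, mem_revEvents, List.pairwise_reverse, List.pairwise_map, increasing_iff]
  simp

theorem forall_mem_revEvents (R : Reversal X Y) (z : E) {es : List (ℝ × V)} {p : ℝ → Prop} :
    (∀ e ∈ R.revEvents z es, p e.1) ↔ ∀ e ∈ es, p (-e.1) := by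
  have h : (∀ e ∈ R.revEvents z es, p e.1) ↔ ∀ t ∈ (R.revEvents z es).map Prod.fst, p t := by
    simp
  rw [h, mem_revEvents]
  simp only [List.mem_reverse, List.mem_map]
  exact ⟨fun h e he => h _ ⟨e, he, rfl⟩, fun h t ⟨e, he, ht⟩ => ht ▸ h e he⟩

theorem toRev_mem_pathsIn (R : Reversal X Y) {T : ℝ} {w : Skeleton E V} {I : Set ℝ} :
    R.toRev T w ∈ pathsIn E Vr I ↔ w ∈ pathsIn E V ((fun t => T - t) ⁻¹' I) := by
  rw [mem_pathsIn, toRev_eq, mem_pathsIn, increasing_delay, increasing_revEvents]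
  refine and_congr_right fun _ => ?_
  have h : (∀ e ∈ delay T (R.revEvents w.1 w.2), e.1 ∈ I) ↔
      ∀ e ∈ R.revEvents w.1 w.2, e.1 + T ∈ I := by
    simp only [delay, List.mem_map]
    exact ⟨fun h e he => h _ ⟨e, he, rfl⟩, fun h t ⟨e, he, ht⟩ => ht ▸ h e he⟩
  change (∀ e ∈ delay T (R.revEvents w.1 w.2), e.1 ∈ I) ↔ _
  rw [h, R.forall_mem_revEvents w.1 (p := fun t => t + T ∈ I)]
  simp [sub_eq_add_neg, add_comm]

end Reversal

/-! ### The law of the waiting time until the next event. -/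

namespace SimRate

variable {E V : Type*} [MeasurableSpace E] [MeasurableSpace V]

@[simp] theorem survival_zero (A : SimRate E V) (w : Skeleton E V) : A.survival w 0 = 1 := by
  simp [survival]

theorem survival_ne_zero (A : SimRate E V) (w : Skeleton E V) (s : ℝ) : A.survival w s ≠ 0 := by
  simp [survival, Real.exp_pos]

theorem survival_ne_top (A : SimRate E V) (w : Skeleton E V) (s : ℝ) : A.survival w s ≠ ∞ :=
  ENNReal.ofReal_ne_top

theorem measurable_rate_apply (A : SimRate E V) (w : Skeleton E V) :
    Measurable fun s => (A.rate w s : ℝ≥0∞) :=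
  (A.measurable_rate.comp (measurable_prodMk_left (x := w))).coe_nnreal_ennreal

theorem measurable_coe_rate_apply (A : SimRate E V) (w : Skeleton E V) :
    Measurable fun s => (A.rate w s : ℝ) :=
  (A.measurable_rate.comp (measurable_prodMk_left (x := w))).coe_nnreal_real

/-- The cumulated rate. -/
def cumulated (A : SimRate E V) (w : Skeleton E V) (s : ℝ) : ℝ :=
  (∫⁻ u in Ioc 0 s, (A.rate w u : ℝ≥0∞)).toReal

theorem cumulated_eq_integral (A : SimRate E V) (w : Skeleton E V) (s : ℝ) :
    A.cumulated w s = ∫ u in Ioc 0 s, (A.rate w u : ℝ) := by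
  rw [cumulated, integral_eq_lintegral_of_nonneg_ae (Filter.Eventually.of_forall fun _ => by positivity)
    (A.measurable_coe_rate_apply w).aestronglyMeasurable]
  simp

theorem integrableOn_rate (A : SimRate E V) (w : Skeleton E V) (s : ℝ) :
    IntegrableOn (fun u => (A.rate w u : ℝ)) (Ioc 0 s) := by
  refine ⟨(A.measurable_coe_rate_apply w).aestronglyMeasurable, ?_⟩
  rw [hasFiniteIntegral_iff_ofReal (Filter.Eventually.of_forall fun _ => by positivity)]
  simpa using A.rate_finite w s

theorem continuousOn_cumulated (A : SimRate E V) (w : Skeleton E V) (s : ℝ) :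
    ContinuousOn (A.cumulated w) (Icc 0 s) := by
  have := intervalIntegral.continuousOn_primitive (μ := volume) (f := fun u => (A.rate w u : ℝ))
    (a := 0) (b := s) ((integrableOn_Icc_iff_integrableOn_Ioc).2 (A.integrableOn_rate w s))
  exact this.congr fun u _ => A.cumulated_eq_integral w u

theorem monotone_cumulated (A : SimRate E V) (w : Skeleton E V) : Monotone (A.cumulated w) :=
  fun _ t hst => ENNReal.toReal_mono (A.rate_finite w t).ne
      (lintegral_mono_set (Ioc_subset_Ioc_right hst))

theorem ofReal_cumulated (A : SimRate E V) (w : Skeleton E V) (s : ℝ) :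
    ENNReal.ofReal (A.cumulated w s) = ∫⁻ u in Ioc 0 s, (A.rate w u : ℝ≥0∞) :=
  ENNReal.ofReal_toReal (A.rate_finite w s).ne

/-- By continuity the cumulated rate takes the value x at some c when x is below its value at s. The
set where it is below x differs from (0, c] only by a plateau at height x, to which the rate
contributes nothing. This replaces a change of variables along a function that is neither
differentiable everywhere nor injective. -/
theorem setLIntegral_rate_cumulated_lt (A : SimRate E V) (w : Skeleton E V) {s : ℝ} (hs : 0 ≤ s)
    {x : ℝ} (hx : 0 ≤ x) :
    ∫⁻ u in Ioc 0 s, {u | A.cumulated w u < x}.indicator (fun u => (A.rate w u : ℝ≥0∞)) u =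
      ENNReal.ofReal (min x (A.cumulated w s)) := by
  have hm : MeasurableSet {u | A.cumulated w u < x} :=
    measurableSet_lt (A.monotone_cumulated w).measurable measurable_const
  have h0 : A.cumulated w 0 = 0 := by simp [cumulated]
  rw [lintegral_indicator hm, Measure.restrict_restrict hm]
  rcases lt_or_ge (A.cumulated w s) x with h | h
  · rw [min_eq_right h.le, ofReal_cumulated, inter_eq_right.2]
    exact fun u hu => (A.monotone_cumulated w hu.2).trans_lt h
  · obtain ⟨c, hc, hcx⟩ : x ∈ A.cumulated w '' Icc 0 s :=
      intermediate_value_Icc hs (A.continuousOn_cumulated w s) ⟨by rwa [h0], h⟩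
    rw [min_eq_left h]
    have e1 : {u | A.cumulated w u < x} ∩ Ioc 0 s ⊆ Ioc 0 c := fun u hu =>
      ⟨hu.2.1, le_of_lt (by
        by_contra hcu
        exact absurd (A.monotone_cumulated w (not_lt.1 hcu)) (by rw [hcx]; exact not_le.2 hu.1))⟩
    set I := {u | A.cumulated w u < x} ∩ Ioc 0 s with hI
    rw [← hcx, ofReal_cumulated]
    refine le_antisymm (lintegral_mono_set e1) ?_
    refine le_of_forall_lt fun y hy => ?_
    -- the rate integrates to zero on the part of `Ioc 0 c` where the cumulated rate equals `x`
    refine hy.trans_le ?_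
    have hsplit : Ioc 0 c ⊆ I ∪ {u ∈ Ioc 0 c | A.cumulated w u = x} := fun u hu => by
      rcases ((A.monotone_cumulated w hu.2).trans_eq hcx).lt_or_eq with h' | h'
      · exact Or.inl ⟨h', hu.1, hu.2.trans hc.2⟩
      · exact Or.inr ⟨hu, h'⟩
    refine (lintegral_mono_set hsplit).trans ((lintegral_union_le _ _ _).trans ?_)
    have hzero : ∫⁻ u in {u ∈ Ioc 0 c | A.cumulated w u = x}, (A.rate w u : ℝ≥0∞) = 0 := by
      have hcl : IsCompact {u ∈ Icc 0 c | A.cumulated w u = x} := by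
        refine isCompact_Icc.of_isClosed_subset ?_ (sep_subset _ _)
        exact (A.continuousOn_cumulated w c).preimage_isClosed_of_isClosed isClosed_Icc
          isClosed_singleton
      have hne : {u ∈ Icc 0 c | A.cumulated w u = x}.Nonempty := ⟨c, ⟨hc.1, le_rfl⟩, hcx⟩
      -- With `a` the left end of the plateau, the cumulated rate is equal at `a` and `c`, so the
      -- rate has integral zero over (a, c].
      obtain ⟨a, ha, hamin⟩ := hcl.exists_isLeast hne
      have hsub : {u ∈ Ioc 0 c | A.cumulated w u = x} ⊆ insert a (Ioc a c) := fun u hu => by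
        rcases (hamin ⟨⟨hu.1.1.le, hu.1.2⟩, hu.2⟩).eq_or_lt with h' | h'
        · exact Or.inl h'.symm
        · exact Or.inr ⟨h', hu.1.2⟩
      have hac : ∫⁻ u in Ioc a c, (A.rate w u : ℝ≥0∞) = 0 := by
        have e2 : ∫⁻ u in Ioc 0 c, (A.rate w u : ℝ≥0∞) =
            (∫⁻ u in Ioc 0 a, (A.rate w u : ℝ≥0∞)) + ∫⁻ u in Ioc a c, (A.rate w u : ℝ≥0∞) := by
          rw [← lintegral_union measurableSet_Ioc
            (by rw [Set.disjoint_left]; exact fun u h1 h2 => absurd h1.2 (not_le.2 h2.1)),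
            Ioc_union_Ioc_eq_Ioc ha.1.1 ha.1.2]
        rw [← ofReal_cumulated, ← ofReal_cumulated, hcx, ha.2] at e2
        exact (ENNReal.add_right_inj ENNReal.ofReal_ne_top).1 (e2.symm.trans (add_zero _).symm)
      refine le_antisymm ((lintegral_mono_set hsub).trans ?_) bot_le
      rw [insert_eq]
      refine (lintegral_union_le _ _ _).trans ?_
      simp [hac]
    rw [hzero, add_zero]

/-- The law of the waiting time, on `(0, s]`. -/
theorem lintegral_waiting_add_survival (A : SimRate E V) (w : Skeleton E V) {s : ℝ} (hs : 0 ≤ s) :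
    (∫⁻ u in Ioc 0 s, (A.rate w u : ℝ≥0∞) * A.survival w u) + A.survival w s = 1 := by
  set L := A.cumulated w with hL
  have hmono := A.monotone_cumulated w
  have hL0 : ∀ u, 0 ≤ L u := fun u => ENNReal.toReal_nonneg
  -- Survival is the probability that an exponential variable of parameter 1 exceeds the cumulated
  -- rate. Writing it as an integral and swapping stands for an integration by parts.
  have hexp : ∀ u, A.survival w u =
      ∫⁻ x in Ioi (0 : ℝ), (Ioi (L u)).indicator (fun x => ENNReal.ofReal (Real.exp (-x))) x := by
    intro u
    rw [lintegral_indicator measurableSet_Ioi, Measure.restrict_restrict measurableSet_Ioi,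
      inter_eq_left.2 (Ioi_subset_Ioi (hL0 u)),
      ← ofReal_integral_eq_lintegral_ofReal (integrableOn_exp_neg_Ioi (L u))
        (Filter.Eventually.of_forall fun _ => (Real.exp_pos _).le), integral_exp_neg_Ioi]
    rfl
  have hJ : Measurable fun p : ℝ × ℝ => (A.rate w p.1 : ℝ≥0∞) *
      (Ioi (L p.1)).indicator (fun x => ENNReal.ofReal (Real.exp (-x))) p.2 := by
    refine ((A.measurable_rate_apply w).comp measurable_fst).mul ?_
    have : (fun p : ℝ × ℝ => (Ioi (L p.1)).indicator
        (fun x => ENNReal.ofReal (Real.exp (-x))) p.2) =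
        {p : ℝ × ℝ | L p.1 < p.2}.indicator fun p => ENNReal.ofReal (Real.exp (-p.2)) := by
      funext p; rfl
    rw [this]
    exact Measurable.indicator (measurable_snd.neg.exp.ennreal_ofReal)
      (measurableSet_lt (hmono.measurable.comp measurable_fst) measurable_snd)
  have h1 : ∫⁻ u in Ioc 0 s, (A.rate w u : ℝ≥0∞) * A.survival w u =
      ∫⁻ x in Ioi (0 : ℝ), ENNReal.ofReal (Real.exp (-x)) * ENNReal.ofReal (min x (L s)) := by
    calc ∫⁻ u in Ioc 0 s, (A.rate w u : ℝ≥0∞) * A.survival w u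
        = ∫⁻ u in Ioc 0 s, ∫⁻ x in Ioi (0 : ℝ), (A.rate w u : ℝ≥0∞) *
            (Ioi (L u)).indicator (fun x => ENNReal.ofReal (Real.exp (-x))) x := by
          refine lintegral_congr fun u => ?_
          rw [hexp u, lintegral_const_mul]
          exact (measurable_neg.exp.ennreal_ofReal).indicator measurableSet_Ioi
      _ = ∫⁻ x in Ioi (0 : ℝ), ∫⁻ u in Ioc 0 s, (A.rate w u : ℝ≥0∞) *
            (Ioi (L u)).indicator (fun x => ENNReal.ofReal (Real.exp (-x))) x :=
          lintegral_lintegral_swap hJ.aemeasurable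
      _ = _ := by
          refine setLIntegral_congr_fun measurableSet_Ioi fun x hx => ?_
          have : (fun u => (A.rate w u : ℝ≥0∞) *
              (Ioi (L u)).indicator (fun x => ENNReal.ofReal (Real.exp (-x))) x) =
              fun u => ENNReal.ofReal (Real.exp (-x)) *
                {u | L u < x}.indicator (fun u => (A.rate w u : ℝ≥0∞)) u := by
            funext u
            by_cases h : L u < x
            · simp [indicator, h, mul_comm]
            · simp [indicator, h]
          simp only [this]
          rw [lintegral_const_mul' _ _ ENNReal.ofReal_ne_top,
            A.setLIntegral_rate_cumulated_lt w hs (le_of_lt hx)]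
  -- Writes min x c as the length of the part of (0, c] below x and swaps once more: what remains is
  -- the integral of exp(-y) over (0, c].
  have h2 : ∀ c : ℝ, 0 ≤ c → (∫⁻ x in Ioi (0 : ℝ),
      ENNReal.ofReal (Real.exp (-x)) * ENNReal.ofReal (min x c)) +
        ENNReal.ofReal (Real.exp (-c)) = 1 := by
    intro c hc
    have e1 : ∀ x ∈ Ioi (0 : ℝ), ENNReal.ofReal (Real.exp (-x)) * ENNReal.ofReal (min x c) =
        ∫⁻ y in Ioc 0 c, (Ioi y).indicator (fun x => ENNReal.ofReal (Real.exp (-x))) x := by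
      intro x hx
      have : (fun y => (Ioi y).indicator (fun x => ENNReal.ofReal (Real.exp (-x))) x) =
          (Iio x).indicator fun _ => ENNReal.ofReal (Real.exp (-x)) := by
        funext y
        by_cases h : y < x
        · simp [indicator, h]
        · simp [indicator, h]
      rw [this, lintegral_indicator measurableSet_Iio, Measure.restrict_restrict measurableSet_Iio,
        setLIntegral_const]
      congr 1
      rcases lt_or_ge c x with h | h
      · rw [min_eq_right h.le, inter_eq_right.2 fun y hy => hy.2.trans_lt h, Real.volume_Ioc,
          sub_zero]
      · rw [min_eq_left h]
        have : Iio x ∩ Ioc 0 c = Ioo 0 x := by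
          ext y
          simp only [mem_inter_iff, mem_Iio, mem_Ioc, mem_Ioo]
          exact ⟨fun h => ⟨h.2.1, h.1⟩, fun h' => ⟨h'.2, h'.1, h'.2.le.trans h⟩⟩
        rw [this, Real.volume_Ioo, sub_zero]
    have hK : Measurable fun p : ℝ × ℝ =>
        (Ioi p.2).indicator (fun x => ENNReal.ofReal (Real.exp (-x))) p.1 := by
      have : (fun p : ℝ × ℝ => (Ioi p.2).indicator
          (fun x => ENNReal.ofReal (Real.exp (-x))) p.1) =
          {p : ℝ × ℝ | p.2 < p.1}.indicator fun p => ENNReal.ofReal (Real.exp (-p.1)) := by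
        funext p; rfl
      rw [this]
      exact Measurable.indicator (measurable_fst.neg.exp.ennreal_ofReal)
        (measurableSet_lt measurable_snd measurable_fst)
    rw [setLIntegral_congr_fun measurableSet_Ioi e1, lintegral_lintegral_swap hK.aemeasurable]
    have e2 : ∀ y ∈ Ioc 0 c, ∫⁻ x in Ioi (0 : ℝ),
        (Ioi y).indicator (fun x => ENNReal.ofReal (Real.exp (-x))) x =
          ENNReal.ofReal (Real.exp (-y)) := by
      intro y hy
      rw [lintegral_indicator measurableSet_Ioi, Measure.restrict_restrict measurableSet_Ioi,
        inter_eq_left.2 (Ioi_subset_Ioi hy.1.le),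
        ← ofReal_integral_eq_lintegral_ofReal (integrableOn_exp_neg_Ioi y)
        (Filter.Eventually.of_forall fun _ => (Real.exp_pos _).le), integral_exp_neg_Ioi]
    rw [setLIntegral_congr_fun measurableSet_Ioc e2, ← ofReal_integral_eq_lintegral_ofReal
      ((integrableOn_exp_neg_Ioi 0).mono_set Ioc_subset_Ioi_self)
      (Filter.Eventually.of_forall fun _ => (Real.exp_pos _).le),
      ← intervalIntegral.integral_of_le hc, ← ENNReal.ofReal_add _ (Real.exp_pos _).le]
    · simp [intervalIntegral.integral_comp_neg]
    · exact intervalIntegral.integral_nonneg hc fun _ _ => (Real.exp_pos _).le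
  rw [h1]
  exact h2 (L s) (hL0 s)

end SimRate

/-! ### Densities of sequences of events, and the law of the simulation. -/

namespace PDMP

variable {E V : Type*} [MeasurableSpace E] [MeasurableSpace V] {μV : Measure V}

/-- The density of the further events `es`, given the past events. -/
def eventsDensity (X : PDMP E V μV) (A : SimRate E V) (z : E) :
    List (ℝ × V) → List (ℝ × V) → ℝ≥0∞
  | _, [] => 1
  | past, e :: es => X.eventDensity A (z, past) e * eventsDensity X A z (past ++ [e]) es

theorem eventsDensity_concat (X : PDMP E V μV) (A : SimRate E V) (z : E)
    (past es : List (ℝ × V)) (e : ℝ × V) :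
    X.eventsDensity A z past (es ++ [e]) =
      X.eventsDensity A z past es * X.eventDensity A (z, past ++ es) e := by
  induction es generalizing past with
  | nil => simp [eventsDensity]
  | cons a es ih => simp [eventsDensity, ih, mul_assoc]

/-- Isolates the horizon T: it enters only through the survival after the last event. -/
theorem futureDensity_eq (X : PDMP E V μV) (A : SimRate E V) (T : ℝ) (z : E)
    (past es : List (ℝ × V)) :
    X.futureDensity A T z past es = X.eventsDensity A z past es *
      A.survival (z, past ++ es) (T - lastTime (past ++ es)) := by
  induction es generalizing past with
  | nil => simp [futureDensity, eventsDensity, last_eq]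
  | cons e es ih => simp [futureDensity, eventsDensity, ih, mul_assoc]

theorem pathDensity_eq (X : PDMP E V μV) (A : SimRate E V) (T : ℝ) (w : Skeleton E V) :
    X.pathDensity A T w = X.eventsDensity A w.1 [] w.2 * A.survival w (T - lastTime w.2) := by
  rw [pathDensity, futureDensity_eq]
  rfl

/-- A path cut exactly at an event has no final survival factor. This is why the density of a path
stopped by an event matches the density that enters its weight. -/
theorem pathDensity_lastTime (X : PDMP E V μV) (A : SimRate E V) (w : Skeleton E V) :
    X.pathDensity A (lastTime w.2) w = X.eventsDensity A w.1 [] w.2 := by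
  rw [pathDensity_eq, sub_self, SimRate.survival_zero, mul_one]

theorem eventDensity_ne_top (X : PDMP E V μV) (A : SimRate E V) (w : Skeleton E V) (e : ℝ × V) :
    X.eventDensity A w e ≠ ∞ := by
  rw [eventDensity]
  split_ifs
  · exact ENNReal.mul_ne_top (ENNReal.mul_ne_top ENNReal.coe_ne_top (A.survival_ne_top _ _))
      ENNReal.coe_ne_top
  · exact ENNReal.zero_ne_top

theorem eventsDensity_ne_top (X : PDMP E V μV) (A : SimRate E V) (z : E)
    (past es : List (ℝ × V)) : X.eventsDensity A z past es ≠ ∞ := by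
  induction es generalizing past with
  | nil => simp [eventsDensity]
  | cons e es ih => exact ENNReal.mul_ne_top (X.eventDensity_ne_top _ _ _) (ih _)

theorem pathDensity_ne_top (X : PDMP E V μV) (A : SimRate E V) (T : ℝ) (w : Skeleton E V) :
    X.pathDensity A T w ≠ ∞ := by
  rw [pathDensity_eq]
  exact ENNReal.mul_ne_top (X.eventsDensity_ne_top _ _ _ _) (A.survival_ne_top _ _)

theorem eventDensity_ne_zero (X : PDMP E V μV) {A : SimRate E V} {w : Skeleton E V} {e : ℝ × V}
    (h : X.eventDensity A w e ≠ 0) : lastTime w.2 < e.1 := by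
  rw [eventDensity, last_eq] at h
  by_contra hc
  simp [hc] at h

/-- The density enforces the order of the events and their positivity, so that integrals may run
over all lists. -/
theorem increasing_of_eventsDensity_ne_zero (X : PDMP E V μV) {A : SimRate E V} {z : E}
    {past es : List (ℝ × V)} (h : X.eventsDensity A z past es ≠ 0) :
    Increasing es ∧ ∀ e ∈ es, lastTime past < e.1 := by
  induction es generalizing past with
  | nil => simp
  | cons e es ih =>
    have h1 := left_ne_zero_of_mul h
    have h2 := ih (right_ne_zero_of_mul h)
    rw [lastTime_concat] at h2
    have h3 := X.eventDensity_ne_zero h1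
    refine ⟨increasing_cons.2 ⟨h2.2, h2.1⟩, fun a ha => ?_⟩
    rcases List.mem_cons.1 ha with rfl | ha
    · exact h3
    · exact h3.trans (h2.2 a ha)

theorem measurable_eventsDensity (X : PDMP E V μV) (A : SimRate E V) :
    Measurable fun w : Skeleton E V => X.eventsDensity A w.1 [] w.2 := by
  have h := measurable_list_rec (S := E × List (ℝ × V)) (α := ℝ × V) (β := ℝ≥0∞)
    (b := fun _ => 1) (g := fun s e => (s.1, s.2 ++ [e]))
    (h := fun s e r => X.eventDensity A s e * r) (F := fun s es => X.eventsDensity A s.1 s.2 es)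
    measurable_const
    ((measurable_fst.comp measurable_fst).prodMk (measurable_append_singleton.comp
      ((measurable_snd.comp measurable_fst).prodMk measurable_snd)))
    (((X.measurable_eventDensity A).comp (measurable_fst.prodMk
      (measurable_fst.comp measurable_snd))).mul (measurable_snd.comp measurable_snd))
    (fun _ => rfl) (fun _ _ _ => rfl)
  exact h.comp ((measurable_fst.prodMk measurable_const).prodMk measurable_snd)

theorem _root_.PathSampler.measurable_lastTime :
    Measurable fun es : List (ℝ × V) => lastTime es := by
  have : Measurable fun p : ℝ × List (ℝ × V) => p.2.foldl (fun _ e => e.1) p.1 :=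
    measurable_foldl (measurable_fst.comp measurable_snd)
  exact this.comp (measurable_prodMk_left (x := (0 : ℝ)))

theorem measurable_pathDensity (X : PDMP E V μV) (A : SimRate E V) :
    Measurable fun p : ℝ × Skeleton E V => X.pathDensity A p.1 p.2 := by
  simp_rw [pathDensity_eq]
  refine ((X.measurable_eventsDensity A).comp measurable_snd).mul ?_
  have h : Measurable fun p : ℝ × Skeleton E V => (p.2, p.1 - lastTime p.2.2) :=
    measurable_snd.prodMk (measurable_fst.sub
      (measurable_lastTime.comp (measurable_snd.comp measurable_snd)))
  have h2 := A.measurable_survival.comp h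
  simpa only [Function.comp_def] using h2

section Simulation

variable [SigmaFinite μV]

theorem lintegral_nextEvent (X : PDMP E V μV) (A : SimRate E V) (w : Skeleton E V)
    {f : ℝ × V → ℝ≥0∞} (hf : Measurable f) :
    ∫⁻ e, f e ∂X.nextEvent A w =
      ∫⁻ e, X.eventDensity A w e * f e ∂((volume : Measure ℝ).prod μV) := by
  have hw : Measurable (X.eventDensity A w) :=
    (X.measurable_eventDensity A).comp (measurable_prodMk_left (x := w))
  rw [nextEvent, Kernel.withDensity_apply _ (X.measurable_eventDensity A), Kernel.const_apply,
    lintegral_withDensity_eq_lintegral_mul _ hw hf]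
  rfl

theorem lintegral_simStep_true (X : PDMP E V μV) (A : SimRate E V) (w : Skeleton E V)
    {f : Skeleton E V × Bool → ℝ≥0∞} (hf : Measurable f) :
    ∫⁻ y, f y ∂X.simStep A (w, true) =
      (∫⁻ e, f ((w.1, w.2 ++ [e]), true) ∂X.nextEvent A w) +
        (1 - X.nextEvent A w univ) * f (w, false) := by
  have happ' : Measurable fun e : ℝ × V =>
      (((w.1, w.2 ++ [e]), true) : Skeleton E V × Bool) :=
    (measurable_const.prodMk (measurable_append_singleton.comp
      (measurable_const.prodMk measurable_id))).prodMk measurable_const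
  change ∫⁻ y, f y ∂((X.nextEvent A w).map (fun e => ((w.1, w.2 ++ [e]), true)) +
        (1 - X.nextEvent A w univ) • Measure.dirac (w, false)) = _
  rw [lintegral_add_measure, lintegral_map hf happ', lintegral_smul_measure,
    lintegral_dirac' _ hf]
  rfl

theorem lintegral_simStep_false (X : PDMP E V μV) (A : SimRate E V) (w : Skeleton E V)
    {f : Skeleton E V × Bool → ℝ≥0∞} (hf : Measurable f) :
    ∫⁻ y, f y ∂X.simStep A (w, false) = f (w, false) := by
  change ∫⁻ y, f y ∂(Measure.dirac (w, false)) = _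
  rw [lintegral_dirac' _ hf]

/-- The next event comes after a time `T`, or never, with the probability of survival. -/
theorem nextEvent_after (X : PDMP E V μV) (A : SimRate E V) (w : Skeleton E V) {T : ℝ}
    (hT : lastTime w.2 ≤ T) :
    X.nextEvent A w {e | T < e.1} + (1 - X.nextEvent A w univ) =
      A.survival w (T - lastTime w.2) := by
  have hmT : MeasurableSet {e : ℝ × V | T < e.1} := measurableSet_lt measurable_const measurable_fst
  have hmT' : MeasurableSet {e : ℝ × V | e.1 ≤ T} :=
    measurableSet_le measurable_fst measurable_const
  have hw : Measurable (X.eventDensity A w) :=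
    (X.measurable_eventDensity A).comp (measurable_prodMk_left (x := w))
  have h1 : X.nextEvent A w {e | e.1 ≤ T} + A.survival w (T - lastTime w.2) = 1 := by
    rw [← A.lintegral_waiting_add_survival w (sub_nonneg.2 hT), ← lintegral_indicator_one hmT',
      lintegral_nextEvent _ _ _ (measurable_one.indicator hmT'),
      lintegral_prod (fun e => X.eventDensity A w e * {e : ℝ × V | e.1 ≤ T}.indicator 1 e)
        (hw.mul (measurable_one.indicator hmT')).aemeasurable]
    congr 1
    have hin : ∀ t : ℝ, ∫⁻ v, X.eventDensity A w (t, v) *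
        {e : ℝ × V | e.1 ≤ T}.indicator 1 (t, v) ∂μV =
        (Ioc 0 (T - lastTime w.2)).indicator
          (fun s => (A.rate w s : ℝ≥0∞) * A.survival w s) (t - lastTime w.2) := by
      intro t
      by_cases h : lastTime w.2 < t ∧ t ≤ T
      · have hm2 : Measurable fun v => (X.markDensity (X.stateAt w t) v : ℝ≥0∞) :=
          (X.measurable_markDensity.comp (measurable_prodMk_left (x := _))).coe_nnreal_ennreal
        have hi : ∀ v : V, {e : ℝ × V | e.1 ≤ T}.indicator (1 : ℝ × V → ℝ≥0∞) (t, v) = 1 :=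
          fun v => indicator_of_mem (show (t, v) ∈ {e : ℝ × V | e.1 ≤ T} from h.2) _
        simp only [eventDensity, last_eq, h.1, if_true, hi, mul_one]
        rw [lintegral_const_mul _ hm2, X.lintegral_markDensity, mul_one,
          indicator_of_mem (by simpa using h)]
      · rw [indicator_of_notMem (by simpa using h), ← lintegral_zero (μ := μV)]
        refine lintegral_congr fun v => ?_
        by_cases h1 : lastTime w.2 < t
        · rw [indicator_of_notMem (fun h2 : (t, v) ∈ {e : ℝ × V | e.1 ≤ T} => h ⟨h1, h2⟩), mul_zero]
        · simp [eventDensity, last_eq, h1]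
    simp_rw [hin]
    rw [lintegral_sub_right_eq_self (fun t => (Ioc 0 (T - lastTime w.2)).indicator
      (fun s => (A.rate w s : ℝ≥0∞) * A.survival w s) t), lintegral_indicator measurableSet_Ioc]
  have h2 : X.nextEvent A w univ = X.nextEvent A w {e | e.1 ≤ T} + X.nextEvent A w {e | T < e.1} := by
    rw [← measure_union _ hmT]
    · congr 1
      ext e
      simp [le_or_gt]
    · rw [Set.disjoint_left]
      exact fun e (he : e.1 ≤ T) (he' : T < e.1) => absurd he (not_le.2 he')
  have h3 := X.nextEvent_le_one A w
  have h4 : X.nextEvent A w {e | e.1 ≤ T} ≠ ∞ :=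
    ((measure_mono (subset_univ _)).trans_lt (h3.trans_lt ENNReal.one_lt_top)).ne
  -- The mass of an event up to T is finite, so it may be added to both sides, which then equal 1.
  refine (ENNReal.add_right_inj h4).1 ?_
  rw [h1, ← add_assoc, ← h2]
  exact add_tsub_cancel_of_le h3

instance isMarkovKernel_trajectoryLaw (X : PDMP E V μV) (A : SimRate E V) :
    IsMarkovKernel (X.trajectoryLaw A) := by
  rw [trajectoryLaw]; infer_instance

/-- The Markov property of the simulation. -/
theorem lintegral_trajectoryLaw_step (X : PDMP E V μV) (A : SimRate E V) (z : E) (n : ℕ)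
    {F : (Skeleton E V × Bool) × (Skeleton E V × Bool) → ℝ≥0∞} (hF : Measurable F) :
    ∫⁻ ω, F (ω n, ω (n + 1)) ∂X.trajectoryLaw A z =
      ∫⁻ ω, ∫⁻ y, F (ω n, y) ∂X.simStep A (ω n) ∂X.trajectoryLaw A z := by
  set κ : (n : ℕ) → Kernel ((i : Finset.Iic n) → Skeleton E V × Bool) (Skeleton E V × Bool) :=
    fun n => (X.simStep A).comap (fun h => h ⟨n, Finset.mem_Iic.2 le_rfl⟩)
      (measurable_pi_apply _) with hκ
  set x0 : (i : Finset.Iic 0) → Skeleton E V × Bool := fun _ => ((z, []), true)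
  have hlaw : X.trajectoryLaw A z = Kernel.traj (X := fun _ => Skeleton E V × Bool) κ 0 x0 := rfl
  have h := Kernel.partialTraj_compProd_eq_map_traj (X := fun _ => Skeleton E V × Bool) (κ := κ)
    (Nat.zero_le n) (x₀ := x0)
  have hG : Measurable fun p : ((i : Finset.Iic n) → Skeleton E V × Bool) × (Skeleton E V × Bool) =>
      F (p.1 ⟨n, Finset.mem_Iic.2 le_rfl⟩, p.2) :=
    hF.comp (((measurable_pi_apply _).comp measurable_fst).prodMk measurable_snd)
  have hm : Measurable fun x : ℕ → Skeleton E V × Bool =>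
      (Preorder.frestrictLe (π := fun _ => Skeleton E V × Bool) n x, x (n + 1)) := by fun_prop
  have hI : Measurable fun p : Skeleton E V × Bool => ∫⁻ y, F (p, y) ∂X.simStep A p :=
    Measurable.lintegral_kernel_prod_right' hF
  have hI' : Measurable fun h : (i : Finset.Iic n) → Skeleton E V × Bool =>
      ∫⁻ y, F (h ⟨n, Finset.mem_Iic.2 le_rfl⟩, y) ∂κ n h :=
    hI.comp (measurable_pi_apply (⟨n, Finset.mem_Iic.2 le_rfl⟩ : Finset.Iic n))
  have h1 := lintegral_map (μ := Kernel.traj (X := fun _ => Skeleton E V × Bool) κ 0 x0) hG hm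
  rw [← h, Measure.lintegral_compProd hG, ← Kernel.traj_map_frestrictLe_apply,
    lintegral_map hI' (by fun_prop)] at h1
  rw [hlaw]
  exact h1.symm

theorem lintegral_trajectoryLaw_zero (X : PDMP E V μV) (A : SimRate E V) (z : E)
    {F : Skeleton E V × Bool → ℝ≥0∞} (hF : Measurable F) :
    ∫⁻ ω, F (ω 0) ∂X.trajectoryLaw A z = F ((z, []), true) := by
  set κ : (n : ℕ) → Kernel ((i : Finset.Iic n) → Skeleton E V × Bool) (Skeleton E V × Bool) :=
    fun n => (X.simStep A).comap (fun h => h ⟨n, Finset.mem_Iic.2 le_rfl⟩)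
      (measurable_pi_apply _) with hκ
  set x0 : (i : Finset.Iic 0) → Skeleton E V × Bool := fun _ => ((z, []), true)
  have hlaw : X.trajectoryLaw A z = Kernel.traj (X := fun _ => Skeleton E V × Bool) κ 0 x0 := rfl
  have hm : Measurable fun h : (i : Finset.Iic 0) → Skeleton E V × Bool =>
      F (h ⟨0, Finset.mem_Iic.2 le_rfl⟩) := hF.comp (measurable_pi_apply _)
  have h := Kernel.traj_map_frestrictLe_apply (X := fun _ => Skeleton E V × Bool) (κ := κ) 0 0 x0
  have h1 := lintegral_map (μ := Kernel.traj (X := fun _ => Skeleton E V × Bool) κ 0 x0) hm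
    (g := Preorder.frestrictLe (π := fun _ => Skeleton E V × Bool) 0) (by fun_prop)
  rw [h, Kernel.partialTraj_self, Kernel.id_apply, lintegral_dirac' _ hm] at h1
  rw [hlaw]
  exact h1.symm

/-- The law of the first `n` events. -/
theorem lintegral_trajectoryLaw_events (X : PDMP E V μV) (A : SimRate E V) (z : E) (n : ℕ)
    {g : Skeleton E V → ℝ≥0∞} (hg : Measurable g) :
    ∫⁻ ω, (if (ω n).2 = true then g (ω n).1 else 0) ∂X.trajectoryLaw A z =
      ∫⁻ es, X.eventsDensity A z [] es * g (z, es)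
        ∂listMeasure ((volume : Measure ℝ).prod μV) n := by
  have hflag : ∀ {g : Skeleton E V → ℝ≥0∞}, Measurable g →
      Measurable fun p : Skeleton E V × Bool => if p.2 = true then g p.1 else 0 := fun hg =>
    Measurable.ite (measurable_snd (measurableSet_singleton true)) (hg.comp measurable_fst)
      measurable_const
  induction n generalizing g with
  | zero =>
    have hg' : Measurable fun es : List (ℝ × V) => X.eventsDensity A z [] es * g (z, es) :=
      ((X.measurable_eventsDensity A).comp (measurable_prodMk_left (x := z))).mul
        (hg.comp measurable_prodMk_left)
    rw [X.lintegral_trajectoryLaw_zero A z (hflag hg), listMeasure, lintegral_dirac' _ hg']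
    simp [eventsDensity]
  | succ n ih =>
    have happ : Measurable fun q : Skeleton E V × (ℝ × V) =>
        ((q.1.1, q.1.2 ++ [q.2]) : Skeleton E V) :=
      (measurable_fst.comp measurable_fst).prodMk (measurable_append_singleton.comp
        ((measurable_snd.comp measurable_fst).prodMk measurable_snd))
    have hH : Measurable fun q : Skeleton E V × (ℝ × V) =>
        X.eventDensity A q.1 q.2 * g (q.1.1, q.1.2 ++ [q.2]) :=
      (X.measurable_eventDensity A).mul (hg.comp happ)
    have hg2 : Measurable fun w : Skeleton E V =>
        ∫⁻ e, X.eventDensity A w e * g (w.1, w.2 ++ [e]) ∂((volume : Measure ℝ).prod μV) :=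
      Measurable.lintegral_prod_right' hH
    have hstep : ∀ p : Skeleton E V × Bool,
        ∫⁻ y, (if y.2 = true then g y.1 else 0) ∂X.simStep A p =
          if p.2 = true then ∫⁻ e, X.eventDensity A p.1 e * g (p.1.1, p.1.2 ++ [e])
            ∂((volume : Measure ℝ).prod μV) else 0 := by
      rintro ⟨w, b⟩
      cases b
      · rw [lintegral_simStep_false _ _ _ (hflag hg)]; simp
      · rw [lintegral_simStep_true _ _ _ (hflag hg)]
        simp only [if_true, Bool.false_eq_true, if_false, mul_zero, add_zero]
        exact lintegral_nextEvent _ _ _ (hg.comp (happ.comp measurable_prodMk_left))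
    have h1 := X.lintegral_trajectoryLaw_step A z n
      (F := fun p => if p.2.2 = true then g p.2.1 else 0) ((hflag hg).comp measurable_snd)
    simp only at h1
    rw [h1]
    simp_rw [hstep]
    rw [ih hg2]
    -- The simulation appends at the end of the list while `listMeasure` unrolls from the head;
    -- cutting a list of length n + 1 after n entries reconciles the two.
    have hK : Measurable fun p : List (ℝ × V) × List (ℝ × V) =>
        X.eventsDensity A z [] (p.1 ++ p.2) * g (z, p.1 ++ p.2) :=
      ((X.measurable_eventsDensity A).comp (measurable_const.prodMk measurable_append)).mul
        (hg.comp (measurable_const.prodMk measurable_append))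
    have h2 := lintegral_listMeasure_add ((volume : Measure ℝ).prod μV) n 1 hK
    simp only [List.take_append_drop] at h2
    rw [h2]
    refine lintegral_congr fun a => ?_
    have hKa : Measurable fun l : List (ℝ × V) =>
        X.eventsDensity A z [] (a ++ l) * g (z, a ++ l) := hK.comp measurable_prodMk_left
    rw [lintegral_listMeasure_succ _ 0 hKa]
    have hKe : ∀ e, ∫⁻ l, X.eventsDensity A z [] (a ++ e :: l) * g (z, a ++ e :: l)
        ∂listMeasure ((volume : Measure ℝ).prod μV) 0 =
        X.eventsDensity A z [] (a ++ [e]) * g (z, a ++ [e]) := fun e => by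
      have : Measurable fun l : List (ℝ × V) =>
          X.eventsDensity A z [] (a ++ e :: l) * g (z, a ++ e :: l) :=
        hKa.comp (measurable_cons.comp measurable_prodMk_left)
      rw [listMeasure, lintegral_dirac' _ this]
    simp_rw [hKe, eventsDensity_concat, List.nil_append, mul_assoc]
    rw [lintegral_const_mul]
    exact hH.comp (measurable_prodMk_left (x := ((z, a) : Skeleton E V)))

end Simulation

end PDMP

/-! ## Almost sure indistinguishability -/

section Indist

variable {Ω A B T : Type*} [MeasurableSpace Ω] [MeasurableSpace A] [MeasurableSpace B]
  [MeasurableSpace T]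

/-- Each measurable set almost surely contains both or none of `f` and `g`. -/
def Indist (M : Measure Ω) (f g : Ω → A) : Prop :=
  ∀ B, MeasurableSet B → ∀ᵐ ω ∂M, (f ω ∈ B ↔ g ω ∈ B)

theorem Indist.refl (M : Measure Ω) (f : Ω → A) : Indist M f f :=
  fun _ _ => Filter.Eventually.of_forall fun _ => Iff.rfl

theorem Indist.comp {M : Measure Ω} {f g : Ω → A} (h : Indist M f g) {φ : A → B}
    (hφ : Measurable φ) : Indist M (fun ω => φ (f ω)) (fun ω => φ (g ω)) :=
  fun C hC => h (φ ⁻¹' C) (hφ hC)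

/-- The sets that almost surely do not separate f from g form a sigma-algebra. -/
theorem Indist.of_generateFrom {M : Measure Ω} {f g : Ω → A} {C : Set (Set A)}
    (hC : ‹MeasurableSpace A› = MeasurableSpace.generateFrom C)
    (h : ∀ B ∈ C, ∀ᵐ ω ∂M, (f ω ∈ B ↔ g ω ∈ B)) : Indist M f g := by
  intro B hB
  rw [hC] at hB
  induction B, hB using MeasurableSpace.generateFrom_induction with
  | hC B hB _ => exact h B hB
  | empty => simp
  | compl B _ ih => filter_upwards [ih] with ω hω using not_congr hω
  | iUnion s _ ih =>
    filter_upwards [ae_all_iff.2 ih] with ω hω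
    simp only [mem_iUnion, hω]

theorem Indist.prodMk {M : Measure Ω} {f g : Ω → A} {f' g' : Ω → B} (h : Indist M f g)
    (h' : Indist M f' g') : Indist M (fun ω => (f ω, f' ω)) (fun ω => (g ω, g' ω)) := by
  refine Indist.of_generateFrom generateFrom_prod.symm ?_
  rintro _ ⟨s, hs, t, ht, rfl⟩
  filter_upwards [h s hs, h' t ht] with ω h1 h2
  simp [h1, h2]

theorem Indist.pi {ι : Type*} [Countable ι] {A : ι → Type*} [∀ i, MeasurableSpace (A i)]
    {M : Measure Ω} {f g : Ω → ∀ i, A i} (h : ∀ i, Indist M (fun ω => f ω i) (fun ω => g ω i)) :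
    Indist M f g := by
  refine Indist.of_generateFrom (C := {s | ∃ i, MeasurableSet[(inferInstance :
    MeasurableSpace (A i)).comap fun x : ∀ i, A i => x i] s}) ?_ ?_
  · ext s
    exact MeasurableSpace.measurableSet_iSup
  · rintro _ ⟨i, B, hB, rfl⟩
    exact h i B hB

/-- Indistinguishable functions behave alike for all the values of a parameter. -/
theorem Indist.forall_mem {M : Measure Ω} {f g : Ω → A} (h : Indist M f g) {S : Set (A × T)}
    (hS : MeasurableSet S) : ∀ᵐ ω ∂M, ∀ t, ((f ω, t) ∈ S ↔ (g ω, t) ∈ S) := by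
  -- The sets S for which one null set serves all the values of t form a sigma-algebra. It contains
  -- the rectangles, where t plays no role.
  rw [← generateFrom_prod] at hS
  induction S, hS using MeasurableSpace.generateFrom_induction with
  | hC S hS _ =>
    obtain ⟨s, hs, t, ht, rfl⟩ := hS
    filter_upwards [h s hs] with ω h1 u
    simp [h1]
  | empty => simp
  | compl B _ ih => filter_upwards [ih] with ω hω t using not_congr (hω t)
  | iUnion s _ ih =>
    filter_upwards [ae_all_iff.2 ih] with ω hω t
    simp only [mem_iUnion, hω]

/-- Applies `Indist.forall_mem` to the set of pairs (a, t) with F a < t, which determines F; no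
separation of points of the space is needed. -/
theorem Indist.ae_eq {M : Measure Ω} {f g : Ω → A} (h : Indist M f g) {F : A → ℝ≥0∞}
    (hF : Measurable F) : ∀ᵐ ω ∂M, F (f ω) = F (g ω) := by
  have h1 : ∀ᵐ ω ∂M, ∀ t : ℝ≥0∞, ((f ω, t) ∈ {p : A × ℝ≥0∞ | F p.1 < p.2} ↔
      (g ω, t) ∈ {p : A × ℝ≥0∞ | F p.1 < p.2}) :=
    h.forall_mem (measurableSet_lt (hF.comp measurable_fst) measurable_snd)
  filter_upwards [h1] with ω hω
  refine le_antisymm (le_of_not_gt fun h => ?_) (le_of_not_gt fun h => ?_)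
  · exact absurd ((hω _).2 h) (lt_irrefl _)
  · exact absurd ((hω _).1 h) (lt_irrefl _)

theorem Indist.lintegral_eq {M : Measure Ω} {f g : Ω → A} (h : Indist M f g) {F : A → ℝ≥0∞}
    (hF : Measurable F) : ∫⁻ ω, F (f ω) ∂M = ∫⁻ ω, F (g ω) ∂M :=
  lintegral_congr_ae (h.ae_eq hF)

end Indist

/-! ## Regular trajectories -/

section Regular

variable {E V : Type*}

/-- A trajectory from `z` obtained by appending one later event after the other, until there are
no more events. -/
structure Trajectory.Regular (z : E) (ω : Trajectory E V) : Prop where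
  zero : ω 0 = ((z, []), true)
  step : ∀ n, ((ω n).2 = true ∧ ∃ e : ℝ × V, lastTime (ω n).1.2 < e.1 ∧
      ω (n + 1) = (((ω n).1.1, (ω n).1.2 ++ [e]), true)) ∨ ω (n + 1) = ((ω n).1, false)

namespace Trajectory.Regular

variable {z : E} {ω : Trajectory E V}

theorem prefix_of_le (h : ω.Regular z) {n m : ℕ} (hnm : n ≤ m) :
    (ω n).1.2 <+: (ω m).1.2 := by
  induction m, hnm using Nat.le_induction with
  | base => exact List.prefix_rfl
  | succ m _ ih =>
    rcases h.step m with ⟨_, e, _, h'⟩ | h' <;> rw [h']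
    · exact ih.trans (List.prefix_append _ _)
    · exact ih

theorem length_of_true (h : ω.Regular z) {n : ℕ} (hn : (ω n).2 = true) :
    (ω n).1.2.length = n := by
  induction n with
  | zero => rw [h.zero]; rfl
  | succ n ih =>
    rcases h.step n with ⟨ht, e, _, h'⟩ | h'
    · rw [h']; simp [ih ht]
    · rw [h'] at hn; simp at hn

theorem step_of_false (h : ω.Regular z) {n : ℕ} (hn : (ω n).2 = false) : ω (n + 1) = ω n := by
  rcases h.step n with ⟨ht, e, _, h'⟩ | h'
  · simp [hn] at ht
  · rw [h', ← hn]

theorem eq_of_false (h : ω.Regular z) {n m : ℕ} (hnm : n ≤ m) (hn : (ω n).2 = false) :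
    ω m = ω n := by
  induction m, hnm using Nat.le_induction with
  | base => rfl
  | succ m _ ih => rw [h.step_of_false (by rw [ih, hn]), ih]

theorem increasing (h : ω.Regular z) (n : ℕ) :
    Increasing (ω n).1.2 ∧ ∀ e ∈ (ω n).1.2, 0 < e.1 := by
  induction n with
  | zero => rw [h.zero]; simp
  | succ n ih =>
    rcases h.step n with ⟨_, e, he, h'⟩ | h' <;> rw [h']
    · refine ⟨increasing_append.2 ⟨ih.1, by simp [increasing_cons], fun x hx y hy => ?_⟩,
        fun a ha => ?_⟩
      · rw [List.mem_singleton.1 hy]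
        exact (le_lastTime ih.1 hx).trans_lt he
      · rcases List.mem_append.1 ha with ha | ha
        · exact ih.2 a ha
        · rw [List.mem_singleton.1 ha]
          exact (lastTime_nonneg ih.2).trans_lt he
    · exact ih

theorem covers_mono (h : ω.Regular z) {T : ℝ} {n m : ℕ} (hnm : n ≤ m) (hn : ω.Covers T n) :
    ω.Covers T m := by
  rcases hn with hn | ⟨e, he, hT⟩
  · exact Or.inl (by rw [h.eq_of_false hnm hn, hn])
  · exact Or.inr ⟨e, (h.prefix_of_le hnm).subset he, hT⟩

theorem eventsIn_eq_of_covers (h : ω.Regular z) {T : ℝ} {n m : ℕ} (hnm : n ≤ m)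
    (hn : ω.Covers T n) : eventsIn (Iic T) 0 (ω m).1.2 = eventsIn (Iic T) 0 (ω n).1.2 := by
  induction m, hnm using Nat.le_induction with
  | base => rfl
  | succ m hm ih =>
    rcases h.step m with ⟨ht, e, he, h'⟩ | h'
    · rw [h', eventsIn_append, ih]
      rcases h.covers_mono hm hn with h1 | ⟨a, ha, hT⟩
      · simp [ht] at h1
      · rw [eventsIn_eq_nil (es := [e]), List.append_nil]
        intro b hb
        rw [List.mem_singleton.1 hb]
        exact not_le.2 (hT.trans ((le_lastTime (h.increasing m).1 ha).trans_lt he))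
    · rw [h', ih]

/-- The definition reads the events at the first covering step; on a regular trajectory any covering
step will do. -/
theorem eventsUpTo_eq (h : ω.Regular z) {T : ℝ} {n : ℕ} (hn : ω.Covers T n) :
    ω.eventsUpTo T = eventsIn (Iic T) 0 (ω n).1.2 :=
  (h.eventsIn_eq_of_covers (Nat.sInf_le hn) (Nat.sInf_mem (s := {n | ω.Covers T n}) ⟨n, hn⟩)).symm

theorem eventsUpTo_mem (h : ω.Regular z) (T : ℝ) :
    Increasing (ω.eventsUpTo T) ∧ ∀ e ∈ ω.eventsUpTo T, 0 < e.1 ∧ e.1 ≤ T := by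
  have h1 := h.increasing (sInf {n | ω.Covers T n})
  refine ⟨?_, fun e he => ?_⟩
  · rw [Trajectory.eventsUpTo, eventsIn_eq, increasing_delay, increasing_iff]
    exact (increasing_iff.1 h1.1).filter _
  · rw [Trajectory.eventsUpTo, mem_eventsIn_zero] at he
    exact ⟨h1.2 e he.1, he.2⟩

theorem reaches_mono (h : ω.Regular z) {T T' : ℝ} (hT : T ≤ T') (hr : ω.Reaches T') :
    ω.Reaches T ∧ ω.eventsUpTo T = eventsIn (Iic T) 0 (ω.eventsUpTo T') := by
  obtain ⟨n, hn⟩ := hr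
  have hn' : ω.Covers T n := hn.imp id fun ⟨e, he, h'⟩ => ⟨e, he, hT.trans_lt h'⟩
  refine ⟨⟨n, hn'⟩, ?_⟩
  rw [h.eventsUpTo_eq hn, h.eventsUpTo_eq hn']
  simp only [eventsIn_eq, neg_zero, delay_zero, List.filter_filter]
  congr 1
  funext e
  by_cases h1 : e.1 ≤ T
  · simp [h1, h1.trans hT]
  · simp [h1]

/-- The trajectory up to a time does not change until a little later. -/
theorem exists_reaches_add (h : ω.Regular z) {T : ℝ} (hr : ω.Reaches T) :
    ∃ δ > 0, ω.Reaches (T + δ) ∧ ω.eventsUpTo (T + δ) = ω.eventsUpTo T := by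
  obtain ⟨n, hn⟩ := hr
  -- the events later than `T`
  obtain ⟨δ, hδ, hδ'⟩ : ∃ δ > 0, ∀ e ∈ (ω n).1.2, T < e.1 → T + δ < e.1 := by
    induction (ω n).1.2 with
    | nil => exact ⟨1, one_pos, by simp⟩
    | cons e es ih =>
      obtain ⟨δ, hδ, h'⟩ := ih
      by_cases he : T < e.1
      · refine ⟨min δ ((e.1 - T) / 2), lt_min hδ (by linarith), fun a ha hTa => ?_⟩
        rcases List.mem_cons.1 ha with rfl | ha
        · linarith [min_le_right δ ((a.1 - T) / 2)]
        · linarith [min_le_left δ ((e.1 - T) / 2), h' a ha hTa]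
      · refine ⟨δ, hδ, fun a ha hTa => ?_⟩
        rcases List.mem_cons.1 ha with rfl | ha
        · exact absurd hTa he
        · exact h' a ha hTa
  have hn' : ω.Covers (T + δ) n := hn.imp id fun ⟨e, he, h'⟩ => ⟨e, he, hδ' e he h'⟩
  refine ⟨δ, hδ, ⟨n, hn'⟩, ?_⟩
  rw [h.eventsUpTo_eq hn, h.eventsUpTo_eq hn']
  simp only [eventsIn_eq, neg_zero, delay_zero]
  refine List.filter_congr fun e he => ?_
  by_cases h1 : T < e.1
  · simp [not_le.2 h1, not_le.2 (hδ' e he h1)]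
  · simp [not_lt.1 h1, (not_lt.1 h1).trans (le_add_of_nonneg_right hδ.le)]

/-- At the time of the last of the first events, the events are these first events. -/
theorem eventsUpTo_lastTime (h : ω.Regular z) (k : ℕ) :
    ω.Reaches (lastTime (ω k).1.2) ∧ ω.eventsUpTo (lastTime (ω k).1.2) = (ω k).1.2 := by
  have hself : eventsIn (Iic (lastTime (ω k).1.2)) 0 (ω k).1.2 = (ω k).1.2 :=
    eventsIn_eq_self fun e he => le_lastTime (h.increasing k).1 he
  rcases h.step k with ⟨_, e, he, h'⟩ | h'
  · have hc : ω.Covers (lastTime (ω k).1.2) (k + 1) := Or.inr ⟨e, by rw [h']; simp, he⟩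
    refine ⟨⟨_, hc⟩, ?_⟩
    rw [h.eventsUpTo_eq hc, h', eventsIn_append, hself, eventsIn_eq_nil, List.append_nil]
    intro b hb
    rw [List.mem_singleton.1 hb]
    exact not_le.2 he
  · have hc : ω.Covers (lastTime (ω k).1.2) (k + 1) := Or.inl (by rw [h'])
    refine ⟨⟨_, hc⟩, ?_⟩
    rw [h.eventsUpTo_eq hc, h', hself]

/-- The events up to a time are the first events. -/
theorem eventsUpTo_eq_first (h : ω.Regular z) {T : ℝ} (hr : ω.Reaches T) :
    (ω (ω.eventsUpTo T).length).2 = true ∧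
      (ω (ω.eventsUpTo T).length).1.2 = ω.eventsUpTo T ∧
      ω.Covers T ((ω.eventsUpTo T).length + 1) := by
  have hmem := Nat.sInf_mem (s := {n | ω.Covers T n}) hr
  -- Step 0 never covers: it has no events and its flag is still on. So the first covering step has
  -- a predecessor, whose events are exactly those up to T.
  obtain ⟨k, hk⟩ : ∃ k, sInf {n | ω.Covers T n} = k + 1 := by
    refine Nat.exists_eq_succ_of_ne_zero fun h0 => ?_
    rw [h0] at hmem
    rcases hmem with h1 | ⟨e, he, _⟩
    · rw [h.zero] at h1; simp at h1
    · rw [h.zero] at he; simp at he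
  have hnot : ¬ ω.Covers T k := fun hc => by
    have := Nat.sInf_le (s := {n | ω.Covers T n}) hc
    omega
  have hc : ω.Covers T (k + 1) := hk ▸ hmem
  have ht : (ω k).2 = true := by
    by_contra hf
    exact hnot (Or.inl (by simpa using hf))
  have hle : ∀ e ∈ (ω k).1.2, e.1 ≤ T := fun e he => by
    by_contra hf
    exact hnot (Or.inr ⟨e, he, not_le.1 hf⟩)
  have hev : ω.eventsUpTo T = (ω k).1.2 := by
    rw [h.eventsUpTo_eq hc]
    rcases h.step k with ⟨_, e, he, h'⟩ | h'
    · rw [h', eventsIn_append, eventsIn_eq_self hle, eventsIn_eq_nil, List.append_nil]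
      intro b hb
      rw [List.mem_singleton.1 hb]
      rcases hc with h1 | ⟨a, ha, hT⟩
      · rw [h'] at h1; simp at h1
      · rw [h'] at ha
        rcases List.mem_append.1 ha with ha | ha
        · exact absurd (hle a ha) (not_le.2 hT)
        · rw [← List.mem_singleton.1 ha]; exact not_le.2 hT
    · rw [h', eventsIn_eq_self hle]
  rw [hev, h.length_of_true ht]
  exact ⟨ht, rfl, hc⟩

/-- Converse of `eventsUpTo_eq_first`: two consecutive steps suffice to recognise the number of
events up to T. This lets an integral over trajectories be written as a sum over k of one-step
functionals. -/
theorem eq_of_not_covers (h : ω.Regular z) {T : ℝ} {k : ℕ} (hk : (ω k).2 = true)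
    (hle : ∀ e ∈ (ω k).1.2, e.1 ≤ T) (hc : ω.Covers T (k + 1)) :
    ω.Reaches T ∧ ω.eventsUpTo T = (ω k).1.2 := by
  refine ⟨⟨_, hc⟩, ?_⟩
  have h1 := h.eventsUpTo_eq_first ⟨_, hc⟩
  set m := (ω.eventsUpTo T).length
  have hkm : ¬ k < m := fun hlt => by
    rcases h.covers_mono (show k + 1 ≤ m by omega) hc with h2 | ⟨e, he, hT⟩
    · rw [h1.1] at h2; simp at h2
    · rw [h1.2.1] at he
      exact absurd ((h.eventsUpTo_mem T).2 e he).2 (not_le.2 hT)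
  have hmk : ¬ m < k := fun hlt => by
    rcases h.covers_mono (show m + 1 ≤ k by omega) h1.2.2 with h2 | ⟨e, he, hT⟩
    · rw [hk] at h2; simp at h2
    · exact absurd (hle e he) (not_le.2 hT)
  have : k = m := by omega
  rw [this]
  exact h1.2.1.symm

end Trajectory.Regular

end Regular

/-! ### Measurability of the events up to a time. -/

section Measurability

variable {E V S : Type*} [MeasurableSpace E] [MeasurableSpace V] [MeasurableSpace S]

theorem measurable_eventsIn {I : S → Set ℝ} {c : S → ℝ}
    (hI : MeasurableSet {q : S × ℝ | q.2 ∈ I q.1}) (hc : Measurable c) :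
    Measurable fun p : S × List (ℝ × V) => eventsIn (I p.1) (c p.1) p.2 := by
  classical
  refine measurable_list_rec' (b := fun _ => [])
    (h := fun s e r => if e.1 ∈ I s then (e.1 - c s, e.2) :: r else r)
    (F := fun s es => eventsIn (I s) (c s) es) measurable_const ?_ (fun _ => rfl) ?_
  · refine Measurable.ite ?_ ?_ (measurable_snd.comp measurable_snd)
    · have h : Measurable fun a : S × (ℝ × V) × List (ℝ × V) => (a.1, a.2.1.1) := by fun_prop
      exact hI.preimage h
    · refine measurable_cons.comp (Measurable.prodMk ?_ (measurable_snd.comp measurable_snd))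
      fun_prop
  · intro s e es
    by_cases h : e.1 ∈ I s <;> simp [eventsIn, h]

theorem measurable_delay : Measurable fun p : ℝ × List (ℝ × V) => delay p.1 p.2 :=
  measurable_list_map (φ := fun c (e : ℝ × V) => (e.1 + c, e.2)) (by
    unfold Function.uncurry; fun_prop)

theorem measurableSet_covers (n : ℕ) :
    MeasurableSet {p : Trajectory E V × ℝ | p.1.Covers p.2 n} := by
  have h1 : Measurable fun p : Trajectory E V × ℝ => p.1 n := by fun_prop
  have h2 : MeasurableSet {q : ℝ × List (ℝ × V) | ∀ e ∈ q.2, e.1 ≤ q.1} :=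
    measurableSet_forall_mem (p := fun (T : ℝ) (e : ℝ × V) => e.1 ≤ T)
      (measurableSet_le (by fun_prop) (by fun_prop))
  have h3 : {p : Trajectory E V × ℝ | p.1.Covers p.2 n} =
      {p | (p.1 n).2 = false} ∪ {p | ∀ e ∈ (p.1 n).1.2, e.1 ≤ p.2}ᶜ := by
    ext p
    simp [Trajectory.Covers]
  rw [h3]
  refine ((measurable_snd.comp h1) (measurableSet_singleton false)).union
    (MeasurableSet.compl ?_)
  exact h2.preimage (measurable_snd.prodMk (measurable_snd.comp (measurable_fst.comp h1)))

theorem measurableSet_reaches :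
    MeasurableSet {p : Trajectory E V × ℝ | p.1.Reaches p.2} := by
  have : {p : Trajectory E V × ℝ | p.1.Reaches p.2} = ⋃ n, {p | p.1.Covers p.2 n} := by
    ext p; simp [Trajectory.Reaches]
  rw [this]
  exact MeasurableSet.iUnion measurableSet_covers

theorem measurable_eventsUpTo :
    Measurable fun p : Trajectory E V × ℝ => p.1.eventsUpTo p.2 := by
  have hN : Measurable fun p : Trajectory E V × ℝ => sInf {n | p.1.Covers p.2 n} := by
    refine measurable_of_Iic fun n => ?_
    -- Trajectories that never cover the time belong to this set, since the infimum of the empty set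
    -- of naturals is 0.
    have : (fun p : Trajectory E V × ℝ => sInf {n | p.1.Covers p.2 n}) ⁻¹' Iic n =
        (⋃ k ∈ Iic n, {p | p.1.Covers p.2 k}) ∪ {p | p.1.Reaches p.2}ᶜ := by
      ext p
      simp only [mem_preimage, mem_Iic, mem_union, mem_iUnion, mem_compl_iff, exists_prop]
      constructor
      · intro h
        by_cases hr : p.1.Reaches p.2
        · exact Or.inl ⟨_, h, Nat.sInf_mem (s := {n | p.1.Covers p.2 n}) hr⟩
        · exact Or.inr hr
      · rintro (⟨k, hk, hc⟩ | h)
        · exact (Nat.sInf_le (s := {n | p.1.Covers p.2 n}) hc).trans hk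
        · have : {n | p.1.Covers p.2 n} = ∅ := by
            ext k; simp only [mem_ofPred_eq, mem_empty_iff_false, iff_false]
            exact fun hk => h ⟨k, hk⟩
          simp [this]
    rw [this]
    exact (MeasurableSet.biUnion (to_countable _) fun k _ => measurableSet_covers k).union
      measurableSet_reaches.compl
  have hG : Measurable fun q : ℕ × (Trajectory E V × ℝ) =>
      eventsIn (Iic q.2.2) 0 (q.2.1 q.1).1.2 := by
    refine measurable_from_prod_countable_right fun n => ?_
    have h1 := measurable_eventsIn (S := ℝ) (V := V) (I := fun T => Iic T) (c := fun _ => 0)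
      (measurableSet_le measurable_snd measurable_fst) measurable_const
    have h2 : Measurable fun p : Trajectory E V × ℝ => (p.2, (p.1 n).1.2) := by fun_prop
    exact h1.comp h2
  exact hG.comp (hN.prodMk measurable_id)

end Measurability

/-! ### Rebuilding a trajectory so that it is regular at every step. -/

section Regularize

variable {E V : Type*}

/-- Append to `p` the events that `q` has in excess, or stop. -/
def rebuild (p q : Skeleton E V × Bool) : Skeleton E V × Bool :=
  if q.2 = true then ((p.1.1, p.1.2 ++ q.1.2.drop p.1.2.length), true) else (p.1, false)

/-- Rebuild a trajectory from `z` step by step. -/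
def Trajectory.regularize (z : E) (ω : Trajectory E V) : Trajectory E V
  | 0 => ((z, []), true)
  | n + 1 => rebuild (regularize z ω n) (ω (n + 1))

/-- The condition for one step of the rebuilt trajectory to append one later event, or to stop. -/
def IsStep (p q : Skeleton E V × Bool) : Prop :=
  q.2 = true → p.2 = true ∧ q.1.2.length = p.1.2.length + 1 ∧ lastTime p.1.2 < lastTime q.1.2

/-- When the new list is longer by one entry, only its last entry is taken over; the rest comes from
the rebuilt past. Thus the states are consistent by construction, and only flags, lengths and times
remain to be checked. -/
theorem Trajectory.regular_regularize {z : E} {ω : Trajectory E V}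
    (h : ∀ n, IsStep (ω.regularize z n) (ω (n + 1))) : (ω.regularize z).Regular z where
  zero := rfl
  step n := by
    have hn := h n
    change _ ∨ rebuild (ω.regularize z n) (ω (n + 1)) = _
    rw [show ω.regularize z (n + 1) = rebuild (ω.regularize z n) (ω (n + 1)) from rfl]
    set p := ω.regularize z n
    set q := ω (n + 1)
    by_cases hq : q.2 = true
    · obtain ⟨h1, h2, h3⟩ := hn hq
      left
      refine ⟨h1, ?_⟩
      have hd : (q.1.2.drop p.1.2.length).length = 1 := by simp [h2]
      obtain ⟨e, he⟩ := List.length_eq_one_iff.1 hd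
      have hq' : q.1.2 = q.1.2.take p.1.2.length ++ [e] := by
        rw [← he, List.take_append_drop]
      refine ⟨e, ?_, by simp [rebuild, hq, he]⟩
      rw [hq', lastTime_concat] at h3
      exact h3
    · right
      simp [rebuild, hq]

variable [MeasurableSpace E] [MeasurableSpace V]

theorem measurable_rebuild :
    Measurable fun x : (Skeleton E V × Bool) × (Skeleton E V × Bool) => rebuild x.1 x.2 := by
  have hd : Measurable fun x : ℕ × List (ℝ × V) => x.2.drop x.1 :=
    measurable_from_prod_countable_right fun n => measurable_snd.comp (measurable_take_drop n)
  refine Measurable.ite ((measurable_snd.comp measurable_snd) (measurableSet_singleton true)) ?_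
    (by fun_prop)
  refine Measurable.prodMk (Measurable.prodMk (by fun_prop) (measurable_append.comp
    (Measurable.prodMk (by fun_prop) (hd.comp (Measurable.prodMk (measurable_length.comp
      (by fun_prop)) (by fun_prop)))))) measurable_const

theorem measurableSet_isStep :
    MeasurableSet {x : (Skeleton E V × Bool) × (Skeleton E V × Bool) | IsStep x.1 x.2} := by
  have h1 : MeasurableSet {x : (Skeleton E V × Bool) × (Skeleton E V × Bool) | x.2.2 = true} :=
    (measurable_snd.comp measurable_snd) (measurableSet_singleton true)
  have h2 : MeasurableSet {x : (Skeleton E V × Bool) × (Skeleton E V × Bool) | x.1.2 = true} :=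
    (measurable_snd.comp measurable_fst) (measurableSet_singleton true)
  have hl1 : Measurable fun x : (Skeleton E V × Bool) × (Skeleton E V × Bool) => x.1.1.2 := by
    fun_prop
  have hl2 : Measurable fun x : (Skeleton E V × Bool) × (Skeleton E V × Bool) => x.2.1.2 := by
    fun_prop
  have h3 := measurableSet_eq_fun (measurable_length.comp hl2)
    ((measurable_length.comp hl1).add_const 1)
  have h4 := measurableSet_lt (measurable_lastTime.comp hl1) (measurable_lastTime.comp hl2)
  have : {x : (Skeleton E V × Bool) × (Skeleton E V × Bool) | IsStep x.1 x.2} =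
      {x | x.2.2 = true}ᶜ ∪ ({x | x.1.2 = true} ∩ ({x | x.2.1.2.length = x.1.1.2.length + 1} ∩
        {x | lastTime x.1.1.2 < lastTime x.2.1.2})) := by
    ext x
    simp only [IsStep, mem_ofPred_eq, mem_union, mem_compl_iff, mem_inter_iff, imp_iff_not_or]
  rw [this]
  exact h1.compl.union (h2.inter (h3.inter h4))

end Regularize

theorem Indist.trans {Ω A : Type*} [MeasurableSpace Ω] [MeasurableSpace A] {M : Measure Ω}
    {f g h : Ω → A} (h1 : Indist M f g) (h2 : Indist M g h) : Indist M f h := fun B hB => by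
  filter_upwards [h1 B hB, h2 B hB] with ω a b using a.trans b

/-! ### Simulated trajectories are regular up to null sets; the law of their events up to T. -/

section Simulation

variable {E V Ω : Type*} [MeasurableSpace E] [MeasurableSpace V] [MeasurableSpace Ω]
  {μV : Measure V} [SigmaFinite μV]

/-- Almost surely an appended event is later than the last one, because the density of the next
event vanishes otherwise. -/
theorem PDMP.ae_simStep (X : PDMP E V μV) (A : SimRate E V) (p : Skeleton E V × Bool)
    {S : Set (Skeleton E V × Bool)} (hS : MeasurableSet S)
    (h1 : p.2 = true → ∀ e : ℝ × V, lastTime p.1.2 < e.1 → ((p.1.1, p.1.2 ++ [e]), true) ∈ S)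
    (h2 : (p.1, false) ∈ S) : ∀ᵐ y ∂X.simStep A p, y ∈ S := by
  obtain ⟨w, b⟩ := p
  have hm : Measurable (Sᶜ.indicator (1 : Skeleton E V × Bool → ℝ≥0∞)) :=
    measurable_one.indicator hS.compl
  change X.simStep A (w, b) Sᶜ = 0
  rw [← lintegral_indicator_one hS.compl]
  cases b
  · rw [X.lintegral_simStep_false A w hm]
    simpa using h2
  · have happ : Measurable fun e : ℝ × V =>
        (((w.1, w.2 ++ [e]), true) : Skeleton E V × Bool) :=
      (measurable_const.prodMk (measurable_append_singleton.comp
        (measurable_const.prodMk measurable_id))).prodMk measurable_const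
    have h3 : Sᶜ.indicator (1 : Skeleton E V × Bool → ℝ≥0∞) (w, false) = 0 := by simpa using h2
    rw [X.lintegral_simStep_true A w hm, X.lintegral_nextEvent A w
      (f := fun e => Sᶜ.indicator 1 ((w.1, w.2 ++ [e]), true)) (hm.comp happ), h3, mul_zero,
      add_zero, ← lintegral_zero (μ := (volume : Measure ℝ).prod μV)]
    refine lintegral_congr fun e => ?_
    by_cases he : X.eventDensity A w e = 0
    · rw [he, zero_mul]
    · have := h1 rfl e (X.eventDensity_ne_zero he)
      simp only [mul_eq_zero]
      exact Or.inr (indicator_of_notMem (not_not_intro this) _)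

/-- Under `M`, the random trajectory `W` is simulated from `Z`, as far as null sets are
concerned. -/
structure IsSimulation (X : PDMP E V μV) (A : SimRate E V) (M : Measure Ω) (Z : Ω → E)
    (W : Ω → Trajectory E V) : Prop where
  zero : ∀ N : Set (E × (Skeleton E V × Bool)), MeasurableSet N →
    (∀ z, (z, ((z, []), true)) ∈ N) → ∀ᵐ ω ∂M, (Z ω, W ω 0) ∈ N
  step : ∀ n, ∀ N : Set ((Skeleton E V × Bool) × (Skeleton E V × Bool)), MeasurableSet N →
    (∀ p, ∀ᵐ y ∂X.simStep A p, (p, y) ∈ N) → ∀ᵐ ω ∂M, (W ω n, W ω (n + 1)) ∈ N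

namespace IsSimulation

variable {X : PDMP E V μV} {A : SimRate E V} {M : Measure Ω} {Z : Ω → E}
    {W : Ω → Trajectory E V}

/-- Equality of a trajectory with its rebuilt version need not be a measurable event, as the
diagonals of the spaces of states and marks may not be measurable. For each fixed measurable set,
however, membership of a simulated step and of its rebuilt version agree almost surely, and this
passes on by induction. -/
theorem indist (h : IsSimulation X A M Z W) :
    Indist M W (fun ω => (W ω).regularize (Z ω)) := by
  refine Indist.pi fun n => ?_
  induction n with
  | zero =>
    intro B hB
    have hz : Measurable fun x : E × (Skeleton E V × Bool) =>
        (((x.1, []), true) : Skeleton E V × Bool) :=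
      (measurable_fst.prodMk measurable_const).prodMk measurable_const
    have := h.zero {x | x.2 ∈ B ↔ ((x.1, []), true) ∈ B}
      (measurableSet_setOfPred.2 (Measurable.iff (measurableSet_setOfPred.1 (measurable_snd hB))
        (measurableSet_setOfPred.1 (hz hB)))) (by simp)
    filter_upwards [this] with ω hω using hω
  | succ n ih =>
    have h1 : Indist M (fun ω => W ω (n + 1)) (fun ω => rebuild (W ω n) (W ω (n + 1))) := by
      intro B hB
      have hr := measurable_rebuild hB
      have hN : MeasurableSet {x : (Skeleton E V × Bool) × (Skeleton E V × Bool) |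
          x.2 ∈ B ↔ rebuild x.1 x.2 ∈ B} :=
        measurableSet_setOfPred.2 (Measurable.iff (measurableSet_setOfPred.1 (measurable_snd hB))
        (measurableSet_setOfPred.1 hr))
      refine h.step n _ hN fun p => X.ae_simStep A p (S := {y | (p, y) ∈ _})
        (hN.preimage measurable_prodMk_left) (fun hp e he => ?_) ?_
      · simp [rebuild]
      · simp [rebuild]
    exact h1.trans ((ih.prodMk (Indist.refl M fun ω => W ω (n + 1))).comp measurable_rebuild)

/-- `IsStep` looks only at flags, lengths and times, so it is measurable. It holds for simulated
steps, hence also after replacing the past by the rebuilt one. -/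
theorem ae_regular (h : IsSimulation X A M Z W) :
    ∀ᵐ ω ∂M, ((W ω).regularize (Z ω)).Regular (Z ω) := by
  have h1 : ∀ n, ∀ᵐ ω ∂M, IsStep ((W ω).regularize (Z ω) n) (W ω (n + 1)) := fun n => by
    have h2 : ∀ᵐ ω ∂M, (W ω n, W ω (n + 1)) ∈
        {x : (Skeleton E V × Bool) × (Skeleton E V × Bool) | IsStep x.1 x.2} := by
      refine h.step n _ measurableSet_isStep fun p => X.ae_simStep A p (S := {y | (p, y) ∈ _})
        (measurableSet_isStep.preimage measurable_prodMk_left) (fun hp e he => ?_) ?_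
      · simp [IsStep, hp, he]
      · simp [IsStep]
    have h3 : Indist M (fun ω => (W ω n, W ω (n + 1)))
        (fun ω => ((W ω).regularize (Z ω) n, W ω (n + 1))) :=
      Indist.prodMk (h.indist.comp (measurable_pi_apply n)) (Indist.refl M _)
    filter_upwards [h2, h3 _ measurableSet_isStep] with ω a b using b.1 a
  filter_upwards [ae_all_iff.2 h1] with ω hω
  exact Trajectory.regular_regularize hω

end IsSimulation

theorem PDMP.isSimulation_trajectoryLaw (X : PDMP E V μV) (A : SimRate E V) (z : E) :
    IsSimulation X A (X.trajectoryLaw A z) (fun _ => z) id where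
  zero N hN h := by
    have hm : MeasurableSet {y | (z, y) ∈ N} := hN.preimage measurable_prodMk_left
    have h1 := X.lintegral_trajectoryLaw_zero A z (measurable_one.indicator hm.compl)
    rw [indicator_of_notMem (not_not_intro (h z))] at h1
    have hm' : MeasurableSet ((fun ω : Trajectory E V => ω 0) ⁻¹' {y | (z, y) ∈ N}ᶜ) :=
      hm.compl.preimage (measurable_pi_apply 0)
    change X.trajectoryLaw A z ((fun ω : Trajectory E V => ω 0) ⁻¹' {y | (z, y) ∈ N}ᶜ) = 0
    rw [← lintegral_indicator_one hm', ← h1]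
    rfl
  step n N hN h := by
    have h1 := X.lintegral_trajectoryLaw_step A z n (measurable_one.indicator hN.compl)
    have h2 : ∀ p, ∫⁻ y, Nᶜ.indicator (1 : (Skeleton E V × Bool) × (Skeleton E V × Bool) → ℝ≥0∞) (p, y) ∂X.simStep A p = 0 := fun p => by
      have : ∫⁻ y, Nᶜ.indicator (1 : (Skeleton E V × Bool) × (Skeleton E V × Bool) → ℝ≥0∞) (p, y) ∂X.simStep A p =
          ∫⁻ y, 0 ∂X.simStep A p := by
        refine lintegral_congr_ae ?_
        filter_upwards [h p] with y hy
        exact indicator_of_notMem (not_not_intro hy) _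
      rw [this, lintegral_zero]
    simp_rw [h2, lintegral_zero] at h1
    have hm : Measurable fun ω : Trajectory E V => (ω n, ω (n + 1)) := by fun_prop
    change X.trajectoryLaw A z ((fun ω : Trajectory E V => (ω n, ω (n + 1))) ⁻¹' Nᶜ) = 0
    rw [← lintegral_indicator_one (hN.compl.preimage hm), ← h1]
    rfl

/-- The law of the events until time `T`. -/
theorem PDMP.lintegral_trajectoryLaw_eventsUpTo (X : PDMP E V μV) (A : SimRate E V) (z : E)
    {T : ℝ} (hT : 0 ≤ T) {g : List (ℝ × V) → ℝ≥0∞} (hg : Measurable g) :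
    ∫⁻ ω in {ω | ω.Reaches T}, g (ω.eventsUpTo T) ∂X.trajectoryLaw A z =
      ∫⁻ es in {es | ∀ e ∈ es, e.1 ≤ T}, X.pathDensity A T (z, es) * g es
        ∂listSum ((volume : Measure ℝ).prod μV) := by
  classical
  set M := X.trajectoryLaw A z
  have hsim := X.isSimulation_trajectoryLaw A z
  have hR : MeasurableSet {ω : Trajectory E V | ω.Reaches T} :=
    measurableSet_reaches.preimage measurable_prodMk_right
  have hU : Measurable fun ω : Trajectory E V => ω.eventsUpTo T :=
    measurable_eventsUpTo.comp measurable_prodMk_right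
  have hle : MeasurableSet {es : List (ℝ × V) | ∀ e ∈ es, e.1 ≤ T} :=
    (measurableSet_forall_mem (S := Unit) (p := fun _ (e : ℝ × V) => e.1 ≤ T)
      (measurableSet_le (by fun_prop) measurable_const)).preimage (measurable_prodMk_left (x := ()))
  -- the contribution of the trajectories with `k` events until time `T`
  let G : (Skeleton E V × Bool) × (Skeleton E V × Bool) → ℝ≥0∞ := fun x =>
    if x.1.2 = true then (if ∀ e ∈ x.1.1.2, e.1 ≤ T then
      g x.1.1.2 * (if x.2.2 = false ∨ ∃ e ∈ x.2.1.2, T < e.1 then 1 else 0) else 0) else 0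
  have hcov : MeasurableSet {q : Skeleton E V × Bool | q.2 = false ∨ ∃ e ∈ q.1.2, T < e.1} := by
    have : {q : Skeleton E V × Bool | q.2 = false ∨ ∃ e ∈ q.1.2, T < e.1} =
        {q | q.2 = false} ∪ {q | ∀ e ∈ q.1.2, e.1 ≤ T}ᶜ := by ext q; simp
    rw [this]
    exact (measurable_snd (measurableSet_singleton false)).union
      (hle.preimage (measurable_snd.comp measurable_fst)).compl
  have hc1 : Measurable fun q : Skeleton E V × Bool =>
      if q.2 = false ∨ ∃ e ∈ q.1.2, T < e.1 then (1 : ℝ≥0∞) else 0 :=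
    Measurable.ite hcov measurable_const measurable_const
  have hGm : Measurable G := by
    refine Measurable.ite ((measurable_snd.comp measurable_fst) (measurableSet_singleton true))
      (Measurable.ite (hle.preimage (measurable_snd.comp (measurable_fst.comp measurable_fst)))
        (Measurable.mul ?_ (hc1.comp measurable_snd)) measurable_const) measurable_const
    exact hg.comp (measurable_snd.comp (measurable_fst.comp measurable_fst))
  have hkey : ∀ ω : Trajectory E V, ω.Regular z →
      {ω : Trajectory E V | ω.Reaches T}.indicator (fun ω => g (ω.eventsUpTo T)) ω =
        ∑' k, G (ω k, ω (k + 1)) := by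
    intro ω hω
    have hG0 : ∀ k, G (ω k, ω (k + 1)) ≠ 0 → ω.Reaches T ∧ ω.eventsUpTo T = (ω k).1.2 ∧
        (ω k).2 = true := by
      intro k hk
      by_cases h1 : (ω k).2 = true
      swap
      · simp [G, h1] at hk
      by_cases h2 : ∀ e ∈ (ω k).1.2, e.1 ≤ T
      swap
      · exact absurd (by simp only [G, h1, if_true, if_neg h2]) hk
      by_cases h3 : (ω (k + 1)).2 = false ∨ ∃ e ∈ (ω (k + 1)).1.2, T < e.1
      swap
      · exact absurd (by simp only [G, h1, if_true, if_pos h2, if_neg h3, mul_zero]) hk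
      have := hω.eq_of_not_covers h1 h2 h3
      exact ⟨this.1, this.2, h1⟩
    by_cases hr : ω.Reaches T
    · rw [indicator_of_mem (show ω ∈ {ω : Trajectory E V | ω.Reaches T} from hr)]
      have h1 := hω.eventsUpTo_eq_first hr
      rw [tsum_eq_single (ω.eventsUpTo T).length]
      · have h2 : ∀ e ∈ ω.eventsUpTo T, e.1 ≤ T := fun e he => ((hω.eventsUpTo_mem T).2 e he).2
        have h3 := h1.2.2
        simp only [Trajectory.Covers] at h3
        simp only [G, h1.1, h1.2.1, if_true, if_pos h2, if_pos h3, mul_one]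
      · intro k hk
        by_contra h0
        obtain ⟨-, h2, h3⟩ := hG0 k h0
        exact hk (by rw [h2, hω.length_of_true h3])
    · rw [indicator_of_notMem (show ω ∉ {ω : Trajectory E V | ω.Reaches T} from hr),
        eq_comm, ENNReal.tsum_eq_zero]
      intro k
      by_contra h0
      exact hr (hG0 k h0).1
  have hterm : ∀ k, Measurable fun ω : Trajectory E V => G (ω k, ω (k + 1)) := fun k =>
    hGm.comp (by fun_prop)
  have hL : ∫⁻ ω in {ω | ω.Reaches T}, g (ω.eventsUpTo T) ∂M =
      ∫⁻ ω, ∑' k, G (ω k, ω (k + 1)) ∂M := by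
    rw [← lintegral_indicator hR]
    have hm1 : Measurable ({ω : Trajectory E V | ω.Reaches T}.indicator
      (fun ω => g (ω.eventsUpTo T))) := (hg.comp hU).indicator hR
    have hm2 : Measurable fun ω : Trajectory E V => ∑' k, G (ω k, ω (k + 1)) :=
      Measurable.tsum hterm
    -- Both integrands are measurable in the trajectory, so each may be evaluated at the rebuilt
    -- one, where the pointwise identity holds.
    refine (hsim.indist.lintegral_eq hm1).trans (Eq.trans ?_ (hsim.indist.lintegral_eq hm2).symm)
    refine lintegral_congr_ae ?_
    filter_upwards [hsim.ae_regular] with ω hω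
    exact hkey _ hω
  -- Given k events, all up to T, the next step covers T with the probability of survival until T.
  have hstep : ∀ p : Skeleton E V × Bool, ∫⁻ y, G (p, y) ∂X.simStep A p =
      if p.2 = true then (if ∀ e ∈ p.1.2, e.1 ≤ T then
        g p.1.2 * A.survival p.1 (T - lastTime p.1.2) else 0) else 0 := by
    rintro ⟨w, b⟩
    cases b
    · simp [G]
    by_cases h2 : ∀ e ∈ w.2, e.1 ≤ T
    swap
    · simp only [G, if_true, if_neg h2, lintegral_zero]
    simp only [G, if_true, if_pos h2]
    rw [lintegral_const_mul _ hc1]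
    congr 1
    have hlast : lastTime w.2 ≤ T := by
      rcases eq_or_ne w.2 [] with h | h
      · simpa [h] using hT
      · obtain ⟨e, he, h'⟩ := exists_mem_lastTime h
        exact h' ▸ h2 e he
    rw [X.lintegral_simStep_true A w hc1, ← X.nextEvent_after A w hlast]
    simp only [Bool.true_eq_false, false_or, true_or, if_true, mul_one]
    congr 1
    rw [← lintegral_indicator_one (measurableSet_lt measurable_const measurable_fst)]
    refine lintegral_congr fun e => ?_
    have : (∃ a ∈ w.2 ++ [e], T < a.1) ↔ T < e.1 := by
      constructor
      · rintro ⟨a, ha, h⟩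
        rcases List.mem_append.1 ha with ha | ha
        · exact absurd (h2 a ha) (not_le.2 h)
        · rwa [← List.mem_singleton.1 ha]
      · exact fun h => ⟨e, by simp, h⟩
    simp only [this]
    by_cases h : T < e.1
    · rw [if_pos h, indicator_of_mem (show e ∈ {e : ℝ × V | T < e.1} from h)]; rfl
    · rw [if_neg h, indicator_of_notMem (show e ∉ {e : ℝ × V | T < e.1} from h)]
  rw [hL, lintegral_tsum fun k => (hterm k).aemeasurable, ← lintegral_indicator hle,
    lintegral_listSum]
  refine tsum_congr fun k => ?_
  have h1 := X.lintegral_trajectoryLaw_step A z k hGm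
  rw [show M = X.trajectoryLaw A z from rfl, h1]
  simp_rw [hstep]
  have hg2 : Measurable fun w : Skeleton E V => if ∀ e ∈ w.2, e.1 ≤ T then
        g w.2 * A.survival w (T - lastTime w.2) else 0 := by
    refine Measurable.ite (hle.preimage measurable_snd) ((hg.comp measurable_snd).mul ?_)
      measurable_const
    have h : Measurable fun w : Skeleton E V => (w, T - lastTime w.2) :=
      measurable_id.prodMk (measurable_const.sub (measurable_lastTime.comp measurable_snd))
    have h2 := A.measurable_survival.comp h
    simpa only [Function.comp_def] using h2
  rw [X.lintegral_trajectoryLaw_events A z k hg2]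
  refine lintegral_congr fun es => ?_
  by_cases h : ∀ e ∈ es, e.1 ≤ T
  · rw [indicator_of_mem (show es ∈ {es : List (ℝ × V) | ∀ e ∈ es, e.1 ≤ T} from h),
      X.pathDensity_eq]
    simp only [if_pos h]
    ring
  · rw [indicator_of_notMem (show es ∉ {es : List (ℝ × V) | ∀ e ∈ es, e.1 ≤ T} from h)]
    simp only [if_neg h, mul_zero]

end Simulation

/-! ### Measurability of sets of paths and of the path reversal. -/

section Measurability

variable {E V : Type*} [MeasurableSpace E] [MeasurableSpace V]

theorem measurableSet_increasing : MeasurableSet {es : List (ℝ × V) | Increasing es} := by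
  simp_rw [increasing_iff]
  exact measurableSet_pairwise (measurableSet_lt (by fun_prop) (by fun_prop))

theorem measurableSet_forall_time {S : Type*} [MeasurableSpace S] {I : S → Set ℝ}
    (hI : MeasurableSet {q : S × ℝ | q.2 ∈ I q.1}) :
    MeasurableSet {q : S × List (ℝ × V) | ∀ e ∈ q.2, e.1 ∈ I q.1} := by
  refine measurableSet_forall_mem (p := fun (s : S) (e : ℝ × V) => e.1 ∈ I s) ?_
  have h : Measurable fun q : S × (ℝ × V) => (q.1, q.2.1) := by fun_prop
  exact hI.preimage h

theorem measurableSet_mem_pathsIn {S : Type*} [MeasurableSpace S] {I : S → Set ℝ}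
    (hI : MeasurableSet {q : S × ℝ | q.2 ∈ I q.1}) :
    MeasurableSet {q : S × Skeleton E V | q.2 ∈ pathsIn E V (I q.1)} := by
  have h : Measurable fun q : S × Skeleton E V => (q.1, q.2.2) := by fun_prop
  exact (measurableSet_increasing.preimage (measurable_snd.comp h)).inter
    ((measurableSet_forall_time hI).preimage h)

theorem measurableSet_pathsIn {I : Set ℝ} (hI : MeasurableSet I) :
    MeasurableSet (pathsIn E V I) :=
  (measurableSet_mem_pathsIn (S := Unit) (I := fun _ => I) (measurable_snd hI)).preimage
    (measurable_prodMk_left (x := ()))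

theorem measurableSet_ne_nil : MeasurableSet {es : List (ℝ × V) | es ≠ []} := by
  have : {es : List (ℝ × V) | es ≠ []} = {es | es.length = 0}ᶜ := by
    ext es; simp
  rw [this]
  exact (measurable_length (measurableSet_singleton 0)).compl

theorem PDMP.measurable_hop {μV : Measure V} (X : PDMP E V μV) :
    Measurable fun p : E × (ℝ × V) => X.hop p.1 p.2 := by
  have h1 : Measurable fun p : E × (ℝ × V) => (p.2.1, p.1) := by fun_prop
  have h2 : Measurable fun p : E × (ℝ × V) => (X.flow p.2.1 p.1, p.2.2) :=
    (X.measurable_flow.comp h1).prodMk (by fun_prop)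
  have h3 : Measurable fun p : E × (ℝ × V) => (-p.2.1, X.jump (X.flow p.2.1 p.1) p.2.2) :=
    Measurable.prodMk (by fun_prop) (X.measurable_jump.comp h2)
  exact X.measurable_flow.comp h3

theorem PDMP.measurable_run {μV : Measure V} (X : PDMP E V μV) :
    Measurable fun p : E × List (ℝ × V) => X.run p.1 p.2 :=
  measurable_foldl X.measurable_hop

variable {Vr : Type*} [MeasurableSpace Vr] {μV : Measure V} {μVr : Measure Vr}
  {X : PDMP E V μV} {Y : PDMP E Vr μVr}

theorem Reversal.measurable_revEvents (R : Reversal X Y) :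
    Measurable fun p : E × List (ℝ × V) => R.revEvents p.1 p.2 := by
  refine measurable_list_rec (b := fun _ => []) (g := X.hop)
    (h := fun z e r => r ++ [(-e.1, R.revMark (X.flow e.1 z) e.2)])
    (F := fun z es => R.revEvents z es) measurable_const X.measurable_hop ?_ (fun _ => rfl)
    (fun z e es => R.revEvents_cons z e es)
  have h1 : Measurable fun p : E × (ℝ × V) × List (ℝ × Vr) => (p.2.1.1, p.1) := by fun_prop
  have h2 : Measurable fun p : E × (ℝ × V) × List (ℝ × Vr) =>
      (X.flow p.2.1.1 p.1, p.2.1.2) := (X.measurable_flow.comp h1).prodMk (by fun_prop)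
  have h3 : Measurable fun p : E × (ℝ × V) × List (ℝ × Vr) =>
      (p.2.2, (-p.2.1.1, R.revMark (X.flow p.2.1.1 p.1) p.2.1.2)) :=
    Measurable.prodMk (by fun_prop) (Measurable.prodMk (by fun_prop) (R.measurable_revMark.comp h2))
  exact measurable_append_singleton.comp h3

theorem Reversal.measurable_toRev (R : Reversal X Y) :
    Measurable fun p : ℝ × Skeleton E V => R.toRev p.1 p.2 := by
  simp_rw [Reversal.toRev_eq]
  have h1 : Measurable fun p : ℝ × Skeleton E V => (p.1, X.run p.2.1 p.2.2) :=
    measurable_fst.prodMk (X.measurable_run.comp measurable_snd)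
  have h2 : Measurable fun p : ℝ × Skeleton E V => (p.1, R.revEvents p.2.1 p.2.2) :=
    measurable_fst.prodMk (R.measurable_revEvents.comp measurable_snd)
  exact (X.measurable_flow.comp h1).prodMk (measurable_delay.comp h2)

theorem Reversal.measurable_toFwd (R : Reversal X Y) :
    Measurable fun p : ℝ × Skeleton E Vr => R.toFwd p.1 p.2 := R.symm.measurable_toRev

end Measurability

/-! ### Reversed paths with an event at their final time, and the volume change of the flow. -/

section Boundary

variable {E V Vr : Type*} [MeasurableSpace E] [MeasurableSpace V] [MeasurableSpace Vr]
  {μV : Measure V} {μVr : Measure Vr}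
  {X : PDMP E V μV} {Y : PDMP E Vr μVr}

theorem lt_iff_lastTime_lt {es : List (ℝ × V)} (hne : es ≠ []) (hs : Increasing es) {T : ℝ} :
    lastTime es < T ↔ ∀ e ∈ es, e.1 < T := by
  refine ⟨fun h e he => (le_lastTime hs he).trans_lt h, fun h => ?_⟩
  obtain ⟨e, he, h'⟩ := exists_mem_lastTime hne
  exact h' ▸ h e he

theorem map_delay_listSum (μV : Measure V) [SigmaFinite μV] (c : ℝ) :
    (listSum ((volume : Measure ℝ).prod μV)).map (delay c) =
      listSum ((volume : Measure ℝ).prod μV) := by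
  have h : MeasurePreserving (fun e : ℝ × V => (e.1 + c, e.2)) ((volume : Measure ℝ).prod μV)
      ((volume : Measure ℝ).prod μV) :=
    (measurePreserving_add_right volume c).prod (MeasurePreserving.id μV)
  exact map_listSum _ h

theorem measurable_delay_apply (c : ℝ) : Measurable fun es : List (ℝ × V) => delay c es :=
  measurable_delay.comp (measurable_prodMk_left (x := c))

theorem lintegral_delay (μV : Measure V) [SigmaFinite μV] (c : ℝ) {g : List (ℝ × V) → ℝ≥0∞}
    (hg : Measurable g) :
    ∫⁻ es, g (delay c es) ∂listSum ((volume : Measure ℝ).prod μV) =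
      ∫⁻ es, g es ∂listSum ((volume : Measure ℝ).prod μV) := by
  conv_rhs => rw [← map_delay_listSum μV c]
  rw [lintegral_map hg (measurable_delay_apply c)]

/-- A volume change of the path reversal, measurable, positive, and continuous in time. -/
structure ContinuousVolumeChange (R : Reversal X Y) (μE : Measure E)
    (ψ : ℝ → Skeleton E Vr → ℝ≥0) : Prop where
  meas : Measurable fun p : ℝ × Skeleton E Vr => ψ p.1 p.2
  pos : ∀ T, ∀ w ∈ pathsIn E Vr (Ioc 0 T), 0 ≤ T → 0 < ψ T w
  change : R.IsVolumeChange μE ψ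
  cont : ∀ w ∈ pathsIn E Vr (Ioi 0), ContinuousOn (fun t => ψ t w) (Ici (lastTime w.2))

/-- The paths with at least one event, all at positive times. -/
def eventfulPaths (E V : Type*) : Set (Skeleton E V) := {w | w.2 ≠ [] ∧ w ∈ pathsIn E V (Ioi 0)}

theorem measurableSet_eventfulPaths : MeasurableSet (eventfulPaths E V) :=
  (measurableSet_ne_nil.preimage measurable_snd).inter (measurableSet_pathsIn measurableSet_Ioi)

theorem lastTime_pos_of_eventful {w : Skeleton E V} (hw : w ∈ eventfulPaths E V) :
    0 < lastTime w.2 := lastTime_pos hw.1 hw.2.2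

/-- Marks, states, events and durations such that the events are in order within the duration. -/
def boundaryDomain (E V : Type*) : Set (V × E × List (ℝ × V) × ℝ) :=
  {q | 0 < q.2.2.2 ∧ Increasing q.2.2.1 ∧ ∀ e ∈ q.2.2.1, e.1 ∈ Ioo 0 q.2.2.2}

theorem measurableSet_boundaryDomain : MeasurableSet (boundaryDomain E V) := by
  have h1 : MeasurableSet {q : ℝ × List (ℝ × V) | ∀ e ∈ q.2, e.1 ∈ Ioo 0 q.1} :=
    measurableSet_forall_time (S := ℝ) (V := V) (I := fun T => Ioo 0 T)
      ((measurableSet_lt measurable_const measurable_snd).inter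
        (measurableSet_lt measurable_snd measurable_fst))
  have h2 : Measurable fun q : V × E × List (ℝ × V) × ℝ => (q.2.2.2, q.2.2.1) := by fun_prop
  have h3 : Measurable fun q : V × E × List (ℝ × V) × ℝ => q.2.2.1 := by fun_prop
  have h4 : Measurable fun q : V × E × List (ℝ × V) × ℝ => q.2.2.2 := by fun_prop
  exact (measurableSet_lt measurable_const h4).inter
    ((measurableSet_increasing.preimage h3).inter (h1.preimage h2))

theorem lintegral_eq_nil {W : Type*} [MeasurableSpace W] (μE : Measure E) (μW : Measure W)
    [SigmaFinite μE] [SigmaFinite μW] (T : ℝ) {f : Skeleton E W → ℝ≥0∞} (hf : Measurable f)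
    (h0 : ∀ z e es, f (z, e :: es) = 0) :
    ∫⁻ w in pathsIn E W (Ioo 0 T), f w ∂canonicalMeasure μE μW = ∫⁻ z, f (z, []) ∂μE := by
  have hm : Measurable ((pathsIn E W (Ioo 0 T)).indicator f) :=
    hf.indicator (measurableSet_pathsIn measurableSet_Ioo)
  rw [← lintegral_indicator (measurableSet_pathsIn measurableSet_Ioo), canonicalMeasure_eq,
    lintegral_prod _ hm.aemeasurable]
  refine lintegral_congr fun z => ?_
  have hm' : Measurable fun l => (pathsIn E W (Ioo 0 T)).indicator f (z, l) :=
    hm.comp (measurable_prodMk_left (x := z))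
  rw [lintegral_listSum_eq _ hm']
  have h1 : ∀ e es, (pathsIn E W (Ioo 0 T)).indicator f (z, e :: es) = 0 := fun e es => by
    simp [indicator, h0]
  simp only [h1, lintegral_zero, add_zero]
  rw [indicator_of_mem]
  exact mem_pathsIn.2 ⟨by simp [increasing_iff], by simp⟩

namespace Reversal

/-- The reversal of the path which starts with an event. -/
def boundaryMap (R : Reversal X Y) (q : V × E × List (ℝ × V) × ℝ) : Skeleton E Vr :=
  R.toRev q.2.2.2 (q.2.1, (0, q.1) :: q.2.2.1)

theorem measurable_boundaryMap (R : Reversal X Y) : Measurable R.boundaryMap := by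
  have h1 : Measurable fun q : V × E × List (ℝ × V) × ℝ => (((0 : ℝ), q.1), q.2.2.1) := by fun_prop
  have h2 : Measurable fun q : V × E × List (ℝ × V) × ℝ =>
      (q.2.2.2, (q.2.1, ((0 : ℝ), q.1) :: q.2.2.1)) :=
    Measurable.prodMk (by fun_prop) (Measurable.prodMk (by fun_prop) (measurable_cons.comp h1))
  exact R.measurable_toRev.comp h2

/-- The law of the reversed paths with an event at the final time. -/
def boundaryMeasure (R : Reversal X Y) (μE : Measure E) : Measure (Skeleton E Vr) :=
  ((μV.prod (μE.prod ((listSum ((volume : Measure ℝ).prod μV)).prod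
    (volume : Measure ℝ)))).restrict (boundaryDomain E V)).map R.boundaryMap

/-- The state just after the last event of a backward path. -/
def stateAfterLast (R : Reversal X Y) (w : Skeleton E Vr) : E := (R.toFwd (lastTime w.2) w).1

theorem measurable_stateAfterLast (R : Reversal X Y) : Measurable R.stateAfterLast := by
  have h : Measurable fun w : Skeleton E Vr => (lastTime w.2, w) :=
    (measurable_lastTime.comp measurable_snd).prodMk measurable_id
  exact measurable_fst.comp (R.measurable_toFwd.comp h)

theorem lastTime_toRev_cons (R : Reversal X Y) (T : ℝ) (z : E) (e : ℝ × V)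
    (es : List (ℝ × V)) : lastTime (R.toRev T (z, e :: es)).2 = T - e.1 := by
  rw [toRev_eq, revEvents_cons, delay_append]
  simp [sub_eq_add_neg, add_comm]

theorem lastTime_boundaryMap (R : Reversal X Y) (q : V × E × List (ℝ × V) × ℝ) :
    lastTime (R.boundaryMap q).2 = q.2.2.2 := by
  rw [boundaryMap, lastTime_toRev_cons, sub_zero]

theorem toFwd_boundaryMap (R : Reversal X Y) (q : V × E × List (ℝ × V) × ℝ) :
    R.toFwd (lastTime (R.boundaryMap q).2) (R.boundaryMap q) = (q.2.1, (0, q.1) :: q.2.2.1) := by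
  rw [lastTime_boundaryMap, boundaryMap, toFwd_toRev]

theorem stateAfterLast_boundaryMap (R : Reversal X Y) (q : V × E × List (ℝ × V) × ℝ) :
    R.stateAfterLast (R.boundaryMap q) = q.2.1 := by
  rw [stateAfterLast, toFwd_boundaryMap]

/-- Running backwards a path whose first event is at time `t`. -/
theorem toRev_cons_delay (R : Reversal X Y) (T t : ℝ) (z : E) (v : V) (a : List (ℝ × V)) :
    R.toRev T (z, (t, v) :: delay t a) = R.boundaryMap (v, X.flow t z, a, T - t) := by
  have h : ((t, v) :: delay t a) = delay t ((0, v) :: a) := by simp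
  rw [h, boundaryMap, toRev_eq, toRev_eq, PDMP.run_delay, revEvents_delay, PDMP.flow_flow,
    delay_delay]
  simp [sub_eq_add_neg, add_comm]

theorem toRev_ne_nil (R : Reversal X Y) (T : ℝ) (w : Skeleton E V) :
    (R.toRev T w).2 ≠ [] ↔ w.2 ≠ [] := by
  rw [toRev_eq]
  simp only [ne_eq, delay_eq_nil, not_iff_not]
  rcases w with ⟨z, _ | ⟨e, es⟩⟩ <;> simp [revEvents_cons]

theorem boundaryMap_mem_eventfulPaths (R : Reversal X Y) {q : V × E × List (ℝ × V) × ℝ}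
    (hq : q ∈ boundaryDomain E V) : R.boundaryMap q ∈ eventfulPaths E Vr := by
  refine ⟨(R.toRev_ne_nil _ _).2 (by simp), R.toRev_mem_pathsIn.2 (mem_pathsIn.2 ?_)⟩
  obtain ⟨h1, h2, h3⟩ := hq
  refine ⟨increasing_cons.2 ⟨fun a ha => (h3 a ha).1, h2⟩, fun e he => ?_⟩
  rcases List.mem_cons.1 he with rfl | he
  · simpa using h1
  · simpa using (h3 e he).2

variable {R : Reversal X Y} {μE : Measure E} {ψ : ℝ → Skeleton E Vr → ℝ≥0}
  [SigmaFinite μV] [SigmaFinite μVr] [SigmaFinite μE]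

theorem lintegral_boundaryMeasure {h : Skeleton E Vr → ℝ≥0∞} (hh : Measurable h) :
    ∫⁻ w, h w ∂(R.boundaryMeasure μE) = ∫⁻ v, ∫⁻ z, ∫⁻ a, ∫⁻ T,
      (boundaryDomain E V).indicator (fun q => h (R.boundaryMap q)) (v, z, a, T)
        ∂volume ∂listSum ((volume : Measure ℝ).prod μV) ∂μE ∂μV := by
  have hm : Measurable ((boundaryDomain E V).indicator fun q => h (R.boundaryMap q)) :=
    (hh.comp R.measurable_boundaryMap).indicator measurableSet_boundaryDomain
  rw [boundaryMeasure, lintegral_map hh R.measurable_boundaryMap,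
    ← lintegral_indicator measurableSet_boundaryDomain, lintegral_prod _ hm.aemeasurable]
  refine lintegral_congr fun v => ?_
  have hm1 := hm.comp (measurable_prodMk_left (x := v))
  simp only [Function.comp_def] at hm1
  rw [lintegral_prod _ hm1.aemeasurable]
  refine lintegral_congr fun z => ?_
  have hm2 := hm1.comp (measurable_prodMk_left (x := z))
  simp only [Function.comp_def] at hm2
  rw [lintegral_prod _ hm2.aemeasurable]

instance : SFinite (R.boundaryMeasure μE) := by
  rw [boundaryMeasure]; infer_instance

theorem measurable_volumeChange_apply (hψ : ContinuousVolumeChange R μE ψ) (T : ℝ) :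
    Measurable fun w => (ψ T w : ℝ≥0∞) :=
  (hψ.meas.comp (measurable_prodMk_left (x := T))).coe_nnreal_ennreal

/-- Test the volume change of R_T on functions supported by eventless paths. Reversing such a path
is flowing for a time T, so the volume change on eventless paths is that of the flow. -/
theorem lintegral_flow (hψ : ContinuousVolumeChange R μE ψ) {T : ℝ} (hT : 0 ≤ T)
    {H : E → ℝ≥0∞} (hH : Measurable H) :
    ∫⁻ z, H (X.flow T z) ∂μE = ∫⁻ z, ψ T (z, []) * H z ∂μE := by
  classical
  have hnil : MeasurableSet {w : Skeleton E Vr | w.2 = []} := by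
    have h := (measurableSet_ne_nil (V := Vr)).compl.preimage
      (measurable_snd : Measurable fun w : Skeleton E Vr => w.2)
    convert h using 1
    ext w; simp
  have hf : Measurable ({w : Skeleton E Vr | w.2 = []}.indicator fun w => H w.1) :=
    (hH.comp measurable_fst).indicator hnil
  have key := hψ.change T hT _ hf
  rw [lintegral_eq_nil μE μV, lintegral_eq_nil μE μVr] at key
  · simpa [toRev_eq, mul_comm] using key
  · exact hf.mul (measurable_volumeChange_apply hψ T)
  · intro z e es
    rw [indicator_of_notMem, zero_mul]
    simp
  · exact hf.comp (R.measurable_toRev.comp (measurable_prodMk_left (x := T)))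
  · intro z e es
    rw [indicator_of_notMem]
    exact (R.toRev_ne_nil T _).2 (by simp)

end Reversal

end Boundary

/-! ### Measurability rules for the operations on paths. -/

section FunProp

variable {T E V Vr : Type*} [MeasurableSpace T] [MeasurableSpace E] [MeasurableSpace V]
  [MeasurableSpace Vr] {μV : Measure V} {μVr : Measure Vr} {X : PDMP E V μV} {Y : PDMP E Vr μVr}

@[fun_prop]
theorem _root_.Measurable.list_cons {f : T → V} {g : T → List V} (hf : Measurable f)
    (hg : Measurable g) : Measurable fun x => f x :: g x :=
  measurable_cons.comp (hf.prodMk hg)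

@[fun_prop]
theorem _root_.Measurable.list_append {f g : T → List V} (hf : Measurable f) (hg : Measurable g) :
    Measurable fun x => f x ++ g x :=
  measurable_append.comp (hf.prodMk hg)

@[fun_prop]
theorem _root_.Measurable.delay {f : T → ℝ} {g : T → List (ℝ × V)} (hf : Measurable f)
    (hg : Measurable g) : Measurable fun x => PathSampler.delay (f x) (g x) :=
  measurable_delay.comp (hf.prodMk hg)

@[fun_prop]
theorem _root_.Measurable.lastTime {g : T → List (ℝ × V)}
    (hg : Measurable g) : Measurable fun x => PathSampler.lastTime (g x) :=
  measurable_lastTime.comp hg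

@[fun_prop]
theorem _root_.Measurable.flow (X : PDMP E V μV) {f : T → ℝ} {g : T → E} (hf : Measurable f)
    (hg : Measurable g) : Measurable fun x => X.flow (f x) (g x) :=
  X.measurable_flow.comp (hf.prodMk hg)

@[fun_prop]
theorem _root_.Measurable.jump (X : PDMP E V μV) {f : T → E} {g : T → V} (hf : Measurable f)
    (hg : Measurable g) : Measurable fun x => X.jump (f x) (g x) :=
  X.measurable_jump.comp (hf.prodMk hg)

@[fun_prop]
theorem _root_.Measurable.run (X : PDMP E V μV) {f : T → E} {g : T → List (ℝ × V)}
    (hf : Measurable f) (hg : Measurable g) : Measurable fun x => X.run (f x) (g x) :=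
  X.measurable_run.comp (hf.prodMk hg)

@[fun_prop]
theorem _root_.Measurable.revEvents (R : Reversal X Y) {f : T → E} {g : T → List (ℝ × V)}
    (hf : Measurable f) (hg : Measurable g) : Measurable fun x => R.revEvents (f x) (g x) :=
  R.measurable_revEvents.comp (hf.prodMk hg)

@[fun_prop]
theorem _root_.Measurable.toRev (R : Reversal X Y) {f : T → ℝ} {g : T → Skeleton E V}
    (hf : Measurable f) (hg : Measurable g) : Measurable fun x => R.toRev (f x) (g x) :=
  R.measurable_toRev.comp (hf.prodMk hg)

@[fun_prop]
theorem _root_.Measurable.toFwd (R : Reversal X Y) {f : T → ℝ} {g : T → Skeleton E Vr}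
    (hf : Measurable f) (hg : Measurable g) : Measurable fun x => R.toFwd (f x) (g x) :=
  R.measurable_toFwd.comp (hf.prodMk hg)

@[fun_prop]
theorem Reversal.measurable_toRev_apply (R : Reversal X Y) (t : ℝ) : Measurable (R.toRev t) :=
  R.measurable_toRev.comp measurable_prodMk_left

@[fun_prop]
theorem Reversal.measurable_toFwd_apply (R : Reversal X Y) (t : ℝ) : Measurable (R.toFwd t) :=
  R.measurable_toFwd.comp measurable_prodMk_left

@[fun_prop]
theorem PDMP.measurable_flow_apply (X : PDMP E V μV) (t : ℝ) : Measurable (X.flow t) :=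
  X.measurable_flow.comp measurable_prodMk_left

@[fun_prop]
theorem _root_.Measurable.boundaryMap (R : Reversal X Y) {f : T → V × E × List (ℝ × V) × ℝ}
    (hf : Measurable f) : Measurable fun x => R.boundaryMap (f x) :=
  R.measurable_boundaryMap.comp hf

@[fun_prop]
theorem _root_.Measurable.stateAfterLast (R : Reversal X Y) {f : T → Skeleton E Vr}
    (hf : Measurable f) : Measurable fun x => R.stateAfterLast (f x) :=
  R.measurable_stateAfterLast.comp hf

end FunProp

/-! ### Reordering five iterated integrals. -/

section Reorder

variable {A B C D F : Type*} [MeasurableSpace A] [MeasurableSpace B] [MeasurableSpace C]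
  [MeasurableSpace D] [MeasurableSpace F]

theorem lintegral_move_last (μA : Measure A) (μB : Measure B) (μC : Measure C) (μD : Measure D)
    (μF : Measure F) [SFinite μA] [SFinite μB] [SFinite μC] [SFinite μD] [SFinite μF]
    {G : A × B × C × D × F → ℝ≥0∞} (hG : Measurable G) :
    ∫⁻ a, ∫⁻ b, ∫⁻ c, ∫⁻ d, ∫⁻ f, G (a, b, c, d, f) ∂μF ∂μD ∂μC ∂μB ∂μA =
      ∫⁻ c, ∫⁻ d, ∫⁻ b, ∫⁻ f, ∫⁻ a, G (a, b, c, d, f) ∂μA ∂μF ∂μB ∂μD ∂μC := by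
  have e1 : ∀ b c d, ∫⁻ a, ∫⁻ f, G (a, b, c, d, f) ∂μF ∂μA =
      ∫⁻ f, ∫⁻ a, G (a, b, c, d, f) ∂μA ∂μF := fun b c d =>
    lintegral_lintegral_swap (by fun_prop)
  have e2 : ∀ b c, ∫⁻ a, ∫⁻ d, ∫⁻ f, G (a, b, c, d, f) ∂μF ∂μD ∂μA =
      ∫⁻ d, ∫⁻ a, ∫⁻ f, G (a, b, c, d, f) ∂μF ∂μA ∂μD := fun b c =>
    lintegral_lintegral_swap (by fun_prop)
  have e3 : ∀ b, ∫⁻ a, ∫⁻ c, ∫⁻ d, ∫⁻ f, G (a, b, c, d, f) ∂μF ∂μD ∂μC ∂μA =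
      ∫⁻ c, ∫⁻ a, ∫⁻ d, ∫⁻ f, G (a, b, c, d, f) ∂μF ∂μD ∂μA ∂μC := fun b =>
    lintegral_lintegral_swap (by fun_prop)
  rw [lintegral_lintegral_swap (by fun_prop)]
  simp_rw [e3, e2, e1]
  rw [lintegral_lintegral_swap (by fun_prop)]
  refine lintegral_congr fun c => ?_
  rw [lintegral_lintegral_swap (by fun_prop)]

end Reorder

/-! ### The volume change of the reversal at an event time. -/

section Boundary

attribute [local irreducible] Reversal.toRev Reversal.toFwd Reversal.boundaryMap

variable {E V Vr : Type*} [MeasurableSpace E] [MeasurableSpace V] [MeasurableSpace Vr]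
  {μV : Measure V} {μVr : Measure Vr}
  {X : PDMP E V μV} {Y : PDMP E Vr μVr}

/-- Coordinates on the paths with an event: the time t before the first event, and the boundary path
of duration T - t that starts with it. -/
theorem mem_eventfulPaths_cons {z : E} {v : V} {t T : ℝ} {a : List (ℝ × V)} :
    (z, (t, v) :: delay t a) ∈ pathsIn E V (Ioo 0 T) ↔
      0 < t ∧ ((v, X.flow t z, a, T - t) : V × E × List (ℝ × V) × ℝ) ∈ boundaryDomain E V := by
  rw [mem_pathsIn, increasing_cons, increasing_delay]
  simp only [boundaryDomain, mem_ofPred_eq, List.forall_mem_cons, mem_Ioo, sub_pos]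
  have h : ∀ p : ℝ → Prop, (∀ e ∈ delay t a, p e.1) ↔ ∀ e ∈ a, p (e.1 + t) := fun p => by
    simp only [mem_delay]
    exact ⟨fun h e he => h (e.1 + t, e.2) (by simpa using he),
      fun h e he => by simpa using h _ he⟩
  rw [h (fun x => t < x), h (fun x => 0 < x ∧ x < T)]
  constructor
  · rintro ⟨⟨h1, h2⟩, ⟨h3, h4⟩, h5⟩
    exact ⟨h3, h4, h2, fun e he => ⟨by linarith [h1 e he], by linarith [(h5 e he).2]⟩⟩
  · rintro ⟨h1, h2, h3, h4⟩
    exact ⟨⟨fun e he => by linarith [(h4 e he).1], h3⟩, ⟨h1, h2⟩,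
      fun e he => ⟨by linarith [(h4 e he).1], by linarith [(h4 e he).2]⟩⟩

theorem pathsIn_inter_ne_nil_eq_empty {W : Type*} {T : ℝ} (hT : T ≤ 0) :
    pathsIn E W (Ioo 0 T) ∩ {w | w.2 ≠ []} = ∅ := by
  ext ⟨z, es⟩
  simp only [mem_inter_iff, mem_ofPred_eq, mem_empty_iff_false, iff_false, not_and]
  rcases es with _ | ⟨e, es⟩
  · simp
  · intro h
    have := h.2 e (by simp)
    linarith [this.1, this.2]

namespace Reversal

variable {R : Reversal X Y} {μE : Measure E} {ψ : ℝ → Skeleton E Vr → ℝ≥0}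
  [SigmaFinite μV] [SigmaFinite μVr] [SigmaFinite μE]

/-- Split off the first event and count the later ones from its time t. The reversal of the path is
that of the boundary path from the state reached by the flow at t, and the time left after its last
event is t. -/
theorem lintegral_toRev_eventful {F : ℝ × ℝ × Skeleton E Vr → ℝ≥0∞} (hF : Measurable F) (T : ℝ) :
    ∫⁻ w in pathsIn E V (Ioo 0 T) ∩ {w | w.2 ≠ []},
        F (T - lastTime (R.toRev T w).2, T, R.toRev T w) ∂canonicalMeasure μE μV =
      ∫⁻ z, ∫⁻ t in Ioi 0, ∫⁻ v, ∫⁻ a, (boundaryDomain E V).indicator (fun q =>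
        F (t, T, R.boundaryMap q)) (v, X.flow t z, a, T - t)
        ∂listSum ((volume : Measure ℝ).prod μV) ∂μV ∂volume ∂μE := by
  have hS : MeasurableSet (pathsIn E V (Ioo 0 T) ∩ {w : Skeleton E V | w.2 ≠ []}) :=
    (measurableSet_pathsIn measurableSet_Ioo).inter (measurableSet_ne_nil.preimage measurable_snd)
  have hm : Measurable ((pathsIn E V (Ioo 0 T) ∩ {w | w.2 ≠ []}).indicator fun w =>
      F (T - lastTime (R.toRev T w).2, T, R.toRev T w)) :=
    Measurable.indicator (by fun_prop) hS
  rw [← lintegral_indicator hS, canonicalMeasure_eq, lintegral_prod _ hm.aemeasurable]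
  set g : Skeleton E V → ℝ≥0∞ := (pathsIn E V (Ioo 0 T) ∩ {w | w.2 ≠ []}).indicator fun w =>
      F (T - lastTime (R.toRev T w).2, T, R.toRev T w) with hg
  refine lintegral_congr fun z => ?_
  have hz : Measurable fun l => g (z, l) := by fun_prop
  rw [lintegral_listSum_eq _ hz, lintegral_prod _ (by fun_prop)]
  have h0 : g (z, []) = 0 := by simp [g]
  rw [h0, zero_add, ← lintegral_indicator measurableSet_Ioi]
  refine lintegral_congr fun t => ?_
  have hpt : ∀ v a, g (z, (t, v) :: delay t a) = (Ioi (0 : ℝ)).indicator (fun t =>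
      (boundaryDomain E V).indicator (fun q =>
        F (t, T, R.boundaryMap q)) (v, X.flow t z, a, T - t)) t := by
    intro v a
    have hL := R.lastTime_toRev_cons T z (t, v) (delay t a)
    have hiff := mem_eventfulPaths_cons (X := X) (z := z) (v := v) (t := t) (T := T) (a := a)
    by_cases h : (z, (t, v) :: delay t a) ∈ pathsIn E V (Ioo 0 T)
    · obtain ⟨h1, h2⟩ := hiff.1 h
      rw [indicator_of_mem (show t ∈ Ioi 0 from h1), indicator_of_mem h2, hg, indicator_of_mem
        (show _ ∈ _ ∩ _ from ⟨h, by simp⟩), hL, sub_sub_cancel, toRev_cons_delay]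
    · rw [hg, indicator_of_notMem fun h' => h h'.1]
      by_cases h1 : 0 < t
      · rw [indicator_of_mem (show t ∈ Ioi 0 from h1), indicator_of_notMem]
        exact fun h2 => h (hiff.2 ⟨h1, h2⟩)
      · rw [indicator_of_notMem (show t ∉ Ioi 0 from h1)]
  have hd : ∀ v, ∫⁻ a, g (z, (t, v) :: a) ∂listSum ((volume : Measure ℝ).prod μV) =
      ∫⁻ a, g (z, (t, v) :: delay t a) ∂listSum ((volume : Measure ℝ).prod μV) := fun v =>
    (lintegral_delay μV t (g := fun a => g (z, (t, v) :: a)) (by fun_prop)).symm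
  simp_rw [hd, hpt]
  by_cases h1 : t ∈ Ioi (0 : ℝ)
  · simp only [indicator_of_mem h1]
  · simp only [indicator_of_notMem h1, lintegral_zero]

theorem measurable_indicator_boundaryDomain {T : Type*} [MeasurableSpace T]
    {f : T → V × E × List (ℝ × V) × ℝ} (hf : Measurable f) {g : T → ℝ≥0∞} (hg : Measurable g) :
    Measurable fun x => (boundaryDomain E V).indicator (fun _ => g x) (f x) := by
  exact hg.indicator (measurableSet_boundaryDomain.preimage hf)

/-- The volume change of the reversal of the paths which start with an event, integrated over the
time before that event. -/
theorem lintegral_volumeChange_eq (hψ : ContinuousVolumeChange R μE ψ)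
    {F : ℝ × Skeleton E Vr → ℝ≥0∞} (hF : Measurable F) :
    ∫⁻ t in Ioi 0, ∫⁻ w in eventfulPaths E Vr, ψ (lastTime w.2 + t) w * F (t, w)
        ∂canonicalMeasure μE μVr =
      ∫⁻ t in Ioi 0, ∫⁻ w, ψ t (R.stateAfterLast w, []) * F (t, w) ∂(R.boundaryMeasure μE) := by
  have hψm := hψ.meas.coe_nnreal_ennreal
  have hcs : SFinite (canonicalMeasure μE μVr) := by rw [canonicalMeasure_eq]; infer_instance
  -- Substitution T = `lastTime w.2` + t: the events of w are all before T exactly when t is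
  -- positive.
  have stepA : ∫⁻ t in Ioi 0, ∫⁻ w in eventfulPaths E Vr, ψ (lastTime w.2 + t) w * F (t, w)
        ∂canonicalMeasure μE μVr =
      ∫⁻ T, ∫⁻ w in pathsIn E Vr (Ioo 0 T) ∩ {w | w.2 ≠ []},
        F (T - lastTime w.2, w) * ψ T w ∂canonicalMeasure μE μVr := by
    have hS : ∀ T, MeasurableSet (pathsIn E Vr (Ioo 0 T) ∩ {w : Skeleton E Vr | w.2 ≠ []}) :=
      fun T => (measurableSet_pathsIn measurableSet_Ioo).inter
        (measurableSet_ne_nil.preimage measurable_snd)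
    have hmem : ∀ T, ∀ w ∈ eventfulPaths E Vr,
        (w ∈ pathsIn E Vr (Ioo 0 T) ∩ {w | w.2 ≠ []} ↔ 0 < T - lastTime w.2) := by
      intro T w hw
      have h := lt_iff_lastTime_lt hw.1 hw.2.1 (T := T)
      rw [sub_pos, h]
      refine ⟨fun h e he => (h.1.2 e he).2, fun h => ⟨⟨hw.2.1, fun e he => ⟨hw.2.2 e he, h e he⟩⟩, hw.1⟩⟩
    have hsub : ∀ T, ∀ w ∈ pathsIn E Vr (Ioo 0 T) ∩ {w | w.2 ≠ []}, w ∈ eventfulPaths E Vr :=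
      fun T w hw => ⟨hw.2, hw.1.1, fun e he => (hw.1.2 e he).1⟩
    have hR : ∀ T, ∫⁻ w in pathsIn E Vr (Ioo 0 T) ∩ {w | w.2 ≠ []},
        F (T - lastTime w.2, w) * ψ T w ∂canonicalMeasure μE μVr =
        ∫⁻ w in eventfulPaths E Vr, (Ioi (0 : ℝ)).indicator (fun _ =>
          F (T - lastTime w.2, w) * ψ T w) (T - lastTime w.2) ∂canonicalMeasure μE μVr := by
      intro T
      rw [← lintegral_indicator (hS T), ← lintegral_indicator measurableSet_eventfulPaths]
      refine lintegral_congr fun w => ?_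
      by_cases hw : w ∈ eventfulPaths E Vr
      · rw [indicator_of_mem hw]
        by_cases h : 0 < T - lastTime w.2
        · rw [indicator_of_mem ((hmem T w hw).2 h), indicator_of_mem (show _ ∈ Ioi _ from h)]
        · rw [indicator_of_notMem fun h' => h ((hmem T w hw).1 h'),
            indicator_of_notMem (show _ ∉ Ioi _ from h)]
      · rw [indicator_of_notMem hw, indicator_of_notMem fun h' => hw (hsub T w h')]
    have hI : Measurable fun q : ℝ × Skeleton E Vr => (Ioi (0 : ℝ)).indicator (fun _ =>
          F (q.1 - lastTime q.2.2, q.2) * ψ q.1 q.2) (q.1 - lastTime q.2.2) := by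
      have h1 : Measurable fun q : ℝ × Skeleton E Vr =>
          F (q.1 - lastTime q.2.2, q.2) * ψ q.1 q.2 := by
        refine Measurable.mul (by fun_prop) hψm
      have h2 : Measurable fun q : ℝ × Skeleton E Vr => q.1 - lastTime q.2.2 := by fun_prop
      exact h1.indicator ((measurableSet_Ioi (a := (0 : ℝ))).preimage h2)
    simp_rw [hR]
    have hψ2 : Measurable fun q : ℝ × Skeleton E Vr => (ψ (lastTime q.2.2 + q.1) q.2 : ℝ≥0∞) :=
      hψm.comp (g := fun p : ℝ × Skeleton E Vr => (ψ p.1 p.2 : ℝ≥0∞))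
        (f := fun q : ℝ × Skeleton E Vr => (lastTime q.2.2 + q.1, q.2)) (by fun_prop)
    have hL : AEMeasurable (Function.uncurry fun (t : ℝ) (w : Skeleton E Vr) =>
        (ψ (lastTime w.2 + t) w : ℝ≥0∞) * F (t, w)) ((volume.restrict (Ioi 0)).prod
          ((canonicalMeasure μE μVr).restrict (eventfulPaths E Vr))) := (hψ2.mul hF).aemeasurable
    have hI' : AEMeasurable (Function.uncurry fun (t : ℝ) (w : Skeleton E Vr) =>
        (Ioi (0 : ℝ)).indicator (fun _ => F (t - lastTime w.2, w) * ψ t w) (t - lastTime w.2))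
        (volume.prod ((canonicalMeasure μE μVr).restrict (eventfulPaths E Vr))) := hI.aemeasurable
    rw [lintegral_lintegral_swap hL, lintegral_lintegral_swap hI']
    refine lintegral_congr fun w => ?_
    rw [← lintegral_indicator measurableSet_Ioi]
    conv_rhs => rw [← lintegral_add_right_eq_self _ (lastTime w.2)]
    refine lintegral_congr fun t => ?_
    simp only [add_sub_cancel_right]
    by_cases ht : 0 < t
    · rw [indicator_of_mem (show t ∈ Ioi 0 from ht), indicator_of_mem (show t ∈ Ioi 0 from ht),
        mul_comm, add_comm]
    · rw [indicator_of_notMem (show t ∉ Ioi 0 from ht), indicator_of_notMem (show t ∉ Ioi 0 from ht)]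
  -- The given volume change of R_T, restricted to paths with events; for negative T both sides are
  -- empty.
  have stepB : ∀ T, ∫⁻ w in pathsIn E Vr (Ioo 0 T) ∩ {w | w.2 ≠ []},
        F (T - lastTime w.2, w) * ψ T w ∂canonicalMeasure μE μVr =
      ∫⁻ w in pathsIn E V (Ioo 0 T) ∩ {w | w.2 ≠ []},
        F (T - lastTime (R.toRev T w).2, R.toRev T w) ∂canonicalMeasure μE μV := by
    intro T
    rcases lt_or_ge T 0 with hT | hT
    · rw [pathsIn_inter_ne_nil_eq_empty hT.le, pathsIn_inter_ne_nil_eq_empty hT.le]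
      simp
    · have hn : MeasurableSet {w : Skeleton E Vr | w.2 ≠ []} :=
        measurableSet_ne_nil.preimage measurable_snd
      have hn' : MeasurableSet {w : Skeleton E V | w.2 ≠ []} :=
        measurableSet_ne_nil.preimage measurable_snd
      have h := hψ.change T hT ({w | w.2 ≠ []}.indicator fun w => F (T - lastTime w.2, w))
        (Measurable.indicator (by fun_prop) hn)
      rw [inter_comm, ← Measure.restrict_restrict hn, ← lintegral_indicator hn,
        inter_comm, ← Measure.restrict_restrict hn', ← lintegral_indicator hn']
      convert h.symm using 2
      · ext w
        by_cases h : w.2 = [] <;> simp [h]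
      · ext w
        have := R.toRev_ne_nil T w
        by_cases h : w.2 = []
        · rw [indicator_of_notMem (by simpa using h), indicator_of_notMem (by simp; tauto)]
        · rw [indicator_of_mem (by simpa using h), indicator_of_mem (by simp; tauto)]
  have hG : Measurable fun q : ℝ × E × ℝ × V × List (ℝ × V) =>
      (boundaryDomain E V).indicator (fun q' => F (q.2.2.1, R.boundaryMap q'))
        (q.2.2.2.1, X.flow q.2.2.1 q.2.1, q.2.2.2.2, q.1 - q.2.2.1) := by
    have h := measurable_indicator_boundaryDomain (E := E) (V := V)
      (f := fun q : ℝ × E × ℝ × V × List (ℝ × V) =>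
        (q.2.2.2.1, X.flow q.2.2.1 q.2.1, q.2.2.2.2, q.1 - q.2.2.1)) (by fun_prop)
      (g := fun q => F (q.2.2.1, R.boundaryMap
        (q.2.2.2.1, X.flow q.2.2.1 q.2.1, q.2.2.2.2, q.1 - q.2.2.1))) (by fun_prop)
    exact h
  have stepC := lintegral_toRev_eventful (R := R) (μE := μE)
    (F := fun p => F (p.1, p.2.2)) (by fun_prop)
  rw [stepA, lintegral_congr stepB, lintegral_congr stepC, lintegral_move_last (μA := volume) (μB := μE)
    (μC := volume.restrict (Ioi 0)) (μD := μV) (μF := listSum (volume.prod μV)) hG]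
  refine setLIntegral_congr_fun measurableSet_Ioi fun t ht => ?_
  have hH : Measurable fun q : V × E × List (ℝ × V) × ℝ =>
      (boundaryDomain E V).indicator (fun q' => F (t, R.boundaryMap q')) q :=
    Measurable.indicator (by fun_prop) measurableSet_boundaryDomain
  have hψt : Measurable fun z => (ψ t (z, []) : ℝ≥0∞) :=
    (measurable_volumeChange_apply hψ t).comp measurable_prodMk_right
  simp only
  rw [lintegral_boundaryMeasure (h := fun w => ψ t (R.stateAfterLast w, []) * F (t, w))
    (Measurable.mul (hψt.comp (by fun_prop)) (by fun_prop))]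
  refine lintegral_congr fun v => ?_
  -- With t fixed, the total duration T is traded for the duration T - t of the boundary path.
  have hs : ∀ z a, ∫⁻ T, (boundaryDomain E V).indicator (fun q' => F (t, R.boundaryMap q'))
        (v, X.flow t z, a, T - t) = ∫⁻ T, (boundaryDomain E V).indicator
          (fun q' => F (t, R.boundaryMap q')) (v, X.flow t z, a, T) := fun z a =>
    lintegral_sub_right_eq_self (fun T => (boundaryDomain E V).indicator
          (fun q' => F (t, R.boundaryMap q')) (v, X.flow t z, a, T)) t
  simp_rw [hs]
  -- The initial state is replaced by the state just before the first event, at the cost of the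
  -- volume change of the flow during t.
  rw [lintegral_flow hψ (le_of_lt ht) (H := fun z => ∫⁻ a, ∫⁻ T, (boundaryDomain E V).indicator
    (fun q' => F (t, R.boundaryMap q')) (v, z, a, T) ∂volume ∂listSum (volume.prod μV))
    (by fun_prop)]
  refine lintegral_congr fun z => ?_
  rw [← lintegral_const_mul' _ _ ENNReal.coe_ne_top]
  refine lintegral_congr fun a => ?_
  rw [← lintegral_const_mul' _ _ ENNReal.coe_ne_top]
  refine lintegral_congr fun T => ?_
  by_cases h : (v, z, a, T) ∈ boundaryDomain E V
  · rw [indicator_of_mem h, indicator_of_mem h, stateAfterLast_boundaryMap]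
  · rw [indicator_of_notMem h, indicator_of_notMem h, mul_zero]

instance : SigmaFinite (canonicalMeasure μE μVr) := by rw [canonicalMeasure_eq]; infer_instance

/-- In boundary coordinates this map is a projection, so statements for almost every state transfer
to almost every boundary path. -/
theorem quasiMeasurePreserving_stateAfterLast :
    Measure.QuasiMeasurePreserving R.stateAfterLast (R.boundaryMeasure μE) μE := by
  refine ⟨R.measurable_stateAfterLast, Measure.AbsolutelyContinuous.mk fun A hA h0 => ?_⟩
  have h1 : ∀ᵐ q ∂μV.prod (μE.prod ((listSum ((volume : Measure ℝ).prod μV)).prod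
      (volume : Measure ℝ))), q.2.1 ∉ A :=
    Measure.quasiMeasurePreserving_snd.ae
      (Measure.quasiMeasurePreserving_fst.ae (measure_eq_zero_iff_ae_notMem.1 h0))
  rw [Measure.map_apply R.measurable_stateAfterLast hA, boundaryMeasure,
    Measure.map_apply R.measurable_boundaryMap (R.measurable_stateAfterLast hA),
    measure_eq_zero_iff_ae_notMem]
  simp only [mem_preimage, stateAfterLast_boundaryMap]
  exact ae_restrict_of_ae h1

/-- A positive density, integrated over a parameter of positive measure, detects null sets. -/
theorem lintegral_mul_indicator_eq_zero {W : Type*} [MeasurableSpace W] {ν : Measure W}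
    [SFinite ν] {g : ℝ × W → ℝ≥0∞} (hg : Measurable g)
    (hpos : ∀ t, 0 < t → ∀ᵐ w ∂ν, g (t, w) ≠ 0) {A : Set W} (hA : MeasurableSet A) :
    ∫⁻ t in Ioi (0 : ℝ), ∫⁻ w, g (t, w) * A.indicator 1 w ∂ν = 0 ↔ ν A = 0 := by
  have hm : Measurable fun q : ℝ × W => g q * A.indicator 1 q.2 :=
    hg.mul ((measurable_one.indicator hA).comp measurable_snd)
  have hm' : ∀ t, Measurable fun w => g (t, w) * A.indicator 1 w := fun t =>
    hm.comp measurable_prodMk_left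
  rw [lintegral_eq_zero_iff (by fun_prop)]
  constructor
  · intro h
    have hne : (ae (volume.restrict (Ioi (0 : ℝ)))).NeBot := by
      rw [ae_neBot]; simp
    obtain ⟨t, ht, ht0⟩ := (h.and (ae_restrict_mem measurableSet_Ioi)).exists
    have h2 := (lintegral_eq_zero_iff (hm' t)).1 ht
    rw [measure_eq_zero_iff_ae_notMem]
    filter_upwards [h2, hpos t ht0] with w h3 h4 hw
    simp [hw, h4] at h3
  · intro h
    refine Filter.Eventually.of_forall fun t => ?_
    refine (lintegral_eq_zero_iff (hm' t)).2 ?_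
    filter_upwards [measure_eq_zero_iff_ae_notMem.1 h] with w hw
    simp [hw]

theorem measurable_volumeChange_add (hψ : ContinuousVolumeChange R μE ψ) :
    Measurable fun q : ℝ × Skeleton E Vr => (ψ (lastTime q.2.2 + q.1) q.2 : ℝ≥0∞) := by
  have h : Measurable fun q : ℝ × Skeleton E Vr => (lastTime q.2.2 + q.1, q.2) := by fun_prop
  exact hψ.meas.coe_nnreal_ennreal.comp h

theorem measurable_volumeChange_nil (hψ : ContinuousVolumeChange R μE ψ) :
    Measurable fun q : ℝ × Skeleton E Vr => (ψ q.1 (R.stateAfterLast q.2, []) : ℝ≥0∞) := by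
  have h : Measurable fun q : ℝ × Skeleton E Vr =>
    (q.1, (R.stateAfterLast q.2, ([] : List (ℝ × Vr)))) := by fun_prop
  exact hψ.meas.coe_nnreal_ennreal.comp h

theorem volumeChange_ne_zero (hψ : ContinuousVolumeChange R μE ψ) {w : Skeleton E Vr}
    (hw : w ∈ pathsIn E Vr (Ioi 0)) {T : ℝ} (hT : lastTime w.2 ≤ T) : (ψ T w : ℝ≥0∞) ≠ 0 := by
  have h0 : 0 ≤ lastTime w.2 := lastTime_nonneg fun e he => hw.2 e he
  exact_mod_cast (hψ.pos T w ⟨hw.1, fun e he => ⟨hw.2 e he, (le_lastTime hw.1 he).trans hT⟩⟩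
    (h0.trans hT)).ne'

theorem nil_mem_pathsIn (z : E) (I : Set ℝ) : ((z, []) : Skeleton E V) ∈ pathsIn E V I :=
  mem_pathsIn.2 ⟨by simp [increasing_iff], by simp⟩

/-- Take F in `lintegral_volumeChange_eq` to be the indicator of A, independent of t. Both volume
changes are positive, so each side vanishes exactly when A is null for the corresponding measure. A
density therefore exists, before it is known. -/
theorem boundaryMeasure_eq_zero_iff (hψ : ContinuousVolumeChange R μE ψ)
    {A : Set (Skeleton E Vr)} (hA : MeasurableSet A) :
    R.boundaryMeasure μE A = 0 ↔
      (canonicalMeasure μE μVr).restrict (eventfulPaths E Vr) A = 0 := by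
  have h := lintegral_volumeChange_eq hψ (F := fun p => A.indicator 1 p.2)
    ((measurable_one.indicator hA).comp measurable_snd)
  rw [← lintegral_mul_indicator_eq_zero (measurable_volumeChange_nil hψ) (fun t ht => ?_) hA,
    ← lintegral_mul_indicator_eq_zero (measurable_volumeChange_add hψ) (fun t ht => ?_) hA]
  · exact (Eq.congr h rfl).symm
  · filter_upwards [ae_restrict_mem measurableSet_eventfulPaths] with w hw
    exact volumeChange_ne_zero hψ hw.2 (by linarith)
  · refine Filter.Eventually.of_forall fun w => ?_
    exact volumeChange_ne_zero hψ (nil_mem_pathsIn _ _) (by simpa using ht.le)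

/-- On eventless paths R_0 is the identity, and densities are unique almost everywhere. -/
theorem ae_volumeChange_zero (hψ : ContinuousVolumeChange R μE ψ) :
    ∀ᵐ z ∂μE, (ψ 0 (z, []) : ℝ≥0∞) = 1 := by
  have hm : Measurable fun z => (ψ 0 (z, []) : ℝ≥0∞) :=
    (measurable_volumeChange_apply hψ 0).comp measurable_prodMk_right
  refine ((withDensity_eq_iff_of_sigmaFinite hm.aemeasurable measurable_one.aemeasurable).1 ?_)
  ext A hA
  have h := lintegral_flow hψ le_rfl (H := A.indicator 1) (measurable_one.indicator hA)
  rw [withDensity_apply _ hA, withDensity_apply _ hA, ← lintegral_indicator hA,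
    ← lintegral_indicator hA]
  simp only [PDMP.flow_zero] at h
  convert h.symm using 2
  ext z
  by_cases hz : z ∈ A <;> simp [hz]

/-- Every right neighbourhood of 0 has positive measure, so a relation valid for almost all t can be
carried to the limit at 0. -/
theorem frequently_of_ae_restrict_Ioi {p : ℝ → Prop} (h : ∀ᵐ t ∂volume.restrict (Ioi 0), p t) :
    ∃ᶠ t in nhdsWithin 0 (Ioi 0), p t := by
  intro hn
  obtain ⟨u, hu, hsub⟩ := mem_nhdsGT_iff_exists_Ioo_subset.1 hn
  have h2 : ∀ᵐ t ∂volume.restrict (Ioo 0 u), p t :=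
    ae_restrict_of_ae_restrict_of_subset Ioo_subset_Ioi_self h
  have hne : (ae (volume.restrict (Ioo (0 : ℝ) u))).NeBot := by
    rw [ae_neBot]
    simpa using hu
  obtain ⟨t, ht, ht0⟩ := (h2.and (ae_restrict_mem measurableSet_Ioo)).exists
  exact hsub ht0 ht

theorem tendsto_volumeChange (hψ : ContinuousVolumeChange R μE ψ) {w : Skeleton E Vr}
    (hw : w ∈ pathsIn E Vr (Ioi 0)) :
    Filter.Tendsto (fun t => (ψ (lastTime w.2 + t) w : ℝ≥0∞)) (nhdsWithin 0 (Ioi 0))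
      (nhds (ψ (lastTime w.2) w)) := by
  have h1 := hψ.cont w hw (lastTime w.2) self_mem_Ici
  refine ENNReal.tendsto_coe.2 (h1.tendsto.comp ?_)
  refine tendsto_nhdsWithin_iff.2 ⟨?_, ?_⟩
  · have h2 : Filter.Tendsto (fun t => lastTime w.2 + t) (nhds 0) (nhds (lastTime w.2 + 0)) :=
      (continuous_const.add continuous_id).tendsto 0
    rw [add_zero] at h2
    exact h2.mono_left nhdsWithin_le_nhds
  · filter_upwards [self_mem_nhdsWithin] with t ht
    exact le_add_of_nonneg_right (le_of_lt (mem_Ioi.1 ht))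

/-- Let r be the Radon–Nikodym derivative of the boundary measure. The identity
`lintegral_volumeChange_eq` then says that ψ at time `lastTime w.2 + t` is r(w) times the volume
change of the flow during t, for almost all (w, t). Letting t tend to 0, continuity identifies r
with ψ at the last event time, since the volume change of the flow tends to 1. -/
theorem boundaryMeasure_aux (hψ : ContinuousVolumeChange R μE ψ) :
    R.boundaryMeasure μE = ((canonicalMeasure μE μVr).restrict (eventfulPaths E Vr)).withDensity
      (fun w => ψ (lastTime w.2) w) ∧
    ∀ᵐ w ∂(canonicalMeasure μE μVr).restrict (eventfulPaths E Vr), ∀ᵐ t ∂volume.restrict (Ioi 0),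
      (ψ (lastTime w.2 + t) w : ℝ≥0∞) = ψ (lastTime w.2) w * ψ t (R.stateAfterLast w, []) := by
  set C := (canonicalMeasure μE μVr).restrict (eventfulPaths E Vr) with hC
  set N := R.boundaryMeasure μE with hN
  have hac : N ≪ C := Measure.AbsolutelyContinuous.mk fun A hA h =>
    (boundaryMeasure_eq_zero_iff hψ hA).2 h
  have hac' : C ≪ N := Measure.AbsolutelyContinuous.mk fun A hA h =>
    (boundaryMeasure_eq_zero_iff hψ hA).1 h
  set r := N.rnDeriv C with hr
  have hrm : Measurable r := Measure.measurable_rnDeriv _ _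
  have hNr : C.withDensity r = N := Measure.withDensity_rnDeriv_eq N C hac
  have hf := measurable_volumeChange_add hψ
  have hg := measurable_volumeChange_nil hψ
  have hae : ∀ᵐ q ∂(volume.restrict (Ioi (0 : ℝ))).prod C,
      (ψ (lastTime q.2.2 + q.1) q.2 : ℝ≥0∞) = r q.2 * ψ q.1 (R.stateAfterLast q.2, []) := by
    have hgr : Measurable fun q : ℝ × Skeleton E Vr =>
        r q.2 * (ψ q.1 (R.stateAfterLast q.2, []) : ℝ≥0∞) := (hrm.comp measurable_snd).mul hg
    refine (withDensity_eq_iff_of_sigmaFinite hf.aemeasurable hgr.aemeasurable).1 ?_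
    ext A hA
    have h := lintegral_volumeChange_eq hψ (F := A.indicator 1) (measurable_one.indicator hA)
    rw [withDensity_apply _ hA, withDensity_apply _ hA, ← lintegral_indicator hA,
      ← lintegral_indicator hA, lintegral_prod _ (hf.indicator hA).aemeasurable,
      lintegral_prod _ (hgr.indicator hA).aemeasurable]
    refine (lintegral_congr fun t => lintegral_congr fun w => ?_).trans
      (h.trans (lintegral_congr fun t => ?_))
    · by_cases hz : (t, w) ∈ A <;> simp [hz]
    · have hm : Measurable fun w => (ψ t (R.stateAfterLast w, []) : ℝ≥0∞) * A.indicator 1 (t, w) :=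
        (hg.comp (measurable_prodMk_left (x := t))).mul
          ((measurable_one.indicator hA).comp measurable_prodMk_left)
      rw [← hN, ← hNr, lintegral_withDensity_eq_lintegral_mul _ hrm hm]
      refine lintegral_congr fun w => ?_
      by_cases hz : (t, w) ∈ A <;> simp [hz]
  have hae' : ∀ᵐ w ∂C, ∀ᵐ t ∂volume.restrict (Ioi (0 : ℝ)),
      (ψ (lastTime w.2 + t) w : ℝ≥0∞) = r w * ψ t (R.stateAfterLast w, []) := by
    have h := Measure.ae_ae_of_ae_prod hae
    rwa [Measure.ae_ae_comm] at h
    exact measurableSet_eq_fun hf ((hrm.comp measurable_snd).mul hg)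
  have h1 : ∀ᵐ w ∂C, (ψ 0 (R.stateAfterLast w, []) : ℝ≥0∞) = 1 :=
    hac'.ae_le (quasiMeasurePreserving_stateAfterLast.ae (ae_volumeChange_zero hψ))
  have hr' : ∀ᵐ w ∂C, r w = ψ (lastTime w.2) w := by
    filter_upwards [hae', h1, ae_restrict_mem measurableSet_eventfulPaths] with w hw hw1 hw2
    have t1 := tendsto_volumeChange hψ hw2.2
    have t2 := tendsto_volumeChange hψ (nil_mem_pathsIn (V := Vr) (R.stateAfterLast w) (Ioi 0))
    simp only [lastTime_nil, zero_add, hw1] at t2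
    have t3 := ENNReal.Tendsto.const_mul (a := r w) t2 (Or.inl one_ne_zero)
    rw [mul_one] at t3
    exact (tendsto_nhds_unique_of_frequently_eq t1 t3 (frequently_of_ae_restrict_Ioi hw)).symm
  refine ⟨?_, ?_⟩
  · rw [← hNr]
    exact withDensity_congr_ae hr'
  · filter_upwards [hae', hr'] with w h h'
    rwa [h'] at h

/-- Paths run backwards from an event: the volume change of the reversal at the last event. -/
theorem boundaryMeasure_eq_withDensity (hψ : ContinuousVolumeChange R μE ψ) :
    R.boundaryMeasure μE = ((canonicalMeasure μE μVr).restrict (eventfulPaths E Vr)).withDensity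
      fun w => ψ (lastTime w.2) w :=
  (boundaryMeasure_aux hψ).1

/-- The cocycle relation of the volume change, split at the last event. -/
theorem ae_volumeChange_mul (hψ : ContinuousVolumeChange R μE ψ) :
    ∀ᵐ w ∂(canonicalMeasure μE μVr).restrict (eventfulPaths E Vr), ∀ᵐ t ∂volume.restrict (Ioi 0),
      (ψ (lastTime w.2 + t) w : ℝ≥0∞) = ψ (lastTime w.2) w * ψ t (R.stateAfterLast w, []) :=
  (boundaryMeasure_aux hψ).2

theorem ae_stateAfterLast (hψ : ContinuousVolumeChange R μE ψ) {p : E → Prop}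
    (hp : ∀ᵐ z ∂μE, p z) :
    ∀ᵐ w ∂(canonicalMeasure μE μVr).restrict (eventfulPaths E Vr), p (R.stateAfterLast w) :=
  (Measure.AbsolutelyContinuous.mk fun _ hA h =>
    (boundaryMeasure_eq_zero_iff hψ hA).1 h : _ ≪ R.boundaryMeasure μE).ae_le
    (quasiMeasurePreserving_stateAfterLast.ae hp)

end Reversal

end Boundary

/-! ### Cutting a list of events at a time. -/

section Split

variable {V : Type*}

theorem eventsIn_Iic_append_Ioi {es : List (ℝ × V)} (hs : Increasing es) (T : ℝ) :
    eventsIn (Iic T) 0 es ++ eventsIn (Ioi T) 0 es = es := by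
  induction es with
  | nil => simp [eventsIn]
  | cons e es ih =>
    obtain ⟨h1, h2⟩ := increasing_cons.1 hs
    have hc : ∀ I : Set ℝ, eventsIn I 0 (e :: es) = eventsIn I 0 [e] ++ eventsIn I 0 es :=
      fun I => eventsIn_append (a := [e])
    rw [hc, hc]
    by_cases he : e.1 ≤ T
    · rw [eventsIn_eq_self (es := [e]) (by simpa using he),
        eventsIn_eq_nil (es := [e]) (I := Ioi T) (by simpa using he)]
      simpa using ih h2
    · have h3 : ∀ a ∈ es, a.1 ∉ Iic T := fun a ha h => by
        have := h1 a ha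
        rw [mem_Iic] at h
        linarith
      rw [eventsIn_eq_nil (es := [e]) (by simpa using he), eventsIn_eq_nil h3,
        eventsIn_eq_self (es := [e]) (I := Ioi T) (by simpa using he),
        eventsIn_eq_self (es := es) (I := Ioi T) fun a ha => by simpa using h3 a ha]
      rfl

theorem increasing_eventsIn {I : Set ℝ} {es : List (ℝ × V)} (hs : Increasing es) :
    Increasing (eventsIn I 0 es) := by
  simp only [eventsIn_eq, neg_zero, delay_zero]
  rw [increasing_iff] at hs ⊢
  exact hs.filter _

theorem forall_mem_delay {c : ℝ} {es : List (ℝ × V)} {p : ℝ → Prop} :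
    (∀ e ∈ delay c es, p e.1) ↔ ∀ e ∈ es, p (e.1 + c) := by
  simp only [mem_delay]
  exact ⟨fun h e he => h (e.1 + c, e.2) (by simpa using he), fun h e he => by simpa using h _ he⟩

/-- The events before a time are those before any slightly smaller time. -/
theorem eventually_eventsIn_Iic_eq (es : List (ℝ × V)) (T : ℝ) :
    ∀ᶠ t in nhdsWithin T (Iio T), eventsIn (Iic t) 0 es = eventsIn (Iio T) 0 es ∧
      ∀ e ∈ eventsIn (Iio T) 0 es, e.1 < t := by
  have h : ∀ᶠ t in nhdsWithin T (Iio T), ∀ e ∈ es, e.1 < T → e.1 < t := by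
    induction es with
    | nil => simp
    | cons e es ih =>
      have h1 : ∀ᶠ t in nhdsWithin T (Iio T), e.1 < T → e.1 < t := by
        by_cases he : e.1 < T
        · filter_upwards [Ioo_mem_nhdsLT he] with t ht _ using ht.1
        · exact Filter.Eventually.of_forall fun t h => absurd h he
      filter_upwards [ih, h1] with t h2 h3
      simpa using ⟨h3, fun a b ha => h2 (a, b) ha⟩
  filter_upwards [h, self_mem_nhdsWithin] with t ht htT
  refine ⟨?_, fun e he => ?_⟩
  · simp only [eventsIn_eq, neg_zero, delay_zero]
    refine List.filter_congr fun e he => ?_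
    have := ht e he
    simp only [mem_Iic, mem_Iio, decide_eq_decide]
    exact ⟨fun h => h.trans_lt htT, fun h => (this h).le⟩
  · rw [mem_eventsIn_zero] at he
    exact ht e he.1 he.2

end Split

/-! ### Paths through a given state, and the stopping criterion on them. -/

section Join

variable {E V Vr : Type*} [MeasurableSpace E] [MeasurableSpace V] [MeasurableSpace Vr]
  {μV : Measure V} {μVr : Measure Vr} {X : PDMP E V μV} {Y : PDMP E Vr μVr}

namespace Reversal

/-- The path through the state `z` at time `l`, with the backward events `b` before this time and
the forward events `f` after it. -/
def join (R : Reversal X Y) (l : ℝ) (z : E) (b : List (ℝ × Vr)) (f : List (ℝ × V)) :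
    Skeleton E V :=
  (X.flow (-l) (Y.run z b), delay l (R.symm.revEvents z b ++ f))

theorem join_eq (R : Reversal X Y) (l : ℝ) (z : E) (b : List (ℝ × Vr)) (f : List (ℝ × V)) :
    R.join l z b f = ((R.toFwd l (z, b)).1, (R.toFwd l (z, b)).2 ++ delay l f) := by
  rw [toFwd_eq, toRev_eq, R.flow_eq, join, delay_append]

theorem run_rev_symm (R : Reversal X Y) (z : E) (b : List (ℝ × Vr)) :
    X.run (Y.run z b) (R.symm.revEvents z b) = z := R.symm.run_revEvents z b

/-- The position l of the state on the path only shifts the event points, so a criterion that sees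
nothing else does not depend on it. -/
theorem points_join (R : Reversal X Y) (l : ℝ) (z : E) (b : List (ℝ × Vr))
    (f : List (ℝ × V)) : X.eventPoints (R.join l z b f) =
      (X.points (Y.run z b) (R.symm.revEvents z b ++ f)).map fun a => (a.1 + l, a.2) := by
  rw [PDMP.eventPoints_eq, join, PDMP.points_delay, PDMP.flow_flow_neg]

theorem forall_join {R : Reversal X Y} {l : ℝ} {z : E} {b : List (ℝ × Vr)}
    {f : List (ℝ × V)} {p : ℝ → Prop} : (∀ e ∈ (R.join l z b f).2, p e.1) ↔
      (∀ e ∈ b, p (l - e.1)) ∧ ∀ e ∈ f, p (l + e.1) := by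
  rw [join, forall_mem_delay]
  simp only [List.mem_append, or_imp, forall_and]
  rw [R.symm.forall_mem_revEvents z (p := fun t => p (t + l))]
  refine and_congr (forall₂_congr fun e _ => ?_) (forall₂_congr fun e _ => ?_)
  · rw [neg_add_eq_sub]
  · rw [add_comm]

theorem increasing_join {R : Reversal X Y} {l : ℝ} {z : E} {b : List (ℝ × Vr)}
    {f : List (ℝ × V)} (hb : Increasing b) (hf : Increasing f) (hb0 : ∀ e ∈ b, 0 < e.1)
    (hf0 : ∀ e ∈ f, 0 < e.1) : Increasing (R.join l z b f).2 := by
  rw [join, increasing_delay, increasing_append, R.symm.increasing_revEvents]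
  refine ⟨hb, hf, ?_⟩
  rw [R.symm.forall_mem_revEvents z (p := fun t => ∀ y ∈ f, t < y.1)]
  intro e he y hy
  linarith [hb0 e he, hf0 y hy]

/-- Shrinking the window around z amounts to dropping the events further than l' backward and r'
forward. The events lie in three groups, before, inside and after the new window, and only the
middle one survives. -/
theorem subPath_join (R : Reversal X Y) {l l' : ℝ} {z : E} {b : List (ℝ × Vr)}
    {f : List (ℝ × V)} {r' : ℝ} (hb : Increasing b) (hf : Increasing f) (hb0 : ∀ e ∈ b, 0 < e.1)
    (hf0 : ∀ e ∈ f, 0 < e.1) (hl' : 0 ≤ l') (hr' : 0 ≤ r') :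
    X.subPath (R.join l z b f) (l - l') (l + r') =
      R.join l' z (eventsIn (Iic l') 0 b) (eventsIn (Iic r') 0 f) := by
  have eb := eventsIn_Iic_append_Ioi hb l'
  have ef := eventsIn_Iic_append_Ioi hf r'
  set b1 := eventsIn (Iic l') 0 b with hb1
  set b2 := eventsIn (Ioi l') 0 b with hb2
  set f1 := eventsIn (Iic r') 0 f with hf1
  set f2 := eventsIn (Ioi r') 0 f with hf2
  have mb1 : ∀ e ∈ b1, 0 < e.1 ∧ e.1 ≤ l' := fun e he => by
    rw [hb1, mem_eventsIn_zero] at he; exact ⟨hb0 e he.1, he.2⟩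
  have mb2 : ∀ e ∈ b2, l' < e.1 := fun e he => by
    rw [hb2, mem_eventsIn_zero] at he; exact he.2
  have mf1 : ∀ e ∈ f1, 0 < e.1 ∧ e.1 ≤ r' := fun e he => by
    rw [hf1, mem_eventsIn_zero] at he; exact ⟨hf0 e he.1, he.2⟩
  have mf2 : ∀ e ∈ f2, r' < e.1 := fun e he => by
    rw [hf2, mem_eventsIn_zero] at he; exact he.2
  have hJ : (R.join l z b f).2 = delay l (R.symm.revEvents (Y.run z b1) b2) ++
      delay l (R.symm.revEvents z b1 ++ f1) ++ delay l f2 := by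
    rw [join]
    conv_lhs => rw [← eb, ← ef]
    simp [R.symm.revEvents_append]
  have hJ1 : (R.join l z b f).1 = X.flow (-l) (Y.run z b) := rfl
  have i1 : ∀ e ∈ delay l (R.symm.revEvents (Y.run z b1) b2), e.1 < l - l' := by
    rw [forall_mem_delay (p := fun t => t < l - l'),
      R.symm.forall_mem_revEvents _ (p := fun t => t + l < l - l')]
    intro e he; linarith [mb2 e he]
  have i2 : ∀ e ∈ delay l (R.symm.revEvents z b1 ++ f1), l - l' ≤ e.1 ∧ e.1 ≤ l + r' := by
    rw [forall_mem_delay (p := fun t => l - l' ≤ t ∧ t ≤ l + r')]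
    simp only [List.mem_append, or_imp, forall_and]
    rw [R.symm.forall_mem_revEvents _ (p := fun t => l - l' ≤ t + l),
      R.symm.forall_mem_revEvents _ (p := fun t => t + l ≤ l + r')]
    exact ⟨⟨fun e he => by linarith [(mb1 e he).2], fun e he => by linarith [(mf1 e he).1]⟩,
      fun e he => by linarith [(mb1 e he).1], fun e he => by linarith [(mf1 e he).2]⟩
  have i3 : ∀ e ∈ delay l f2, l + r' < e.1 := by
    rw [forall_mem_delay (p := fun t => l + r' < t)]
    intro e he; linarith [mf2 e he]
  rw [PDMP.subPath, hJ, hJ1, PDMP.stateAt_eq]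
  simp only [eventsIn_append]
  rw [eventsIn_eq_self (I := Iio (l - l')) i1,
    eventsIn_eq_nil (I := Iio (l - l')) (es := delay l (R.symm.revEvents z b1 ++ f1))
      (fun e he => not_lt.2 (i2 e he).1),
    eventsIn_eq_nil (I := Iio (l - l')) (es := delay l f2)
      (fun e he h => by linarith [i3 e he, mem_Iio.1 h]),
    eventsIn_eq_nil (I := Icc (l - l') (l + r'))
      (es := delay l (R.symm.revEvents (Y.run z b1) b2)) (fun e he h => by linarith [i1 e he, h.1]),
    eventsIn_eq_nil (I := Icc (l - l') (l + r')) (es := delay l f2)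
      (fun e he h => by linarith [i3 e he, h.2]),
    eventsIn_eq_delay (I := Icc (l - l') (l + r')) i2]
  simp only [List.append_nil, List.nil_append, delay_delay, PDMP.run_delay,
    PDMP.flow_flow]
  -- The dropped backward events are run forward again to find the state at the new left end.
  have hrun : X.run (Y.run z b) (R.symm.revEvents (Y.run z b1) b2) = Y.run z b1 := by
    conv_lhs => rw [← eb, PDMP.run_append]
    exact R.run_rev_symm _ _
  rw [add_neg_cancel, PDMP.flow_zero, hrun, join]
  congr 2
  all_goals ring_nf

/-- The path which ends (in backward time) with an event at time `l`. -/
theorem join_concat (R : Reversal X Y) (z : E) (b : List (ℝ × Vr)) (e : ℝ × Vr)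
    (f : List (ℝ × V)) : ∃ v y, R.join e.1 z (b ++ [e]) f = (y, (0, v) :: (R.join e.1 z b f).2) ∧
      X.jump y v = (R.join e.1 z b f).1 := by
  have hJ : R.join e.1 z (b ++ [e]) f = (X.flow (-e.1) (Y.run z (b ++ [e])),
      (0, R.fwdMark (Y.flow e.1 (Y.run z b)) e.2) :: (R.join e.1 z b f).2) := by
    rw [join, join, R.symm.revEvents_append, revEvents_cons]
    simp [symm]
  refine ⟨_, _, hJ, ?_⟩
  rw [PDMP.run_append, PDMP.run_cons, PDMP.run_nil, PDMP.hop, R.flow_eq (-e.1), neg_neg,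
    PDMP.flow_neg_flow, R.jump_fwdMark, R.flow_eq, join]

end Reversal

/-- Whether a path is valid on an interval slightly larger than that spanned by its events. -/
def openCrit (X : PDMP E V μV) (crit : Skeleton E V → ℝ → Prop) (w : Skeleton E V) : Prop :=
  crit (X.flow (-1) w.1, delay 1 w.2) (lastTime w.2 + 2)

/-- When no event is at an extremity, validity is a function of the event points alone. `openCrit`
evaluates it on a reference interval: the shift by 1 and the length `lastTime w.2 + 2` keep the
extremities away from all the events, even from one at time 0 of w. -/
theorem crit_iff_openCrit {crit : Skeleton E V → ℝ → Prop} (h : X.DependsOnlyOnEvents crit)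
    {v w : Skeleton E V} {L c : ℝ} (hL : 0 ≤ L) (hv : v ∈ pathsIn E V (Ioo 0 L))
    (hw : Increasing w.2) (hw0 : ∀ e ∈ w.2, 0 ≤ e.1)
    (hp : X.eventPoints v = (X.eventPoints w).map fun a => (a.1 + c, a.2)) :
    crit v L ↔ openCrit X crit w := by
  have hl : 0 ≤ lastTime w.2 := by
    rcases eq_or_ne w.2 [] with h | h
    · simp [h]
    · obtain ⟨e, he, h'⟩ := exists_mem_lastTime h
      exact h' ▸ hw0 e he
  have hd : ∀ e ∈ delay 1 w.2, 1 ≤ e.1 ∧ e.1 ≤ lastTime w.2 + 1 := by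
    rw [forall_mem_delay (p := fun t => 1 ≤ t ∧ t ≤ lastTime w.2 + 1)]
    exact fun e he => ⟨by linarith [hw0 e he], by linarith [le_lastTime hw he]⟩
  refine (h (X.flow (-1) w.1, delay 1 w.2) (lastTime w.2 + 2) v L (1 - c) (by linarith) hL
    ⟨increasing_delay.2 hw, fun e he => ⟨by linarith [(hd e he).1], by linarith [(hd e he).2]⟩⟩
    ⟨hv.1, fun e he => ⟨(hv.2 e he).1.le, (hv.2 e he).2.le⟩⟩ ?_ ?_ ?_).symm
  · rw [hp, PDMP.eventPoints_eq, PDMP.eventPoints_eq, PDMP.points_delay, PDMP.flow_flow_neg,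
      List.map_map]
    congr 1
    funext a
    simp only [Function.comp_apply, Prod.mk.injEq, and_true]
    ring
  · refine iff_of_false ?_ ?_
    · rintro h
      obtain ⟨e, he, h0⟩ := List.mem_map.1 h
      linarith [(hd e he).1]
    · rintro h
      obtain ⟨e, he, h0⟩ := List.mem_map.1 h
      linarith [(hv.2 e he).1]
  · refine iff_of_false ?_ ?_
    · rintro h
      obtain ⟨e, he, h0⟩ := List.mem_map.1 h
      linarith [(hd e he).2]
    · rintro h
      obtain ⟨e, he, h0⟩ := List.mem_map.1 h
      linarith [(hv.2 e he).2]

/-- Validity of a window without events at its extremities does not change with the window as long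
as its events stay the same. -/
theorem crit_join_iff {crit : Skeleton E V → ℝ → Prop} (h : X.DependsOnlyOnEvents crit)
    (R : Reversal X Y) {l r l' : ℝ} {z : E} {b : List (ℝ × Vr)} {f : List (ℝ × V)}
    (hl : 0 ≤ l) (hr : 0 ≤ r) (hb : Increasing b) (hf : Increasing f)
    (hb0 : ∀ e ∈ b, 0 < e.1 ∧ e.1 < l) (hf0 : ∀ e ∈ f, 0 < e.1 ∧ e.1 < r)
    (hb' : ∀ e ∈ b, e.1 ≤ l') (hl' : 0 ≤ l') :
    crit (R.join l z b f) (l + r) ↔ openCrit X crit (R.join l' z b f) := by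
  refine crit_iff_openCrit h (c := l - l') (by linarith) ⟨R.increasing_join hb hf
    (fun e he => (hb0 e he).1) fun e he => (hf0 e he).1, ?_⟩
    (R.increasing_join hb hf (fun e he => (hb0 e he).1) fun e he => (hf0 e he).1) ?_ ?_
  · exact R.forall_join.2 ⟨fun e he => ⟨by linarith [hb0 e he], by linarith [hb0 e he]⟩,
      fun e he => ⟨by linarith [hf0 e he], by linarith [hf0 e he]⟩⟩
  · exact R.forall_join.2 ⟨fun e he => by linarith [hb' e he],
      fun e he => by linarith [hf0 e he]⟩
  · rw [R.points_join, R.points_join, List.map_map]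
    congr 1
    funext a
    simp only [Function.comp_apply, Prod.mk.injEq, and_true]
    ring

/-- The criterion is satisfied until just before the extremities of a path, and not beyond. -/
def IsStop (R : Reversal X Y) (crit : Skeleton E V → ℝ → Prop) (l r : ℝ) (z : E)
    (b : List (ℝ × Vr)) (f : List (ℝ × V)) : Prop :=
  openCrit X crit (R.join l z (eventsIn (Iio l) 0 b) (eventsIn (Iio r) 0 f)) ∧
    ¬ openCrit X crit (R.join l z b f)

end Join

/-! ### When the construction of the path stops. -/

section Draws

variable {E V Vr : Type*} [MeasurableSpace E] [MeasurableSpace V] [MeasurableSpace Vr]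
  {μV : Measure V} {μVr : Measure Vr} {X : PDMP E V μV} {Y : PDMP E Vr μVr}

theorem Trajectory.Regular.eventually_right {z : E} {ω : Trajectory E V} (h : ω.Regular z) {T : ℝ}
    (hr : ω.Reaches T) :
    ∀ᶠ t in nhdsWithin T (Ioi T), ω.Reaches t ∧ ω.eventsUpTo t = ω.eventsUpTo T := by
  obtain ⟨δ, hδ, h1, h2⟩ := h.exists_reaches_add hr
  filter_upwards [Ioo_mem_nhdsGT (lt_add_of_pos_right T hδ)] with t ht
  obtain ⟨h3, h4⟩ := h.reaches_mono ht.2.le h1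
  refine ⟨h3, ?_⟩
  rw [h4, h2, eventsIn_eq_self]
  exact fun e he => ((h.eventsUpTo_mem T).2 e he).2.trans ht.1.le

theorem Trajectory.Regular.eventually_left {z : E} {ω : Trajectory E V} (h : ω.Regular z) {T : ℝ}
    (hr : ω.Reaches T) :
    ∀ᶠ t in nhdsWithin T (Iio T), ω.Reaches t ∧
      ω.eventsUpTo t = eventsIn (Iio T) 0 (ω.eventsUpTo T) ∧
      ∀ e ∈ eventsIn (Iio T) 0 (ω.eventsUpTo T), e.1 < t := by
  filter_upwards [eventually_eventsIn_Iic_eq (ω.eventsUpTo T) T, self_mem_nhdsWithin] with t h1 h2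
  obtain ⟨h3, h4⟩ := h.reaches_mono (le_of_lt (mem_Iio.1 h2)) hr
  exact ⟨h3, h4.trans h1.1, h1.2⟩

theorem tendsto_mul_nhdsGT {a : ℝ} (ha : 0 < a) (T : ℝ) :
    Filter.Tendsto (fun t => a * t) (nhdsWithin T (Ioi T)) (nhdsWithin (a * T) (Ioi (a * T))) := by
  refine tendsto_nhdsWithin_iff.2 ⟨((continuous_const_mul a).tendsto T).mono_left
    nhdsWithin_le_nhds, ?_⟩
  filter_upwards [self_mem_nhdsWithin] with t ht using mul_lt_mul_of_pos_left ht ha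

theorem tendsto_mul_nhdsLT {a : ℝ} (ha : 0 < a) (T : ℝ) :
    Filter.Tendsto (fun t => a * t) (nhdsWithin T (Iio T)) (nhdsWithin (a * T) (Iio (a * T))) := by
  refine tendsto_nhdsWithin_iff.2 ⟨((continuous_const_mul a).tendsto T).mono_left
    nhdsWithin_le_nhds, ?_⟩
  filter_upwards [self_mem_nhdsWithin] with t ht using mul_lt_mul_of_pos_left ht ha

/-- A draw with `α` in `(0, 1)` and well-formed trajectories through its state. -/
structure RegularDraw (s : Draw E V Vr) : Prop where
  pos : 0 < s.2.1
  lt_one : s.2.1 < 1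
  bwd : s.2.2.1.Regular s.1
  fwd : s.2.2.2.Regular s.1

namespace Sampler

variable (S : Sampler X Y)

theorem window_eq (s : Draw E V Vr) (t : ℝ) : S.window s t =
    S.reversal.join (s.2.1 * t) s.1 (s.2.2.1.eventsUpTo (s.2.1 * t))
      (s.2.2.2.eventsUpTo ((1 - s.2.1) * t)) := by
  rw [window, Reversal.join_eq, eventsIn_univ]

/-- The construction of the path stops at the length `T`. -/
def StopsAt (s : Draw E V Vr) (T : ℝ) : Prop :=
  IsStop S.reversal S.criterion (s.2.1 * T) ((1 - s.2.1) * T) s.1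
    (s.2.2.1.eventsUpTo (s.2.1 * T)) (s.2.2.2.eventsUpTo ((1 - s.2.1) * T))

variable {S} {s : Draw E V Vr}

/-- The windows are nested because both α and 1 - α are positive, so consistency applies. -/
theorem mem_validTimes_of_le (hs : RegularDraw s) (hc : X.IsConsistent S.criterion) {t t' : ℝ}
    (ht : t ∈ S.validTimes s) (h0 : 0 ≤ t') (hle : t' ≤ t) : t' ∈ S.validTimes s := by
  obtain ⟨ht0, hd, hcr⟩ := ht
  have hα := hs.pos
  have hα' : 0 < 1 - s.2.1 := by linarith [hs.lt_one]
  have hl : s.2.1 * t' ≤ s.2.1 * t := mul_le_mul_of_nonneg_left hle hα.le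
  have hr : (1 - s.2.1) * t' ≤ (1 - s.2.1) * t := mul_le_mul_of_nonneg_left hle hα'.le
  obtain ⟨b1, b2⟩ := hs.bwd.reaches_mono hl hd.1
  obtain ⟨f1, f2⟩ := hs.fwd.reaches_mono hr hd.2
  refine ⟨h0, ⟨b1, f1⟩, ?_⟩
  obtain ⟨ib, mb⟩ := hs.bwd.eventsUpTo_mem (s.2.1 * t)
  obtain ⟨fi, mf⟩ := hs.fwd.eventsUpTo_mem ((1 - s.2.1) * t)
  rw [window_eq] at hcr ⊢
  have hmem : S.reversal.join (s.2.1 * t) s.1 (s.2.2.1.eventsUpTo (s.2.1 * t))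
      (s.2.2.2.eventsUpTo ((1 - s.2.1) * t)) ∈ pathsIn E V (Icc 0 t) :=
    ⟨S.reversal.increasing_join ib fi (fun e he => (mb e he).1) fun e he => (mf e he).1,
      S.reversal.forall_join.2 ⟨fun e he => ⟨by linarith [mb e he], by nlinarith [mb e he]⟩,
        fun e he => ⟨by nlinarith [mf e he], by linarith [mf e he]⟩⟩⟩
  have h := hc _ t (s.2.1 * t - s.2.1 * t') (s.2.1 * t + (1 - s.2.1) * t') hmem (by linarith)
    (by nlinarith) (by linarith) hcr
  rw [S.reversal.subPath_join ib fi (fun e he => (mb e he).1) (fun e he => (mf e he).1)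
    (by positivity) (by positivity), ← b2, ← f2] at h
  convert h using 1
  ring

/-- Just after T no new event has occurred, and an event at an extremity of the window at T has
become interior. -/
theorem eventually_mem_validTimes_right (hs : RegularDraw s)
    (he : X.DependsOnlyOnEvents S.criterion) {T : ℝ} (hT : 0 < T) (hd : Defined s T) :
    ∀ᶠ t in nhdsWithin T (Ioi T), (t ∈ S.validTimes s ↔ openCrit X S.criterion
      (S.reversal.join (s.2.1 * T) s.1 (s.2.2.1.eventsUpTo (s.2.1 * T))
        (s.2.2.2.eventsUpTo ((1 - s.2.1) * T)))) := by
  have hα := hs.pos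
  have hα' : 0 < 1 - s.2.1 := by linarith [hs.lt_one]
  filter_upwards [(tendsto_mul_nhdsGT hα T).eventually (hs.bwd.eventually_right hd.1),
    (tendsto_mul_nhdsGT hα' T).eventually (hs.fwd.eventually_right hd.2), self_mem_nhdsWithin]
    with t hb hf ht
  rw [mem_Ioi] at ht
  have hl : s.2.1 * T < s.2.1 * t := mul_lt_mul_of_pos_left ht hα
  have hr : (1 - s.2.1) * T < (1 - s.2.1) * t := mul_lt_mul_of_pos_left ht hα'
  obtain ⟨ib, mb⟩ := hs.bwd.eventsUpTo_mem (s.2.1 * T)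
  obtain ⟨fi, mf⟩ := hs.fwd.eventsUpTo_mem ((1 - s.2.1) * T)
  have h := crit_join_iff he S.reversal (l := s.2.1 * t) (r := (1 - s.2.1) * t)
    (l' := s.2.1 * T) (z := s.1) (by nlinarith) (by nlinarith) ib fi
    (fun e he => ⟨(mb e he).1, by linarith [mb e he]⟩)
    (fun e he => ⟨(mf e he).1, by linarith [mf e he]⟩) (fun e he => (mb e he).2) (by positivity)
  have ht2 : s.2.1 * t + (1 - s.2.1) * t = t := by ring
  rw [← h, ht2]
  change (0 ≤ t ∧ Defined s t ∧ S.criterion (S.window s t) t) ↔ _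
  rw [window_eq, hb.2, hf.2]
  exact ⟨fun h => h.2.2, fun h => ⟨(hT.trans ht).le, ⟨hb.1, hf.1⟩, h⟩⟩

/-- Just before T the window contains the events of the window at T except those at its extremities.
-/
theorem eventually_mem_validTimes_left (hs : RegularDraw s)
    (he : X.DependsOnlyOnEvents S.criterion) {T : ℝ} (hT : 0 < T) (hd : Defined s T) :
    ∀ᶠ t in nhdsWithin T (Iio T), (t ∈ S.validTimes s ↔ openCrit X S.criterion
      (S.reversal.join (s.2.1 * T) s.1
        (eventsIn (Iio (s.2.1 * T)) 0 (s.2.2.1.eventsUpTo (s.2.1 * T)))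
        (eventsIn (Iio ((1 - s.2.1) * T)) 0 (s.2.2.2.eventsUpTo ((1 - s.2.1) * T))))) := by
  have hα := hs.pos
  have hα' : 0 < 1 - s.2.1 := by linarith [hs.lt_one]
  filter_upwards [(tendsto_mul_nhdsLT hα T).eventually (hs.bwd.eventually_left hd.1),
    (tendsto_mul_nhdsLT hα' T).eventually (hs.fwd.eventually_left hd.2), Ioo_mem_nhdsLT hT]
    with t hb hf ht
  obtain ⟨ht0, ht⟩ := ht
  have hl : s.2.1 * t < s.2.1 * T := mul_lt_mul_of_pos_left ht hα
  obtain ⟨ib, mb⟩ := hs.bwd.eventsUpTo_mem (s.2.1 * T)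
  obtain ⟨fi, mf⟩ := hs.fwd.eventsUpTo_mem ((1 - s.2.1) * T)
  have h := crit_join_iff he S.reversal (l := s.2.1 * t) (r := (1 - s.2.1) * t)
    (l' := s.2.1 * T) (z := s.1) (by positivity) (by positivity) (increasing_eventsIn ib)
    (increasing_eventsIn fi)
    (fun e he => ⟨(mb e (mem_eventsIn_zero.1 he).1).1, hb.2.2 e he⟩)
    (fun e he => ⟨(mf e (mem_eventsIn_zero.1 he).1).1, hf.2.2 e he⟩)
    (fun e he => (mb e (mem_eventsIn_zero.1 he).1).2) (by positivity)
  have ht2 : s.2.1 * t + (1 - s.2.1) * t = t := by ring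
  rw [← h, ht2]
  change (0 ≤ t ∧ Defined s t ∧ S.criterion (S.window s t) t) ↔ _
  rw [window_eq, hb.2.1, hf.2.1]
  exact ⟨fun h => h.2.2, fun h => ⟨ht0.le, ⟨hb.1, hf.1⟩, h⟩⟩

/-- The valid times are closed downward, so T is their supremum exactly when times just before are
valid and times just after are not. The validity at T itself is immaterial. -/
theorem stopsAt_iff (hs : RegularDraw s) (hc : X.IsConsistent S.criterion)
    (he : X.DependsOnlyOnEvents S.criterion) {T : ℝ} (hT : 0 < T) (hd : Defined s T) :
    S.StopsAt s T ↔ BddAbove (S.validTimes s) ∧ S.length s = T := by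
  have hR := eventually_mem_validTimes_right hs he hT hd
  have hL := eventually_mem_validTimes_left hs he hT hd
  constructor
  · rintro ⟨h1, h2⟩
    have hub : ∀ t ∈ S.validTimes s, t ≤ T := by
      intro t ht
      by_contra hlt
      obtain ⟨t', h3, h4⟩ := (hR.and (Ioo_mem_nhdsGT (not_le.1 hlt))).exists
      exact h2 (h3.1 (mem_validTimes_of_le hs hc ht (hT.trans h4.1).le h4.2.le))
    have hlb : ∀ u < T, ∃ t ∈ S.validTimes s, u < t := by
      intro u hu
      obtain ⟨t', h3, h4⟩ := (hL.and (Ioo_mem_nhdsLT hu)).exists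
      exact ⟨t', h3.2 h1, h4.1⟩
    refine ⟨⟨T, hub⟩, csSup_eq_of_forall_le_of_forall_lt_exists_gt ?_ hub hlb⟩
    obtain ⟨t, ht, _⟩ := hlb 0 hT
    exact ⟨t, ht⟩
  · rintro ⟨hb, rfl⟩
    constructor
    · obtain ⟨t, h3, h4⟩ := (hL.and (Ioo_mem_nhdsLT hT)).exists
      have hne : (S.validTimes s).Nonempty := by
        by_contra h
        rw [length, not_nonempty_iff_eq_empty.1 h, Real.sSup_empty] at hT
        exact lt_irrefl _ hT
      obtain ⟨t', h5, h6⟩ := exists_lt_of_lt_csSup hne h4.2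
      exact h3.1 (mem_validTimes_of_le hs hc h5 h4.1.le h6.le)
    · intro h
      obtain ⟨t, h3, h4⟩ := (hR.and self_mem_nhdsWithin).exists
      exact absurd (le_csSup hb (h3.2 h)) (not_le.2 h4)

theorem stops_iff (hs : RegularDraw s) (hc : X.IsConsistent S.criterion)
    (he : X.DependsOnlyOnEvents S.criterion) {T : ℝ} :
    S.Stops s ∧ S.length s = T ↔ 0 < T ∧ Defined s T ∧ S.StopsAt s T := by
  constructor
  · rintro ⟨⟨h1, h2, h3⟩, rfl⟩
    exact ⟨h2, h3, (stopsAt_iff hs hc he h2 h3).2 ⟨h1, rfl⟩⟩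
  · rintro ⟨h1, h2, h3⟩
    obtain ⟨h4, rfl⟩ := (stopsAt_iff hs hc he h1 h2).1 h3
    exact ⟨⟨h4, h1, h2⟩, rfl⟩

/-- The path stops at the `k`-th forward event. -/
def StopsForward (S : Sampler X Y) (k : ℕ) (s : Draw E V Vr) : Prop :=
  (s.2.2.2 k).2 = true ∧ (s.2.2.2 k).1.2 ≠ [] ∧
    s.2.2.1.Reaches (s.2.1 / (1 - s.2.1) * lastTime (s.2.2.2 k).1.2) ∧
    IsStop S.reversal S.criterion (s.2.1 / (1 - s.2.1) * lastTime (s.2.2.2 k).1.2)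
      (lastTime (s.2.2.2 k).1.2) s.1
      (s.2.2.1.eventsUpTo (s.2.1 / (1 - s.2.1) * lastTime (s.2.2.2 k).1.2)) (s.2.2.2 k).1.2

/-- The path stops at the `k`-th backward event, and not at a forward event. -/
def StopsBackward (S : Sampler X Y) (k : ℕ) (s : Draw E V Vr) : Prop :=
  (s.2.2.1 k).2 = true ∧ (s.2.2.1 k).1.2 ≠ [] ∧
    s.2.2.2.Reaches ((1 - s.2.1) / s.2.1 * lastTime (s.2.2.1 k).1.2) ∧
    (∀ e ∈ s.2.2.2.eventsUpTo ((1 - s.2.1) / s.2.1 * lastTime (s.2.2.1 k).1.2),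
      e.1 < (1 - s.2.1) / s.2.1 * lastTime (s.2.2.1 k).1.2) ∧
    IsStop S.reversal S.criterion (lastTime (s.2.2.1 k).1.2)
      ((1 - s.2.1) / s.2.1 * lastTime (s.2.2.1 k).1.2) s.1 (s.2.2.1 k).1.2
      (s.2.2.2.eventsUpTo ((1 - s.2.1) / s.2.1 * lastTime (s.2.2.1 k).1.2))

/-- An event at time u at the forward extremity forces (1 - α)T = u, hence the backward duration αT
= αu/(1 - α). The index k is determined by the draw, so the cases for different k are disjoint. -/
theorem stopsForward_iff (hs : RegularDraw s) (hc : X.IsConsistent S.criterion)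
    (he : X.DependsOnlyOnEvents S.criterion) {k : ℕ} :
    S.StopsForward k s ↔ (S.Stops s ∧ S.HitForward s) ∧
      (s.2.2.2.eventsUpTo ((1 - s.2.1) * S.length s)).length = k := by
  have hα := hs.pos
  have hα' : 0 < 1 - s.2.1 := by linarith [hs.lt_one]
  constructor
  · rintro ⟨h1, h2, h3, h4⟩
    set u := lastTime (s.2.2.2 k).1.2 with hu
    obtain ⟨r1, r2⟩ := hs.fwd.eventsUpTo_lastTime k
    have hu0 : 0 < u := lastTime_pos h2 (hs.fwd.increasing k).2
    have e1 : s.2.1 * (u / (1 - s.2.1)) = s.2.1 / (1 - s.2.1) * u := by ring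
    have e2 : (1 - s.2.1) * (u / (1 - s.2.1)) = u := by field_simp
    have hT := (stops_iff hs hc he (T := u / (1 - s.2.1))).2 ⟨by positivity,
      ⟨by rw [e1]; exact h3, by rw [e2]; exact r1⟩, by rw [StopsAt, e1, e2, r2]; exact h4⟩
    refine ⟨⟨hT.1, ?_⟩, ?_⟩
    · rw [HitForward, hT.2, e2, r2]
      obtain ⟨e, he, h'⟩ := exists_mem_lastTime h2
      exact List.mem_map.2 ⟨e, he, h'⟩
    · rw [hT.2, e2, r2, hs.fwd.length_of_true h1]
  · rintro ⟨⟨h1, h2⟩, h3⟩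
    obtain ⟨h4, h5, h6⟩ := (stops_iff hs hc he).1 ⟨h1, rfl⟩
    set T := S.length s with hT
    obtain ⟨g1, g2, -⟩ := hs.fwd.eventsUpTo_eq_first h5.2
    rw [h3] at g1 g2
    obtain ⟨e, he, h7⟩ := List.mem_map.1 h2
    have hne : s.2.2.2.eventsUpTo ((1 - s.2.1) * T) ≠ [] := List.ne_nil_of_mem he
    obtain ⟨ii, mm⟩ := hs.fwd.eventsUpTo_mem ((1 - s.2.1) * T)
    have hu : lastTime (s.2.2.2 k).1.2 = (1 - s.2.1) * T := by
      rw [g2]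
      refine le_antisymm ?_ (h7 ▸ le_lastTime ii he)
      obtain ⟨e', he', h'⟩ := exists_mem_lastTime hne
      exact h' ▸ (mm e' he').2
    have e1 : s.2.1 / (1 - s.2.1) * ((1 - s.2.1) * T) = s.2.1 * T := by field_simp
    refine ⟨g1, by rwa [g2], ?_, ?_⟩
    · rw [hu, e1]; exact h5.1
    · rw [hu, e1, g2]; exact h6

theorem stopsBackward_iff (hs : RegularDraw s) (hc : X.IsConsistent S.criterion)
    (he : X.DependsOnlyOnEvents S.criterion) {k : ℕ} :
    S.StopsBackward k s ↔ (S.Stops s ∧ ¬ S.HitForward s) ∧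
      (s.2.2.1.eventsUpTo (s.2.1 * S.length s)).length = k := by
  have hα := hs.pos
  have hα' : 0 < 1 - s.2.1 := by linarith [hs.lt_one]
  constructor
  · rintro ⟨h1, h2, h3, h4, h4'⟩
    set u := lastTime (s.2.2.1 k).1.2 with hu
    obtain ⟨r1, r2⟩ := hs.bwd.eventsUpTo_lastTime k
    have hu0 : 0 < u := lastTime_pos h2 (hs.bwd.increasing k).2
    have e1 : s.2.1 * (u / s.2.1) = u := by field_simp
    have e2 : (1 - s.2.1) * (u / s.2.1) = (1 - s.2.1) / s.2.1 * u := by ring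
    have hT := (stops_iff hs hc he (T := u / s.2.1)).2 ⟨by positivity,
      ⟨by rw [e1]; exact r1, by rw [e2]; exact h3⟩, by rw [StopsAt, e1, e2, r2]; exact h4'⟩
    refine ⟨⟨hT.1, ?_⟩, ?_⟩
    · rw [HitForward, hT.2, e2]
      intro h
      obtain ⟨e, he, h'⟩ := List.mem_map.1 h
      exact (h4 e he).ne h'
    · rw [hT.2, e1, r2, hs.bwd.length_of_true h1]
  · rintro ⟨⟨h1, h2⟩, h3⟩
    obtain ⟨h4, h5, h6⟩ := (stops_iff hs hc he).1 ⟨h1, rfl⟩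
    rw [HitForward] at h2
    set T := S.length s with hT
    obtain ⟨g1, g2, -⟩ := hs.bwd.eventsUpTo_eq_first h5.1
    rw [h3] at g1 g2
    obtain ⟨ii, mm⟩ := hs.bwd.eventsUpTo_mem (s.2.1 * T)
    obtain ⟨fi, fm⟩ := hs.fwd.eventsUpTo_mem ((1 - s.2.1) * T)
    have hf : ∀ e ∈ s.2.2.2.eventsUpTo ((1 - s.2.1) * T), e.1 < (1 - s.2.1) * T := fun e he =>
      lt_of_le_of_ne (fm e he).2 fun h => h2 (List.mem_map.2 ⟨e, he, h⟩)
    -- Without an event at either extremity the windows just before and just after T would have the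
    -- same events, and the criterion could not change value.
    have hb : ∃ e ∈ s.2.2.1.eventsUpTo (s.2.1 * T), e.1 = s.2.1 * T := by
      by_contra hcon
      push Not at hcon
      have hb : ∀ e ∈ s.2.2.1.eventsUpTo (s.2.1 * T), e.1 ∈ Iio (s.2.1 * T) := fun e he =>
        lt_of_le_of_ne (mm e he).2 (hcon e he)
      have h7 := h6.1
      rw [eventsIn_eq_self hb, eventsIn_eq_self (I := Iio _) hf] at h7
      exact h6.2 h7
    obtain ⟨e, he, h7⟩ := hb
    have hne : s.2.2.1.eventsUpTo (s.2.1 * T) ≠ [] := List.ne_nil_of_mem he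
    have hu : lastTime (s.2.2.1 k).1.2 = s.2.1 * T := by
      rw [g2]
      refine le_antisymm ?_ (h7 ▸ le_lastTime ii he)
      obtain ⟨e', he', h'⟩ := exists_mem_lastTime hne
      exact h' ▸ (mm e' he').2
    have e1 : (1 - s.2.1) / s.2.1 * (s.2.1 * T) = (1 - s.2.1) * T := by field_simp
    refine ⟨g1, by rwa [g2], ?_, ?_, ?_⟩
    · rw [hu, e1]; exact h5.2
    · rw [hu, e1]; exact hf
    · rw [hu, e1, g2]; exact h6

end Sampler

end Draws

/-! ### Measurability rules for paths and their stopping. -/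

section FunProp

variable {T E V Vr : Type*} [MeasurableSpace T] [MeasurableSpace E] [MeasurableSpace V]
  [MeasurableSpace Vr] {μV : Measure V} {μVr : Measure Vr} {X : PDMP E V μV} {Y : PDMP E Vr μVr}

@[fun_prop]
theorem _root_.Measurable.eventsUpTo {f : T → Trajectory E V} {g : T → ℝ} (hf : Measurable f)
    (hg : Measurable g) : Measurable fun x => (f x).eventsUpTo (g x) :=
  measurable_eventsUpTo.comp (hf.prodMk hg)

@[fun_prop]
theorem _root_.Measurable.pathDensity (X : PDMP E V μV) (A : SimRate E V) {f : T → ℝ}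
    {g : T → Skeleton E V} (hf : Measurable f) (hg : Measurable g) :
    Measurable fun x => X.pathDensity A (f x) (g x) :=
  (X.measurable_pathDensity A).comp (hf.prodMk hg)

@[fun_prop]
theorem _root_.Measurable.eventsIn_Iic {f c : T → ℝ} {g : T → List (ℝ × V)} (hf : Measurable f)
    (hc : Measurable c) (hg : Measurable g) :
    Measurable fun x => eventsIn (Iic (f x)) (c x) (g x) :=
  (measurable_eventsIn (I := fun x => Iic (f x)) (measurableSet_le measurable_snd
    (hf.comp measurable_fst)) hc).comp (measurable_id.prodMk hg)

@[fun_prop]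
theorem _root_.Measurable.eventsIn_Iio {f c : T → ℝ} {g : T → List (ℝ × V)} (hf : Measurable f)
    (hc : Measurable c) (hg : Measurable g) :
    Measurable fun x => eventsIn (Iio (f x)) (c x) (g x) :=
  (measurable_eventsIn (I := fun x => Iio (f x)) (measurableSet_lt measurable_snd
    (hf.comp measurable_fst)) hc).comp (measurable_id.prodMk hg)

@[fun_prop]
theorem _root_.Measurable.eventsIn_Ioi {f c : T → ℝ} {g : T → List (ℝ × V)} (hf : Measurable f)
    (hc : Measurable c) (hg : Measurable g) :
    Measurable fun x => eventsIn (Ioi (f x)) (c x) (g x) :=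
  (measurable_eventsIn (I := fun x => Ioi (f x)) (measurableSet_lt (hf.comp measurable_fst)
    measurable_snd) hc).comp (measurable_id.prodMk hg)

@[fun_prop]
theorem _root_.Measurable.stateAt (X : PDMP E V μV) {f : T → ℝ}
    {g : T → Skeleton E V} (hf : Measurable f) (hg : Measurable g) :
    Measurable fun x => X.stateAt (g x) (f x) :=
  X.measurable_stateAt.comp (hg.prodMk hf)

@[fun_prop]
theorem _root_.Measurable.position (X : PDMP E V μV) {f : T → ℝ}
    {g : T → Skeleton E V} (hf : Measurable f) (hg : Measurable g) :
    Measurable fun x => X.position (g x) (f x) := by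
  unfold PDMP.position
  fun_prop

@[fun_prop]
theorem _root_.Measurable.join (R : Reversal X Y) {f : T → ℝ} {z : T → E}
    {b : T → List (ℝ × Vr)} {g : T → List (ℝ × V)} (hf : Measurable f) (hz : Measurable z)
    (hb : Measurable b) (hg : Measurable g) :
    Measurable fun x => R.join (f x) (z x) (b x) (g x) := by
  unfold Reversal.join
  fun_prop

theorem measurableSet_openCrit {crit : Skeleton E V → ℝ → Prop}
    (hc : MeasurableSet {p : Skeleton E V × ℝ | crit p.1 p.2}) :
    MeasurableSet {w | openCrit X crit w} := by
  have h : Measurable fun w : Skeleton E V =>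
      (((X.flow (-1) w.1, delay 1 w.2), lastTime w.2 + 2) : Skeleton E V × ℝ) := by fun_prop
  exact hc.preimage h

theorem measurableSet_isStop (R : Reversal X Y) {crit : Skeleton E V → ℝ → Prop}
    (hc : MeasurableSet {p : Skeleton E V × ℝ | crit p.1 p.2}) {l r : T → ℝ} {z : T → E}
    {b : T → List (ℝ × Vr)} {f : T → List (ℝ × V)} (hl : Measurable l) (hr : Measurable r)
    (hz : Measurable z) (hb : Measurable b) (hf : Measurable f) :
    MeasurableSet {x | IsStop R crit (l x) (r x) (z x) (b x) (f x)} := by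
  have h1 : Measurable fun x => R.join (l x) (z x) (eventsIn (Iio (l x)) 0 (b x))
    (eventsIn (Iio (r x)) 0 (f x)) := by fun_prop
  have h2 : Measurable fun x => R.join (l x) (z x) (b x) (f x) := by fun_prop
  exact ((measurableSet_openCrit hc).preimage h1).inter
    ((measurableSet_openCrit hc).preimage h2).compl

end FunProp

/-! ### The law of a draw, and measurable versions of the length of its path. -/

section Law

variable {E V Vr : Type*} [MeasurableSpace E] [MeasurableSpace V] [MeasurableSpace Vr]
  {μV : Measure V} {μVr : Measure Vr} [SigmaFinite μV] [SigmaFinite μVr]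
  {X : PDMP E V μV} {Y : PDMP E Vr μVr}

/-- A random draw, up to null sets. -/
structure IsDraw (S : Sampler X Y) (M : Measure (Draw E V Vr)) : Prop where
  alpha : ∀ᵐ s ∂M, s.2.1 ∈ Ioo (0 : ℝ) 1
  bwd : IsSimulation Y S.bwdRate M (fun s => s.1) (fun s => s.2.2.1)
  fwd : IsSimulation X S.fwdRate M (fun s => s.1) (fun s => s.2.2.2)

namespace Sampler

/-- The trajectories of a draw, rebuilt step by step from its state. -/
def regularizeDraw (s : Draw E V Vr) : Draw E V Vr :=
  (s.1, s.2.1, s.2.2.1.regularize s.1, s.2.2.2.regularize s.1)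

variable (S : Sampler X Y)

theorem drawLaw_apply (z : E) : S.drawLaw z = ((volume.restrict (Ioo (0 : ℝ) 1)).prod
    ((Y.trajectoryLaw S.bwdRate z).prod (X.trajectoryLaw S.fwdRate z))).map (Prod.mk z) := by
  rw [drawLaw, Kernel.prod_apply, Kernel.prod_apply, Kernel.prod_apply, Kernel.const_apply,
    Kernel.id_apply, Measure.dirac_prod]

instance isProbabilityMeasure_unit_interval :
    IsProbabilityMeasure (volume.restrict (Ioo (0 : ℝ) 1)) := ⟨by simp⟩

instance isMarkovKernel_drawLaw : IsMarkovKernel S.drawLaw := by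
  rw [drawLaw]; infer_instance

theorem isDraw_drawLaw (z : E) : IsDraw S (S.drawLaw z) := by
  have hb := Y.isSimulation_trajectoryLaw S.bwdRate z
  have hf := X.isSimulation_trajectoryLaw S.fwdRate z
  have key : ∀ {A : Set (Draw E V Vr)}, MeasurableSet A → (∀ᵐ r ∂(volume.restrict
      (Ioo (0 : ℝ) 1)).prod ((Y.trajectoryLaw S.bwdRate z).prod (X.trajectoryLaw S.fwdRate z)),
        (z, r) ∈ A) → ∀ᵐ s ∂S.drawLaw z, s ∈ A := fun hA h => by
    rw [drawLaw_apply]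
    exact (ae_map_iff measurable_prodMk_left.aemeasurable hA).2 h
  have kb : ∀ {p : Trajectory E Vr → Prop}, (∀ᵐ ω ∂Y.trajectoryLaw S.bwdRate z, p ω) →
      ∀ᵐ r ∂(volume.restrict (Ioo (0 : ℝ) 1)).prod ((Y.trajectoryLaw S.bwdRate z).prod
        (X.trajectoryLaw S.fwdRate z)), p r.2.1 := fun h =>
    Measure.quasiMeasurePreserving_snd.ae (Measure.quasiMeasurePreserving_fst.ae h)
  have kf : ∀ {p : Trajectory E V → Prop}, (∀ᵐ ω ∂X.trajectoryLaw S.fwdRate z, p ω) →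
      ∀ᵐ r ∂(volume.restrict (Ioo (0 : ℝ) 1)).prod ((Y.trajectoryLaw S.bwdRate z).prod
        (X.trajectoryLaw S.fwdRate z)), p r.2.2 := fun h =>
    Measure.quasiMeasurePreserving_snd.ae (Measure.quasiMeasurePreserving_snd.ae h)
  refine ⟨?_, ⟨fun N hN h => ?_, fun n N hN h => ?_⟩, ⟨fun N hN h => ?_, fun n N hN h => ?_⟩⟩
  · have hm : Measurable fun s : Draw E V Vr => s.2.1 := by fun_prop
    refine key (measurableSet_Ioo.preimage hm) ?_
    exact Measure.quasiMeasurePreserving_fst.ae (ae_restrict_mem measurableSet_Ioo)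
  · have hm : Measurable fun s : Draw E V Vr => (s.1, s.2.2.1 0) := by fun_prop
    exact key (hN.preimage hm) (kb (hb.zero N hN h))
  · have hm : Measurable fun s : Draw E V Vr => (s.2.2.1 n, s.2.2.1 (n + 1)) := by fun_prop
    exact key (hN.preimage hm) (kb (hb.step n N hN h))
  · have hm : Measurable fun s : Draw E V Vr => (s.1, s.2.2.2 0) := by fun_prop
    exact key (hN.preimage hm) (kf (hf.zero N hN h))
  · have hm : Measurable fun s : Draw E V Vr => (s.2.2.2 n, s.2.2.2 (n + 1)) := by fun_prop
    exact key (hN.preimage hm) (kf (hf.step n N hN h))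

theorem isDraw_bind {F : Type*} [MeasurableSpace F] (η : Kernel F E) (x : F) :
    IsDraw S ((S.drawLaw ∘ₖ η) x) := by
  have key : ∀ {A : Set (Draw E V Vr)}, MeasurableSet A → (∀ z, ∀ᵐ s ∂S.drawLaw z, s ∈ A) →
      ∀ᵐ s ∂(S.drawLaw ∘ₖ η) x, s ∈ A := fun hA h => by
    rw [Kernel.comp_apply]
    exact Measure.ae_comp_of_ae_ae hA (Filter.Eventually.of_forall h)
  refine ⟨?_, ⟨fun N hN h => ?_, fun n N hN h => ?_⟩, ⟨fun N hN h => ?_, fun n N hN h => ?_⟩⟩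
  · have hm : Measurable fun s : Draw E V Vr => s.2.1 := by fun_prop
    exact key (measurableSet_Ioo.preimage hm) fun z => (S.isDraw_drawLaw z).alpha
  · have hm : Measurable fun s : Draw E V Vr => (s.1, s.2.2.1 0) := by fun_prop
    exact key (hN.preimage hm) fun z => (S.isDraw_drawLaw z).bwd.zero N hN h
  · have hm : Measurable fun s : Draw E V Vr => (s.2.2.1 n, s.2.2.1 (n + 1)) := by fun_prop
    exact key (hN.preimage hm) fun z => (S.isDraw_drawLaw z).bwd.step n N hN h
  · have hm : Measurable fun s : Draw E V Vr => (s.1, s.2.2.2 0) := by fun_prop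
    exact key (hN.preimage hm) fun z => (S.isDraw_drawLaw z).fwd.zero N hN h
  · have hm : Measurable fun s : Draw E V Vr => (s.2.2.2 n, s.2.2.2 (n + 1)) := by fun_prop
    exact key (hN.preimage hm) fun z => (S.isDraw_drawLaw z).fwd.step n N hN h

variable {S} {M : Measure (Draw E V Vr)}

theorem indist_regularizeDraw (h : IsDraw S M) : Indist M id regularizeDraw :=
  (Indist.refl M fun s => s.1).prodMk ((Indist.refl M fun s => s.2.1).prodMk
    (h.bwd.indist.prodMk h.fwd.indist))

theorem ae_regularDraw (h : IsDraw S M) : ∀ᵐ s ∂M, RegularDraw (regularizeDraw s) := by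
  filter_upwards [h.alpha, h.bwd.ae_regular, h.fwd.ae_regular] with s h1 h2 h3
  exact ⟨h1.1, h1.2, h2, h3⟩

/-- The measurability of the data of a sampler. -/
structure IsMeasurable (S : Sampler X Y) : Prop where
  volumeChange : Measurable fun p : ℝ × Skeleton E Vr => S.volumeChange p.1 p.2
  target : Measurable S.target
  criterion : MeasurableSet {p : Skeleton E V × ℝ | S.criterion p.1 p.2}

theorem measurable_window (S : Sampler X Y) :
    Measurable fun p : Draw E V Vr × ℝ => S.window p.1 p.2 := by
  simp_rw [window_eq]
  fun_prop

theorem measurableSet_defined : MeasurableSet {p : Draw E V Vr × ℝ | Defined p.1 p.2} := by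
  have h1 : Measurable fun p : Draw E V Vr × ℝ => (p.1.2.2.1, p.1.2.1 * p.2) := by fun_prop
  have h2 : Measurable fun p : Draw E V Vr × ℝ => (p.1.2.2.2, (1 - p.1.2.1) * p.2) := by fun_prop
  exact (measurableSet_reaches.preimage h1).inter (measurableSet_reaches.preimage h2)

theorem measurableSet_validTimes (hS : S.IsMeasurable) :
    MeasurableSet {p : Draw E V Vr × ℝ | p.2 ∈ S.validTimes p.1} := by
  have h1 : Measurable fun p : Draw E V Vr × ℝ => (S.window p.1 p.2, p.2) :=
    S.measurable_window.prodMk measurable_snd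
  exact (measurableSet_le measurable_const measurable_snd).inter
    (measurableSet_defined.inter (hS.criterion.preimage h1))

/-- The restriction of a valid trajectory to a smaller interval is valid. -/
def DownClosed (S : Sampler X Y) (s : Draw E V Vr) : Prop :=
  ∀ t ∈ S.validTimes s, ∀ t', 0 ≤ t' → t' ≤ t → t' ∈ S.validTimes s

/-- Indistinguishability holds for all times at once by `Indist.forall_mem`, so the whole set of
valid times is that of the rebuilt draw. -/
theorem ae_downClosed (h : IsDraw S M) (hS : S.IsMeasurable) (hc : X.IsConsistent S.criterion) :
    ∀ᵐ s ∂M, S.DownClosed s := by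
  filter_upwards [(indist_regularizeDraw h).forall_mem (measurableSet_validTimes hS),
    ae_regularDraw h] with s h1 h2 t ht t' h0 h3
  exact (h1 t').2 (mem_validTimes_of_le h2 hc ((h1 t).1 ht) h0 h3)

/-- The supremum of the valid times, computed over the rational times. -/
def ratLength (S : Sampler X Y) (s : Draw E V Vr) : ℝ≥0∞ :=
  open Classical in ⨆ q : ℚ, if (q : ℝ) ∈ S.validTimes s then ENNReal.ofReal q else 0

theorem measurable_ratLength (hS : S.IsMeasurable) : Measurable S.ratLength := by
  classical
  refine Measurable.iSup fun q => Measurable.ite ?_ measurable_const measurable_const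
  exact (measurableSet_validTimes hS).preimage (measurable_prodMk_right (y := (q : ℝ)))

variable {s : Draw E V Vr}

theorem ratLength_le {T : ℝ} (h : ∀ t ∈ S.validTimes s, t ≤ T) :
    S.ratLength s ≤ ENNReal.ofReal T := by
  refine iSup_le fun q => ?_
  split_ifs with hq
  · exact ENNReal.ofReal_le_ofReal (h _ hq)
  · exact bot_le

/-- Nonnegative rationals below a valid time are valid, so rational times suffice for the supremum.
-/
theorem le_ratLength (h : S.DownClosed s) {t : ℝ} (ht : t ∈ S.validTimes s) :
    ENNReal.ofReal t ≤ S.ratLength s := by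
  refine le_of_forall_lt fun c hc => ?_
  have hct : c ≠ ∞ := hc.ne_top
  have h1 : c.toReal < t := by
    rcases (ENNReal.lt_ofReal_iff_toReal_lt hct).1 hc with h
    exact h
  obtain ⟨q, hq1, hq2⟩ := exists_rat_btwn h1
  have hq0 : (0 : ℝ) ≤ q := ENNReal.toReal_nonneg.trans hq1.le
  refine lt_of_lt_of_le ?_ (le_iSup (fun q : ℚ => _) q)
  rw [if_pos (h t ht q hq0 hq2.le)]
  exact (ENNReal.lt_ofReal_iff_toReal_lt hct).2 hq1

theorem bddAbove_iff (h : S.DownClosed s) : BddAbove (S.validTimes s) ↔ S.ratLength s ≠ ∞ := by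
  constructor
  · rintro ⟨T, hT⟩
    exact ((ratLength_le hT).trans_lt ENNReal.ofReal_lt_top).ne
  · intro hne
    refine ⟨(S.ratLength s).toReal, fun t ht => ?_⟩
    exact (ENNReal.ofReal_le_iff_le_toReal hne).1 (le_ratLength h ht)

/-- The default values agree: the real supremum is 0 on empty and on unbounded sets, and so is the
right side, by `toReal` of 0 and of infinity. -/
theorem length_eq (h : S.DownClosed s) : S.length s = (S.ratLength s).toReal := by
  rcases (S.validTimes s).eq_empty_or_nonempty with h0 | ⟨t0, h0⟩
  · have : S.ratLength s = 0 := by simp [ratLength, h0]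
    rw [length, h0, this]; simp
  · by_cases hb : BddAbove (S.validTimes s)
    · have hne := (bddAbove_iff h).1 hb
      have hnn : 0 ≤ S.length s := h0.1.trans (le_csSup hb h0)
      refine le_antisymm (csSup_le ⟨t0, h0⟩ fun t ht =>
        (ENNReal.ofReal_le_iff_le_toReal hne).1 (le_ratLength h ht)) ?_
      rw [← ENNReal.toReal_ofReal hnn]
      exact ENNReal.toReal_mono ENNReal.ofReal_ne_top (ratLength_le fun t ht => le_csSup hb ht)
    · rw [length, Real.sSup_of_not_bddAbove hb]
      have := (bddAbove_iff h).not.1 hb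
      rw [not_not] at this
      rw [this]; simp

/-- A measurable version of the stopping condition. -/
def Stops' (S : Sampler X Y) (s : Draw E V Vr) : Prop :=
  S.ratLength s ≠ ∞ ∧ 0 < (S.ratLength s).toReal ∧ Defined s (S.ratLength s).toReal

/-- A measurable version of the condition of being hit forward. -/
def HitForward' (S : Sampler X Y) (s : Draw E V Vr) : Prop :=
  ¬ ∀ e ∈ s.2.2.2.eventsUpTo ((1 - s.2.1) * (S.ratLength s).toReal),
    e.1 ≠ (1 - s.2.1) * (S.ratLength s).toReal

theorem measurableSet_stops' (hS : S.IsMeasurable) : MeasurableSet {s | S.Stops' s} := by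
  have h1 := measurable_ratLength hS
  have h2 : Measurable fun s => (s, (S.ratLength s).toReal) :=
    measurable_id.prodMk h1.ennreal_toReal
  exact (h1 (measurableSet_singleton ∞).compl).inter
    ((measurableSet_lt measurable_const h1.ennreal_toReal).inter
      (measurableSet_defined.preimage h2))

theorem measurableSet_hitForward' (hS : S.IsMeasurable) :
    MeasurableSet {s | S.HitForward' s} := by
  have h1 := (measurable_ratLength hS).ennreal_toReal
  have h2 : Measurable fun s : Draw E V Vr => ((1 - s.2.1) * (S.ratLength s).toReal,
    s.2.2.2.eventsUpTo ((1 - s.2.1) * (S.ratLength s).toReal)) := by fun_prop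
  have h3 : MeasurableSet {q : ℝ × List (ℝ × V) | ∀ e ∈ q.2, e.1 ∈ ({q.1}ᶜ : Set ℝ)} :=
    measurableSet_forall_time (I := fun t => {t}ᶜ)
      (measurableSet_eq_fun measurable_snd measurable_fst).compl
  exact (h3.preimage h2).compl

theorem stops_iff' (h : S.DownClosed s) : S.Stops s ↔ S.Stops' s := by
  rw [Stops, Stops', bddAbove_iff h, length_eq h]

theorem hitForward_iff' (h : S.DownClosed s) : S.HitForward s ↔ S.HitForward' s := by
  rw [HitForward, HitForward', length_eq h]
  simp

end Sampler

end Law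

/-! ### Metropolis–Hastings balance on an interval. -/

section Metropolis

/-- When a = 0 the convention for the quotient does not matter, as the acceptance is multiplied by
a. -/
theorem _root_.ENNReal.mul_min_one_div {a b : ℝ≥0∞} (ha : a ≠ ∞) : a * min 1 (b / a) = min a b := by
  rcases eq_or_ne a 0 with rfl | h0
  · simp
  · have h : Monotone fun x : ℝ≥0∞ => a * x := fun x y hxy => mul_le_mul_right hxy a
    have h2 := h.map_min (a := 1) (b := b / a)
    simp only [mul_one, ENNReal.mul_div_cancel h0 ha] at h2
    exact h2

/-- Metropolis–Hastings balance: proposals are drawn from a density proportional to `p`,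
independently of the current point, for a target of density `r * p`. -/
theorem lintegral_metropolis {m : Measure ℝ} [SFinite m] {r p g : ℝ → ℝ≥0∞} (hr : Measurable r)
    (hp : Measurable p) (hg : Measurable g) (hfin : ∀ᵐ l ∂m, r l ≠ ∞) {c : ℝ≥0∞}
    (hc : ∫⁻ l, c * p l ∂m = 1) :
    ∫⁻ l, r l * p l * ∫⁻ l', c * p l' * (min 1 (r l' / r l) * g l' +
        (1 - min 1 (r l' / r l)) * g l) ∂m ∂m = ∫⁻ l, r l * p l * g l ∂m := by
  have hacc : Measurable fun q : ℝ × ℝ => min 1 (r q.2 / r q.1) := by fun_prop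
  have e1 : ∀ l, r l * p l * ∫⁻ l', c * p l' * (min 1 (r l' / r l) * g l' +
        (1 - min 1 (r l' / r l)) * g l) ∂m =
      ∫⁻ l', p l * (c * p l') * (r l * min 1 (r l' / r l)) * g l' ∂m +
        ∫⁻ l', r l * p l * (c * p l') * (1 - min 1 (r l' / r l)) * g l ∂m := by
    intro l
    have hal : Measurable fun l' => min 1 (r l' / r l) := by fun_prop
    rw [← lintegral_const_mul _ (by fun_prop), ← lintegral_add_left (by fun_prop)]
    refine lintegral_congr fun l' => ?_
    ring
  -- Detailed balance: the flow of accepted moves p(l) p(l') min(r(l), r(l')) is symmetric in l and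
  -- l'.
  have e2 : ∫⁻ l, ∫⁻ l', p l * (c * p l') * (r l * min 1 (r l' / r l)) * g l' ∂m ∂m =
      ∫⁻ l, ∫⁻ l', r l * p l * (c * p l') * min 1 (r l' / r l) * g l ∂m ∂m := by
    calc ∫⁻ l, ∫⁻ l', p l * (c * p l') * (r l * min 1 (r l' / r l)) * g l' ∂m ∂m
        = ∫⁻ l, ∫⁻ l', p l * (c * p l') * min (r l) (r l') * g l' ∂m ∂m := by
          refine lintegral_congr_ae (hfin.mono fun l hl => lintegral_congr fun l' => ?_)
          rw [ENNReal.mul_min_one_div hl]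
      _ = ∫⁻ l', ∫⁻ l, p l * (c * p l') * min (r l) (r l') * g l' ∂m ∂m :=
          lintegral_lintegral_swap (by fun_prop)
      _ = ∫⁻ l, ∫⁻ l', r l * p l * (c * p l') * min 1 (r l' / r l) * g l ∂m ∂m := by
          refine lintegral_congr_ae (hfin.mono fun l hl => lintegral_congr fun l' => ?_)
          have h := ENNReal.mul_min_one_div (b := r l') hl
          rw [min_comm, ← h]
          ring
  simp_rw [e1]
  rw [lintegral_add_left (by fun_prop), e2, ← lintegral_add_left (by fun_prop)]
  refine lintegral_congr fun l => ?_
  rw [← lintegral_add_left (by fun_prop)]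
  have e3 : ∀ l', r l * p l * (c * p l') * min 1 (r l' / r l) * g l +
      r l * p l * (c * p l') * (1 - min 1 (r l' / r l)) * g l =
      r l * p l * g l * (c * p l') := fun l' => by
    have h : min 1 (r l' / r l) + (1 - min 1 (r l' / r l)) = 1 :=
      add_tsub_cancel_of_le (min_le_left _ _)
    calc _ = r l * p l * g l * (c * p l') *
          (min 1 (r l' / r l) + (1 - min 1 (r l' / r l))) := by ring
      _ = _ := by rw [h, mul_one]
  simp_rw [e3]
  rw [lintegral_const_mul _ (by fun_prop), hc, mul_one]

end Metropolis

/-! ### The two proposal densities. -/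

section Proposal

/-- Half the density of the proposal when the path was stopped going forward. -/
def fwdDensity (T t : ℝ) : ℝ≥0∞ := ENNReal.ofReal ((T - t) / T ^ 2)

/-- Half the density of the proposal when the path was stopped going backward. -/
def bwdDensity (T t : ℝ) : ℝ≥0∞ := ENNReal.ofReal (t / T ^ 2)

@[fun_prop]
theorem measurable_fwdDensity {S : Type*} [MeasurableSpace S] {f g : S → ℝ} (hf : Measurable f)
    (hg : Measurable g) : Measurable fun x => fwdDensity (f x) (g x) := by
  unfold fwdDensity; fun_prop

@[fun_prop]
theorem measurable_bwdDensity {S : Type*} [MeasurableSpace S] {f g : S → ℝ} (hf : Measurable f)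
    (hg : Measurable g) : Measurable fun x => bwdDensity (f x) (g x) := by
  unfold bwdDensity; fun_prop

theorem lintegral_bwdDensity {T : ℝ} (hT : 0 < T) : ∫⁻ l in Icc 0 T, 2 * bwdDensity T l = 1 := by
  have h1 : ∫⁻ l in Icc 0 T, 2 * bwdDensity T l = ∫⁻ l in Icc 0 T, ENNReal.ofReal (2 / T ^ 2 * l) := by
    refine setLIntegral_congr_fun measurableSet_Icc fun l hl => ?_
    simp only [bwdDensity]
    rw [show (2 : ℝ≥0∞) = ENNReal.ofReal 2 by simp, ← ENNReal.ofReal_mul (by norm_num)]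
    congr 1; ring
  have hc : Continuous fun l : ℝ => 2 / T ^ 2 * l := by fun_prop
  rw [h1, ← ofReal_integral_eq_lintegral_ofReal (hc.continuousOn.integrableOn_compact isCompact_Icc)]
  · rw [integral_Icc_eq_integral_Ioc, ← intervalIntegral.integral_of_le hT.le,
      intervalIntegral.integral_const_mul, integral_id]
    rw [ENNReal.ofReal_eq_one]
    field_simp
    ring
  · filter_upwards [ae_restrict_mem measurableSet_Icc] with l hl
    have := hl.1
    positivity

theorem lintegral_fwdDensity {T : ℝ} (hT : 0 < T) : ∫⁻ l in Icc 0 T, 2 * fwdDensity T l = 1 := by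
  rw [← lintegral_bwdDensity hT, ← lintegral_indicator measurableSet_Icc,
    ← lintegral_indicator measurableSet_Icc, ← lintegral_sub_left_eq_self _ T]
  refine lintegral_congr fun l => ?_
  have : T - l ∈ Icc 0 T ↔ l ∈ Icc 0 T := by
    simp only [mem_Icc]; constructor <;> rintro ⟨h1, h2⟩ <;> constructor <;> linarith
  by_cases h : l ∈ Icc 0 T
  · rw [indicator_of_mem (this.2 h), indicator_of_mem h, fwdDensity, bwdDensity, sub_sub_cancel]
  · rw [indicator_of_notMem (fun h' => h (this.1 h')), indicator_of_notMem h]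

end Proposal

/-! ### The law of the output as a kernel. -/

section Output

variable {E V Vr : Type*} [MeasurableSpace E] [MeasurableSpace V] [MeasurableSpace Vr]
  {μV : Measure V} {μVr : Measure Vr} {X : PDMP E V μV} {Y : PDMP E Vr μVr}

namespace Sampler

variable {S : Sampler X Y}

theorem IsMeasurable.weight (hS : S.IsMeasurable) :
    Measurable fun p : Skeleton E V × ℝ × ℝ => S.weight p.1 p.2.1 p.2.2 := by
  have h1 : Measurable fun p : Skeleton E V × ℝ × ℝ =>
      (p.2.2, S.reversal.toRev p.2.2 (p.1.1, eventsIn (Iic p.2.2) 0 p.1.2)) := by fun_prop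
  have h2 := (hS.volumeChange.comp h1).coe_nnreal_ennreal.inv
  have h3 : Measurable fun p : Skeleton E V × ℝ × ℝ => X.position p.1 p.2.2 := by fun_prop
  have h4 := (hS.target.comp h3).coe_nnreal_ennreal
  have h5 : Measurable fun p : Skeleton E V × ℝ × ℝ => Y.pathDensity S.bwdRate p.2.2
    (S.reversal.toRev p.2.2 (p.1.1, eventsIn (Iic p.2.2) 0 p.1.2)) := by fun_prop
  have h6 : Measurable fun p : Skeleton E V × ℝ × ℝ => X.pathDensity S.fwdRate (p.2.1 - p.2.2)
    (X.position p.1 p.2.2, eventsIn (Ioi p.2.2) p.2.2 p.1.2) := by fun_prop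
  exact ((h4.mul h5).mul h6).mul h2

/-- The law of the next state on a path `p.1` on `[0, p.2.1]`, from the offset `p.2.2`, when twice
`d` is the density of the proposal. -/
def moveLaw (S : Sampler X Y) (d : ℝ → ℝ → ℝ≥0∞) (p : Skeleton E V × ℝ × ℝ) : Measure E :=
  ((volume.restrict (Icc 0 p.2.1)).withDensity fun t => 2 * d p.2.1 t).bind fun l' =>
    min 1 (S.weight p.1 p.2.1 l' / S.weight p.1 p.2.1 p.2.2) • Measure.dirac (X.position p.1 l') +
    (1 - min 1 (S.weight p.1 p.2.1 l' / S.weight p.1 p.2.1 p.2.2)) •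
      Measure.dirac (X.position p.1 p.2.2)

theorem measurable_weight_apply (hS : S.IsMeasurable) (w : Skeleton E V) (T : ℝ) :
    Measurable (S.weight w T) := by
  have h : Measurable fun l : ℝ => (w, T, l) := by fun_prop
  exact hS.weight.comp h

theorem moveLaw_apply (hS : S.IsMeasurable) {d : ℝ → ℝ → ℝ≥0∞}
    (hd : Measurable fun q : ℝ × ℝ => d q.1 q.2) (p : Skeleton E V × ℝ × ℝ) {A : Set E}
    (hA : MeasurableSet A) :
    S.moveLaw d p A = ∫⁻ l' in Icc 0 p.2.1, 2 * d p.2.1 l' *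
      (min 1 (S.weight p.1 p.2.1 l' / S.weight p.1 p.2.1 p.2.2) *
          A.indicator 1 (X.position p.1 l') +
        (1 - min 1 (S.weight p.1 p.2.1 l' / S.weight p.1 p.2.1 p.2.2)) *
          A.indicator 1 (X.position p.1 p.2.2)) := by
  have hw := measurable_weight_apply hS p.1 p.2.1
  have hdT : Measurable fun t => d p.2.1 t := hd.comp measurable_prodMk_left
  have hpos : ∀ {B : Set E}, MeasurableSet B →
      Measurable fun l' => B.indicator (1 : E → ℝ≥0∞) (X.position p.1 l') := fun hB =>
    (measurable_one.indicator hB).comp (by fun_prop)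
  have hm : Measurable fun l' =>
      min 1 (S.weight p.1 p.2.1 l' / S.weight p.1 p.2.1 p.2.2) • Measure.dirac (X.position p.1 l') +
      (1 - min 1 (S.weight p.1 p.2.1 l' / S.weight p.1 p.2.1 p.2.2)) •
        Measure.dirac (X.position p.1 p.2.2) := by
    refine Measure.measurable_of_measurable_coe _ fun B hB => ?_
    simp only [Measure.add_apply, Measure.smul_apply, smul_eq_mul, Measure.dirac_apply' _ hB]
    have := hpos hB
    fun_prop
  have hm' : Measurable fun l' => (min 1 (S.weight p.1 p.2.1 l' / S.weight p.1 p.2.1 p.2.2) *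
          A.indicator (1 : E → ℝ≥0∞) (X.position p.1 l') +
        (1 - min 1 (S.weight p.1 p.2.1 l' / S.weight p.1 p.2.1 p.2.2)) *
          A.indicator 1 (X.position p.1 p.2.2)) := by
    have := hpos hA
    fun_prop
  rw [moveLaw, Measure.bind_apply hA hm.aemeasurable]
  simp only [Measure.add_apply, Measure.smul_apply, smul_eq_mul, Measure.dirac_apply' _ hA]
  rw [lintegral_withDensity_eq_lintegral_mul _ (by fun_prop) hm']
  rfl

theorem measurable_moveLaw (hS : S.IsMeasurable) {d : ℝ → ℝ → ℝ≥0∞}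
    (hd : Measurable fun q : ℝ × ℝ => d q.1 q.2) : Measurable (S.moveLaw d) := by
  refine Measure.measurable_of_measurable_coe _ fun A hA => ?_
  simp_rw [moveLaw_apply hS hd _ hA, ← lintegral_indicator measurableSet_Icc]
  refine Measurable.lintegral_prod_right' (f := fun q : (Skeleton E V × ℝ × ℝ) × ℝ =>
    (Icc 0 q.1.2.1).indicator (fun l' => 2 * d q.1.2.1 l' *
      (min 1 (S.weight q.1.1 q.1.2.1 l' / S.weight q.1.1 q.1.2.1 q.1.2.2) *
          A.indicator 1 (X.position q.1.1 l') +
        (1 - min 1 (S.weight q.1.1 q.1.2.1 l' / S.weight q.1.1 q.1.2.1 q.1.2.2)) *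
          A.indicator 1 (X.position q.1.1 q.1.2.2))) q.2) ?_
  have i1 : Measurable fun q : (Skeleton E V × ℝ × ℝ) × ℝ => (q.1.1, q.1.2.1, q.2) := by fun_prop
  have i2 : Measurable fun q : (Skeleton E V × ℝ × ℝ) × ℝ => (q.1.2.1, q.2) := by fun_prop
  have h1 := hS.weight.comp i1
  have i3 : Measurable fun q : (Skeleton E V × ℝ × ℝ) × ℝ => q.1 := measurable_fst
  have h2 := hS.weight.comp i3
  have h3 := hd.comp i2
  have j1 : Measurable fun q : (Skeleton E V × ℝ × ℝ) × ℝ => X.position q.1.1 q.2 := by fun_prop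
  have j2 : Measurable fun q : (Skeleton E V × ℝ × ℝ) × ℝ => X.position q.1.1 q.1.2.2 := by fun_prop
  have h4 := (measurable_one.indicator hA).comp (f := fun q : (Skeleton E V × ℝ × ℝ) × ℝ =>
    X.position q.1.1 q.2) (g := A.indicator (1 : E → ℝ≥0∞)) j1
  have h5 := (measurable_one.indicator hA).comp (f := fun q : (Skeleton E V × ℝ × ℝ) × ℝ =>
    X.position q.1.1 q.1.2.2) (g := A.indicator (1 : E → ℝ≥0∞)) j2
  simp only [Function.comp_def] at h1 h2 h3 h4 h5
  have h6 : Measurable fun q : (Skeleton E V × ℝ × ℝ) × ℝ => 2 * d q.1.2.1 q.2 *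
      (min 1 (S.weight q.1.1 q.1.2.1 q.2 / S.weight q.1.1 q.1.2.1 q.1.2.2) *
          A.indicator 1 (X.position q.1.1 q.2) +
        (1 - min 1 (S.weight q.1.1 q.1.2.1 q.2 / S.weight q.1.1 q.1.2.1 q.1.2.2)) *
          A.indicator 1 (X.position q.1.1 q.1.2.2)) := by
    fun_prop
  have hset : MeasurableSet {q : (Skeleton E V × ℝ × ℝ) × ℝ | q.2 ∈ Icc 0 q.1.2.1} :=
    (measurableSet_le measurable_const measurable_snd).inter
      (measurableSet_le measurable_snd (by fun_prop))
  exact h6.indicator hset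

theorem moveLaw_univ (hS : S.IsMeasurable) {d : ℝ → ℝ → ℝ≥0∞}
    (hd : Measurable fun q : ℝ × ℝ => d q.1 q.2) (p : Skeleton E V × ℝ × ℝ)
    (h1 : ∫⁻ l in Icc 0 p.2.1, 2 * d p.2.1 l = 1) : S.moveLaw d p univ = 1 := by
  rw [moveLaw_apply hS hd _ MeasurableSet.univ]
  refine Eq.trans (lintegral_congr fun l => ?_) h1
  simp only [indicator_univ, Pi.one_apply, mul_one]
  rw [add_tsub_cancel_of_le (min_le_left _ _), mul_one]

/-- The stopped path with its length and the offset of the starting point, in terms of a measurable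
version of the length. -/
def stopped (S : Sampler X Y) (s : Draw E V Vr) : Skeleton E V × ℝ × ℝ :=
  (S.window s (S.ratLength s).toReal, (S.ratLength s).toReal, s.2.1 * (S.ratLength s).toReal)

variable [SigmaFinite μV] [SigmaFinite μVr]

theorem measurable_stopped (hS : S.IsMeasurable) : Measurable S.stopped := by
  have h1 := (measurable_ratLength hS).ennreal_toReal
  have h2 : Measurable fun s : Draw E V Vr => (s, (S.ratLength s).toReal) := by fun_prop
  have h3 : Measurable fun s : Draw E V Vr => s.2.1 * (S.ratLength s).toReal := by fun_prop
  exact (S.measurable_window.comp h2).prodMk (h1.prodMk h3)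

/-- The factor 2 that normalises the proposal is moved out of the density, which leaves the
Jacobians of the substitution of α. -/
theorem outputLaw_eq {s : Draw E V Vr} (h : S.DownClosed s) :
    S.outputLaw s = open Classical in if S.Stops' s then
      (if S.HitForward' s then S.moveLaw fwdDensity (S.stopped s)
        else S.moveLaw bwdDensity (S.stopped s))
      else Measure.dirac s.1 := by
  classical
  rw [outputLaw]
  by_cases h1 : S.Stops' s
  · rw [if_pos ((stops_iff' h).2 h1), if_pos h1]
    have h2 : ∀ x y : ℝ, ENNReal.ofReal (2 * x / y) = 2 * ENNReal.ofReal (x / y) := fun x y => by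
      rw [show (2 : ℝ≥0∞) = ENNReal.ofReal 2 by simp, ← ENNReal.ofReal_mul (by norm_num)]
      congr 1; ring
    by_cases h3 : S.HitForward' s
    · rw [if_pos h3, moveLaw, proposal]
      simp only [if_pos ((hitForward_iff' h).2 h3), h2, acceptance, path, offset, length_eq h]
      rfl
    · rw [if_neg h3, moveLaw, proposal]
      simp only [if_neg ((hitForward_iff' h).not.2 h3), h2, acceptance, path, offset, length_eq h]
      rfl
  · rw [if_neg (fun h' => h1 ((stops_iff' h).1 h')), if_neg h1]

/-- The law of the output given the draw, as a kernel. -/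
def outputKernel (S : Sampler X Y) (hS : S.IsMeasurable) : Kernel (Draw E V Vr) E where
  toFun s := open Classical in if S.Stops' s then
      (if S.HitForward' s then S.moveLaw fwdDensity (S.stopped s)
        else S.moveLaw bwdDensity (S.stopped s))
      else Measure.dirac s.1
  measurable' := by
    classical
    refine Measurable.ite (measurableSet_stops' hS) (Measurable.ite (measurableSet_hitForward' hS)
      ?_ ?_) (Measure.measurable_dirac.comp measurable_fst)
    · exact (measurable_moveLaw hS (by fun_prop)).comp (measurable_stopped hS)
    · exact (measurable_moveLaw hS (by fun_prop)).comp (measurable_stopped hS)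

instance isMarkovKernel_outputKernel (hS : S.IsMeasurable) :
    IsMarkovKernel (S.outputKernel hS) := by
  classical
  refine ⟨fun s => ⟨?_⟩⟩
  change (if S.Stops' s then
      (if S.HitForward' s then S.moveLaw fwdDensity (S.stopped s)
        else S.moveLaw bwdDensity (S.stopped s))
      else Measure.dirac s.1) univ = 1
  split_ifs with h1 h2
  · exact moveLaw_univ hS (by fun_prop) _ (lintegral_fwdDensity h1.2.1)
  · exact moveLaw_univ hS (by fun_prop) _ (lintegral_bwdDensity h1.2.1)
  · simp

theorem outputKernel_apply (hS : S.IsMeasurable) (s : Draw E V Vr) (A : Set E)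
    (hA : MeasurableSet A) : S.outputKernel hS s A =
      {s | S.Stops' s ∧ S.HitForward' s}.indicator
        (fun s => S.moveLaw fwdDensity (S.stopped s) A) s +
      {s | S.Stops' s ∧ ¬ S.HitForward' s}.indicator
        (fun s => S.moveLaw bwdDensity (S.stopped s) A) s +
      {s | ¬ S.Stops' s}.indicator (fun s => A.indicator 1 s.1) s := by
  classical
  change (if S.Stops' s then
      (if S.HitForward' s then S.moveLaw fwdDensity (S.stopped s)
        else S.moveLaw bwdDensity (S.stopped s))
      else Measure.dirac s.1) A = _
  by_cases h1 : S.Stops' s <;> by_cases h2 : S.HitForward' s <;>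
    simp [indicator, h1, h2, Measure.dirac_apply' _ hA]

/-- The output law is defined through a supremum whose measurability is not established, but almost
surely it is the kernel. This is what makes the algorithm a Markov kernel. -/
theorem bind_outputLaw (hS : S.IsMeasurable) (hc : X.IsConsistent S.criterion)
    {M : Measure (Draw E V Vr)} (hM : IsDraw S M) :
    M.bind S.outputLaw = M.bind (S.outputKernel hS) := by
  refine Measure.bind_congr_right ?_
  filter_upwards [ae_downClosed hM hS hc] with s hs
  exact outputLaw_eq hs

end Sampler

end Output

/-! ### Splitting a sequence of events at a given time, without multiplicity. -/

section Lists

variable {α : Type*} [MeasurableSpace α] {μ : Measure α} [SigmaFinite μ]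

theorem ae_listSum_forall_mem {p : α → Prop} (h : ∀ᵐ e ∂μ, p e) :
    ∀ᵐ l ∂listSum μ, ∀ e ∈ l, p e := by
  obtain ⟨B, hB, hBm, hB0⟩ := exists_measurable_superset_of_null (ae_iff.1 h)
  have hBc : ∀ᵐ e ∂μ, e ∉ B := measure_eq_zero_iff_ae_notMem.1 hB0
  have hS : MeasurableSet {l : List α | ∀ e ∈ l, e ∉ B} := by
    have := measurableSet_forall_mem (S := Unit) (p := fun _ (e : α) => e ∉ B)
      (measurable_snd hBm.compl)
    exact this.preimage (measurable_prodMk_left (x := ()))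
  have key : ∀ n, ∀ᵐ l ∂listMeasure μ n, ∀ e ∈ l, e ∉ B := by
    intro n
    induction n with
    | zero =>
      rw [listMeasure]
      exact (ae_dirac_iff hS).2 (by simp)
    | succ n ih =>
      rw [listMeasure]
      refine (ae_map_iff measurable_cons.aemeasurable hS).2 ?_
      filter_upwards [Measure.quasiMeasurePreserving_fst.ae hBc,
        Measure.quasiMeasurePreserving_snd.ae ih] with q h1 h2
      simpa using ⟨h1, h2⟩
  rw [listSum]
  refine Measure.ae_sum_iff.2 fun n => ?_
  filter_upwards [key n] with l hl e he
  by_contra hp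
  exact hl e he (hB hp)

theorem ae_listSum_time_ne {V : Type*} [MeasurableSpace V] (μV : Measure V) [SigmaFinite μV]
    (t : ℝ) : ∀ᵐ es ∂listSum ((volume : Measure ℝ).prod μV), ∀ e ∈ es, e.1 ≠ t := by
  refine ae_listSum_forall_mem (p := fun e : ℝ × V => e.1 ≠ t) ?_
  have h : ∀ᵐ x : ℝ, x ≠ t := by simp [ae_iff]
  exact Measure.quasiMeasurePreserving_fst.ae h

variable {V : Type*}

-- For ordered events, none of them at t, exactly one place to cut separates the events before t
-- from those after.
open Classical in
theorem sum_split_at {es : List (ℝ × V)} (hs : Increasing es) {t : ℝ} (ht : ∀ e ∈ es, e.1 ≠ t)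
    (c : ℝ≥0∞) : ∑ m ∈ Finset.range (es.length + 1),
      (if (∀ e ∈ es.take m, e.1 < t) ∧ ∀ e ∈ es.drop m, t < e.1 then c else 0) = c := by
  induction es with
  | nil => simp
  | cons e es ih =>
    obtain ⟨h1, h2⟩ := increasing_cons.1 hs
    have ht' : ∀ a ∈ es, a.1 ≠ t := fun a ha => ht a (List.mem_cons_of_mem _ ha)
    rw [List.length_cons, Finset.sum_range_succ']
    rcases lt_or_gt_of_ne (ht e List.mem_cons_self) with h | h
    · rw [if_neg (fun h' => absurd (h'.2 e (by simp)) (not_lt.2 h.le)), add_zero]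
      conv_rhs => rw [← ih h2 ht']
      refine Finset.sum_congr rfl fun m _ => ?_
      simp [h]
    · rw [Finset.sum_eq_zero, zero_add, if_pos]
      · exact ⟨by simp, fun a ha => by
          rcases List.mem_cons.1 ha with rfl | ha
          · exact h
          · exact h.trans (h1 a ha)⟩
      · intro m _
        rw [if_neg]
        intro h'
        exact absurd (h'.1 e (by simp)) (not_lt.2 h.le)

variable [MeasurableSpace V]

open Classical in
/-- Splitting a list of events at a time. -/
theorem lintegral_append_delay (μV : Measure V) [SigmaFinite μV] (t : ℝ)
    {h : List (ℝ × V) → ℝ≥0∞} (hh : Measurable h) (h0 : ∀ es, h es ≠ 0 → Increasing es) :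
    ∫⁻ a, ∫⁻ f, (if (∀ e ∈ a, e.1 < t) ∧ ∀ e ∈ f, 0 < e.1 then h (a ++ delay t f) else 0)
        ∂listSum ((volume : Measure ℝ).prod μV) ∂listSum ((volume : Measure ℝ).prod μV) =
      ∫⁻ es, h es ∂listSum ((volume : Measure ℝ).prod μV) := by
  set lam := listSum ((volume : Measure ℝ).prod μV)
  have hlt : MeasurableSet {a : List (ℝ × V) | ∀ e ∈ a, e.1 < t} :=
    (measurableSet_forall_time (S := Unit) (V := V) (I := fun _ => Iio t)
      (measurable_snd measurableSet_Iio)).preimage (measurable_prodMk_left (x := ()))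
  have hgt : MeasurableSet {a : List (ℝ × V) | ∀ e ∈ a, t < e.1} :=
    (measurableSet_forall_time (S := Unit) (V := V) (I := fun _ => Ioi t)
      (measurable_snd measurableSet_Ioi)).preimage (measurable_prodMk_left (x := ()))
  have hk : Measurable fun q : List (ℝ × V) × List (ℝ × V) =>
      if (∀ e ∈ q.1, e.1 < t) ∧ ∀ e ∈ q.2, t < e.1 then h (q.1 ++ q.2) else 0 :=
    Measurable.ite ((hlt.preimage measurable_fst).inter (hgt.preimage measurable_snd))
      (hh.comp (by fun_prop)) measurable_const
  have e1 : ∀ a, ∫⁻ f, (if (∀ e ∈ a, e.1 < t) ∧ ∀ e ∈ f, 0 < e.1 then h (a ++ delay t f) else 0)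
      ∂lam = ∫⁻ f, (if (∀ e ∈ a, e.1 < t) ∧ ∀ e ∈ f, t < e.1 then h (a ++ f) else 0) ∂lam := by
    intro a
    have hka := hk.comp (measurable_prodMk_left (x := a))
    simp only [Function.comp_def] at hka
    rw [← lintegral_delay μV t hka]
    refine lintegral_congr fun f => ?_
    simp only [forall_mem_delay (p := fun x => t < x), lt_add_iff_pos_left]
  simp_rw [e1]
  rw [lintegral_listSum_split _ hk]
  refine lintegral_congr_ae ?_
  filter_upwards [ae_listSum_time_ne μV t] with es hes
  simp only [List.take_append_drop]
  by_cases hz : h es = 0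
  · simp [hz]
  · exact sum_split_at (h0 es hz) hes _

end Lists

/-! ### From the uniform variable α to the position on the stopped path. -/

section Substitution

/-- Substitution l = αu/(1 - α), with inverse α = l/(l + u). For T = l + u the Jacobian u/(l + u)²
is (T - l)/T²: this is the origin of the proposal density after a forward stop. -/
theorem lintegral_ratio {u : ℝ} (hu : 0 < u) (h : ℝ → ℝ≥0∞) :
    ∫⁻ α in Ioo (0 : ℝ) 1, h (α / (1 - α) * u) =
      ∫⁻ l in Ioi (0 : ℝ), ENNReal.ofReal (u / (l + u) ^ 2) * h l := by
  have himg : (fun l : ℝ => l / (l + u)) '' Ioi 0 = Ioo 0 1 := by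
    ext α
    constructor
    · rintro ⟨l, hl, rfl⟩
      rw [mem_Ioi] at hl
      exact ⟨by positivity, (div_lt_one (by positivity)).2 (by linarith)⟩
    · rintro ⟨h0, h1⟩
      have : 0 < 1 - α := by linarith
      refine ⟨α / (1 - α) * u, by rw [mem_Ioi]; positivity, ?_⟩
      field_simp
      ring
  have hd : ∀ l ∈ Ioi (0 : ℝ), HasDerivWithinAt (fun l : ℝ => l / (l + u)) (u / (l + u) ^ 2)
      (Ioi 0) l := by
    intro l hl
    rw [mem_Ioi] at hl
    have h1 : HasDerivAt (fun l : ℝ => l / (l + u)) ((1 * (l + u) - l * 1) / (l + u) ^ 2) l :=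
      (hasDerivAt_id' l).div ((hasDerivAt_id' l).add_const u) (by positivity)
    rw [one_mul, mul_one, add_sub_cancel_left] at h1
    exact h1.hasDerivWithinAt
  have hinj : InjOn (fun l : ℝ => l / (l + u)) (Ioi 0) := by
    intro a ha b hb hab
    rw [mem_Ioi] at ha hb
    beta_reduce at hab
    rw [div_eq_div_iff (by positivity) (by positivity)] at hab
    have : (a - b) * u = 0 := by linarith
    rcases mul_eq_zero.1 this with h | h
    · linarith
    · exact absurd h hu.ne'
  rw [← himg, lintegral_image_eq_lintegral_abs_deriv_mul measurableSet_Ioi hd hinj]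
  refine setLIntegral_congr_fun measurableSet_Ioi fun l hl => ?_
  rw [mem_Ioi] at hl
  have e1 : l / (l + u) / (1 - l / (l + u)) * u = l := by
    have : l + u ≠ 0 := by positivity
    have h3 : 1 - l / (l + u) = u / (l + u) := by field_simp; ring
    rw [h3]
    field_simp
  rw [e1, abs_of_nonneg (by positivity)]

/-- The same after exchanging α and 1 - α. Here u is the offset itself and l the forward duration,
so the Jacobian is offset/T², the proposal density after a backward stop. -/
theorem lintegral_ratio' {u : ℝ} (hu : 0 < u) (h : ℝ → ℝ≥0∞) :
    ∫⁻ α in Ioo (0 : ℝ) 1, h ((1 - α) / α * u) =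
      ∫⁻ l in Ioi (0 : ℝ), ENNReal.ofReal (u / (u + l) ^ 2) * h l := by
  have hsym : ∫⁻ α in Ioo (0 : ℝ) 1, h ((1 - α) / α * u) =
      ∫⁻ α in Ioo (0 : ℝ) 1, h (α / (1 - α) * u) := by
    rw [← lintegral_indicator measurableSet_Ioo, ← lintegral_indicator measurableSet_Ioo,
      ← lintegral_sub_left_eq_self _ 1]
    refine lintegral_congr fun α => ?_
    have : 1 - α ∈ Ioo (0 : ℝ) 1 ↔ α ∈ Ioo (0 : ℝ) 1 := by
      simp only [mem_Ioo]; constructor <;> rintro ⟨h1, h2⟩ <;> constructor <;> linarith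
    by_cases hα : α ∈ Ioo (0 : ℝ) 1
    · rw [indicator_of_mem (this.2 hα), indicator_of_mem hα, sub_sub_cancel]
    · rw [indicator_of_notMem (fun h' => hα (this.1 h')), indicator_of_notMem hα]
  rw [hsym, lintegral_ratio hu]
  simp_rw [add_comm u]

end Substitution

/-! ### The stopped path, decomposed over the index of the event that stops it. -/

section Stopped

variable {E V Vr : Type*} [MeasurableSpace E] [MeasurableSpace V] [MeasurableSpace Vr]
  {μV : Measure V} {μVr : Measure Vr} {X : PDMP E V μV} {Y : PDMP E Vr μVr}

namespace Sampler

/-- The path stopped at the `k`-th forward event, with its length and the offset of the starting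
point. -/
def fwdPath (S : Sampler X Y) (k : ℕ) (s : Draw E V Vr) : Skeleton E V × ℝ × ℝ :=
  (S.reversal.join (s.2.1 / (1 - s.2.1) * lastTime (s.2.2.2 k).1.2) s.1
      (s.2.2.1.eventsUpTo (s.2.1 / (1 - s.2.1) * lastTime (s.2.2.2 k).1.2)) (s.2.2.2 k).1.2,
    s.2.1 / (1 - s.2.1) * lastTime (s.2.2.2 k).1.2 + lastTime (s.2.2.2 k).1.2,
    s.2.1 / (1 - s.2.1) * lastTime (s.2.2.2 k).1.2)

/-- The path stopped at the `k`-th backward event, with its length and the offset of the starting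
point. -/
def bwdPath (S : Sampler X Y) (k : ℕ) (s : Draw E V Vr) : Skeleton E V × ℝ × ℝ :=
  (S.reversal.join (lastTime (s.2.2.1 k).1.2) s.1 (s.2.2.1 k).1.2
      (s.2.2.2.eventsUpTo ((1 - s.2.1) / s.2.1 * lastTime (s.2.2.1 k).1.2)),
    lastTime (s.2.2.1 k).1.2 + (1 - s.2.1) / s.2.1 * lastTime (s.2.2.1 k).1.2,
    lastTime (s.2.2.1 k).1.2)

variable {S : Sampler X Y} {s : Draw E V Vr}

theorem downClosed_of_regular (hs : RegularDraw s) (hc : X.IsConsistent S.criterion) :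
    S.DownClosed s := fun _ ht _ h0 hle => mem_validTimes_of_le hs hc ht h0 hle

variable [SigmaFinite μV] [SigmaFinite μVr]

theorem stopped_of_stopsForward (hs : RegularDraw s) (hc : X.IsConsistent S.criterion)
    (he : X.DependsOnlyOnEvents S.criterion) {k : ℕ} (h : S.StopsForward k s) :
    S.stopped s = S.fwdPath k s := by
  have hα := hs.pos
  have hα' : 0 < 1 - s.2.1 := by linarith [hs.lt_one]
  obtain ⟨h1, h2, h3, h4⟩ := h
  set u := lastTime (s.2.2.2 k).1.2 with hu
  obtain ⟨r1, r2⟩ := hs.fwd.eventsUpTo_lastTime k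
  have hu0 : 0 < u := lastTime_pos h2 (hs.fwd.increasing k).2
  have e1 : s.2.1 * (u / (1 - s.2.1)) = s.2.1 / (1 - s.2.1) * u := by ring
  have e2 : (1 - s.2.1) * (u / (1 - s.2.1)) = u := by field_simp
  have e3 : s.2.1 / (1 - s.2.1) * u + u = u / (1 - s.2.1) := by field_simp; ring
  have hT := (stops_iff hs hc he (T := u / (1 - s.2.1))).2 ⟨by positivity,
    ⟨by rw [e1]; exact h3, by rw [e2]; exact r1⟩, by rw [StopsAt, e1, e2, r2]; exact h4⟩
  rw [stopped, ← length_eq (downClosed_of_regular hs hc), hT.2, window_eq, e1, e2, r2, fwdPath,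
    ← hu, e3]

theorem stopped_of_stopsBackward (hs : RegularDraw s) (hc : X.IsConsistent S.criterion)
    (he : X.DependsOnlyOnEvents S.criterion) {k : ℕ} (h : S.StopsBackward k s) :
    S.stopped s = S.bwdPath k s := by
  have hα := hs.pos
  have hα' : 0 < 1 - s.2.1 := by linarith [hs.lt_one]
  obtain ⟨h1, h2, h3, h4, h4'⟩ := h
  set u := lastTime (s.2.2.1 k).1.2 with hu
  obtain ⟨r1, r2⟩ := hs.bwd.eventsUpTo_lastTime k
  have hu0 : 0 < u := lastTime_pos h2 (hs.bwd.increasing k).2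
  have e1 : s.2.1 * (u / s.2.1) = u := by field_simp
  have e2 : (1 - s.2.1) * (u / s.2.1) = (1 - s.2.1) / s.2.1 * u := by ring
  have e3 : u + (1 - s.2.1) / s.2.1 * u = u / s.2.1 := by field_simp; ring
  have hT := (stops_iff hs hc he (T := u / s.2.1)).2 ⟨by positivity,
    ⟨by rw [e1]; exact r1, by rw [e2]; exact h3⟩, by rw [StopsAt, e1, e2, r2]; exact h4'⟩
  rw [stopped, ← length_eq (downClosed_of_regular hs hc), hT.2, window_eq, e1, e2, r2, bwdPath,
    ← hu, e3]

/-- By `stopsForward_iff` at most one term is nonzero. Each term depends on the length T only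
through event times, whose law is known. -/
theorem tsum_stopsForward (hs : RegularDraw s) (hc : X.IsConsistent S.criterion)
    (he : X.DependsOnlyOnEvents S.criterion) (G : Skeleton E V × ℝ × ℝ → ℝ≥0∞) :
    {s | S.Stops' s ∧ S.HitForward' s}.indicator (fun s => G (S.stopped s)) s =
      ∑' k, {s | S.StopsForward k s}.indicator (fun s => G (S.fwdPath k s)) s := by
  have hd := downClosed_of_regular hs hc
  have hiff := fun k => stopsForward_iff hs hc he (k := k)
  by_cases h : S.Stops' s ∧ S.HitForward' s
  · have h' : S.Stops s ∧ S.HitForward s := ⟨(stops_iff' hd).2 h.1, (hitForward_iff' hd).2 h.2⟩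
    set k0 := (s.2.2.2.eventsUpTo ((1 - s.2.1) * S.length s)).length
    have hk0 : S.StopsForward k0 s := (hiff k0).2 ⟨h', rfl⟩
    rw [indicator_of_mem (show s ∈ {s | S.Stops' s ∧ S.HitForward' s} from h),
      tsum_eq_single k0, indicator_of_mem (show s ∈ {s | S.StopsForward k0 s} from hk0),
      stopped_of_stopsForward hs hc he hk0]
    intro k hk
    rw [indicator_of_notMem (show s ∉ {s | S.StopsForward k s} from
      fun hk' => hk ((hiff k).1 hk').2.symm)]
  · rw [indicator_of_notMem (show s ∉ {s | S.Stops' s ∧ S.HitForward' s} from h), eq_comm,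
      ENNReal.tsum_eq_zero]
    intro k
    by_cases hk' : S.StopsForward k s
    swap
    · rw [indicator_of_notMem (show s ∉ {s | S.StopsForward k s} from hk')]
    refine absurd ?_ h
    obtain ⟨⟨h1, h2⟩, _⟩ := (hiff k).1 hk'
    exact ⟨(stops_iff' hd).1 h1, (hitForward_iff' hd).1 h2⟩

theorem tsum_stopsBackward (hs : RegularDraw s) (hc : X.IsConsistent S.criterion)
    (he : X.DependsOnlyOnEvents S.criterion) (G : Skeleton E V × ℝ × ℝ → ℝ≥0∞) :
    {s | S.Stops' s ∧ ¬ S.HitForward' s}.indicator (fun s => G (S.stopped s)) s =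
      ∑' k, {s | S.StopsBackward k s}.indicator (fun s => G (S.bwdPath k s)) s := by
  have hd := downClosed_of_regular hs hc
  have hiff := fun k => stopsBackward_iff hs hc he (k := k)
  by_cases h : S.Stops' s ∧ ¬ S.HitForward' s
  · have h' : S.Stops s ∧ ¬ S.HitForward s :=
      ⟨(stops_iff' hd).2 h.1, fun hh => h.2 ((hitForward_iff' hd).1 hh)⟩
    set k0 := (s.2.2.1.eventsUpTo (s.2.1 * S.length s)).length
    have hk0 : S.StopsBackward k0 s := (hiff k0).2 ⟨h', rfl⟩
    rw [indicator_of_mem (show s ∈ {s | S.Stops' s ∧ ¬ S.HitForward' s} from h),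
      tsum_eq_single k0, indicator_of_mem (show s ∈ {s | S.StopsBackward k0 s} from hk0),
      stopped_of_stopsBackward hs hc he hk0]
    intro k hk
    rw [indicator_of_notMem (show s ∉ {s | S.StopsBackward k s} from
      fun hk' => hk ((hiff k).1 hk').2.symm)]
  · rw [indicator_of_notMem (show s ∉ {s | S.Stops' s ∧ ¬ S.HitForward' s} from h), eq_comm,
      ENNReal.tsum_eq_zero]
    intro k
    by_cases hk' : S.StopsBackward k s
    swap
    · rw [indicator_of_notMem (show s ∉ {s | S.StopsBackward k s} from hk')]
    refine absurd ?_ h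
    obtain ⟨⟨h1, h2⟩, _⟩ := (hiff k).1 hk'
    exact ⟨(stops_iff' hd).1 h1, fun hh => h2 ((hitForward_iff' hd).2 hh)⟩

/-- The value of a functional of the stopped path, when the path stops with the backward events `b`
during the time `l` and the forward events `f` during the time `r`. -/
def stopTerm (S : Sampler X Y) (G : Skeleton E V × ℝ × ℝ → ℝ≥0∞) (l r : ℝ) (z : E)
    (b : List (ℝ × Vr)) (f : List (ℝ × V)) : ℝ≥0∞ :=
  open Classical in
  if IsStop S.reversal S.criterion l r z b f then G (S.reversal.join l z b f, l + r, l) else 0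

theorem measurable_stopTerm (hS : S.IsMeasurable) {G : Skeleton E V × ℝ × ℝ → ℝ≥0∞}
    (hG : Measurable G) {T : Type*} [MeasurableSpace T] {l r : T → ℝ} {z : T → E}
    {b : T → List (ℝ × Vr)} {f : T → List (ℝ × V)} (hl : Measurable l) (hr : Measurable r)
    (hz : Measurable z) (hb : Measurable b) (hf : Measurable f) :
    Measurable fun x => S.stopTerm G (l x) (r x) (z x) (b x) (f x) := by
  classical
  exact Measurable.ite (measurableSet_isStop S.reversal hS.criterion hl hr hz hb hf)
    (by fun_prop) measurable_const

-- The conditions are nested with the flag outermost, in the form to which the law of the first k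
-- events applies.
open Classical in
theorem indicator_stopsForward (G : Skeleton E V × ℝ × ℝ → ℝ≥0∞) (k : ℕ) (s : Draw E V Vr) :
    {s | S.StopsForward k s}.indicator (fun s => G (S.fwdPath k s)) s =
      if (s.2.2.2 k).2 = true then
        (if (s.2.2.2 k).1.2 ≠ [] ∧
            s.2.2.1.Reaches (s.2.1 / (1 - s.2.1) * lastTime (s.2.2.2 k).1.2) then
          S.stopTerm G (s.2.1 / (1 - s.2.1) * lastTime (s.2.2.2 k).1.2)
            (lastTime (s.2.2.2 k).1.2) s.1
            (s.2.2.1.eventsUpTo (s.2.1 / (1 - s.2.1) * lastTime (s.2.2.2 k).1.2))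
            (s.2.2.2 k).1.2 else 0) else 0 := by
  by_cases h : S.StopsForward k s
  · rw [indicator_of_mem (show s ∈ {s | S.StopsForward k s} from h), if_pos h.1,
      if_pos ⟨h.2.1, h.2.2.1⟩, stopTerm, if_pos h.2.2.2, fwdPath]
  · rw [indicator_of_notMem (show s ∉ {s | S.StopsForward k s} from h)]
    by_cases h1 : (s.2.2.2 k).2 = true
    · rw [if_pos h1]
      split_ifs with h2
      · rw [stopTerm, if_neg fun h3 => h ⟨h1, h2.1, h2.2, h3⟩]
      · rfl
    · rw [if_neg h1]

open Classical in
theorem indicator_stopsBackward (G : Skeleton E V × ℝ × ℝ → ℝ≥0∞) (k : ℕ) (s : Draw E V Vr) :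
    {s | S.StopsBackward k s}.indicator (fun s => G (S.bwdPath k s)) s =
      if (s.2.2.1 k).2 = true then
        (if (s.2.2.1 k).1.2 ≠ [] ∧
            s.2.2.2.Reaches ((1 - s.2.1) / s.2.1 * lastTime (s.2.2.1 k).1.2) then
          (if (∀ e ∈ s.2.2.2.eventsUpTo ((1 - s.2.1) / s.2.1 * lastTime (s.2.2.1 k).1.2),
              e.1 < (1 - s.2.1) / s.2.1 * lastTime (s.2.2.1 k).1.2) then
            S.stopTerm G (lastTime (s.2.2.1 k).1.2)
              ((1 - s.2.1) / s.2.1 * lastTime (s.2.2.1 k).1.2) s.1 (s.2.2.1 k).1.2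
              (s.2.2.2.eventsUpTo ((1 - s.2.1) / s.2.1 * lastTime (s.2.2.1 k).1.2)) else 0)
          else 0) else 0 := by
  by_cases h : S.StopsBackward k s
  · rw [indicator_of_mem (show s ∈ {s | S.StopsBackward k s} from h), if_pos h.1,
      if_pos ⟨h.2.1, h.2.2.1⟩, if_pos h.2.2.2.1, stopTerm, if_pos h.2.2.2.2, bwdPath]
  · rw [indicator_of_notMem (show s ∉ {s | S.StopsBackward k s} from h)]
    by_cases h1 : (s.2.2.1 k).2 = true
    · rw [if_pos h1]
      split_ifs with h2 h3
      · rw [stopTerm, if_neg fun h4 => h ⟨h1, h2.1, h2.2, h3, h4⟩]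
      · rfl
      · rfl
    · rw [if_neg h1]

theorem _root_.PathSampler.measurableSet_forall_lt {T V : Type*} [MeasurableSpace T] [MeasurableSpace V]
    {es : T → List (ℝ × V)} {t : T → ℝ} (hes : Measurable es) (ht : Measurable t) :
    MeasurableSet {x | ∀ e ∈ es x, e.1 < t x} := by
  have h : MeasurableSet {q : ℝ × List (ℝ × V) | ∀ e ∈ q.2, e.1 ∈ Iio q.1} :=
    measurableSet_forall_time (I := fun t => Iio t) (measurableSet_lt measurable_snd measurable_fst)
  exact h.preimage (ht.prodMk hes)

theorem _root_.PathSampler.measurableSet_forall_le {T V : Type*} [MeasurableSpace T] [MeasurableSpace V]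
    {es : T → List (ℝ × V)} {t : T → ℝ} (hes : Measurable es) (ht : Measurable t) :
    MeasurableSet {x | ∀ e ∈ es x, e.1 ≤ t x} := by
  have h : MeasurableSet {q : ℝ × List (ℝ × V) | ∀ e ∈ q.2, e.1 ∈ Iic q.1} :=
    measurableSet_forall_time (I := fun t => Iic t) (measurableSet_le measurable_snd measurable_fst)
  exact h.preimage (ht.prodMk hes)

theorem measurable_stopsForward (hS : S.IsMeasurable) {G : Skeleton E V × ℝ × ℝ → ℝ≥0∞}
    (hG : Measurable G) (k : ℕ) :
    Measurable fun s => {s | S.StopsForward k s}.indicator (fun s => G (S.fwdPath k s)) s := by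
  classical
  simp_rw [indicator_stopsForward]
  have hr : Measurable fun s : Draw E V Vr =>
    (s.2.2.1, s.2.1 / (1 - s.2.1) * lastTime (s.2.2.2 k).1.2) := by fun_prop
  refine Measurable.ite ?_ (Measurable.ite ?_ (measurable_stopTerm hS hG (by fun_prop)
    (by fun_prop) (by fun_prop) (by fun_prop) (by fun_prop)) measurable_const) measurable_const
  · exact (measurableSet_singleton true).preimage
      (show Measurable fun s : Draw E V Vr => (s.2.2.2 k).2 by fun_prop)
  · exact (measurableSet_ne_nil.preimage
      (show Measurable fun s : Draw E V Vr => (s.2.2.2 k).1.2 by fun_prop)).inter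
      (measurableSet_reaches.preimage hr)

theorem measurable_stopsBackward (hS : S.IsMeasurable) {G : Skeleton E V × ℝ × ℝ → ℝ≥0∞}
    (hG : Measurable G) (k : ℕ) :
    Measurable fun s => {s | S.StopsBackward k s}.indicator (fun s => G (S.bwdPath k s)) s := by
  classical
  simp_rw [indicator_stopsBackward]
  have hr : Measurable fun s : Draw E V Vr =>
    (s.2.2.2, (1 - s.2.1) / s.2.1 * lastTime (s.2.2.1 k).1.2) := by fun_prop
  refine Measurable.ite ?_ (Measurable.ite ?_ (Measurable.ite ?_ (measurable_stopTerm hS hG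
    (by fun_prop) (by fun_prop) (by fun_prop) (by fun_prop) (by fun_prop)) measurable_const)
    measurable_const) measurable_const
  · exact (measurableSet_singleton true).preimage
      (show Measurable fun s : Draw E V Vr => (s.2.2.1 k).2 by fun_prop)
  · exact (measurableSet_ne_nil.preimage
      (show Measurable fun s : Draw E V Vr => (s.2.2.1 k).1.2 by fun_prop)).inter
      (measurableSet_reaches.preimage hr)
  · exact measurableSet_forall_lt (by fun_prop) (by fun_prop)

/-- A draw is almost surely indistinguishable from its rebuilt version, which is regular. Identities
proved for regular draws thus hold under the integral, provided that both sides are measurable. -/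
theorem lintegral_eq_of_regular {M : Measure (Draw E V Vr)} (hM : IsDraw S M)
    {F F' : Draw E V Vr → ℝ≥0∞} (hF : Measurable F) (hF' : Measurable F')
    (h : ∀ s, RegularDraw s → F s = F' s) : ∫⁻ s, F s ∂M = ∫⁻ s, F' s ∂M := by
  have h1 := (indist_regularizeDraw hM).lintegral_eq hF
  have h2 := (indist_regularizeDraw hM).lintegral_eq hF'
  simp only [id] at h1 h2
  rw [h1, h2]
  exact lintegral_congr_ae ((ae_regularDraw hM).mono fun s hs => h _ hs)

theorem lintegral_stopsForward (hS : S.IsMeasurable) (hc : X.IsConsistent S.criterion)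
    (he : X.DependsOnlyOnEvents S.criterion) {M : Measure (Draw E V Vr)} (hM : IsDraw S M)
    {G : Skeleton E V × ℝ × ℝ → ℝ≥0∞} (hG : Measurable G) :
    ∫⁻ s, {s | S.Stops' s ∧ S.HitForward' s}.indicator (fun s => G (S.stopped s)) s ∂M =
      ∫⁻ s, ∑' k, {s | S.StopsForward k s}.indicator (fun s => G (S.fwdPath k s)) s ∂M :=
  lintegral_eq_of_regular hM ((hG.comp (measurable_stopped hS)).indicator
    ((measurableSet_stops' hS).inter (measurableSet_hitForward' hS)))
    (Measurable.tsum fun k => measurable_stopsForward hS hG k)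
    fun _ hs => tsum_stopsForward hs hc he G

theorem lintegral_stopsBackward (hS : S.IsMeasurable) (hc : X.IsConsistent S.criterion)
    (he : X.DependsOnlyOnEvents S.criterion) {M : Measure (Draw E V Vr)} (hM : IsDraw S M)
    {G : Skeleton E V × ℝ × ℝ → ℝ≥0∞} (hG : Measurable G) :
    ∫⁻ s, {s | S.Stops' s ∧ ¬ S.HitForward' s}.indicator (fun s => G (S.stopped s)) s ∂M =
      ∫⁻ s, ∑' k, {s | S.StopsBackward k s}.indicator (fun s => G (S.bwdPath k s)) s ∂M :=
  lintegral_eq_of_regular hM ((hG.comp (measurable_stopped hS)).indicator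
    ((measurableSet_stops' hS).inter (measurableSet_hitForward' hS).compl))
    (Measurable.tsum fun k => measurable_stopsBackward hS hG k)
    fun _ hs => tsum_stopsBackward hs hc he G

/-- On a draw, the stopped path is at the current state at its offset. -/
theorem position_stopped (hs : RegularDraw s) :
    X.position (S.stopped s).1 (S.stopped s).2.2 = s.1 := by
  obtain ⟨ib, mb⟩ := hs.bwd.eventsUpTo_mem (s.2.1 * (S.ratLength s).toReal)
  obtain ⟨fi, mf⟩ := hs.fwd.eventsUpTo_mem ((1 - s.2.1) * (S.ratLength s).toReal)
  rw [stopped, window_eq, Reversal.join, PDMP.position, PDMP.stateAt_eq, delay_append,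
    eventsIn_append, eventsIn_eq_self, eventsIn_eq_nil, List.append_nil]
  · simp [PDMP.run_delay, Reversal.run_rev_symm]
  · rw [forall_mem_delay (p := fun t => t ∉ Iic (s.2.1 * (S.ratLength s).toReal))]
    intro e he
    simp only [mem_Iic, not_le]
    linarith [mf e he]
  · rw [forall_mem_delay (p := fun t => t ∈ Iic (s.2.1 * (S.ratLength s).toReal)),
      S.reversal.symm.forall_mem_revEvents _ (p := fun t => t + s.2.1 * (S.ratLength s).toReal ∈
        Iic (s.2.1 * (S.ratLength s).toReal))]
    intro e he
    simp only [mem_Iic]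
    linarith [mb e he]

end Sampler

end Stopped

/-! ### Integrals over two independent trajectories from the same state. -/

section Pair

variable {E V W : Type*} [MeasurableSpace E] [MeasurableSpace V] [MeasurableSpace W]
  {μV : Measure V} {μW : Measure W} [SigmaFinite μV] [SigmaFinite μW]

theorem PDMP.measurable_eventsDensity_apply {X : PDMP E V μV} {A : SimRate E V} (z : E) :
    Measurable fun es => X.eventsDensity A z [] es := by
  have h := (X.measurable_eventsDensity A).comp (measurable_prodMk_left (x := z))
  exact h

theorem PDMP.mem_pathsIn_of_pathDensity_ne_zero {X : PDMP E V μV} {A : SimRate E V} {T : ℝ}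
    {w : Skeleton E V} (h : X.pathDensity A T w ≠ 0) : w ∈ pathsIn E V (Ioi 0) := by
  rw [X.pathDensity_eq] at h
  obtain ⟨h1, h2⟩ := X.increasing_of_eventsDensity_ne_zero (left_ne_zero_of_mul h)
  exact ⟨h1, fun e he => by simpa using h2 e he⟩

theorem measurableSet_skeleton_pathsIn (z : E) {I : Set ℝ} (hI : MeasurableSet I) :
    MeasurableSet {b : List (ℝ × V) | (z, b) ∈ pathsIn E V I} :=
  (measurableSet_pathsIn hI).preimage measurable_prodMk_left

/-- Replacing a closed interval by an open one in the integral of a path density. -/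
theorem lintegral_pathDensity_Ioo (X : PDMP E V μV) (A : SimRate E V) (z : E) (l : ℝ)
    (g : List (ℝ × V) → ℝ≥0∞) :
    ∫⁻ b in {b | ∀ e ∈ b, e.1 ≤ l}, X.pathDensity A l (z, b) * g b
        ∂listSum ((volume : Measure ℝ).prod μV) =
      ∫⁻ b in {b | (z, b) ∈ pathsIn E V (Ioo 0 l)}, X.pathDensity A l (z, b) * g b
        ∂listSum ((volume : Measure ℝ).prod μV) := by
  have hle : MeasurableSet {b : List (ℝ × V) | ∀ e ∈ b, e.1 ≤ l} :=
    measurableSet_forall_le measurable_id measurable_const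
  rw [← lintegral_indicator hle,
    ← lintegral_indicator (measurableSet_skeleton_pathsIn z measurableSet_Ioo)]
  classical
  refine lintegral_congr_ae ((ae_listSum_time_ne μV l).mono fun b hb => ?_)
  simp only [indicator, mem_ofPred_eq]
  by_cases h : X.pathDensity A l (z, b) = 0
  · simp [h]
  · have h1 := PDMP.mem_pathsIn_of_pathDensity_ne_zero h
    refine if_congr ⟨fun h2 => ⟨h1.1, fun e he => ⟨h1.2 e he, lt_of_le_of_ne (h2 e he) (hb e he)⟩⟩,
      fun h2 e he => (h2.2 e he).2.le⟩ rfl rfl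

open Classical in
/-- Two independent trajectories from `z`: integral over the events of the first one of a functional
that involves the path of the second during the time `q α` times that of the event. -/
theorem lintegral_trajectory_pair (X : PDMP E V μV) (A : SimRate E V) (Y : PDMP E W μW)
    (B : SimRate E W) (z : E) {q : ℝ → ℝ} (hq : Measurable q)
    (hq0 : ∀ α ∈ Ioo (0 : ℝ) 1, 0 ≤ q α)
    (hsub : ∀ u : ℝ, 0 < u → ∀ h : ℝ → ℝ≥0∞, ∫⁻ α in Ioo (0 : ℝ) 1, h (q α * u) =
      ∫⁻ l in Ioi (0 : ℝ), ENNReal.ofReal (u / (l + u) ^ 2) * h l)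
    {g : ℝ → List (ℝ × V) → List (ℝ × W) → ℝ≥0∞}
    (hg : Measurable fun p : ℝ × List (ℝ × V) × List (ℝ × W) => g p.1 p.2.1 p.2.2) :
    ∫⁻ α in Ioo (0 : ℝ) 1, ∫⁻ ω' : Trajectory E W, ∫⁻ ω : Trajectory E V, ∑' k, (if (ω k).2 = true then
        (if (ω k).1.2 ≠ [] ∧ ω'.Reaches (q α * lastTime (ω k).1.2) then
          g (q α * lastTime (ω k).1.2) (ω k).1.2 (ω'.eventsUpTo (q α * lastTime (ω k).1.2))
          else 0) else 0) ∂X.trajectoryLaw A z ∂Y.trajectoryLaw B z =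
      ∫⁻ f, X.eventsDensity A z [] f * (if f ≠ [] then ∫⁻ l in Ioi (0 : ℝ),
        ENNReal.ofReal (lastTime f / (l + lastTime f) ^ 2) *
          ∫⁻ b in {b | (z, b) ∈ pathsIn E W (Ioo 0 l)}, Y.pathDensity B l (z, b) * g l f b
            ∂listSum ((volume : Measure ℝ).prod μW) else 0)
        ∂listSum ((volume : Measure ℝ).prod μV) := by
  have hdens := PDMP.measurable_eventsDensity_apply (X := X) (A := A) z
  have hm : Measurable fun p : ℝ × Trajectory E W × List (ℝ × V) =>
      if p.2.2 ≠ [] ∧ p.2.1.Reaches (q p.1 * lastTime p.2.2) then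
        g (q p.1 * lastTime p.2.2) p.2.2 (p.2.1.eventsUpTo (q p.1 * lastTime p.2.2)) else 0 := by
    have h1 : Measurable fun p : ℝ × Trajectory E W × List (ℝ × V) =>
      (p.2.1, q p.1 * lastTime p.2.2) := by fun_prop
    have h2 : Measurable fun p : ℝ × Trajectory E W × List (ℝ × V) =>
      (q p.1 * lastTime p.2.2, p.2.2, p.2.1.eventsUpTo (q p.1 * lastTime p.2.2)) := by fun_prop
    refine Measurable.ite ((measurableSet_ne_nil.preimage
      (show Measurable fun p : ℝ × Trajectory E W × List (ℝ × V) => p.2.2 by fun_prop)).inter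
      (measurableSet_reaches.preimage h1)) ?_ measurable_const
    exact hg.comp h2
  -- Summing over k the laws of the first k events gives one integral over lists of all lengths.
  have e1 : ∀ (α : ℝ) (ω' : Trajectory E W), ∫⁻ ω, ∑' k, (if (ω k).2 = true then
        (if (ω k).1.2 ≠ [] ∧ ω'.Reaches (q α * lastTime (ω k).1.2) then
          g (q α * lastTime (ω k).1.2) (ω k).1.2 (ω'.eventsUpTo (q α * lastTime (ω k).1.2))
          else 0) else 0) ∂X.trajectoryLaw A z =
      ∫⁻ f, X.eventsDensity A z [] f * (if f ≠ [] ∧ ω'.Reaches (q α * lastTime f) then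
          g (q α * lastTime f) f (ω'.eventsUpTo (q α * lastTime f)) else 0)
        ∂listSum ((volume : Measure ℝ).prod μV) := by
    intro α ω'
    have h1 : Measurable fun w : Skeleton E V => (α, ω', w.2) := by fun_prop
    have h2 := hm.comp h1
    simp only [Function.comp_def] at h2
    rw [lintegral_tsum, lintegral_listSum]
    · exact tsum_congr fun k => X.lintegral_trajectoryLaw_events A z k h2
    · intro k
      refine (Measurable.ite ((measurableSet_singleton true).preimage
        (show Measurable fun ω : Trajectory E V => (ω k).2 by fun_prop)) ?_
        measurable_const).aemeasurable
      exact h2.comp (show Measurable fun ω : Trajectory E V => (ω k).1 by fun_prop)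
  have e2 : ∀ α : ℝ, ∫⁻ ω' : Trajectory E W, ∫⁻ f, X.eventsDensity A z [] f *
        (if f ≠ [] ∧ ω'.Reaches (q α * lastTime f) then
          g (q α * lastTime f) f (ω'.eventsUpTo (q α * lastTime f)) else 0)
        ∂listSum ((volume : Measure ℝ).prod μV) ∂Y.trajectoryLaw B z =
      ∫⁻ f, X.eventsDensity A z [] f * ∫⁻ ω', (if f ≠ [] ∧ ω'.Reaches (q α * lastTime f) then
          g (q α * lastTime f) f (ω'.eventsUpTo (q α * lastTime f)) else 0)
        ∂Y.trajectoryLaw B z ∂listSum ((volume : Measure ℝ).prod μV) := by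
    intro α
    have h2 := hm.comp (measurable_prodMk_left (x := α))
    simp only [Function.comp_def] at h2
    rw [lintegral_lintegral_swap]
    · refine lintegral_congr fun f => ?_
      rw [lintegral_const_mul]
      exact h2.comp (measurable_prodMk_right (y := f))
    · exact ((hdens.comp measurable_snd).mul h2).aemeasurable
  -- Given α and the events f of the first trajectory, the time explored by the second is fixed, so
  -- the law of its events up to a fixed time applies.
  have e3 : ∀ f, X.eventsDensity A z [] f ≠ 0 → f ≠ [] → ∀ α ∈ Ioo (0 : ℝ) 1,
      ∫⁻ ω' : Trajectory E W, (if f ≠ [] ∧ ω'.Reaches (q α * lastTime f) then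
          g (q α * lastTime f) f (ω'.eventsUpTo (q α * lastTime f)) else 0)
        ∂Y.trajectoryLaw B z =
      ∫⁻ b in {b | (z, b) ∈ pathsIn E W (Ioo 0 (q α * lastTime f))},
        Y.pathDensity B (q α * lastTime f) (z, b) * g (q α * lastTime f) f b
            ∂listSum ((volume : Measure ℝ).prod μW) := by
    intro f hf hne α hα
    obtain ⟨_, h2⟩ := X.increasing_of_eventsDensity_ne_zero hf
    have hu : 0 < lastTime f := lastTime_pos hne (by simpa using h2)
    have hT : 0 ≤ q α * lastTime f := mul_nonneg (hq0 α hα) hu.le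
    have hgl : Measurable fun b => g (q α * lastTime f) f b := by
      have : Measurable fun b : List (ℝ × W) => (q α * lastTime f, f, b) := by fun_prop
      exact hg.comp this
    have hR : MeasurableSet {ω' : Trajectory E W | ω'.Reaches (q α * lastTime f)} :=
      measurableSet_reaches.preimage (measurable_prodMk_right (y := q α * lastTime f))
    rw [← lintegral_pathDensity_Ioo, ← Y.lintegral_trajectoryLaw_eventsUpTo B z hT hgl,
      ← lintegral_indicator hR]
    refine lintegral_congr fun ω' => ?_
    simp only [indicator, mem_ofPred_eq, hne, ne_eq, not_false_eq_true, true_and]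
  simp_rw [e1, e2]
  rw [lintegral_lintegral_swap]
  · refine lintegral_congr fun f => ?_
    have h4 : Measurable fun α => ∫⁻ ω', (if f ≠ [] ∧ ω'.Reaches (q α * lastTime f) then
          g (q α * lastTime f) f (ω'.eventsUpTo (q α * lastTime f)) else 0)
        ∂Y.trajectoryLaw B z := by
      have h5 : Measurable fun p : ℝ × Trajectory E W => (p.1, p.2, f) := by fun_prop
      have h6 := hm.comp h5
      exact h6.lintegral_prod_right'
    rw [lintegral_const_mul _ h4]
    by_cases h0 : X.eventsDensity A z [] f = 0
    · rw [h0, zero_mul, zero_mul]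
    by_cases hne : f = []
    · simp [hne]
    rw [if_pos hne, setLIntegral_congr_fun measurableSet_Ioo (e3 f h0 hne)]
    obtain ⟨_, h2⟩ := X.increasing_of_eventsDensity_ne_zero h0
    -- Only now is α eliminated in favour of the duration l of the second path; `hsub` is the
    -- substitution for either direction of stopping.
    rw [hsub _ (lastTime_pos hne (by simpa using h2)) fun l =>
      ∫⁻ b in {b | (z, b) ∈ pathsIn E W (Ioo 0 l)}, Y.pathDensity B l (z, b) * g l f b
            ∂listSum ((volume : Measure ℝ).prod μW)]
  · have h5 : Measurable fun p : (ℝ × List (ℝ × V)) × Trajectory E W => (p.1.1, p.2, p.1.2) := by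
      fun_prop
    have h6 := (hm.comp h5).lintegral_prod_right' (ν := Y.trajectoryLaw B z)
    exact ((hdens.comp measurable_snd).mul h6).aemeasurable

end Pair

/-! ### The density of the stopped draws around a fixed state. -/

section Stopped

variable {E V Vr : Type*} [MeasurableSpace E] [MeasurableSpace V] [MeasurableSpace Vr]
  {μV : Measure V} {μVr : Measure Vr} {X : PDMP E V μV} {Y : PDMP E Vr μVr}
  [SigmaFinite μV] [SigmaFinite μVr]

namespace Sampler

variable {S : Sampler X Y}

theorem lintegral_drawLaw (S : Sampler X Y) (z : E) {F : Draw E V Vr → ℝ≥0∞} (hF : Measurable F) :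
    ∫⁻ s, F s ∂S.drawLaw z = ∫⁻ α in Ioo (0 : ℝ) 1, ∫⁻ ω', ∫⁻ ω, F (z, α, ω', ω)
      ∂X.trajectoryLaw S.fwdRate z ∂Y.trajectoryLaw S.bwdRate z := by
  have h1 : Measurable fun p : ℝ × Trajectory E Vr × Trajectory E V => F (z, p) :=
    hF.comp measurable_prodMk_left
  rw [S.drawLaw_apply, lintegral_map hF measurable_prodMk_left, lintegral_prod _ h1.aemeasurable]
  refine lintegral_congr fun α => ?_
  have h2 := h1.comp (measurable_prodMk_left (x := α))
  exact lintegral_prod _ h2.aemeasurable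

open Classical in
theorem lintegral_drawLaw_stopsForward (hS : S.IsMeasurable) {G : Skeleton E V × ℝ × ℝ → ℝ≥0∞}
    (hG : Measurable G) (z : E) :
    ∫⁻ s, ∑' k, {s | S.StopsForward k s}.indicator (fun s => G (S.fwdPath k s)) s ∂S.drawLaw z =
      ∫⁻ f, X.eventsDensity S.fwdRate z [] f * (if f ≠ [] then ∫⁻ l in Ioi (0 : ℝ),
        ENNReal.ofReal (lastTime f / (l + lastTime f) ^ 2) *
          ∫⁻ b in {b | (z, b) ∈ pathsIn E Vr (Ioo 0 l)}, Y.pathDensity S.bwdRate l (z, b) *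
            S.stopTerm G l (lastTime f) z b f ∂listSum ((volume : Measure ℝ).prod μVr) else 0)
        ∂listSum ((volume : Measure ℝ).prod μV) := by
  rw [lintegral_drawLaw S z (Measurable.tsum fun k => measurable_stopsForward hS hG k)]
  simp_rw [indicator_stopsForward]
  exact lintegral_trajectory_pair X S.fwdRate Y S.bwdRate z (q := fun α => α / (1 - α))
    (by fun_prop) (fun α hα => div_nonneg hα.1.le (by linarith [hα.2]))
    (fun u hu h => lintegral_ratio hu h)
    (g := fun l f b => S.stopTerm G l (lastTime f) z b f)
    (measurable_stopTerm hS hG (by fun_prop) (by fun_prop) (by fun_prop) (by fun_prop)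
      (by fun_prop))

open Classical in
theorem lintegral_drawLaw_stopsBackward (hS : S.IsMeasurable) {G : Skeleton E V × ℝ × ℝ → ℝ≥0∞}
    (hG : Measurable G) (z : E) :
    ∫⁻ s, ∑' k, {s | S.StopsBackward k s}.indicator (fun s => G (S.bwdPath k s)) s ∂S.drawLaw z =
      ∫⁻ b, Y.eventsDensity S.bwdRate z [] b * (if b ≠ [] then ∫⁻ r in Ioi (0 : ℝ),
        ENNReal.ofReal (lastTime b / (r + lastTime b) ^ 2) *
          ∫⁻ f in {f | (z, f) ∈ pathsIn E V (Ioo 0 r)}, X.pathDensity S.fwdRate r (z, f) *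
            S.stopTerm G (lastTime b) r z b f ∂listSum ((volume : Measure ℝ).prod μV) else 0)
        ∂listSum ((volume : Measure ℝ).prod μVr) := by
  have h3 : Measurable fun s => ∑' k,
      {s | S.StopsBackward k s}.indicator (fun s => G (S.bwdPath k s)) s :=
    Measurable.tsum fun k => measurable_stopsBackward hS hG k
  rw [lintegral_drawLaw S z h3]
  have hswap : ∀ α : ℝ, ∫⁻ ω' : Trajectory E Vr, ∫⁻ ω : Trajectory E V, ∑' k,
        {s | S.StopsBackward k s}.indicator (fun s => G (S.bwdPath k s)) (z, α, ω', ω)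
        ∂X.trajectoryLaw S.fwdRate z ∂Y.trajectoryLaw S.bwdRate z =
      ∫⁻ ω : Trajectory E V, ∫⁻ ω' : Trajectory E Vr, ∑' k,
        {s | S.StopsBackward k s}.indicator (fun s => G (S.bwdPath k s)) (z, α, ω', ω)
        ∂Y.trajectoryLaw S.bwdRate z ∂X.trajectoryLaw S.fwdRate z := by
    intro α
    have h1 : Measurable fun p : Trajectory E Vr × Trajectory E V =>
      ((z, α, p.1, p.2) : Draw E V Vr) := by fun_prop
    exact lintegral_lintegral_swap (h3.comp h1).aemeasurable
  simp_rw [hswap, indicator_stopsBackward]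
  have hm : Measurable fun p : ℝ × List (ℝ × Vr) × List (ℝ × V) =>
      if (∀ e ∈ p.2.2, e.1 < p.1) then S.stopTerm G (lastTime p.2.1) p.1 z p.2.1 p.2.2 else 0 :=
    Measurable.ite (measurableSet_forall_lt (by fun_prop) (by fun_prop))
      (measurable_stopTerm hS hG (by fun_prop) (by fun_prop) (by fun_prop) (by fun_prop)
      (by fun_prop)) measurable_const
  have key := lintegral_trajectory_pair Y S.bwdRate X S.fwdRate z (q := fun α => (1 - α) / α)
    (by fun_prop) (fun α hα => div_nonneg (by linarith [hα.2]) hα.1.le)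
    (fun u hu h => (lintegral_ratio' hu h).trans
      (lintegral_congr fun l => by rw [add_comm u l]))
    (g := fun l b f => if (∀ e ∈ f, e.1 < l) then S.stopTerm G (lastTime b) l z b f else 0) hm
  refine key.trans (lintegral_congr fun b => ?_)
  congr 1
  split_ifs with hb
  · refine lintegral_congr fun l => ?_
    congr 1
    refine setLIntegral_congr_fun (measurableSet_skeleton_pathsIn z measurableSet_Ioo)
      fun f hf => ?_
    -- The exclusion of a forward event at the extremity is automatic: up to a null set the forward
    -- events lie in the open interval.
    rw [if_pos fun e he => (hf.2 e he).2]
  · rfl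

end Sampler

end Stopped

/-! ### Further reorderings of iterated integrals. -/

section Swap

variable {A B C D : Type*} [MeasurableSpace A] [MeasurableSpace B] [MeasurableSpace C]
  [MeasurableSpace D]

theorem lintegral_swap_first_third (μA : Measure A) (μB : Measure B) (μC : Measure C)
    [SFinite μA] [SFinite μB] [SFinite μC] {M : A × B × C → ℝ≥0∞} (hM : Measurable M) :
    ∫⁻ a, ∫⁻ b, ∫⁻ c, M (a, b, c) ∂μC ∂μB ∂μA = ∫⁻ c, ∫⁻ b, ∫⁻ a, M (a, b, c) ∂μA ∂μB ∂μC := by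
  calc ∫⁻ a, ∫⁻ b, ∫⁻ c, M (a, b, c) ∂μC ∂μB ∂μA
      = ∫⁻ a, ∫⁻ c, ∫⁻ b, M (a, b, c) ∂μB ∂μC ∂μA :=
        lintegral_congr fun a => lintegral_lintegral_swap (by fun_prop)
    _ = ∫⁻ c, ∫⁻ a, ∫⁻ b, M (a, b, c) ∂μB ∂μA ∂μC := lintegral_lintegral_swap (by fun_prop)
    _ = _ := lintegral_congr fun c => lintegral_lintegral_swap (by fun_prop)

theorem lintegral_rotate (μA : Measure A) (μB : Measure B) (μC : Measure C) (μD : Measure D)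
    [SFinite μA] [SFinite μB] [SFinite μC] [SFinite μD] {M : A × B × C × D → ℝ≥0∞}
    (hM : Measurable M) :
    ∫⁻ a, ∫⁻ b, ∫⁻ c, ∫⁻ d, M (a, b, c, d) ∂μD ∂μC ∂μB ∂μA =
      ∫⁻ c, ∫⁻ a, ∫⁻ d, ∫⁻ b, M (a, b, c, d) ∂μB ∂μD ∂μA ∂μC := by
  calc ∫⁻ a, ∫⁻ b, ∫⁻ c, ∫⁻ d, M (a, b, c, d) ∂μD ∂μC ∂μB ∂μA
      = ∫⁻ a, ∫⁻ c, ∫⁻ b, ∫⁻ d, M (a, b, c, d) ∂μD ∂μB ∂μC ∂μA :=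
        lintegral_congr fun a => lintegral_lintegral_swap (by fun_prop)
    _ = ∫⁻ c, ∫⁻ a, ∫⁻ b, ∫⁻ d, M (a, b, c, d) ∂μD ∂μB ∂μA ∂μC :=
        lintegral_lintegral_swap (by fun_prop)
    _ = _ := lintegral_congr fun c => lintegral_congr fun a =>
        lintegral_lintegral_swap (by fun_prop)

end Swap

/-! ### Paths stopped at a forward event, parametrised from their first state. -/

section Forward

variable {E V Vr : Type*} [MeasurableSpace E] [MeasurableSpace V] [MeasurableSpace Vr]
  {μE : Measure E} {μV : Measure V} {μVr : Measure Vr} {X : PDMP E V μV} {Y : PDMP E Vr μVr}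

theorem lastTime_append_delay {a f : List (ℝ × V)} (hf : f ≠ []) (l : ℝ) :
    lastTime (a ++ delay l f) = lastTime f + l := by
  rw [lastTime_append_of_ne_nil _ (by simpa using hf), lastTime_delay l hf]

theorem eventsIn_Iic_append_delay {a f : List (ℝ × V)} {l : ℝ} (ha : ∀ e ∈ a, e.1 < l)
    (hf : ∀ e ∈ f, 0 < e.1) : eventsIn (Iic l) 0 (a ++ delay l f) = a := by
  rw [eventsIn_append, eventsIn_eq_self fun e he => (ha e he).le, eventsIn_eq_nil, List.append_nil]
  rw [forall_mem_delay (p := fun t => t ∉ Iic l)]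
  intro e he
  simpa using hf e he

theorem eventsIn_Ioi_append_delay {a f : List (ℝ × V)} {l : ℝ} (ha : ∀ e ∈ a, e.1 < l)
    (hf : ∀ e ∈ f, 0 < e.1) : eventsIn (Ioi l) l (a ++ delay l f) = f := by
  rw [eventsIn_append, eventsIn_eq_nil fun e he => by simpa using (ha e he).le, List.nil_append,
    eventsIn_eq_delay, delay_delay, add_neg_cancel, delay_zero]
  rw [forall_mem_delay (p := fun t => t ∈ Ioi l)]
  intro e he
  simpa using hf e he

theorem eventsIn_Iio_delay (c l : ℝ) (f : List (ℝ × V)) :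
    eventsIn (Iio (c + l)) 0 (delay l f) = delay l (eventsIn (Iio c) 0 f) := by
  induction f with
  | nil => simp [eventsIn]
  | cons e f ih =>
    have h1 := eventsIn_append (I := Iio (c + l)) (c := 0) (a := delay l [e]) (b := delay l f)
    have h2 := eventsIn_append (I := Iio c) (c := 0) (a := [e]) (b := f)
    rw [← delay_append, List.singleton_append] at h1
    rw [List.singleton_append] at h2
    rw [h1, h2, delay_append, ih]
    congr 1
    by_cases h : e.1 < c <;> simp [eventsIn, h]

namespace Sampler

variable (S : Sampler X Y)

/-- The paths, from their first point, that stop at their last event. -/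
def fwdStopped : Set (Skeleton E V) :=
  {w | w ∈ eventfulPaths E V ∧
    openCrit X S.criterion (w.1, eventsIn (Iio (lastTime w.2)) 0 w.2) ∧
    ¬ openCrit X S.criterion w}

variable {S}

theorem measurableSet_fwdStopped (hS : S.IsMeasurable) : MeasurableSet S.fwdStopped := by
  have h : Measurable fun w : Skeleton E V => (w.1, eventsIn (Iio (lastTime w.2)) 0 w.2) := by
    fun_prop
  exact measurableSet_eventfulPaths.inter (((measurableSet_openCrit hS.criterion).preimage h).inter
    (measurableSet_openCrit hS.criterion).compl)

open Classical in
/-- Up to the volume change, the density of the stopped paths around `z` is the weight. -/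
theorem fwd_density_eq (G : Skeleton E V × ℝ × ℝ → ℝ≥0∞) {l : ℝ} (hl : 0 < l) (y : E)
    (a f : List (ℝ × V)) :
    (if f ≠ [] ∧ S.reversal.toRev l (y, a) ∈ pathsIn E Vr (Ioo 0 l) then
      S.target (S.reversal.toRev l (y, a)).1 *
        (X.eventsDensity S.fwdRate (S.reversal.toRev l (y, a)).1 [] f *
          (ENNReal.ofReal (lastTime f / (l + lastTime f) ^ 2) *
            (Y.pathDensity S.bwdRate l (S.reversal.toRev l (y, a)) *
              S.stopTerm G l (lastTime f) (S.reversal.toRev l (y, a)).1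
                (S.reversal.toRev l (y, a)).2 f))) else 0) *
        (S.volumeChange l (S.reversal.toRev l (y, a)) : ℝ≥0∞)⁻¹ =
      if (∀ e ∈ a, e.1 < l) ∧ ∀ e ∈ f, 0 < e.1 then
        (if (y, a ++ delay l f) ∈ S.fwdStopped ∧ l ∈ Ioo 0 (lastTime (a ++ delay l f)) then
          S.weight (y, a ++ delay l f) (lastTime (a ++ delay l f)) l *
            fwdDensity (lastTime (a ++ delay l f)) l *
            G ((y, a ++ delay l f), lastTime (a ++ delay l f), l) else 0) else 0 := by
  have hmem : S.reversal.toRev l (y, a) ∈ pathsIn E Vr (Ioo 0 l) ↔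
      ((y, a) : Skeleton E V) ∈ pathsIn E V (Ioo 0 l) := by
    rw [S.reversal.toRev_mem_pathsIn]
    have : (fun t => l - t) ⁻¹' Ioo 0 l = Ioo 0 l := by ext; simp [and_comm]
    rw [this]
  rw [hmem]
  -- Outside this set both sides vanish: on the left because the density of disordered events is
  -- zero, on the right because the stopped paths are ordered and l lies before their last event.
  by_cases hgood : (f ≠ [] ∧ ((y, a) : Skeleton E V) ∈ pathsIn E V (Ioo 0 l)) ∧
      Increasing f ∧ ∀ e ∈ f, 0 < e.1
  · obtain ⟨⟨hne, ha⟩, hfi, hf0⟩ := hgood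
    obtain ⟨hai, ha'⟩ := ha
    have hal : ∀ e ∈ a, e.1 < l := fun e he => (ha' e he).2
    have hu : 0 < lastTime f := lastTime_pos hne hf0
    rw [if_pos ⟨hne, hai, ha'⟩, if_pos ⟨hal, hf0⟩, lastTime_append_delay hne]
    have hlt : l ∈ Ioo 0 (lastTime f + l) := ⟨hl, by linarith⟩
    have hev : ((y, a ++ delay l f) : Skeleton E V) ∈ eventfulPaths E V := by
      refine ⟨by simp [hne], increasing_append.2 ⟨hai, increasing_delay.2 hfi, ?_⟩, ?_⟩
      · intro x hx
        rw [forall_mem_delay (p := fun t => x.1 < t)]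
        intro e he
        linarith [hal x hx, hf0 e he]
      · intro e he
        rcases List.mem_append.1 he with he | he
        · exact (ha' e he).1
        · have := forall_mem_delay (p := fun t => 0 < t) (c := l) (es := f)
          exact this.2 (fun e he => by linarith [hf0 e he]) e he
    -- The backward part is the reversal of the first part of the path, so joining turns it back:
    -- the stopped path is the original one, whatever l.
    have hj : ∀ g, S.reversal.join l (S.reversal.toRev l (y, a)).1 (S.reversal.toRev l (y, a)).2 g =
        (y, a ++ delay l g) := by
      intro g
      rw [S.reversal.join_eq, Prod.mk.eta, S.reversal.toFwd_toRev]
    have hb : eventsIn (Iio l) 0 (S.reversal.toRev l (y, a)).2 = (S.reversal.toRev l (y, a)).2 :=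
      eventsIn_eq_self fun e he => ((hmem.2 ⟨hai, ha'⟩).2 e he).2
    have h_isStop : IsStop S.reversal S.criterion l (lastTime f) (S.reversal.toRev l (y, a)).1
        (S.reversal.toRev l (y, a)).2 f ↔ (y, a ++ delay l f) ∈ S.fwdStopped := by
      rw [IsStop, hb, hj, hj, fwdStopped, mem_ofPred_eq]
      simp only [hev, true_and, lastTime_append_delay hne]
      rw [eventsIn_append, eventsIn_Iio_delay, eventsIn_eq_self (es := a)]
      intro e he
      exact (hal e he).trans (by linarith)
    have hw : S.weight (y, a ++ delay l f) (lastTime f + l) l =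
        S.target (S.reversal.toRev l (y, a)).1 *
          Y.pathDensity S.bwdRate l (S.reversal.toRev l (y, a)) *
          X.eventsDensity S.fwdRate (S.reversal.toRev l (y, a)).1 [] f *
          (S.volumeChange l (S.reversal.toRev l (y, a)) : ℝ≥0∞)⁻¹ := by
      have hp : X.position (y, a ++ delay l f) l = (S.reversal.toRev l (y, a)).1 := by
        rw [PDMP.position, eventsIn_Iic_append_delay hal hf0]
        rfl
      rw [weight, hp, eventsIn_Iic_append_delay hal hf0, eventsIn_Ioi_append_delay hal hf0,
        add_sub_cancel_right]
      have := X.pathDensity_lastTime S.fwdRate ((S.reversal.toRev l (y, a)).1, f)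
      rw [this]
    -- The Jacobian of the substitution of α is half the proposal density.
    have hd : fwdDensity (lastTime f + l) l =
        ENNReal.ofReal (lastTime f / (l + lastTime f) ^ 2) := by
      rw [fwdDensity, add_sub_cancel_right, add_comm l]
    by_cases hs : (y, a ++ delay l f) ∈ S.fwdStopped
    · rw [if_pos ⟨hs, hlt⟩, stopTerm, if_pos (h_isStop.2 hs), hj, hw, hd, add_comm l]
      ring
    · rw [if_neg fun h => hs h.1, stopTerm, if_neg fun h => hs (h_isStop.1 h)]
      simp
  · have hL : (if f ≠ [] ∧ ((y, a) : Skeleton E V) ∈ pathsIn E V (Ioo 0 l) then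
      S.target (S.reversal.toRev l (y, a)).1 *
        (X.eventsDensity S.fwdRate (S.reversal.toRev l (y, a)).1 [] f *
          (ENNReal.ofReal (lastTime f / (l + lastTime f) ^ 2) *
            (Y.pathDensity S.bwdRate l (S.reversal.toRev l (y, a)) *
              S.stopTerm G l (lastTime f) (S.reversal.toRev l (y, a)).1
                (S.reversal.toRev l (y, a)).2 f))) else 0) = 0 := by
      split_ifs with h
      · have h0 : X.eventsDensity S.fwdRate (S.reversal.toRev l (y, a)).1 [] f = 0 := by
          by_contra h0
          obtain ⟨h1, h2⟩ := X.increasing_of_eventsDensity_ne_zero h0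
          exact hgood ⟨h, h1, by simpa using h2⟩
        rw [h0, zero_mul, mul_zero]
      · rfl
    rw [hL, zero_mul]
    split_ifs with h1 h2
    · exfalso
      apply hgood
      obtain ⟨⟨⟨h3, h4⟩, _⟩, h5⟩ := h2
      obtain ⟨h6, h7⟩ := h4
      obtain ⟨h8, h9, _⟩ := increasing_append.1 h6
      refine ⟨⟨?_, h8, fun e he => ⟨h7 e (List.mem_append_left _ he), h1.1 e he⟩⟩,
        increasing_delay.1 h9, h1.2⟩
      rintro rfl
      simp only [delay_nil, List.append_nil] at h3 h5
      obtain ⟨e, he, he'⟩ := exists_mem_lastTime h3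
      have := h1.1 e he
      linarith [h5.2]
    · rfl
    · rfl

theorem measurable_fwd_integrand (hS : S.IsMeasurable) {G : Skeleton E V × ℝ × ℝ → ℝ≥0∞}
    (hG : Measurable G) : Measurable fun p : E × ℝ × List (ℝ × V) => open Classical in
      if (p.1, p.2.2) ∈ S.fwdStopped ∧ p.2.1 ∈ Ioo 0 (lastTime p.2.2) then
        S.weight (p.1, p.2.2) (lastTime p.2.2) p.2.1 * fwdDensity (lastTime p.2.2) p.2.1 *
          G ((p.1, p.2.2), lastTime p.2.2, p.2.1) else 0 := by
  classical
  have h1 : Measurable fun p : E × ℝ × List (ℝ × V) => (p.1, p.2.2) := by fun_prop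
  have h2 : Measurable fun p : E × ℝ × List (ℝ × V) =>
    (((p.1, p.2.2) : Skeleton E V), lastTime p.2.2, p.2.1) := by fun_prop
  have h3 : Measurable fun p : E × ℝ × List (ℝ × V) => p.2.1 := by fun_prop
  have h4 : Measurable fun p : E × ℝ × List (ℝ × V) => lastTime p.2.2 := by fun_prop
  refine Measurable.ite (((measurableSet_fwdStopped hS).preimage h1).inter
    ((measurableSet_lt measurable_const h3).inter (measurableSet_lt h3 h4))) ?_ measurable_const
  exact ((hS.weight.comp h2).mul (by fun_prop)).mul (hG.comp h2)

variable [SigmaFinite μE] [SigmaFinite μV] [SigmaFinite μVr]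

/-- Change of variables by the path reversal. -/
theorem lintegral_toRev_inv (hψ : ContinuousVolumeChange S.reversal μE S.volumeChange) {l : ℝ}
    (hl : 0 ≤ l) {K : Skeleton E Vr → ℝ≥0∞} (hK : Measurable K)
    (h0 : ∀ w, w ∉ pathsIn E Vr (Ioo 0 l) → K w = 0) :
    ∫⁻ w, K w ∂canonicalMeasure μE μVr = ∫⁻ w, K (S.reversal.toRev l w) *
      (S.volumeChange l (S.reversal.toRev l w) : ℝ≥0∞)⁻¹ ∂canonicalMeasure μE μV := by
  have hvm := Reversal.measurable_volumeChange_apply hψ l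
  have h := hψ.change l hl (fun w => K w * (S.volumeChange l w : ℝ≥0∞)⁻¹) (hK.mul hvm.inv)
  have hp : MeasurableSet (pathsIn E Vr (Ioo 0 l)) := measurableSet_pathsIn measurableSet_Ioo
  have hp' : MeasurableSet (pathsIn E V (Ioo 0 l)) := measurableSet_pathsIn measurableSet_Ioo
  have e1 : ∫⁻ w in pathsIn E Vr (Ioo 0 l), K w * (S.volumeChange l w : ℝ≥0∞)⁻¹ *
      S.volumeChange l w ∂canonicalMeasure μE μVr = ∫⁻ w, K w ∂canonicalMeasure μE μVr := by
    rw [← lintegral_indicator hp]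
    refine lintegral_congr fun w => ?_
    by_cases hw : w ∈ pathsIn E Vr (Ioo 0 l)
    · rw [indicator_of_mem hw, mul_assoc, ENNReal.inv_mul_cancel, mul_one]
      · exact (ENNReal.coe_pos.2 (hψ.pos l w ⟨hw.1, fun e he => Ioo_subset_Ioc_self (hw.2 e he)⟩
          hl)).ne'
      · exact ENNReal.coe_ne_top
    · rw [indicator_of_notMem hw, h0 w hw]
  rw [← e1, ← h, ← lintegral_indicator hp']
  refine lintegral_congr fun w => ?_
  by_cases hw : w ∈ pathsIn E V (Ioo 0 l)
  · rw [indicator_of_mem hw]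
  · rw [indicator_of_notMem hw, h0, zero_mul]
    rw [S.reversal.toRev_mem_pathsIn]
    have : (fun t => l - t) ⁻¹' Ioo 0 l = Ioo 0 l := by ext; simp [and_comm]
    rwa [this]

-- Exchanges the point of view of the sampler, a state z at offset l with its backward and forward
-- events, for that of a whole path w with an offset l on it. The measure on w and the stopping
-- condition no longer involve l, so what remains is the unnormalised law of the offset given the
-- path.
open Classical in
theorem lintegral_target_stopsForward (hS : S.IsMeasurable)
    (hψ : ContinuousVolumeChange S.reversal μE S.volumeChange)
    {G : Skeleton E V × ℝ × ℝ → ℝ≥0∞} (hG : Measurable G) :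
    ∫⁻ z, S.target z * ∫⁻ f, X.eventsDensity S.fwdRate z [] f * (if f ≠ [] then
        ∫⁻ l in Ioi (0 : ℝ), ENNReal.ofReal (lastTime f / (l + lastTime f) ^ 2) *
          ∫⁻ b in {b | (z, b) ∈ pathsIn E Vr (Ioo 0 l)}, Y.pathDensity S.bwdRate l (z, b) *
            S.stopTerm G l (lastTime f) z b f ∂listSum ((volume : Measure ℝ).prod μVr) else 0)
        ∂listSum ((volume : Measure ℝ).prod μV) ∂μE =
      ∫⁻ w in S.fwdStopped, ∫⁻ l in Ioo 0 (lastTime w.2), S.weight w (lastTime w.2) l *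
        fwdDensity (lastTime w.2) l * G (w, lastTime w.2, l) ∂volume ∂canonicalMeasure μE μV := by
  set K : E × List (ℝ × V) × ℝ × List (ℝ × Vr) → ℝ≥0∞ := fun p =>
    if p.2.1 ≠ [] ∧ ((p.1, p.2.2.2) : Skeleton E Vr) ∈ pathsIn E Vr (Ioo 0 p.2.2.1) then
      S.target p.1 * (X.eventsDensity S.fwdRate p.1 [] p.2.1 *
        (ENNReal.ofReal (lastTime p.2.1 / (p.2.2.1 + lastTime p.2.1) ^ 2) *
          (Y.pathDensity S.bwdRate p.2.2.1 (p.1, p.2.2.2) *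
            S.stopTerm G p.2.2.1 (lastTime p.2.1) p.1 p.2.2.2 p.2.1))) else 0 with hKdef
  have hst : Measurable fun p : E × List (ℝ × V) × ℝ × List (ℝ × Vr) =>
      S.stopTerm G p.2.2.1 (lastTime p.2.1) p.1 p.2.2.2 p.2.1 :=
    measurable_stopTerm hS hG (by fun_prop) (by fun_prop) (by fun_prop) (by fun_prop) (by fun_prop)
  have hK : Measurable K := by
    have h1 : Measurable fun p : E × List (ℝ × V) × ℝ × List (ℝ × Vr) =>
      (p.2.2.1, ((p.1, p.2.2.2) : Skeleton E Vr)) := by fun_prop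
    have h2 := measurableSet_mem_pathsIn (E := E) (V := Vr) (S := ℝ) (I := fun l => Ioo 0 l)
      ((measurableSet_lt measurable_const measurable_snd).inter
        (measurableSet_lt measurable_snd measurable_fst))
    refine Measurable.ite ((measurableSet_ne_nil.preimage (show Measurable
      fun p : E × List (ℝ × V) × ℝ × List (ℝ × Vr) => p.2.1 by fun_prop)).inter
      (h2.preimage h1)) ?_ measurable_const
    have h3 : Measurable fun p : E × List (ℝ × V) × ℝ × List (ℝ × Vr) =>
      X.eventsDensity S.fwdRate p.1 [] p.2.1 := (X.measurable_eventsDensity S.fwdRate).comp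
        (show Measurable fun p : E × List (ℝ × V) × ℝ × List (ℝ × Vr) => (p.1, p.2.1) by fun_prop)
    have h4 : Measurable fun p : E × List (ℝ × V) × ℝ × List (ℝ × Vr) => (S.target p.1 : ℝ≥0∞) :=
      (hS.target.comp measurable_fst).coe_nnreal_ennreal
    exact h4.mul (h3.mul (Measurable.mul (by fun_prop) (Measurable.mul (by fun_prop) hst)))
  set H : E × ℝ × List (ℝ × V) → ℝ≥0∞ := fun p =>
      if (p.1, p.2.2) ∈ S.fwdStopped ∧ p.2.1 ∈ Ioo 0 (lastTime p.2.2) then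
        S.weight (p.1, p.2.2) (lastTime p.2.2) p.2.1 * fwdDensity (lastTime p.2.2) p.2.1 *
          G ((p.1, p.2.2), lastTime p.2.2, p.2.1) else 0 with hHdef
  have hH : Measurable H := measurable_fwd_integrand hS hG
  set LV := listSum ((volume : Measure ℝ).prod μV) with hLV
  set LR := listSum ((volume : Measure ℝ).prod μVr) with hLR
  calc _ = ∫⁻ z, ∫⁻ f, ∫⁻ l in Ioi (0 : ℝ), ∫⁻ b, K (z, f, l, b) ∂LR ∂volume ∂LV ∂μE := by
        refine lintegral_congr fun z => ?_
        rw [← lintegral_const_mul' _ _ ENNReal.coe_ne_top]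
        refine lintegral_congr fun f => ?_
        by_cases hf : f = []
        · simp [hf, hKdef]
        rw [if_pos hf, ← lintegral_const_mul' _ _ (X.eventsDensity_ne_top _ _ _ _),
          ← lintegral_const_mul' _ _ ENNReal.coe_ne_top]
        refine lintegral_congr fun l => ?_
        rw [← lintegral_const_mul' _ _ ENNReal.ofReal_ne_top,
          ← lintegral_const_mul' _ _ (X.eventsDensity_ne_top _ _ _ _),
          ← lintegral_const_mul' _ _ ENNReal.coe_ne_top,
          ← lintegral_indicator (measurableSet_skeleton_pathsIn z measurableSet_Ioo)]
        refine lintegral_congr fun b => ?_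
        simp only [hKdef, indicator, mem_ofPred_eq, ne_eq, hf, not_false_eq_true, true_and]
    _ = ∫⁻ l in Ioi (0 : ℝ), ∫⁻ f, ∫⁻ z, ∫⁻ b, K (z, f, l, b) ∂LR ∂μE ∂LV :=
        lintegral_swap_first_third μE LV _ (M := fun p => ∫⁻ b, K (p.1, p.2.1, p.2.2, b) ∂LR)
          (by fun_prop)
    -- For fixed l and f, the change of variables R_l from (y, a) to (z, b) brings in the inverse
    -- volume change, the last factor of the weight.
    _ = ∫⁻ l in Ioi (0 : ℝ), ∫⁻ f, ∫⁻ y, ∫⁻ a,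
          (if (∀ e ∈ a, e.1 < l) ∧ ∀ e ∈ f, 0 < e.1 then H (y, l, a ++ delay l f) else 0)
          ∂LV ∂μE ∂LV := by
        refine setLIntegral_congr_fun measurableSet_Ioi fun l hl => lintegral_congr fun f => ?_
        have h1 : Measurable fun w : Skeleton E Vr => K (w.1, f, l, w.2) := by fun_prop
        have h2 := lintegral_toRev_inv hψ (le_of_lt hl) h1 fun w hw => if_neg fun h => hw h.2
        have h3 : Measurable fun w : Skeleton E V =>
            (S.volumeChange l (S.reversal.toRev l w) : ℝ≥0∞)⁻¹ :=
          ((Reversal.measurable_volumeChange_apply hψ l).comp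
            (S.reversal.measurable_toRev_apply l)).inv
        rw [canonicalMeasure_eq, canonicalMeasure_eq, lintegral_prod _ h1.aemeasurable,
          lintegral_prod _ (by
            exact ((h1.comp (S.reversal.measurable_toRev_apply l)).mul h3).aemeasurable)] at h2
        refine h2.trans (lintegral_congr fun y => lintegral_congr fun a => ?_)
        exact fwd_density_eq G hl y a f
    _ = ∫⁻ y, ∫⁻ l in Ioi (0 : ℝ), ∫⁻ a, ∫⁻ f,
          (if (∀ e ∈ a, e.1 < l) ∧ ∀ e ∈ f, 0 < e.1 then H (y, l, a ++ delay l f) else 0)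
          ∂LV ∂LV ∂volume ∂μE := by
        refine lintegral_rotate (volume.restrict (Ioi 0)) LV μE LV
          (M := fun p => if (∀ e ∈ p.2.2.2, e.1 < p.1) ∧ ∀ e ∈ p.2.1, 0 < e.1 then
            H (p.2.2.1, p.1, p.2.2.2 ++ delay p.1 p.2.1) else 0) ?_
        refine Measurable.ite ((measurableSet_forall_lt (by fun_prop) (by fun_prop)).inter ?_)
          (by fun_prop) measurable_const
        exact ((measurableSet_forall_time (S := Unit) (I := fun _ => Ioi (0 : ℝ))
          (measurableSet_lt measurable_const measurable_snd))).preimage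
          (show Measurable fun p : ℝ × List (ℝ × V) × E × List (ℝ × V) => ((), p.2.1) by fun_prop)
    -- The events a before l and f after l are reassembled into one list; no event is at l, up to a
    -- null set.
    _ = ∫⁻ y, ∫⁻ l in Ioi (0 : ℝ), ∫⁻ es, H (y, l, es) ∂LV ∂volume ∂μE := by
        refine lintegral_congr fun y => lintegral_congr fun l => ?_
        refine lintegral_append_delay μV l (h := fun es => H (y, l, es)) (by fun_prop) ?_
        intro es hes
        by_contra hi
        exact hes (if_neg fun h => hi h.1.1.2.1)
    _ = ∫⁻ y, ∫⁻ es, ∫⁻ l in Ioi (0 : ℝ), H (y, l, es) ∂volume ∂LV ∂μE :=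
        lintegral_congr fun y => lintegral_lintegral_swap (by fun_prop)
    _ = _ := by
        have h1 : Measurable fun w : Skeleton E V => ∫⁻ l in Ioi (0 : ℝ), H (w.1, l, w.2) := by
          fun_prop
        rw [← lintegral_indicator (measurableSet_fwdStopped hS), canonicalMeasure_eq]
        refine (lintegral_prod _ h1.aemeasurable).symm.trans (lintegral_congr fun w => ?_)
        by_cases hw : w ∈ S.fwdStopped
        · rw [indicator_of_mem hw, ← lintegral_indicator measurableSet_Ioi,
            ← lintegral_indicator measurableSet_Ioo]
          refine lintegral_congr fun l => ?_
          simp only [hHdef, indicator, mem_Ioi, hw, true_and]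
          by_cases hl : l ∈ Ioo 0 (lastTime w.2)
          · rw [if_pos hl.1, if_pos hl]
          · rw [if_neg hl, ite_self]
        · rw [indicator_of_notMem hw]
          simp [hHdef, hw]

end Sampler

end Forward

/-! ### Paths stopped at a backward event, parametrised by their initial event. -/

section Backward

variable {E V Vr : Type*} [MeasurableSpace E] [MeasurableSpace V] [MeasurableSpace Vr]
  {μE : Measure E} {μV : Measure V} {μVr : Measure Vr} {X : PDMP E V μV} {Y : PDMP E Vr μVr}

theorem eventsIn_Iio_lastTime_concat {b : List (ℝ × V)} {e : ℝ × V} (h : Increasing (b ++ [e])) :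
    eventsIn (Iio e.1) 0 (b ++ [e]) = b := by
  obtain ⟨_, _, h3⟩ := increasing_append.1 h
  rw [eventsIn_append, eventsIn_eq_self fun x hx => h3 x hx e (by simp),
    eventsIn_eq_nil (by simp), List.append_nil]

/-- The path that starts with an event of mark `q.1` at the state `q.2.1`. -/
def startWith (q : V × E × List (ℝ × V) × ℝ) : Skeleton E V := (q.2.1, (0, q.1) :: q.2.2.1)

@[fun_prop]
theorem _root_.Measurable.startWith {T : Type*} [MeasurableSpace T]
    {f : T → V × E × List (ℝ × V) × ℝ} (hf : Measurable f) :
    Measurable fun x => startWith (f x) := by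
  unfold PathSampler.startWith; fun_prop

namespace Sampler

variable (S : Sampler X Y)

/-- The paths, starting with an event, that stop at that event when they are explored backwards from
a later point. -/
def bwdStopped : Set (V × E × List (ℝ × V) × ℝ) :=
  {q | q ∈ boundaryDomain E V ∧ openCrit X S.criterion (X.jump q.2.1 q.1, q.2.2.1) ∧
    ¬ openCrit X S.criterion (startWith q)}

variable {S}

theorem measurableSet_bwdStopped (hS : S.IsMeasurable) : MeasurableSet S.bwdStopped := by
  have h : Measurable fun q : V × E × List (ℝ × V) × ℝ => (X.jump q.2.1 q.1, q.2.2.1) := by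
    fun_prop
  have h' : Measurable fun q : V × E × List (ℝ × V) × ℝ => startWith q := by fun_prop
  exact measurableSet_boundaryDomain.inter (((measurableSet_openCrit hS.criterion).preimage h).inter
    ((measurableSet_openCrit hS.criterion).preimage h').compl)

-- Counterpart of `fwd_density_eq`. The explored backward path ends at an event, so it is the
-- reversal of a path of duration τ that starts with an event, and τ is at once the offset and the
-- time of its last event: there is no survival factor on the backward side.
open Classical in
theorem bwd_density_eq (G : Skeleton E V × ℝ × ℝ → ℝ≥0∞) (v : V) (y : E) (a f : List (ℝ × V))
    (τ T : ℝ) :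
    (if (v, y, a, τ) ∈ boundaryDomain E V ∧ τ < T ∧
        ((S.reversal.boundaryMap (v, y, a, τ)).1, f) ∈ pathsIn E V (Ioo 0 (T - τ)) then
      S.target (S.reversal.boundaryMap (v, y, a, τ)).1 *
        (Y.eventsDensity S.bwdRate (S.reversal.boundaryMap (v, y, a, τ)).1 []
            (S.reversal.boundaryMap (v, y, a, τ)).2 *
          (ENNReal.ofReal (lastTime (S.reversal.boundaryMap (v, y, a, τ)).2 /
              (T - τ + lastTime (S.reversal.boundaryMap (v, y, a, τ)).2) ^ 2) *
            (X.pathDensity S.fwdRate (T - τ) ((S.reversal.boundaryMap (v, y, a, τ)).1, f) *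
              S.stopTerm G (lastTime (S.reversal.boundaryMap (v, y, a, τ)).2) (T - τ)
                (S.reversal.boundaryMap (v, y, a, τ)).1 (S.reversal.boundaryMap (v, y, a, τ)).2
                f))) * (S.volumeChange τ (S.reversal.boundaryMap (v, y, a, τ)) : ℝ≥0∞)⁻¹
      else 0) =
      if (∀ e ∈ a, e.1 < τ) ∧ ∀ e ∈ f, 0 < e.1 then
        (if (v, y, a ++ delay τ f, T) ∈ S.bwdStopped ∧ τ ∈ Ioo 0 T then
          S.weight (startWith (v, y, a ++ delay τ f, T)) T τ * bwdDensity T τ *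
            G (startWith (v, y, a ++ delay τ f, T), T, τ) else 0) else 0 := by
  have hlast : lastTime (S.reversal.boundaryMap (v, y, a, τ)).2 = τ :=
    S.reversal.lastTime_boundaryMap _
  by_cases hgood : (v, y, a, τ) ∈ boundaryDomain E V ∧ τ < T ∧
        ((S.reversal.boundaryMap (v, y, a, τ)).1, f) ∈ pathsIn E V (Ioo 0 (T - τ))
  · rw [if_pos hgood]
    obtain ⟨hq, hτT, hf⟩ := hgood
    have hev := S.reversal.boundaryMap_mem_eventfulPaths hq
    obtain ⟨hτ, hai, ha⟩ := hq
    obtain ⟨hfi, hf'⟩ := hf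
    simp only at hτ hai ha hfi hf'
    have hal : ∀ e ∈ a, e.1 < τ := fun e he => (ha e he).2
    have hf0 : ∀ e ∈ f, 0 < e.1 := fun e he => (hf' e he).1
    have hal' : ∀ e ∈ (0, v) :: a, e.1 < τ := by
      intro e he
      rcases List.mem_cons.1 he with rfl | he
      · exact hτ
      · exact hal e he
    have hsw : startWith (v, y, a ++ delay τ f, T) = (y, ((0, v) :: a) ++ delay τ f) := rfl
    rw [if_pos ⟨hal, hf0⟩, hlast]
    have hdom : (v, y, a ++ delay τ f, T) ∈ boundaryDomain E V := by
      refine ⟨hτ.trans hτT, increasing_append.2 ⟨hai, increasing_delay.2 hfi, ?_⟩, ?_⟩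
      · intro x hx
        rw [forall_mem_delay (p := fun t => x.1 < t)]
        intro e he
        linarith [hal x hx, hf0 e he]
      · intro e he
        rcases List.mem_append.1 he with he | he
        · exact ⟨(ha e he).1, (hal e he).trans hτT⟩
        · have := forall_mem_delay (p := fun t => t ∈ Ioo 0 T) (c := τ) (es := f)
          exact this.2 (fun e he => ⟨by linarith [hf0 e he], by linarith [(hf' e he).2]⟩) e he
    have hfwd : S.reversal.toFwd τ (S.reversal.boundaryMap (v, y, a, τ)) = (y, (0, v) :: a) := by
      have h := S.reversal.toFwd_boundaryMap (v, y, a, τ)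
      rwa [hlast] at h
    have hj : ∀ g, S.reversal.join τ (S.reversal.boundaryMap (v, y, a, τ)).1
        (S.reversal.boundaryMap (v, y, a, τ)).2 g = (y, ((0, v) :: a) ++ delay τ g) := by
      intro g
      rw [S.reversal.join_eq, Prod.mk.eta, hfwd]
    -- Just before stopping, the last backward event is not yet seen. It is the reversal of the
    -- initial jump, so the path then starts in the state after that jump.
    have hj0 : S.reversal.join τ (S.reversal.boundaryMap (v, y, a, τ)).1
        (eventsIn (Iio τ) 0 (S.reversal.boundaryMap (v, y, a, τ)).2) f =
        (X.jump y v, a ++ delay τ f) := by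
      rcases List.eq_nil_or_concat (S.reversal.boundaryMap (v, y, a, τ)).2 with hnil | ⟨b, e, hb⟩
      · exact absurd hnil hev.1
      rw [List.concat_eq_append] at hb
      have he : e.1 = τ := by rw [← hlast, hb, lastTime_concat]
      have hi := hev.2.1
      have hj1 := hj f
      rw [hb] at hi hj1 ⊢
      rw [← he, eventsIn_Iio_lastTime_concat hi, he]
      obtain ⟨v', y', h1, h2⟩ := S.reversal.join_concat
        (S.reversal.boundaryMap (v, y, a, τ)).1 b e f
      rw [he] at h1 h2
      rw [hj1] at h1
      simp only [List.cons_append, Prod.mk.injEq, List.cons.injEq, true_and] at h1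
      obtain ⟨rfl, rfl, h3⟩ := h1
      rw [h2, h3]
    have hf1 : eventsIn (Iio (T - τ)) 0 f = f := eventsIn_eq_self fun e he => (hf' e he).2
    have h_isStop : IsStop S.reversal S.criterion τ (T - τ) (S.reversal.boundaryMap (v, y, a, τ)).1
        (S.reversal.boundaryMap (v, y, a, τ)).2 f ↔ (v, y, a ++ delay τ f, T) ∈ S.bwdStopped := by
      rw [IsStop, hf1, hj0, hj, bwdStopped, mem_ofPred_eq, hsw]
      simp only [hdom, true_and]
    have hw : S.weight (startWith (v, y, a ++ delay τ f, T)) T τ =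
        S.target (S.reversal.boundaryMap (v, y, a, τ)).1 *
          Y.eventsDensity S.bwdRate (S.reversal.boundaryMap (v, y, a, τ)).1 []
            (S.reversal.boundaryMap (v, y, a, τ)).2 *
          X.pathDensity S.fwdRate (T - τ) ((S.reversal.boundaryMap (v, y, a, τ)).1, f) *
          (S.volumeChange τ (S.reversal.boundaryMap (v, y, a, τ)) : ℝ≥0∞)⁻¹ := by
      have hp : X.position (y, ((0, v) :: a) ++ delay τ f) τ =
          (S.reversal.boundaryMap (v, y, a, τ)).1 := by
        rw [PDMP.position, eventsIn_Iic_append_delay hal' hf0]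
        rfl
      have hq := Y.pathDensity_lastTime S.bwdRate (S.reversal.boundaryMap (v, y, a, τ))
      rw [hlast] at hq
      rw [hsw, weight, hp, eventsIn_Iic_append_delay hal' hf0,
        eventsIn_Ioi_append_delay hal' hf0, ← hq]
      rfl
    have hd : bwdDensity T τ = ENNReal.ofReal (τ / (T - τ + τ) ^ 2) := by
      rw [bwdDensity, sub_add_cancel]
    by_cases hs : (v, y, a ++ delay τ f, T) ∈ S.bwdStopped
    · rw [if_pos ⟨hs, hτ, hτT⟩, stopTerm, if_pos (h_isStop.2 hs), hj, hw, hd, hsw,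
        add_sub_cancel τ T]
      ring
    · rw [if_neg fun h => hs h.1, stopTerm, if_neg fun h => hs (h_isStop.1 h)]
      simp
  · rw [if_neg hgood]
    split_ifs with h1 h2
    · exfalso
      obtain ⟨⟨⟨h3, h4, h5⟩, _⟩, h6⟩ := h2
      simp only at h3 h4 h5
      obtain ⟨h8, h9, _⟩ := increasing_append.1 h4
      refine hgood ⟨⟨h6.1, h8, fun e he => ⟨(h5 e (List.mem_append_left _ he)).1, h1.1 e he⟩⟩,
        h6.2, increasing_delay.1 h9, fun e he => ⟨h1.2 e he, ?_⟩⟩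
      have := forall_mem_delay (p := fun t => t ∈ Ioo 0 T) (c := τ) (es := f)
      have h10 := (this.1 fun e he => h5 e (List.mem_append_right _ he)) e he
      linarith [h10.2]
    · rfl
    · rfl

theorem measurable_bwd_integrand (hS : S.IsMeasurable) {G : Skeleton E V × ℝ × ℝ → ℝ≥0∞}
    (hG : Measurable G) : Measurable fun p : (V × E × List (ℝ × V) × ℝ) × ℝ => open Classical in
      if p.1 ∈ S.bwdStopped ∧ p.2 ∈ Ioo 0 p.1.2.2.2 then
        S.weight (startWith p.1) p.1.2.2.2 p.2 * bwdDensity p.1.2.2.2 p.2 *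
          G (startWith p.1, p.1.2.2.2, p.2) else 0 := by
  classical
  have h2 : Measurable fun p : (V × E × List (ℝ × V) × ℝ) × ℝ =>
    (startWith p.1, p.1.2.2.2, p.2) := by fun_prop
  have h4 : Measurable fun p : (V × E × List (ℝ × V) × ℝ) × ℝ => p.1.2.2.2 := by fun_prop
  refine Measurable.ite (((measurableSet_bwdStopped hS).preimage measurable_fst).inter
    ((measurableSet_lt measurable_const measurable_snd).inter
      (measurableSet_lt measurable_snd h4))) ?_ measurable_const
  exact ((hS.weight.comp h2).mul (by fun_prop)).mul (hG.comp h2)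

variable [SigmaFinite μE] [SigmaFinite μV] [SigmaFinite μVr]

/-- Boundary coordinates for backward paths that end at their last event, with the volume change at
that event given by `boundaryMeasure_eq_withDensity`. -/
theorem lintegral_eventfulPaths (hψ : ContinuousVolumeChange S.reversal μE S.volumeChange)
    {K : Skeleton E Vr → ℝ≥0∞} (hK : Measurable K) :
    ∫⁻ w in eventfulPaths E Vr, K w ∂canonicalMeasure μE μVr =
      ∫⁻ v, ∫⁻ z, ∫⁻ a, ∫⁻ T, (boundaryDomain E V).indicator (fun q =>
        K (S.reversal.boundaryMap q) *
          (S.volumeChange q.2.2.2 (S.reversal.boundaryMap q) : ℝ≥0∞)⁻¹) (v, z, a, T)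
        ∂volume ∂listSum ((volume : Measure ℝ).prod μV) ∂μE ∂μV := by
  have hm1 : Measurable fun w : Skeleton E Vr => (lastTime w.2, w) := by fun_prop
  have hm := (hψ.meas.comp hm1).coe_nnreal_ennreal
  simp only [Function.comp_def] at hm
  have hm' : Measurable fun w : Skeleton E Vr => K w * (S.volumeChange (lastTime w.2) w : ℝ≥0∞)⁻¹ :=
    hK.mul hm.inv
  have h1 : ∫⁻ w in eventfulPaths E Vr, K w ∂canonicalMeasure μE μVr =
      ∫⁻ w, K w * (S.volumeChange (lastTime w.2) w : ℝ≥0∞)⁻¹ ∂(S.reversal.boundaryMeasure μE) := by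
    rw [Reversal.boundaryMeasure_eq_withDensity hψ,
      lintegral_withDensity_eq_lintegral_mul _ hm hm']
    refine setLIntegral_congr_fun measurableSet_eventfulPaths fun w hw => ?_
    simp only [Pi.mul_apply]
    rw [mul_left_comm, ENNReal.mul_inv_cancel (Reversal.volumeChange_ne_zero hψ hw.2 le_rfl)
      ENNReal.coe_ne_top, mul_one]
  rw [h1, Reversal.lintegral_boundaryMeasure hm']
  simp only [S.reversal.lastTime_boundaryMap]

theorem lintegral_Ioi_eq_sub (τ : ℝ) (F : ℝ → ℝ≥0∞) :
    ∫⁻ r in Ioi (0 : ℝ), F r = ∫⁻ T, (Ioi τ).indicator (fun T => F (T - τ)) T := by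
  rw [← lintegral_indicator measurableSet_Ioi, ← lintegral_sub_right_eq_self _ τ]
  refine lintegral_congr fun T => ?_
  simp only [indicator, mem_Ioi, sub_pos]

-- Same exchange as in the forward case. A backward path cut at its last event has a free duration
-- τ, which becomes the offset, while the forward duration r becomes the total length T = τ + r;
-- hence the product measure over mark, state, events and length.
open Classical in
theorem lintegral_target_stopsBackward (hS : S.IsMeasurable)
    (hψ : ContinuousVolumeChange S.reversal μE S.volumeChange)
    {G : Skeleton E V × ℝ × ℝ → ℝ≥0∞} (hG : Measurable G) :
    ∫⁻ z, S.target z * ∫⁻ b, Y.eventsDensity S.bwdRate z [] b * (if b ≠ [] then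
        ∫⁻ r in Ioi (0 : ℝ), ENNReal.ofReal (lastTime b / (r + lastTime b) ^ 2) *
          ∫⁻ f in {f | (z, f) ∈ pathsIn E V (Ioo 0 r)}, X.pathDensity S.fwdRate r (z, f) *
            S.stopTerm G (lastTime b) r z b f ∂listSum ((volume : Measure ℝ).prod μV) else 0)
        ∂listSum ((volume : Measure ℝ).prod μVr) ∂μE =
      ∫⁻ q in S.bwdStopped, ∫⁻ l in Ioo 0 q.2.2.2, S.weight (startWith q) q.2.2.2 l *
        bwdDensity q.2.2.2 l * G (startWith q, q.2.2.2, l) ∂volume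
        ∂(μV.prod (μE.prod ((listSum ((volume : Measure ℝ).prod μV)).prod volume))) := by
  set K : Skeleton E Vr × ℝ × List (ℝ × V) → ℝ≥0∞ := fun p =>
    if ((p.1.1, p.2.2) : Skeleton E V) ∈ pathsIn E V (Ioo 0 p.2.1) then
      S.target p.1.1 * (Y.eventsDensity S.bwdRate p.1.1 [] p.1.2 *
        (ENNReal.ofReal (lastTime p.1.2 / (p.2.1 + lastTime p.1.2) ^ 2) *
          (X.pathDensity S.fwdRate p.2.1 (p.1.1, p.2.2) *
            S.stopTerm G (lastTime p.1.2) p.2.1 p.1.1 p.1.2 p.2.2))) else 0 with hKdef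
  have hst : Measurable fun p : Skeleton E Vr × ℝ × List (ℝ × V) =>
      S.stopTerm G (lastTime p.1.2) p.2.1 p.1.1 p.1.2 p.2.2 :=
    measurable_stopTerm hS hG (by fun_prop) (by fun_prop) (by fun_prop) (by fun_prop) (by fun_prop)
  have hK : Measurable K := by
    have h1 : Measurable fun p : Skeleton E Vr × ℝ × List (ℝ × V) =>
      (p.2.1, ((p.1.1, p.2.2) : Skeleton E V)) := by fun_prop
    have h2 := measurableSet_mem_pathsIn (E := E) (V := V) (S := ℝ) (I := fun l => Ioo 0 l)
      ((measurableSet_lt measurable_const measurable_snd).inter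
        (measurableSet_lt measurable_snd measurable_fst))
    refine Measurable.ite (h2.preimage h1) ?_ measurable_const
    have h3 : Measurable fun p : Skeleton E Vr × ℝ × List (ℝ × V) =>
      Y.eventsDensity S.bwdRate p.1.1 [] p.1.2 := (Y.measurable_eventsDensity S.bwdRate).comp
        measurable_fst
    have h4 : Measurable fun p : Skeleton E Vr × ℝ × List (ℝ × V) => (S.target p.1.1 : ℝ≥0∞) :=
      (hS.target.comp (measurable_fst.comp measurable_fst)).coe_nnreal_ennreal
    exact h4.mul (h3.mul (Measurable.mul (by fun_prop) (Measurable.mul (by fun_prop) hst)))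
  set H : (V × E × List (ℝ × V) × ℝ) × ℝ → ℝ≥0∞ := fun p =>
      if p.1 ∈ S.bwdStopped ∧ p.2 ∈ Ioo 0 p.1.2.2.2 then
        S.weight (startWith p.1) p.1.2.2.2 p.2 * bwdDensity p.1.2.2.2 p.2 *
          G (startWith p.1, p.1.2.2.2, p.2) else 0 with hHdef
  have hH : Measurable H := measurable_bwd_integrand hS hG
  set LV := listSum ((volume : Measure ℝ).prod μV) with hLV
  set LR := listSum ((volume : Measure ℝ).prod μVr) with hLR
  calc _ = ∫⁻ w in eventfulPaths E Vr, ∫⁻ r in Ioi (0 : ℝ), ∫⁻ f, K (w, r, f) ∂LV ∂volume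
          ∂canonicalMeasure μE μVr := by
        have h1 : Measurable fun w : Skeleton E Vr => (eventfulPaths E Vr).indicator
            (fun w => ∫⁻ r in Ioi (0 : ℝ), ∫⁻ f, K (w, r, f) ∂LV ∂volume) w :=
          Measurable.indicator (by fun_prop) measurableSet_eventfulPaths
        rw [← lintegral_indicator measurableSet_eventfulPaths, canonicalMeasure_eq,
          lintegral_prod _ h1.aemeasurable]
        refine lintegral_congr fun z => ?_
        rw [← lintegral_const_mul' _ _ ENNReal.coe_ne_top]
        refine lintegral_congr fun b => ?_
        by_cases hb : (z, b) ∈ eventfulPaths E Vr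
        · rw [indicator_of_mem hb, if_pos hb.1,
            ← lintegral_const_mul' _ _ (Y.eventsDensity_ne_top _ _ _ _),
            ← lintegral_const_mul' _ _ ENNReal.coe_ne_top]
          refine lintegral_congr fun r => ?_
          rw [← lintegral_const_mul' _ _ ENNReal.ofReal_ne_top,
            ← lintegral_const_mul' _ _ (Y.eventsDensity_ne_top _ _ _ _),
            ← lintegral_const_mul' _ _ ENNReal.coe_ne_top,
            ← lintegral_indicator (measurableSet_skeleton_pathsIn z measurableSet_Ioo)]
          refine lintegral_congr fun f => ?_
          simp only [hKdef, indicator, mem_ofPred_eq]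
        · rw [indicator_of_notMem hb]
          by_cases hne : b = []
          · simp [hne]
          have h0 : Y.eventsDensity S.bwdRate z [] b = 0 := by
            by_contra h0
            obtain ⟨h1, h2⟩ := Y.increasing_of_eventsDensity_ne_zero h0
            exact hb ⟨hne, h1, by simpa using h2⟩
          rw [h0, zero_mul, mul_zero]
    -- Passes to boundary coordinates for the backward path, then translates r = T - τ.
    _ = ∫⁻ v, ∫⁻ y, ∫⁻ a, ∫⁻ τ, ∫⁻ T, ∫⁻ f,
          (if (∀ e ∈ a, e.1 < τ) ∧ ∀ e ∈ f, 0 < e.1 then H ((v, y, a ++ delay τ f, T), τ) else 0)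
          ∂LV ∂volume ∂volume ∂LV ∂μE ∂μV := by
        rw [lintegral_eventfulPaths hψ (by fun_prop)]
        refine lintegral_congr fun v => lintegral_congr fun y => lintegral_congr fun a =>
          lintegral_congr fun τ => ?_
        have hKm : ∀ w, Measurable fun p : ℝ × List (ℝ × V) => K (w, p.1, p.2) := fun w => by
          fun_prop
        -- The density identity is read from right to left, so that the two sides can be compared
        -- term by term.
        simp only [hHdef, ← bwd_density_eq]
        by_cases hq : (v, y, a, τ) ∈ boundaryDomain E V
        · rw [indicator_of_mem hq, lintegral_Ioi_eq_sub τ]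
          set ψi : ℝ≥0∞ := (S.volumeChange τ (S.reversal.boundaryMap (v, y, a, τ)) : ℝ≥0∞)⁻¹
            with hψi
          have hfin : ψi ≠ ∞ := ENNReal.inv_ne_top.2 (Reversal.volumeChange_ne_zero hψ
            (S.reversal.boundaryMap_mem_eventfulPaths hq).2
            (S.reversal.lastTime_boundaryMap _).le)
          rw [← lintegral_mul_const' _ _ hfin]
          refine lintegral_congr fun T => ?_
          by_cases hT : τ < T
          · rw [indicator_of_mem (show T ∈ Ioi τ from hT), ← lintegral_mul_const' _ _ hfin]
            refine lintegral_congr fun f => ?_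
            simp only [hKdef, hq, hT, true_and, ite_mul, zero_mul]
          · rw [indicator_of_notMem (show T ∉ Ioi τ from hT)]
            simp [hT]
        · rw [indicator_of_notMem hq]
          simp [hq]
    _ = ∫⁻ v, ∫⁻ y, ∫⁻ T, ∫⁻ τ, ∫⁻ a, ∫⁻ f,
          (if (∀ e ∈ a, e.1 < τ) ∧ ∀ e ∈ f, 0 < e.1 then H ((v, y, a ++ delay τ f, T), τ) else 0)
          ∂LV ∂LV ∂volume ∂volume ∂μE ∂μV := by
        refine lintegral_congr fun v => lintegral_congr fun y => ?_
        have hm : Measurable fun p : (List (ℝ × V) × ℝ × ℝ) × List (ℝ × V) =>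
            (if (∀ e ∈ p.1.1, e.1 < p.1.2.1) ∧ ∀ e ∈ p.2, 0 < e.1 then
              H ((v, y, p.1.1 ++ delay p.1.2.1 p.2, p.1.2.2), p.1.2.1) else 0) := by
          refine Measurable.ite ((measurableSet_forall_lt (by fun_prop) (by fun_prop)).inter ?_)
            (by fun_prop) measurable_const
          exact ((measurableSet_forall_time (S := Unit) (I := fun _ => Ioi (0 : ℝ))
            (measurableSet_lt measurable_const measurable_snd))).preimage
            (show Measurable fun p : (List (ℝ × V) × ℝ × ℝ) × List (ℝ × V) => ((), p.2) by
              fun_prop)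
        exact lintegral_swap_first_third LV volume volume (M := fun p => ∫⁻ f,
          (if (∀ e ∈ p.1, e.1 < p.2.1) ∧ ∀ e ∈ f, 0 < e.1 then
            H ((v, y, p.1 ++ delay p.2.1 f, p.2.2), p.2.1) else 0) ∂LV) hm.lintegral_prod_right'
    _ = ∫⁻ v, ∫⁻ y, ∫⁻ T, ∫⁻ τ, ∫⁻ es, H ((v, y, es, T), τ) ∂LV ∂volume ∂volume ∂μE ∂μV := by
        refine lintegral_congr fun v => lintegral_congr fun y => lintegral_congr fun T =>
          lintegral_congr fun τ => ?_
        refine lintegral_append_delay μV τ (h := fun es => H ((v, y, es, T), τ)) (by fun_prop) ?_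
        intro es hes
        by_contra hi
        exact hes (if_neg fun h => hi h.1.1.2.1)
    _ = ∫⁻ v, ∫⁻ y, ∫⁻ es, ∫⁻ T, ∫⁻ τ, H ((v, y, es, T), τ) ∂volume ∂volume ∂LV ∂μE ∂μV := by
        refine lintegral_congr fun v => lintegral_congr fun y => ?_
        refine (lintegral_swap_first_third volume volume LV
          (M := fun p : ℝ × ℝ × List (ℝ × V) => H ((v, y, p.2.2, p.1), p.2.1)) (by fun_prop)).trans
          (lintegral_congr fun es => lintegral_lintegral_swap (by fun_prop))
    _ = ∫⁻ q, ∫⁻ τ, H (q, τ) ∂volume ∂(μV.prod (μE.prod (LV.prod volume))) := by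
        rw [lintegral_prod _ (by fun_prop)]
        refine lintegral_congr fun v => ?_
        rw [lintegral_prod _ (by fun_prop)]
        refine lintegral_congr fun y => ?_
        rw [lintegral_prod _ (by fun_prop)]
    _ = _ := by
        rw [← lintegral_indicator (measurableSet_bwdStopped hS)]
        refine lintegral_congr fun q => ?_
        by_cases hq : q ∈ S.bwdStopped
        · rw [indicator_of_mem hq, ← lintegral_indicator measurableSet_Ioo]
          refine lintegral_congr fun l => ?_
          simp only [hHdef, indicator, hq, true_and]
        · rw [indicator_of_notMem hq]
          simp [hHdef, hq]

end Sampler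

end Backward

/-! ### Invariance of the target under the simulation and the move. -/

section Invariance

variable {E V Vr : Type*} [MeasurableSpace E] [MeasurableSpace V] [MeasurableSpace Vr]
  {μE : Measure E} {μV : Measure V} {μVr : Measure Vr} {X : PDMP E V μV} {Y : PDMP E Vr μVr}

theorem ae_forall_time_ne (es : List (ℝ × V)) : ∀ᵐ l : ℝ, ∀ e ∈ es, e.1 ≠ l := by
  have h : ({l | ∃ e ∈ es, e.1 = l} : Set ℝ).Countable := by
    have : ({l | ∃ e ∈ es, e.1 = l} : Set ℝ) = Prod.fst '' {e | e ∈ es} := rfl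
    rw [this]
    exact (List.finite_toSet es).countable.image _
  filter_upwards [h.ae_notMem volume] with l hl e he h' using hl ⟨e, he, h'⟩

theorem lintegral_add_add {α : Type*} [MeasurableSpace α] {μ : Measure α} {f g h : α → ℝ≥0∞}
    (hf : Measurable f) (hg : Measurable g) :
    ∫⁻ a, (f a + g a + h a) ∂μ = ∫⁻ a, f a ∂μ + ∫⁻ a, g a ∂μ + ∫⁻ a, h a ∂μ := by
  rw [lintegral_add_left (by fun_prop), lintegral_add_left hf]

namespace Sampler

variable {S : Sampler X Y}

/-- An event at time 0 is allowed, since paths stopped backward have one; it is reversed to time l.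
This is why positivity of the volume change is needed with events up to the final time included.
That l is not an event time keeps the reversed events at positive times. -/
theorem toRev_eventsIn_mem {w : Skeleton E V} (hw : Increasing w.2) (h0 : ∀ e ∈ w.2, 0 ≤ e.1)
    {l : ℝ} (hne : ∀ e ∈ w.2, e.1 ≠ l) :
    S.reversal.toRev l (w.1, eventsIn (Iic l) 0 w.2) ∈ pathsIn E Vr (Ioc 0 l) := by
  rw [S.reversal.toRev_mem_pathsIn]
  refine ⟨increasing_eventsIn hw, fun e he => ?_⟩
  obtain ⟨h1, h2⟩ := mem_eventsIn_zero.1 he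
  exact ⟨sub_pos.2 (lt_of_le_of_ne h2 (hne e h1)), by linarith [h0 e h1]⟩

theorem volumeChange_ne_zero (hψ : ContinuousVolumeChange S.reversal μE S.volumeChange)
    {w : Skeleton E V} (hw : Increasing w.2) (h0 : ∀ e ∈ w.2, 0 ≤ e.1) {l : ℝ} (hl : 0 ≤ l)
    (hne : ∀ e ∈ w.2, e.1 ≠ l) :
    (S.volumeChange l (S.reversal.toRev l (w.1, eventsIn (Iic l) 0 w.2)) : ℝ≥0∞) ≠ 0 :=
  (ENNReal.coe_pos.2 (hψ.pos l _ (toRev_eventsIn_mem hw h0 hne) hl)).ne'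

theorem weight_ne_top (hψ : ContinuousVolumeChange S.reversal μE S.volumeChange)
    {w : Skeleton E V} (hw : Increasing w.2) (h0 : ∀ e ∈ w.2, 0 ≤ e.1) {l : ℝ} (hl : 0 ≤ l)
    (hne : ∀ e ∈ w.2, e.1 ≠ l) (T : ℝ) : S.weight w T l ≠ ∞ :=
  ENNReal.mul_ne_top (ENNReal.mul_ne_top (ENNReal.mul_ne_top ENNReal.coe_ne_top
    (Y.pathDensity_ne_top _ _ _)) (X.pathDensity_ne_top _ _ _))
    (ENNReal.inv_ne_top.2 (volumeChange_ne_zero hψ hw h0 hl hne))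

theorem ae_weight_ne_top (hψ : ContinuousVolumeChange S.reversal μE S.volumeChange)
    {w : Skeleton E V} (hw : Increasing w.2) (h0 : ∀ e ∈ w.2, 0 ≤ e.1) (T : ℝ) :
    ∀ᵐ l ∂volume.restrict (Icc 0 T), S.weight w T l ≠ ∞ := by
  filter_upwards [ae_restrict_of_ae (ae_forall_time_ne w.2), ae_restrict_mem measurableSet_Icc]
    with l hl hl'
  exact weight_ne_top hψ hw h0 hl'.1 hl T

/-- The move along a given path preserves the weight. -/
theorem lintegral_weight_moveLaw (hS : S.IsMeasurable)
    (hψ : ContinuousVolumeChange S.reversal μE S.volumeChange) {d : ℝ → ℝ → ℝ≥0∞}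
    (hd : Measurable fun q : ℝ × ℝ => d q.1 q.2) {w : Skeleton E V} (hw : Increasing w.2)
    (h0 : ∀ e ∈ w.2, 0 ≤ e.1) {T : ℝ} (h1 : ∫⁻ l in Icc 0 T, 2 * d T l = 1) {A : Set E}
    (hA : MeasurableSet A) :
    ∫⁻ l in Ioo 0 T, S.weight w T l * d T l * S.moveLaw d (w, T, l) A =
      ∫⁻ l in Ioo 0 T, S.weight w T l * d T l * A.indicator 1 (X.position w l) := by
  have hpos : Measurable fun l => A.indicator (1 : E → ℝ≥0∞) (X.position w l) :=
    (measurable_one.indicator hA).comp (by fun_prop)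
  have hdT : Measurable fun l => d T l := hd.comp (measurable_prodMk_left (x := T))
  rw [Measure.restrict_congr_set (μ := volume) (Ioo_ae_eq_Icc (a := (0 : ℝ)) (b := T))]
  rw [← lintegral_metropolis (measurable_weight_apply hS w T) hdT hpos
    (ae_weight_ne_top hψ hw h0 T) h1]
  refine lintegral_congr fun l => ?_
  rw [moveLaw_apply hS hd _ hA]

theorem events_of_fwdStopped {w : Skeleton E V} (hw : w ∈ S.fwdStopped) :
    Increasing w.2 ∧ (∀ e ∈ w.2, 0 ≤ e.1) ∧ 0 < lastTime w.2 :=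
  ⟨hw.1.2.1, fun e he => le_of_lt (hw.1.2.2 e he), lastTime_pos_of_eventful hw.1⟩

theorem events_of_bwdStopped {q : V × E × List (ℝ × V) × ℝ} (hq : q ∈ S.bwdStopped) :
    Increasing (startWith q).2 ∧ (∀ e ∈ (startWith q).2, 0 ≤ e.1) ∧ 0 < q.2.2.2 := by
  obtain ⟨⟨h1, h2, h3⟩, _⟩ := hq
  refine ⟨increasing_cons.2 ⟨fun a ha => (h3 a ha).1, h2⟩, fun e he => ?_, h1⟩
  rcases List.mem_cons.1 he with rfl | he
  · exact le_rfl
  · exact (h3 e he).1.le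

variable [SigmaFinite μE] [SigmaFinite μV] [SigmaFinite μVr]

/-- The law of the path stopped at a forward event, when the draw starts from the target. -/
theorem lintegral_stopped_forward (hS : S.IsMeasurable) (hc : X.IsConsistent S.criterion)
    (he : X.DependsOnlyOnEvents S.criterion)
    (hψ : ContinuousVolumeChange S.reversal μE S.volumeChange)
    {G : Skeleton E V × ℝ × ℝ → ℝ≥0∞} (hG : Measurable G) :
    ∫⁻ z, S.target z * ∫⁻ s, {s | S.Stops' s ∧ S.HitForward' s}.indicator
        (fun s => G (S.stopped s)) s ∂S.drawLaw z ∂μE =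
      ∫⁻ w in S.fwdStopped, ∫⁻ l in Ioo 0 (lastTime w.2), S.weight w (lastTime w.2) l *
        fwdDensity (lastTime w.2) l * G (w, lastTime w.2, l) ∂volume ∂canonicalMeasure μE μV := by
  rw [← lintegral_target_stopsForward hS hψ hG]
  refine lintegral_congr fun z => ?_
  rw [lintegral_stopsForward hS hc he (S.isDraw_drawLaw z) hG, lintegral_drawLaw_stopsForward hS hG]

/-- The law of the path stopped at a backward event, when the draw starts from the target. -/
theorem lintegral_stopped_backward (hS : S.IsMeasurable) (hc : X.IsConsistent S.criterion)
    (he : X.DependsOnlyOnEvents S.criterion)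
    (hψ : ContinuousVolumeChange S.reversal μE S.volumeChange)
    {G : Skeleton E V × ℝ × ℝ → ℝ≥0∞} (hG : Measurable G) :
    ∫⁻ z, S.target z * ∫⁻ s, {s | S.Stops' s ∧ ¬ S.HitForward' s}.indicator
        (fun s => G (S.stopped s)) s ∂S.drawLaw z ∂μE =
      ∫⁻ q in S.bwdStopped, ∫⁻ l in Ioo 0 q.2.2.2, S.weight (startWith q) q.2.2.2 l *
        bwdDensity q.2.2.2 l * G (startWith q, q.2.2.2, l) ∂volume
        ∂(μV.prod (μE.prod ((listSum ((volume : Measure ℝ).prod μV)).prod volume))) := by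
  rw [← lintegral_target_stopsBackward hS hψ hG]
  refine lintegral_congr fun z => ?_
  rw [lintegral_stopsBackward hS hc he (S.isDraw_drawLaw z) hG,
    lintegral_drawLaw_stopsBackward hS hG]

/-- Both sides are integrals against the joint law of the stopped path and its offset, and on each
fixed path they agree by Metropolis–Hastings balance. On the right, the point of the path at the
offset is the starting state. -/
theorem lintegral_moveLaw_forward (hS : S.IsMeasurable) (hc : X.IsConsistent S.criterion)
    (he : X.DependsOnlyOnEvents S.criterion)
    (hψ : ContinuousVolumeChange S.reversal μE S.volumeChange) {A : Set E}
    (hA : MeasurableSet A) :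
    ∫⁻ z, S.target z * ∫⁻ s, {s | S.Stops' s ∧ S.HitForward' s}.indicator
        (fun s => S.moveLaw fwdDensity (S.stopped s) A) s ∂S.drawLaw z ∂μE =
      ∫⁻ z, S.target z * ∫⁻ s, {s | S.Stops' s ∧ S.HitForward' s}.indicator
        (fun s => A.indicator 1 s.1) s ∂S.drawLaw z ∂μE := by
  have hd : Measurable fun q : ℝ × ℝ => fwdDensity q.1 q.2 := by fun_prop
  have hpos : Measurable fun p : Skeleton E V × ℝ × ℝ =>
      A.indicator (1 : E → ℝ≥0∞) (X.position p.1 p.2.2) :=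
    (measurable_one.indicator hA).comp (by fun_prop)
  have hset := (measurableSet_stops' hS).inter (measurableSet_hitForward' hS)
  have h1 := lintegral_stopped_forward hS hc he hψ
    ((Measure.measurable_coe hA).comp (measurable_moveLaw hS hd))
  have h2 := lintegral_stopped_forward hS hc he hψ hpos
  simp only [Function.comp_def] at h1
  rw [h1]
  refine Eq.trans ?_ (h2.symm.trans (lintegral_congr fun z => ?_))
  · refine setLIntegral_congr_fun (measurableSet_fwdStopped hS) fun w hw => ?_
    obtain ⟨h3, h4, h5⟩ := events_of_fwdStopped hw
    exact lintegral_weight_moveLaw hS hψ hd h3 h4 (lintegral_fwdDensity h5) hA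
  · congr 1
    refine lintegral_eq_of_regular (S.isDraw_drawLaw z)
      ((hpos.comp (measurable_stopped hS)).indicator hset)
      (((measurable_one.indicator hA).comp measurable_fst).indicator hset) fun s hs => ?_
    have hp := position_stopped (S := S) hs
    by_cases h : s ∈ {s | S.Stops' s ∧ S.HitForward' s}
    · rw [indicator_of_mem h, indicator_of_mem h, hp]
    · rw [indicator_of_notMem h, indicator_of_notMem h]

theorem lintegral_moveLaw_backward (hS : S.IsMeasurable) (hc : X.IsConsistent S.criterion)
    (he : X.DependsOnlyOnEvents S.criterion)
    (hψ : ContinuousVolumeChange S.reversal μE S.volumeChange) {A : Set E}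
    (hA : MeasurableSet A) :
    ∫⁻ z, S.target z * ∫⁻ s, {s | S.Stops' s ∧ ¬ S.HitForward' s}.indicator
        (fun s => S.moveLaw bwdDensity (S.stopped s) A) s ∂S.drawLaw z ∂μE =
      ∫⁻ z, S.target z * ∫⁻ s, {s | S.Stops' s ∧ ¬ S.HitForward' s}.indicator
        (fun s => A.indicator 1 s.1) s ∂S.drawLaw z ∂μE := by
  have hd : Measurable fun q : ℝ × ℝ => bwdDensity q.1 q.2 := by fun_prop
  have hpos : Measurable fun p : Skeleton E V × ℝ × ℝ =>
      A.indicator (1 : E → ℝ≥0∞) (X.position p.1 p.2.2) :=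
    (measurable_one.indicator hA).comp (by fun_prop)
  have hset := (measurableSet_stops' hS).inter (measurableSet_hitForward' hS).compl
  have h1 := lintegral_stopped_backward hS hc he hψ
    ((Measure.measurable_coe hA).comp (measurable_moveLaw hS hd))
  have h2 := lintegral_stopped_backward hS hc he hψ hpos
  simp only [Function.comp_def] at h1
  rw [h1]
  refine Eq.trans ?_ (h2.symm.trans (lintegral_congr fun z => ?_))
  · refine setLIntegral_congr_fun (measurableSet_bwdStopped hS) fun q hq => ?_
    obtain ⟨h3, h4, h5⟩ := events_of_bwdStopped hq
    exact lintegral_weight_moveLaw hS hψ hd h3 h4 (lintegral_bwdDensity h5) hA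
  · congr 1
    refine lintegral_eq_of_regular (S.isDraw_drawLaw z)
      ((hpos.comp (measurable_stopped hS)).indicator hset)
      (((measurable_one.indicator hA).comp measurable_fst).indicator hset) fun s hs => ?_
    have hp := position_stopped (S := S) hs
    by_cases h : s ∈ {s | S.Stops' s ∧ ¬ S.HitForward' s}
    · rw [indicator_of_mem h, indicator_of_mem h, hp]
    · rw [indicator_of_notMem h, indicator_of_notMem h]

/-- The simulation and the move leave the target invariant. -/
theorem invariant_outputKernel (hS : S.IsMeasurable) (hc : X.IsConsistent S.criterion)
    (he : X.DependsOnlyOnEvents S.criterion)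
    (hψ : ContinuousVolumeChange S.reversal μE S.volumeChange) :
    (S.outputKernel hS ∘ₖ S.drawLaw).Invariant (μE.withDensity fun z => (S.target z : ℝ≥0∞)) := by
  have ht : Measurable fun z => (S.target z : ℝ≥0∞) := hS.target.coe_nnreal_ennreal
  rw [Kernel.Invariant]
  ext A hA
  rw [Measure.bind_apply hA (Kernel.aemeasurable _),
    lintegral_withDensity_eq_lintegral_mul _ ht (Kernel.measurable_coe _ hA),
    withDensity_apply _ hA, ← lintegral_indicator hA]
  have hs := measurableSet_stops' hS
  have hh := measurableSet_hitForward' hS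
  have m1 : Measurable fun s => {s | S.Stops' s ∧ S.HitForward' s}.indicator
      (fun s => S.moveLaw fwdDensity (S.stopped s) A) s :=
    ((Measure.measurable_coe hA).comp ((measurable_moveLaw hS (by fun_prop)).comp
      (measurable_stopped hS))).indicator (hs.inter hh)
  have m2 : Measurable fun s => {s | S.Stops' s ∧ ¬ S.HitForward' s}.indicator
      (fun s => S.moveLaw bwdDensity (S.stopped s) A) s :=
    ((Measure.measurable_coe hA).comp ((measurable_moveLaw hS (by fun_prop)).comp
      (measurable_stopped hS))).indicator (hs.inter hh.compl)
  have mA : Measurable fun s : Draw E V Vr => A.indicator (1 : E → ℝ≥0∞) s.1 :=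
    (measurable_one.indicator hA).comp measurable_fst
  have i1 : Measurable fun s => {s | S.Stops' s ∧ S.HitForward' s}.indicator
      (fun s => A.indicator (1 : E → ℝ≥0∞) s.1) s := mA.indicator (hs.inter hh)
  have i2 : Measurable fun s => {s | S.Stops' s ∧ ¬ S.HitForward' s}.indicator
      (fun s => A.indicator (1 : E → ℝ≥0∞) s.1) s := mA.indicator (hs.inter hh.compl)
  have kd : ∀ {F : Draw E V Vr → ℝ≥0∞}, Measurable F →
      Measurable fun z => (S.target z : ℝ≥0∞) * ∫⁻ s, F s ∂S.drawLaw z := fun hF =>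
    ht.mul hF.lintegral_kernel
  have e1 : ∀ z, ((fun z => (S.target z : ℝ≥0∞)) * fun z => (S.outputKernel hS ∘ₖ S.drawLaw) z A) z =
      S.target z * (∫⁻ s, {s | S.Stops' s ∧ S.HitForward' s}.indicator
        (fun s => S.moveLaw fwdDensity (S.stopped s) A) s ∂S.drawLaw z) +
      S.target z * (∫⁻ s, {s | S.Stops' s ∧ ¬ S.HitForward' s}.indicator
        (fun s => S.moveLaw bwdDensity (S.stopped s) A) s ∂S.drawLaw z) +
      S.target z * ∫⁻ s, {s | ¬ S.Stops' s}.indicator (fun s => A.indicator 1 s.1) s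
        ∂S.drawLaw z := by
    intro z
    simp only [Pi.mul_apply, Kernel.comp_apply' _ _ _ hA, outputKernel_apply hS _ A hA]
    rw [lintegral_add_add m1 m2, mul_add, mul_add]
  have e2 : ∀ z, A.indicator (fun z => (S.target z : ℝ≥0∞)) z =
      S.target z * (∫⁻ s, {s | S.Stops' s ∧ S.HitForward' s}.indicator
        (fun s => A.indicator 1 s.1) s ∂S.drawLaw z) +
      S.target z * (∫⁻ s, {s | S.Stops' s ∧ ¬ S.HitForward' s}.indicator
        (fun s => A.indicator 1 s.1) s ∂S.drawLaw z) +
      S.target z * ∫⁻ s, {s | ¬ S.Stops' s}.indicator (fun s => A.indicator 1 s.1) s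
        ∂S.drawLaw z := by
    intro z
    rw [← mul_add, ← mul_add, ← lintegral_add_add i1 i2]
    have e3 : ∀ s : Draw E V Vr, {s | S.Stops' s ∧ S.HitForward' s}.indicator
        -- The three cases partition the draws, so without a move they add up to the law of the
        -- starting state.
        (fun s => A.indicator (1 : E → ℝ≥0∞) s.1) s +
        {s | S.Stops' s ∧ ¬ S.HitForward' s}.indicator (fun s => A.indicator 1 s.1) s +
        {s | ¬ S.Stops' s}.indicator (fun s => A.indicator 1 s.1) s = A.indicator 1 s.1 := by
      intro s
      by_cases h1 : S.Stops' s <;> by_cases h2 : S.HitForward' s <;> simp [indicator, h1, h2]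
    simp only [e3]
    rw [S.drawLaw_apply, lintegral_map mA measurable_prodMk_left]
    simp only [lintegral_const, measure_univ, mul_one]
    by_cases h : z ∈ A <;> simp [h]
  simp_rw [e1, e2]
  rw [lintegral_add_add (kd m1) (kd m2), lintegral_add_add (kd i1) (kd i2),
    lintegral_moveLaw_forward hS hc he hψ hA, lintegral_moveLaw_backward hS hc he hψ hA]

end Sampler

end Invariance

/-! ### The Markov property of the exact process in terms of path densities. -/

section Exact

variable {E V : Type*} [MeasurableSpace E] [MeasurableSpace V] {μV : Measure V}
  {X : PDMP E V μV} {A : SimRate E V}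

namespace PDMP

theorem IsExact.survival_eq (h : X.IsExact A) (w : Skeleton E V) (s : ℝ) :
    A.survival w s = X.exactRate.survival w s := by
  have h1 : ∫⁻ u in Ioc 0 s, (A.rate w u : ℝ≥0∞) =
      ∫⁻ u in Ioc 0 s, (X.exactRate.rate w u : ℝ≥0∞) :=
    setLIntegral_congr_fun measurableSet_Ioc fun u hu => by simp only [h w u hu.1.le]
  rw [SimRate.survival, SimRate.survival, h1]

theorem IsExact.eventDensity_eq (h : X.IsExact A) (w : Skeleton E V) (e : ℝ × V) :
    X.eventDensity A w e = X.eventDensity X.exactRate w e := by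
  rw [eventDensity, eventDensity]
  split_ifs with h1
  · rw [h.survival_eq, h _ _ (sub_pos.2 h1).le]
  · rfl

theorem IsExact.futureDensity_eq (h : X.IsExact A) (T : ℝ) (z : E) (past es : List (ℝ × V)) :
    X.futureDensity A T z past es = X.futureDensity X.exactRate T z past es := by
  induction es generalizing past with
  | nil => rw [futureDensity, futureDensity, h.survival_eq]
  | cons e es ih => rw [futureDensity, futureDensity, h.eventDensity_eq, ih]

theorem IsExact.pathDensity_eq (h : X.IsExact A) (T : ℝ) (w : Skeleton E V) :
    X.pathDensity A T w = X.pathDensity X.exactRate T w :=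
  h.futureDensity_eq T w.1 [] w.2

theorem last_concat (z : E) (past : List (ℝ × V)) (e : ℝ × V) :
    X.last (z, past ++ [e]) = X.afterEvent (X.last (z, past)) e := by
  simp [last]

theorem last_nil (z : E) : X.last (z, []) = (z, 0) := rfl

theorem survival_exactRate_congr {w w' : Skeleton E V} (h : (X.last w).1 = (X.last w').1) (s : ℝ) :
    X.exactRate.survival w s = X.exactRate.survival w' s := by
  simp only [SimRate.survival, exactRate, h]

/-- The Markov property of the exact process without events. -/
theorem survival_exactRate_add (w w' : Skeleton E V) {s t : ℝ} (hs : 0 ≤ s) (ht : 0 ≤ t)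
    (h : (X.last w').1 = X.flow s (X.last w).1) :
    X.exactRate.survival w (s + t) = X.exactRate.survival w s * X.exactRate.survival w' t := by
  have e1 : ∫⁻ u in Ioc 0 (s + t), (X.exactRate.rate w u : ℝ≥0∞) =
      (∫⁻ u in Ioc 0 s, (X.exactRate.rate w u : ℝ≥0∞)) +
        ∫⁻ u in Ioc 0 t, (X.exactRate.rate w' u : ℝ≥0∞) := by
    rw [← Ioc_union_Ioc_eq_Ioc hs (le_add_of_nonneg_right ht),
      lintegral_union measurableSet_Ioc (Ioc_disjoint_Ioc_of_le le_rfl)]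
    congr 1
    rw [← lintegral_indicator measurableSet_Ioc, ← lintegral_indicator measurableSet_Ioc,
      ← lintegral_add_left_eq_self _ s]
    refine lintegral_congr fun u => ?_
    have hiff : s + u ∈ Ioc s (s + t) ↔ u ∈ Ioc 0 t := by
      simp only [mem_Ioc]; constructor <;> rintro ⟨h1, h2⟩ <;> constructor <;> linarith
    by_cases hu : u ∈ Ioc 0 t
    · rw [indicator_of_mem hu, indicator_of_mem (hiff.2 hu)]
      simp only [exactRate]
      rw [h, flow_flow, add_comm s u]
    · rw [indicator_of_notMem hu, indicator_of_notMem (fun h' => hu (hiff.1 h'))]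
  rw [SimRate.survival, SimRate.survival, SimRate.survival, e1,
    ENNReal.toReal_add (X.exactRate.rate_finite _ _).ne (X.exactRate.rate_finite _ _).ne, neg_add,
    Real.exp_add, ENNReal.ofReal_mul (Real.exp_pos _).le]

theorem eventDensity_exactRate_delay {w w' : Skeleton E V} {c : ℝ}
    (h1 : (X.last w).1 = (X.last w').1) (h2 : (X.last w).2 = (X.last w').2 + c) (e : ℝ × V) :
    X.eventDensity X.exactRate w (e.1 + c, e.2) = X.eventDensity X.exactRate w' e := by
  have h3 : e.1 + c - (X.last w).2 = e.1 - (X.last w').2 := by rw [h2]; ring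
  have h4 : (X.last w).2 < e.1 + c ↔ (X.last w').2 < e.1 := by rw [h2, add_lt_add_iff_right]
  simp only [eventDensity, h3, h4, stateAt, h1, survival_exactRate_congr h1]
  simp only [exactRate, h1]

/-- The exact process is homogeneous, and depends on the past only through its last state. -/
theorem futureDensity_exactRate_delay {c : ℝ} (T : ℝ) (es : List (ℝ × V)) {z z' : E}
    {past past' : List (ℝ × V)} (h1 : (X.last (z, past)).1 = (X.last (z', past')).1)
    (h2 : (X.last (z, past)).2 = (X.last (z', past')).2 + c) :
    X.futureDensity X.exactRate (T + c) z past (delay c es) =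
      X.futureDensity X.exactRate T z' past' es := by
  induction es generalizing past past' with
  | nil =>
    rw [delay_nil, futureDensity, futureDensity, survival_exactRate_congr h1, h2]
    congr 1; ring
  | cons e es ih =>
    rw [delay_cons, futureDensity, futureDensity, eventDensity_exactRate_delay h1 h2]
    congr 1
    refine ih ?_ ?_
    · rw [last_concat, last_concat, afterEvent, afterEvent, h1, h2]
      simp only
      congr 2; ring
    · rw [last_concat, last_concat, afterEvent, afterEvent]

theorem futureDensity_append (T : ℝ) (z : E) (past a b : List (ℝ × V)) :
    X.futureDensity A T z past (a ++ b) =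
      X.eventsDensity A z past a * X.futureDensity A T z (past ++ a) b := by
  induction a generalizing past with
  | nil => simp [eventsDensity]
  | cons e a ih => simp [futureDensity, eventsDensity, ih, mul_assoc]

/-- The Markov property of the exact process. -/
theorem pathDensity_exactRate_append {y z : E} {a f : List (ℝ × V)} {l r : ℝ}
    (hl : lastTime a ≤ l) (hr : 0 ≤ r) (hf : ∀ e ∈ f, 0 < e.1) (hz : z = X.stateAt (y, a) l) :
    X.pathDensity X.exactRate (l + r) (y, a ++ delay l f) =
      X.pathDensity X.exactRate l (y, a) * X.pathDensity X.exactRate r (z, f) := by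
  have hl2 : (X.last (y, a)).2 = lastTime a := by rw [last_eq]
  have hs : 0 ≤ l - (X.last (y, a)).2 := by rw [hl2]; linarith
  have hadd : ∀ t, 0 ≤ t → X.exactRate.survival (y, a) (l - (X.last (y, a)).2 + t) =
      X.exactRate.survival (y, a) (l - (X.last (y, a)).2) * X.exactRate.survival (z, []) t :=
    fun t ht => survival_exactRate_add _ _ hs ht (by rw [last_nil, hz]; rfl)
  -- The waiting time running at l is cut there, and its survival factorises. After the next event,
  -- the two pasts lead to the same last state, up to the shift by l, and the densities coincide.
  have key : X.futureDensity X.exactRate (l + r) y a (delay l f) =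
      X.exactRate.survival (y, a) (l - lastTime a) * X.futureDensity X.exactRate r z [] f := by
    rw [← hl2]
    rcases f with _ | ⟨e, f⟩
    · rw [delay_nil, futureDensity, futureDensity, last_nil, sub_zero, ← hadd r hr]
      congr 1; ring
    · have he : 0 < e.1 := hf e (by simp)
      have h3 : e.1 + l - (X.last (y, a)).2 = l - (X.last (y, a)).2 + e.1 := by ring
      have h4 : X.stateAt (y, a) (e.1 + l) = X.stateAt (z, []) e.1 := by
        rw [stateAt_eq, stateAt_eq, hz, stateAt_eq, run_nil, flow_flow]
      have hev : X.eventDensity X.exactRate (y, a) (e.1 + l, e.2) =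
          X.exactRate.survival (y, a) (l - (X.last (y, a)).2) *
            X.eventDensity X.exactRate (z, []) e := by
        rw [eventDensity, eventDensity, if_pos (show (X.last (y, a)).2 < e.1 + l by linarith),
          if_pos (show (X.last (z, [])).2 < e.1 by rw [last_nil]; exact he)]
        simp only [h3, h4]
        rw [hadd _ he.le, last_nil, sub_zero]
        have h5 : X.exactRate.rate (y, a) (l - (X.last (y, a)).2 + e.1) =
            X.exactRate.rate (z, []) e.1 := by
          simp only [exactRate, last_nil]
          rw [hz, stateAt, flow_flow, add_comm e.1]
        rw [h5]
        ring
      rw [delay_cons, futureDensity, futureDensity, hev, mul_assoc]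
      congr 2
      rw [add_comm l r]
      refine futureDensity_exactRate_delay r f ?_ ?_
      · rw [last_concat, last_concat]
        change X.jump (X.stateAt (y, a) (e.1 + l)) e.2 = X.jump (X.stateAt (z, []) e.1) e.2
        rw [h4]
      · rw [last_concat, last_concat, afterEvent, afterEvent]
  rw [pathDensity, futureDensity_append, List.nil_append, key, X.pathDensity_eq, pathDensity]
  ring

/-- The density of a path of the exact process, with its first event put apart. -/
theorem pathDensity_exactRate_cons {y : E} {v : V} {a : List (ℝ × V)} {t : ℝ} (ht : 0 < t)
    (T : ℝ) :
    X.pathDensity X.exactRate (T + t) (X.flow (-t) y, (t, v) :: delay t a) =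
      X.rate y * X.exactRate.survival (X.flow (-t) y, []) t * X.markDensity y v *
        X.pathDensity X.exactRate T (X.jump y v, a) := by
  have h := futureDensity_exactRate_delay (X := X) (c := t) T a (z := X.flow (-t) y)
    (z' := X.jump y v) (past := [] ++ [(t, v)]) (past' := [])
    (by rw [last_concat, last_nil, last_nil, afterEvent]; simp)
    (by rw [last_concat, last_nil, last_nil, afterEvent]; simp)
  rw [pathDensity, futureDensity, h, eventDensity, last_nil, if_pos ht, pathDensity]
  simp [exactRate, last_nil, stateAt]

end PDMP

end Exact

/-! ### The density of the law of a path started from a given distribution. -/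

section PathLaw

variable {E V : Type*} [MeasurableSpace E] [MeasurableSpace V] {μE : Measure E} {μV : Measure V}
  [SigmaFinite μE] [SigmaFinite μV]

theorem measurable_mul_pathDensity (X : PDMP E V μV) (A : SimRate E V) {p : E → ℝ≥0}
    (hp : Measurable p) (T : ℝ) :
    Measurable fun w : Skeleton E V => (p w.1 : ℝ≥0∞) * X.pathDensity A T w :=
  (hp.comp measurable_fst).coe_nnreal_ennreal.mul (by fun_prop)

theorem PDMP.measurable_pathLaw (X : PDMP E V μV) (A : SimRate E V) (T : ℝ) :
    Measurable (X.pathLaw A T) := by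
  refine Measure.measurable_of_measurable_coe _ fun B hB => ?_
  have hR : MeasurableSet {ω : Trajectory E V | ω.Reaches T} :=
    measurableSet_reaches.preimage (measurable_prodMk_right (y := T))
  have hm : Measurable fun q : E × Trajectory E V => ((q.1, q.2.eventsUpTo T) : Skeleton E V) := by
    fun_prop
  have h := Kernel.measurable_kernel_prodMk_left (κ := X.trajectoryLaw A)
    ((hm hB).inter (measurable_snd hR))
  refine (congrArg Measurable (funext fun z => ?_)).mpr h
  have hz := hm.comp (measurable_prodMk_left (x := z))
  simp only [Function.comp_def] at hz
  rw [PDMP.pathLaw, Measure.map_apply hz hB, Measure.restrict_apply (hz hB)]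
  rfl

/-- Events up to T included may be taken in the open interval, as an event exactly at T has
probability zero. This puts the law on the domain where the volume change is given. -/
theorem lintegral_bind_pathLaw (X : PDMP E V μV) (A : SimRate E V) {p : E → ℝ≥0}
    (hp : Measurable p) {T : ℝ} (hT : 0 ≤ T) {F : Skeleton E V → ℝ≥0∞} (hF : Measurable F) :
    ∫⁻ w, F w ∂((μE.withDensity fun z => (p z : ℝ≥0∞)).bind (X.pathLaw A T)) =
      ∫⁻ w in pathsIn E V (Ioo 0 T), p w.1 * X.pathDensity A T w * F w
        ∂canonicalMeasure μE μV := by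
  have hm := measurable_mul_pathDensity X A hp T
  have hI := measurableSet_pathsIn (E := E) (V := V) (measurableSet_Ioo (a := (0 : ℝ)) (b := T))
  have hm' : Measurable fun w : Skeleton E V => (p w.1 : ℝ≥0∞) * X.pathDensity A T w * F w :=
    hm.mul hF
  have hc : Measurable fun z => ∫⁻ w, F w ∂X.pathLaw A T z :=
    (Measure.measurable_lintegral hF).comp (X.measurable_pathLaw A T)
  rw [Measure.lintegral_bind (X.measurable_pathLaw A T).aemeasurable hF.aemeasurable,
    lintegral_withDensity_eq_lintegral_mul _ hp.coe_nnreal_ennreal hc,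
    ← lintegral_indicator hI, canonicalMeasure_eq,
    lintegral_prod _ (hm'.indicator hI).aemeasurable]
  refine lintegral_congr fun z => ?_
  have hz : Measurable fun ω : Trajectory E V => ((z, ω.eventsUpTo T) : Skeleton E V) := by fun_prop
  have hg : Measurable fun es => F (z, es) := hF.comp measurable_prodMk_left
  simp only [Pi.mul_apply]
  rw [PDMP.pathLaw, lintegral_map hF hz, X.lintegral_trajectoryLaw_eventsUpTo A z hT hg,
    lintegral_pathDensity_Ioo, ← lintegral_const_mul' _ _ ENNReal.coe_ne_top,
    ← lintegral_indicator (measurableSet_skeleton_pathsIn z measurableSet_Ioo)]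
  refine lintegral_congr fun es => ?_
  by_cases h : (z, es) ∈ pathsIn E V (Ioo 0 T)
  · rw [indicator_of_mem h, indicator_of_mem (show es ∈ {b | (z, b) ∈ pathsIn E V (Ioo 0 T)} from h),
      mul_assoc]
  · rw [indicator_of_notMem h,
      indicator_of_notMem (show es ∉ {b | (z, b) ∈ pathsIn E V (Ioo 0 T)} from h)]

end PathLaw

/-! ### Time reversal as an identity between densities. -/

section TimeReversal

variable {E V Vr : Type*} [MeasurableSpace E] [MeasurableSpace V] [MeasurableSpace Vr]
  {μE : Measure E} {μV : Measure V} {μVr : Measure Vr} {X : PDMP E V μV} {Y : PDMP E Vr μVr}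
  {R : Reversal X Y} {ψ : ℝ → Skeleton E Vr → ℝ≥0} {p : E → ℝ≥0}
  [SigmaFinite μE] [SigmaFinite μV] [SigmaFinite μVr]

namespace Reversal

/-- The reversed path has the density of the backward process, up to the volume change. -/
def IsDensityReversal (R : Reversal X Y) (ψ : ℝ → Skeleton E Vr → ℝ≥0) (p : E → ℝ≥0) (T : ℝ)
    (w : Skeleton E Vr) : Prop :=
  (p w.1 : ℝ≥0∞) * Y.pathDensity Y.exactRate T w =
    ψ T w * (p (R.toFwd T w).1 * X.pathDensity X.exactRate T (R.toFwd T w))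

theorem measurableSet_isDensityReversal (hψ : ContinuousVolumeChange R μE ψ) (hp : Measurable p) :
    MeasurableSet {q : ℝ × Skeleton E Vr | R.IsDensityReversal ψ p q.1 q.2} := by
  have h1 : Measurable fun q : ℝ × Skeleton E Vr => (p q.2.1 : ℝ≥0∞) :=
    (hp.comp (by fun_prop)).coe_nnreal_ennreal
  have h2 : Measurable fun q : ℝ × Skeleton E Vr => (p (R.toFwd q.1 q.2).1 : ℝ≥0∞) :=
    (hp.comp (by fun_prop)).coe_nnreal_ennreal
  have h3 := hψ.meas.coe_nnreal_ennreal
  exact measurableSet_eq_fun (by fun_prop) (by fun_prop)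

/-- The laws of the backward path and of the reversed forward path agree. The first has an explicit
density; the volume change gives one for the second. Densities with respect to a sigma-finite
measure are unique. -/
theorem ae_isDensityReversal (hψ : ContinuousVolumeChange R μE ψ) (hp : Measurable p)
    (hR : R.IsTimeReversal (μE.withDensity fun z => (p z : ℝ≥0∞))) {T : ℝ} (hT : 0 < T) :
    ∀ᵐ w ∂canonicalMeasure μE μVr, w ∈ pathsIn E Vr (Ioo 0 T) → R.IsDensityReversal ψ p T w := by
  have hI := measurableSet_pathsIn (E := E) (V := Vr) (measurableSet_Ioo (a := (0 : ℝ)) (b := T))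
  rw [← ae_restrict_iff' hI]
  have hψT := measurable_volumeChange_apply hψ T
  have hX : Measurable fun w : Skeleton E Vr =>
      (p (R.toFwd T w).1 : ℝ≥0∞) * X.pathDensity X.exactRate T (R.toFwd T w) :=
    (measurable_mul_pathDensity X X.exactRate hp T).comp (R.measurable_toFwd_apply T)
  refine ae_eq_of_forall_setLIntegral_eq_of_sigmaFinite
    (measurable_mul_pathDensity Y Y.exactRate hp T) (hψT.mul hX) fun B hB _ => ?_
  have hF : Measurable (B.indicator (1 : Skeleton E Vr → ℝ≥0∞)) := measurable_one.indicator hB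
  have hF' : Measurable fun w => B.indicator (1 : Skeleton E Vr → ℝ≥0∞) (R.toRev T w) :=
    hF.comp (R.measurable_toRev_apply T)
  have e1 := lintegral_bind_pathLaw (μE := μE) Y Y.exactRate hp hT.le hF
  rw [← hR T hT, lintegral_map hF (R.measurable_toRev_apply T),
    lintegral_bind_pathLaw X X.exactRate hp hT.le hF'] at e1
  have e2 := hψ.change T hT.le (fun w => p (R.toFwd T w).1 *
    X.pathDensity X.exactRate T (R.toFwd T w) * B.indicator 1 w) (hX.mul hF)
  simp only [R.toFwd_toRev] at e2
  rw [← lintegral_indicator hB, ← lintegral_indicator hB]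
  have e3 : ∀ w, B.indicator (fun w => (p w.1 : ℝ≥0∞) * Y.pathDensity Y.exactRate T w) w =
      p w.1 * Y.pathDensity Y.exactRate T w * B.indicator 1 w := fun w => by
    by_cases h : w ∈ B <;> simp [h]
  have e4 : ∀ w, B.indicator (fun w => (ψ T w : ℝ≥0∞) * (p (R.toFwd T w).1 *
      X.pathDensity X.exactRate T (R.toFwd T w))) w = p (R.toFwd T w).1 *
      X.pathDensity X.exactRate T (R.toFwd T w) * B.indicator 1 w * ψ T w := fun w => by
    by_cases h : w ∈ B <;> simp [h, mul_comm]
  refine (lintegral_congr e3).trans ((e1.symm.trans e2).trans (lintegral_congr e4).symm)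

end Reversal

end TimeReversal

/-! ### Almost-everywhere properties of paths cut at a time. -/

section AlmostEverywhere

theorem measurableSet_ae {A B : Type*} [MeasurableSpace A] [MeasurableSpace B] {ν : Measure B}
    [SFinite ν] {Q : A → B → Prop} (hQ : MeasurableSet {x : A × B | Q x.1 x.2}) :
    MeasurableSet {x | ∀ᵐ y ∂ν, Q x y} :=
  (measurable_measure_prodMk_left (ν := ν) hQ.compl) (measurableSet_singleton 0)

variable {V : Type*} [MeasurableSpace V] {μV : Measure V} [SigmaFinite μV]

theorem ae_listSum_nil {α : Type*} [MeasurableSpace α] {μ : Measure α} {P : List α → Prop}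
    (hP : MeasurableSet {l | P l}) (h : ∀ᵐ l ∂listSum μ, P l) : P [] :=
  (ae_dirac_iff hP).1 (Measure.ae_sum_iff.1 h 0)

/-- A property of the sequences of events that are cut at time `t`. -/
theorem ae_append_delay (t : ℝ) {P : List (ℝ × V) → Prop} (hP : MeasurableSet {es | P es})
    (h : ∀ᵐ a ∂listSum ((volume : Measure ℝ).prod μV), ∀ f, (∀ e ∈ a, e.1 < t) →
      (∀ e ∈ f, 0 < e.1) → Increasing (a ++ delay t f) → P (a ++ delay t f)) :
    ∀ᵐ es ∂listSum ((volume : Measure ℝ).prod μV), Increasing es → P es := by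
  have hB : MeasurableSet {es : List (ℝ × V) | Increasing es ∧ ¬ P es} :=
    measurableSet_increasing.inter hP.compl
  have h0 := lintegral_append_delay μV t (h := {es | Increasing es ∧ ¬ P es}.indicator 1)
    (measurable_one.indicator hB) fun es hes => (mem_of_indicator_ne_zero hes).1
  rw [lintegral_indicator_one hB] at h0
  have h1 : listSum ((volume : Measure ℝ).prod μV) {es : List (ℝ × V) | Increasing es ∧ ¬ P es} = 0 := by
    rw [← h0]
    refine (lintegral_congr_ae (g := fun _ => 0) ?_).trans lintegral_zero
    filter_upwards [h] with a ha
    refine (lintegral_congr (g := fun _ => 0) fun f => ?_).trans lintegral_zero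
    split_ifs with hc
    · exact indicator_of_notMem (fun hm => hm.2 (ha f hc.1 hc.2 hm.1)) _
    · rfl
  rw [ae_iff]
  refine (congrArg (listSum ((volume : Measure ℝ).prod μV)) (Set.ext fun es => ?_)).trans h1
  simp only [mem_ofPred_eq, Classical.not_imp]

/-- A property of the sequences of events up to time `p.2` that are cut at a time `t`. -/
theorem ae_ae_append_delay {D : List (ℝ × V) → ℝ → Prop}
    (hD : MeasurableSet {q : List (ℝ × V) × ℝ | D q.1 q.2})
    {Q : List (ℝ × V) × ℝ → ℝ → Prop}
    (hQ : MeasurableSet {q : (List (ℝ × V) × ℝ) × ℝ | Q q.1 q.2})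
    (hae : ∀ᵐ q ∂(listSum ((volume : Measure ℝ).prod μV)).prod (volume : Measure ℝ), D q.1 q.2)
    (h : ∀ a t T f, D a t → (∀ e ∈ a, e.1 < t) → (∀ e ∈ f, 0 < e.1) →
      Increasing (a ++ delay t f) → Q (a ++ delay t f, T) t)
    (hinc : ∀ q t, ¬ Increasing q.1 → Q q t) :
    ∀ᵐ q ∂(listSum ((volume : Measure ℝ).prod μV)).prod (volume : Measure ℝ), ∀ᵐ t : ℝ, Q q t := by
  rw [Measure.ae_ae_comm hQ]
  have h1 := (Measure.ae_ae_comm hD).1 (Measure.ae_ae_of_ae_prod hae)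
  filter_upwards [h1] with t ht
  have hQt : MeasurableSet {q : List (ℝ × V) × ℝ | Q q t} :=
    hQ.preimage (measurable_prodMk_right (y := t))
  rw [Measure.ae_prod_iff_ae_ae hQt, Measure.ae_ae_comm (p := fun es T => Q (es, T) t) hQt]
  refine Filter.Eventually.of_forall fun T => ?_
  have hP : MeasurableSet {es : List (ℝ × V) | Q (es, T) t} :=
    hQt.preimage (measurable_prodMk_right (y := T))
  have h2 : ∀ᵐ es ∂listSum ((volume : Measure ℝ).prod μV), Increasing es → Q (es, T) t := by
    refine ae_append_delay t hP ?_
    filter_upwards [ht] with a ha f h3 h4 h5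
    exact h a t T f ha h3 h4 h5
  filter_upwards [h2] with es h3
  by_cases hi : Increasing es
  · exact h3 hi
  · exact hinc _ _ hi

end AlmostEverywhere

/-! ### The density identity on paths without events and on paths that start with an event. -/

section TimeReversal

variable {E V Vr : Type*} [MeasurableSpace E] [MeasurableSpace V] [MeasurableSpace Vr]
  {μE : Measure E} {μV : Measure V} {μVr : Measure Vr} {X : PDMP E V μV} {Y : PDMP E Vr μVr}
  {R : Reversal X Y} {ψ : ℝ → Skeleton E Vr → ℝ≥0} {p : E → ℝ≥0}
  [SigmaFinite μE] [SigmaFinite μV] [SigmaFinite μVr]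

namespace Reversal

theorem measurableSet_isDensityReversal_apply (hψ : ContinuousVolumeChange R μE ψ)
    (hp : Measurable p) (T : ℝ) : MeasurableSet {w | R.IsDensityReversal ψ p T w} :=
  (measurableSet_isDensityReversal hψ hp).preimage (measurable_prodMk_left (x := T))

/-- The exceptional null set of backward paths is pulled back to forward paths by the volume change
formula applied to its indicator. -/
theorem ae_isDensityReversal_toRev (hψ : ContinuousVolumeChange R μE ψ) (hp : Measurable p)
    (hR : R.IsTimeReversal (μE.withDensity fun z => (p z : ℝ≥0∞))) {T : ℝ} (hT : 0 < T) :
    ∀ᵐ w ∂canonicalMeasure μE μV, w ∈ pathsIn E V (Ioo 0 T) →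
      R.IsDensityReversal ψ p T (R.toRev T w) := by
  have hI := measurableSet_pathsIn (E := E) (V := V) (measurableSet_Ioo (a := (0 : ℝ)) (b := T))
  have hI' := measurableSet_pathsIn (E := E) (V := Vr) (measurableSet_Ioo (a := (0 : ℝ)) (b := T))
  have hB := (measurableSet_isDensityReversal_apply hψ hp T).compl
  have h := hψ.change T hT.le _ (measurable_one.indicator hB)
  have h0 : ∫⁻ w in pathsIn E Vr (Ioo 0 T), {w | R.IsDensityReversal ψ p T w}ᶜ.indicator 1 w *
      (ψ T w : ℝ≥0∞) ∂canonicalMeasure μE μVr = 0 := by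
    rw [← lintegral_zero (μ := (canonicalMeasure μE μVr).restrict (pathsIn E Vr (Ioo 0 T)))]
    refine lintegral_congr_ae ?_
    filter_upwards [(ae_restrict_iff' hI').2 (ae_isDensityReversal hψ hp hR hT)] with w hw
    rw [indicator_of_notMem (by simpa using hw), zero_mul]
  rw [h0] at h
  have hm : Measurable fun w => {w | R.IsDensityReversal ψ p T w}ᶜ.indicator
      (1 : Skeleton E Vr → ℝ≥0∞) (R.toRev T w) :=
    (measurable_one.indicator hB).comp (R.measurable_toRev_apply T)
  rw [lintegral_eq_zero_iff hm] at h
  rw [← ae_restrict_iff' hI]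
  filter_upwards [h] with w hw
  by_contra hc
  rw [Pi.zero_apply, indicator_of_mem (show R.toRev T w ∈ {w | R.IsDensityReversal ψ p T w}ᶜ from hc)]
    at hw
  exact one_ne_zero hw

/-- The empty list is an atom of the measure on lists, so for almost every state the identity holds
for the eventless path itself. -/
theorem ae_isDensityReversal_nil (hψ : ContinuousVolumeChange R μE ψ) (hp : Measurable p)
    (hR : R.IsTimeReversal (μE.withDensity fun z => (p z : ℝ≥0∞))) :
    ∀ᵐ z ∂μE, ∀ᵐ t ∂volume.restrict (Ioi (0 : ℝ)), R.IsDensityReversal ψ p t (z, []) := by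
  have hm : Measurable fun q : E × ℝ => ((q.2, (q.1, [])) : ℝ × Skeleton E Vr) := by fun_prop
  rw [Measure.ae_ae_comm (p := fun z t => R.IsDensityReversal ψ p t (z, []))
    ((measurableSet_isDensityReversal hψ hp).preimage hm)]
  filter_upwards [ae_restrict_mem measurableSet_Ioi] with t ht
  have hI' := measurableSet_pathsIn (E := E) (V := Vr) (measurableSet_Ioo (a := (0 : ℝ)) (b := t))
  have h := ae_isDensityReversal hψ hp hR (mem_Ioi.1 ht)
  rw [canonicalMeasure_eq] at h
  filter_upwards [Measure.ae_ae_of_ae_prod h] with z hz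
  have hz' : Measurable fun es : List (ℝ × Vr) => (z, es) := measurable_prodMk_left
  have hset : MeasurableSet {es : List (ℝ × Vr) | (z, es) ∈ pathsIn E Vr (Ioo 0 t) →
      R.IsDensityReversal ψ p t (z, es)} := by
    have := ((hI'.preimage hz').compl).union
      ((measurableSet_isDensityReversal_apply hψ hp t).preimage hz')
    refine (congrArg MeasurableSet (Set.ext fun es => ?_)).mp this
    simp only [mem_union, mem_compl_iff, mem_preimage, mem_ofPred_eq, imp_iff_not_or]
  exact ae_listSum_nil hset hz (nil_mem_pathsIn z _)

/-- For a given path, the identity is known at almost every duration beyond its last event, not at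
the last event itself. The duration is written as the last event time plus t. -/
theorem ae_isDensityReversal_lastTime_add (hψ : ContinuousVolumeChange R μE ψ) (hp : Measurable p)
    (hR : R.IsTimeReversal (μE.withDensity fun z => (p z : ℝ≥0∞))) :
    ∀ᵐ w ∂(canonicalMeasure μE μVr).restrict (eventfulPaths E Vr),
      ∀ᵐ t ∂volume.restrict (Ioi (0 : ℝ)), R.IsDensityReversal ψ p (lastTime w.2 + t) w := by
  have hm : Measurable fun q : Skeleton E Vr × ℝ => ((q.2, q.1) : ℝ × Skeleton E Vr) := by fun_prop
  have hI : MeasurableSet {q : Skeleton E Vr × ℝ | q.1 ∈ pathsIn E Vr (Ioo 0 q.2)} := by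
    have := measurableSet_mem_pathsIn (E := E) (V := Vr) (S := ℝ) (I := fun T => Ioo 0 T)
      ((measurableSet_lt measurable_const measurable_snd).inter
        (measurableSet_lt measurable_snd measurable_fst))
    exact this.preimage hm
  have hset : MeasurableSet {q : Skeleton E Vr × ℝ | 0 < q.2 → q.1 ∈ pathsIn E Vr (Ioo 0 q.2) →
      R.IsDensityReversal ψ p q.2 q.1} := by
    have h0 : MeasurableSet {q : Skeleton E Vr × ℝ | 0 < q.2} :=
      measurableSet_lt measurable_const measurable_snd
    have := h0.compl.union (hI.compl.union ((measurableSet_isDensityReversal hψ hp).preimage hm))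
    refine (congrArg MeasurableSet (Set.ext fun q => ?_)).mp this
    simp only [mem_union, mem_compl_iff, mem_preimage, mem_ofPred_eq, imp_iff_not_or]
  have h1 : ∀ᵐ T : ℝ, ∀ᵐ w ∂canonicalMeasure μE μVr, 0 < T → w ∈ pathsIn E Vr (Ioo 0 T) →
      R.IsDensityReversal ψ p T w := by
    refine Filter.Eventually.of_forall fun T => ?_
    by_cases hT : 0 < T
    · filter_upwards [ae_isDensityReversal hψ hp hR hT] with w hw _ using hw
    · exact Filter.Eventually.of_forall fun w h => absurd h hT
  rw [← Measure.ae_ae_comm (p := fun w T => 0 < T → w ∈ pathsIn E Vr (Ioo 0 T) →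
      R.IsDensityReversal ψ p T w) hset] at h1
  rw [ae_restrict_iff' measurableSet_eventfulPaths]
  filter_upwards [h1] with w hw hev
  rw [ae_restrict_iff' measurableSet_Ioi]
  filter_upwards [(measurePreserving_add_left volume
    (lastTime w.2)).quasiMeasurePreserving.ae hw] with t ht ht0
  have hl := lastTime_pos_of_eventful hev
  refine ht (add_pos hl ht0) ⟨hev.2.1, fun e he => ⟨hev.2.2 e he, ?_⟩⟩
  linarith [le_lastTime hev.2.1 he, mem_Ioi.1 ht0]

/-- The reversed paths with an event at the final time have the density of the backward process. -/
theorem boundaryMap_density {v : V} {y : E} {a : List (ℝ × V)} {τ t : ℝ} (ht : 0 < t)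
    (h1 : R.IsDensityReversal ψ p (τ + t) (R.boundaryMap (v, y, a, τ)))
    (h2 : (ψ (τ + t) (R.boundaryMap (v, y, a, τ)) : ℝ≥0∞) =
      ψ τ (R.boundaryMap (v, y, a, τ)) * ψ t (y, []))
    (h3 : R.IsDensityReversal ψ p t (y, [])) :
    (p (R.boundaryMap (v, y, a, τ)).1 : ℝ≥0∞) *
        Y.pathDensity Y.exactRate τ (R.boundaryMap (v, y, a, τ)) =
      ψ τ (R.boundaryMap (v, y, a, τ)) * (p y * (X.rate y * X.markDensity y v *
        X.pathDensity X.exactRate τ (X.jump y v, a))) := by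
  -- The same backward skeleton is the reversal of a longer path, in which the initial event comes
  -- at time t. Only the duration τ + t differs.
  have hw : R.boundaryMap (v, y, a, τ) =
      R.toRev (τ + t) (X.flow (-t) y, (t, v) :: delay t a) := by
    rw [toRev_cons_delay, X.flow_flow_neg, add_sub_cancel_right]
  have hlast : lastTime (R.boundaryMap (v, y, a, τ)).2 = τ := R.lastTime_boundaryMap _
  have hY : Y.exactRate.survival (R.boundaryMap (v, y, a, τ)) t =
      Y.exactRate.survival (y, []) t := by
    refine PDMP.survival_exactRate_congr ?_ t
    have := R.stateAfterLast_boundaryMap (v, y, a, τ)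
    rw [stateAfterLast, toFwd, reversePath, PDMP.stateAt, PDMP.last_eq] at this
    rw [PDMP.last_nil, PDMP.last_eq]
    simpa [Y.flow_zero] using this
  rw [IsDensityReversal, h2] at h1
  rw [Y.pathDensity_eq, hlast, add_sub_cancel_left, hY] at h1
  rw [show R.toFwd (τ + t) (R.boundaryMap (v, y, a, τ)) = (X.flow (-t) y, (t, v) :: delay t a) by
    rw [hw, toFwd_toRev], PDMP.pathDensity_exactRate_cons ht] at h1
  rw [IsDensityReversal] at h3
  have hy : R.toFwd t (y, []) = (X.flow (-t) y, []) := by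
    rw [toFwd_eq, toRev_eq]
    simp [R.flow_eq]
  have e1 : X.pathDensity X.exactRate t (X.flow (-t) y, []) =
      X.exactRate.survival (X.flow (-t) y, []) t := by
    rw [X.pathDensity_eq]; simp [PDMP.eventsDensity]
  have e2 : Y.pathDensity Y.exactRate t (y, []) = Y.exactRate.survival (y, []) t := by
    rw [Y.pathDensity_eq]; simp [PDMP.eventsDensity]
  rw [hy, e1, e2] at h3
  have e3 : Y.pathDensity Y.exactRate τ (R.boundaryMap (v, y, a, τ)) =
      Y.eventsDensity Y.exactRate (R.boundaryMap (v, y, a, τ)).1 []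
        (R.boundaryMap (v, y, a, τ)).2 := by
    rw [Y.pathDensity_eq, hlast, sub_self, SimRate.survival_zero, mul_one]
  rw [e3]
  -- The common factor is the backward survival during t; it never vanishes, as cumulated rates are
  -- finite.
  refine (ENNReal.mul_left_inj (SimRate.survival_ne_zero Y.exactRate (y, []) t)
    (SimRate.survival_ne_top Y.exactRate (y, []) t)).1 ?_
  rw [mul_assoc, h1]
  calc _ = ψ τ (R.boundaryMap (v, y, a, τ)) * (ψ t (y, []) * (p (X.flow (-t) y) *
        X.exactRate.survival (X.flow (-t) y, []) t)) * (X.rate y * X.markDensity y v *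
          X.pathDensity X.exactRate τ (X.jump y v, a)) := by ring
    _ = _ := by rw [← h3]; ring

/-- Paths with an event at an extremity are null, so the identity cannot be read off there. Lengthen
almost every such path by some good t > 0 and use the identity for the longer path, the cocycle
relation and the identity for the eventless part. One good t suffices, as the conclusion does not
involve t. -/
theorem ae_boundaryMap_density (hψ : ContinuousVolumeChange R μE ψ) (hp : Measurable p)
    (hR : R.IsTimeReversal (μE.withDensity fun z => (p z : ℝ≥0∞))) :
    ∀ᵐ q ∂μV.prod (μE.prod ((listSum ((volume : Measure ℝ).prod μV)).prod (volume : Measure ℝ))),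
      q ∈ boundaryDomain E V →
      (p (R.boundaryMap q).1 : ℝ≥0∞) * Y.pathDensity Y.exactRate q.2.2.2 (R.boundaryMap q) =
        ψ q.2.2.2 (R.boundaryMap q) * (p q.2.1 * (X.rate q.2.1 * X.markDensity q.2.1 q.1 *
          X.pathDensity X.exactRate q.2.2.2 (X.jump q.2.1 q.1, q.2.2.1))) := by
  rw [← ae_restrict_iff' measurableSet_boundaryDomain]
  have h0 : ∀ᵐ w ∂(R.boundaryMeasure μE), ∀ᵐ t ∂volume.restrict (Ioi (0 : ℝ)),
      R.IsDensityReversal ψ p (lastTime w.2 + t) w ∧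
      (ψ (lastTime w.2 + t) w : ℝ≥0∞) = ψ (lastTime w.2) w * ψ t (R.stateAfterLast w, []) ∧
      R.IsDensityReversal ψ p t (R.stateAfterLast w, []) := by
    rw [boundaryMeasure_eq_withDensity hψ]
    refine (withDensity_absolutelyContinuous _ _).ae_le ?_
    filter_upwards [ae_isDensityReversal_lastTime_add hψ hp hR, ae_volumeChange_mul hψ,
      ae_stateAfterLast hψ (ae_isDensityReversal_nil hψ hp hR)] with w h1 h2 h3
    filter_upwards [h1, h2, h3] with t h1 h2 h3 using ⟨h1, h2, h3⟩
  filter_upwards [ae_of_ae_map R.measurable_boundaryMap.aemeasurable h0] with q hq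
  obtain ⟨v, y, a, τ⟩ := q
  have : Filter.NeBot (ae (volume.restrict (Ioi (0 : ℝ)))) :=
    ae_neBot.2 (by simp [Measure.restrict_eq_zero])
  obtain ⟨t, ⟨h1, h2, h3⟩, ht⟩ := (hq.and (ae_restrict_mem measurableSet_Ioi)).exists
  rw [R.lastTime_boundaryMap] at h1 h2
  rw [R.stateAfterLast_boundaryMap] at h2 h3
  exact boundaryMap_density ht h1 h2 h3

end Reversal

end TimeReversal

/-! ### For the exact rates, the weight is constant along almost every stopped path. -/

section ConstantWeight

variable {E V Vr : Type*} [MeasurableSpace E] [MeasurableSpace V] [MeasurableSpace Vr]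
  {μE : Measure E} {μV : Measure V} {μVr : Measure Vr} {X : PDMP E V μV} {Y : PDMP E Vr μVr}

namespace Sampler

variable {S : Sampler X Y}

/-- The constant c stands for the forward density of the part before l. The volume change of the
reversal cancels its inverse in the weight. -/
theorem weight_append_delay (hX : X.IsExact S.fwdRate) (hY : Y.IsExact S.bwdRate) {y : E}
    {a f : List (ℝ × V)} {l T : ℝ} (hal : ∀ e ∈ a, e.1 < l) (hf : ∀ e ∈ f, 0 < e.1) {c : ℝ≥0∞}
    (h0 : (S.volumeChange l (S.reversal.toRev l (y, a)) : ℝ≥0∞) ≠ 0)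
    (h : (S.target (S.reversal.toRev l (y, a)).1 : ℝ≥0∞) *
        Y.pathDensity Y.exactRate l (S.reversal.toRev l (y, a)) =
      S.volumeChange l (S.reversal.toRev l (y, a)) * c) :
    S.weight (y, a ++ delay l f) T l =
      c * X.pathDensity X.exactRate (T - l) (X.stateAt (y, a) l, f) := by
  have hp : X.position (y, a ++ delay l f) l = X.stateAt (y, a) l := by
    rw [PDMP.position, eventsIn_Iic_append_delay hal hf]
  rw [weight, hp, eventsIn_Iic_append_delay hal hf, eventsIn_Ioi_append_delay hal hf,
    hX.pathDensity_eq, hY.pathDensity_eq]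
  rw [show X.stateAt (y, a) l = (S.reversal.toRev l (y, a)).1 from rfl, h]
  calc _ = ((S.volumeChange l (S.reversal.toRev l (y, a)) : ℝ≥0∞) *
        (S.volumeChange l (S.reversal.toRev l (y, a)) : ℝ≥0∞)⁻¹) *
        (c * X.pathDensity X.exactRate (T - l) ((S.reversal.toRev l (y, a)).1, f)) := by ring
    _ = _ := by rw [ENNReal.mul_inv_cancel h0 ENNReal.coe_ne_top, one_mul]

theorem lastTime_le_of_forall {a : List (ℝ × V)} {l : ℝ} (hl : 0 ≤ l) (h : ∀ e ∈ a, e.1 ≤ l) :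
    lastTime a ≤ l := by
  rcases eq_or_ne a [] with rfl | hne
  · simpa using hl
  · obtain ⟨e, he, hel⟩ := exists_mem_lastTime hne
    exact hel ▸ h e he

variable [SigmaFinite μE] [SigmaFinite μV] [SigmaFinite μVr]

/-- The first two factors of the weight are, by time reversal, the target at the initial state times
the forward density on [0, l], once the volume change is cancelled. The Markov property joins this
with the density on [l, T], and l disappears. -/
theorem ae_weight_eventfulPaths (hS : S.IsMeasurable)
    (hψ : ContinuousVolumeChange S.reversal μE S.volumeChange)
    (hR : S.reversal.IsTimeReversal (μE.withDensity fun z => (S.target z : ℝ≥0∞)))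
    (hX : X.IsExact S.fwdRate) (hY : Y.IsExact S.bwdRate) :
    ∀ᵐ w ∂(canonicalMeasure μE μV).restrict (eventfulPaths E V),
      ∀ᵐ l ∂volume.restrict (Ioo 0 (lastTime w.2)), S.weight w (lastTime w.2) l =
        S.target w.1 * X.pathDensity X.exactRate (lastTime w.2) w := by
  have hw : Measurable fun q : Skeleton E V × ℝ => S.weight q.1 (lastTime q.1.2) q.2 := by
    have h : Measurable fun q : Skeleton E V × ℝ => (q.1, lastTime q.1.2, q.2) := by fun_prop
    have h' := hS.weight.comp h
    simp only [Function.comp_def] at h'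
    exact h'
  have hc1 : Measurable fun q : Skeleton E V × ℝ => (S.target q.1.1 : ℝ≥0∞) :=
    (hS.target.comp (by fun_prop)).coe_nnreal_ennreal
  have hc : Measurable fun q : Skeleton E V × ℝ =>
      S.target q.1.1 * X.pathDensity X.exactRate (lastTime q.1.2) q.1 :=
    hc1.mul (by fun_prop)
  have hI : MeasurableSet {q : Skeleton E V × ℝ |
      q.1 ∈ eventfulPaths E V ∧ q.2 ∈ Ioo 0 (lastTime q.1.2)} :=
    (measurableSet_eventfulPaths.preimage measurable_fst).inter
      ((measurableSet_lt measurable_const measurable_snd).inter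
        (measurableSet_lt measurable_snd (by fun_prop)))
  have hQ : MeasurableSet {q : Skeleton E V × ℝ |
      q.1 ∈ eventfulPaths E V ∧ q.2 ∈ Ioo 0 (lastTime q.1.2) →
        S.weight q.1 (lastTime q.1.2) q.2 =
          S.target q.1.1 * X.pathDensity X.exactRate (lastTime q.1.2) q.1} := by
    refine (congrArg MeasurableSet (Set.ext fun q => ?_)).mp
      (hI.compl.union (measurableSet_eq_fun hw hc))
    simp only [mem_union, mem_compl_iff, mem_ofPred_eq, imp_iff_not_or]
  have hIl : MeasurableSet {q : ℝ × Skeleton E V | q.2 ∈ pathsIn E V (Ioo 0 q.1)} :=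
    measurableSet_mem_pathsIn (E := E) (V := V) (S := ℝ) (I := fun T => Ioo 0 T)
      ((measurableSet_lt measurable_const measurable_snd).inter
        (measurableSet_lt measurable_snd measurable_fst))
  have hm : Measurable fun q : Skeleton E V × ℝ => (q.2, S.reversal.toRev q.2 q.1) := by fun_prop
  have hD : MeasurableSet {q : Skeleton E V × ℝ | 0 < q.2 ∧ q.1 ∈ pathsIn E V (Ioo 0 q.2) →
      S.reversal.IsDensityReversal S.volumeChange S.target q.2 (S.reversal.toRev q.2 q.1)} := by
    have hs : Measurable fun q : Skeleton E V × ℝ => (q.2, q.1) := by fun_prop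
    have h0 : MeasurableSet {q : Skeleton E V × ℝ | 0 < q.2} :=
      measurableSet_lt measurable_const measurable_snd
    refine (congrArg MeasurableSet (Set.ext fun q => ?_)).mp ((h0.inter (hIl.preimage hs)).compl.union
      ((Reversal.measurableSet_isDensityReversal hψ hS.target).preimage hm))
    simp only [mem_union, mem_compl_iff, mem_ofPred_eq, imp_iff_not_or, mem_inter_iff, mem_preimage]
  have h1 : ∀ᵐ w ∂canonicalMeasure μE μV, ∀ᵐ l : ℝ, 0 < l ∧ w ∈ pathsIn E V (Ioo 0 l) →
      S.reversal.IsDensityReversal S.volumeChange S.target l (S.reversal.toRev l w) := by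
    rw [Measure.ae_ae_comm (p := fun w l => 0 < l ∧ w ∈ pathsIn E V (Ioo 0 l) →
      S.reversal.IsDensityReversal S.volumeChange S.target l (S.reversal.toRev l w)) hD]
    refine Filter.Eventually.of_forall fun l => ?_
    by_cases hl : 0 < l
    · filter_upwards [Reversal.ae_isDensityReversal_toRev hψ hS.target hR hl] with w h1 h2
      exact h1 h2.2
    · exact Filter.Eventually.of_forall fun w h => absurd h.1 hl
  have h2 : ∀ᵐ w ∂canonicalMeasure μE μV, ∀ᵐ l : ℝ,
      w ∈ eventfulPaths E V ∧ l ∈ Ioo 0 (lastTime w.2) → S.weight w (lastTime w.2) l =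
        S.target w.1 * X.pathDensity X.exactRate (lastTime w.2) w := by
    rw [canonicalMeasure_eq] at h1 ⊢
    rw [Measure.ae_prod_iff_ae_ae (measurableSet_ae (Q := fun w l =>
      w ∈ eventfulPaths E V ∧ l ∈ Ioo 0 (lastTime w.2) → S.weight w (lastTime w.2) l =
        S.target w.1 * X.pathDensity X.exactRate (lastTime w.2) w) hQ)]
    filter_upwards [Measure.ae_ae_of_ae_prod h1] with y hy
    have hy1 : Measurable fun q : List (ℝ × V) × ℝ => (((y, q.1), q.2) : Skeleton E V × ℝ) := by
      fun_prop
    have hy2 : Measurable fun q : (List (ℝ × V) × ℝ) × ℝ =>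
        (((y, q.1.1), q.2) : Skeleton E V × ℝ) := by fun_prop
    have h3 := ae_ae_append_delay (μV := μV) (D := fun a l =>
        0 < l ∧ ((y, a) : Skeleton E V) ∈ pathsIn E V (Ioo 0 l) →
          S.reversal.IsDensityReversal S.volumeChange S.target l (S.reversal.toRev l (y, a)))
      (hD.preimage hy1) (Q := fun q l => ((y, q.1) : Skeleton E V) ∈ eventfulPaths E V ∧
        l ∈ Ioo 0 (lastTime q.1) → S.weight (y, q.1) (lastTime q.1) l =
          S.target y * X.pathDensity X.exactRate (lastTime q.1) (y, q.1))
      (hQ.preimage hy2) ((Measure.ae_prod_iff_ae_ae (hD.preimage hy1)).2 hy) ?_ ?_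
    · filter_upwards [Measure.ae_ae_of_ae_prod h3] with es hes
      obtain ⟨T, hT⟩ := hes.exists
      exact hT
    · rintro a l T f hD hal hf hi ⟨hev, hl⟩
      simp only at hev hl ⊢
      have hdel := hev.2.2
      have ha0 : ∀ e ∈ a, 0 < e.1 := fun e he => hdel e (List.mem_append_left _ he)
      obtain ⟨hai, -, -⟩ := increasing_append.1 hi
      have hmem : ((y, a) : Skeleton E V) ∈ pathsIn E V (Ioo 0 l) :=
        ⟨hai, fun e he => ⟨ha0 e he, hal e he⟩⟩
      have hrev : S.reversal.toRev l (y, a) ∈ pathsIn E Vr (Ioo 0 l) := by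
        rw [S.reversal.toRev_mem_pathsIn]
        refine ⟨hai, fun e he => ?_⟩
        have := hmem.2 e he
        exact ⟨by linarith [this.2], by linarith [this.1]⟩
      have h0 : (S.volumeChange l (S.reversal.toRev l (y, a)) : ℝ≥0∞) ≠ 0 :=
        Reversal.volumeChange_ne_zero hψ ⟨hrev.1, fun e he => (hrev.2 e he).1⟩
          (lastTime_le_of_forall hl.1.le fun e he => (hrev.2 e he).2.le)
      have h4 := hD ⟨hl.1, hmem⟩
      rw [Reversal.IsDensityReversal, S.reversal.toFwd_toRev] at h4
      rw [weight_append_delay hX hY hal hf h0 h4, mul_assoc,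
        ← PDMP.pathDensity_exactRate_append (lastTime_le_of_forall hl.1.le fun e he => (hal e he).le)
          (sub_nonneg.2 hl.2.le) hf rfl, add_sub_cancel]
    · rintro q l hi ⟨hev, -⟩
      exact absurd hev.2.1 hi
  rw [ae_restrict_iff' measurableSet_eventfulPaths]
  filter_upwards [h2] with w hw hev
  rw [ae_restrict_iff' measurableSet_Ioo]
  filter_upwards [hw] with l h hl using h ⟨hev, hl⟩

/-- Same computation with an event at time 0, whose density is the product of the rate and the mark
density there. The Markov property is applied to the path that starts after this jump. -/
theorem ae_weight_boundaryDomain (hS : S.IsMeasurable)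
    (hψ : ContinuousVolumeChange S.reversal μE S.volumeChange)
    (hR : S.reversal.IsTimeReversal (μE.withDensity fun z => (S.target z : ℝ≥0∞)))
    (hX : X.IsExact S.fwdRate) (hY : Y.IsExact S.bwdRate) :
    ∀ᵐ q ∂(μV.prod (μE.prod ((listSum ((volume : Measure ℝ).prod μV)).prod
        (volume : Measure ℝ)))).restrict (boundaryDomain E V),
      ∀ᵐ l ∂volume.restrict (Ioo 0 q.2.2.2), S.weight (startWith q) q.2.2.2 l =
        S.target q.2.1 * (X.rate q.2.1 * X.markDensity q.2.1 q.1 *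
          X.pathDensity X.exactRate q.2.2.2 (X.jump q.2.1 q.1, q.2.2.1)) := by
  have hw : Measurable fun q : (V × E × List (ℝ × V) × ℝ) × ℝ =>
      S.weight (startWith q.1) q.1.2.2.2 q.2 := by
    have h : Measurable fun q : (V × E × List (ℝ × V) × ℝ) × ℝ =>
      (startWith q.1, q.1.2.2.2, q.2) := by fun_prop
    have h' := hS.weight.comp h
    simp only [Function.comp_def] at h'
    exact h'
  have hc : Measurable fun q : V × E × List (ℝ × V) × ℝ =>
      (S.target q.2.1 : ℝ≥0∞) * (X.rate q.2.1 * X.markDensity q.2.1 q.1 *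
          X.pathDensity X.exactRate q.2.2.2 (X.jump q.2.1 q.1, q.2.2.1)) := by
    have j0 : Measurable fun q : V × E × List (ℝ × V) × ℝ => q.2.1 := by fun_prop
    have j1 : Measurable fun q : V × E × List (ℝ × V) × ℝ => (q.2.1, q.1) := by fun_prop
    have j2 : Measurable fun q : V × E × List (ℝ × V) × ℝ =>
      X.pathDensity X.exactRate q.2.2.2 (X.jump q.2.1 q.1, q.2.2.1) := by fun_prop
    exact (hS.target.comp j0).coe_nnreal_ennreal.mul
      (((X.measurable_rate.comp j0).coe_nnreal_ennreal.mul
        (X.measurable_markDensity.comp j1).coe_nnreal_ennreal).mul j2)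
  have hfst : Measurable fun q : (V × E × List (ℝ × V) × ℝ) × ℝ => q.1 := measurable_fst
  have hc' := hc.comp hfst
  simp only [Function.comp_def] at hc'
  have hI : MeasurableSet {q : (V × E × List (ℝ × V) × ℝ) × ℝ |
      q.1 ∈ boundaryDomain E V ∧ q.2 ∈ Ioo 0 q.1.2.2.2} :=
    (measurableSet_boundaryDomain.preimage measurable_fst).inter
      ((measurableSet_lt measurable_const measurable_snd).inter
        (measurableSet_lt measurable_snd (by fun_prop)))
  have hQ : MeasurableSet {q : (V × E × List (ℝ × V) × ℝ) × ℝ |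
      q.1 ∈ boundaryDomain E V ∧ q.2 ∈ Ioo 0 q.1.2.2.2 →
        S.weight (startWith q.1) q.1.2.2.2 q.2 =
          S.target q.1.2.1 * (X.rate q.1.2.1 * X.markDensity q.1.2.1 q.1.1 *
            X.pathDensity X.exactRate q.1.2.2.2 (X.jump q.1.2.1 q.1.1, q.1.2.2.1))} := by
    refine (congrArg MeasurableSet (Set.ext fun q => ?_)).mp
      (hI.compl.union (measurableSet_eq_fun hw hc'))
    simp only [mem_union, mem_compl_iff, mem_ofPred_eq, imp_iff_not_or]
  have hD : MeasurableSet {q : V × E × List (ℝ × V) × ℝ | q ∈ boundaryDomain E V →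
      (S.target (S.reversal.boundaryMap q).1 : ℝ≥0∞) *
        Y.pathDensity Y.exactRate q.2.2.2 (S.reversal.boundaryMap q) =
      S.volumeChange q.2.2.2 (S.reversal.boundaryMap q) *
        (S.target q.2.1 * (X.rate q.2.1 * X.markDensity q.2.1 q.1 *
          X.pathDensity X.exactRate q.2.2.2 (X.jump q.2.1 q.1, q.2.2.1)))} := by
    have h1 : Measurable fun q : V × E × List (ℝ × V) × ℝ =>
        (S.target (S.reversal.boundaryMap q).1 : ℝ≥0∞) *
          Y.pathDensity Y.exactRate q.2.2.2 (S.reversal.boundaryMap q) := by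
      have j0 : Measurable fun q : V × E × List (ℝ × V) × ℝ => (S.reversal.boundaryMap q).1 := by
        fun_prop
      exact (hS.target.comp j0).coe_nnreal_ennreal.mul (by fun_prop)
    have h2 : Measurable fun q : V × E × List (ℝ × V) × ℝ =>
        (q.2.2.2, S.reversal.boundaryMap q) := by fun_prop
    refine (congrArg MeasurableSet (Set.ext fun q => ?_)).mp
      (measurableSet_boundaryDomain.compl.union (measurableSet_eq_fun h1
        ((hS.volumeChange.comp h2).coe_nnreal_ennreal.mul hc)))
    simp only [mem_union, mem_compl_iff, mem_ofPred_eq, imp_iff_not_or, Function.comp_apply,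
      Pi.mul_apply]
  have h2 : ∀ᵐ q ∂μV.prod (μE.prod ((listSum ((volume : Measure ℝ).prod μV)).prod
        (volume : Measure ℝ))), ∀ᵐ l : ℝ, q ∈ boundaryDomain E V ∧ l ∈ Ioo 0 q.2.2.2 →
      S.weight (startWith q) q.2.2.2 l =
        S.target q.2.1 * (X.rate q.2.1 * X.markDensity q.2.1 q.1 *
          X.pathDensity X.exactRate q.2.2.2 (X.jump q.2.1 q.1, q.2.2.1)) := by
    have hQ' := measurableSet_ae (ν := (volume : Measure ℝ)) (Q := fun q l =>
      q ∈ boundaryDomain E V ∧ l ∈ Ioo 0 q.2.2.2 → S.weight (startWith q) q.2.2.2 l =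
        S.target q.2.1 * (X.rate q.2.1 * X.markDensity q.2.1 q.1 *
          X.pathDensity X.exactRate q.2.2.2 (X.jump q.2.1 q.1, q.2.2.1))) hQ
    rw [Measure.ae_prod_iff_ae_ae hQ']
    filter_upwards [Measure.ae_ae_of_ae_prod
      (Reversal.ae_boundaryMap_density hψ hS.target hR)] with v hv
    have hv' : Measurable fun q : E × List (ℝ × V) × ℝ => (v, q) := measurable_prodMk_left
    refine (Measure.ae_prod_iff_ae_ae (hQ'.preimage hv')).2 ?_
    filter_upwards [Measure.ae_ae_of_ae_prod hv] with y hy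
    have hy1 : Measurable fun q : List (ℝ × V) × ℝ => (v, y, q) := by fun_prop
    have hy2 : Measurable fun q : (List (ℝ × V) × ℝ) × ℝ => ((v, y, q.1), q.2) := by fun_prop
    refine ae_ae_append_delay (μV := μV) (D := fun a l => (v, y, a, l) ∈ boundaryDomain E V →
      (S.target (S.reversal.boundaryMap (v, y, a, l)).1 : ℝ≥0∞) *
        Y.pathDensity Y.exactRate l (S.reversal.boundaryMap (v, y, a, l)) =
      S.volumeChange l (S.reversal.boundaryMap (v, y, a, l)) *
        (S.target y * (X.rate y * X.markDensity y v *
          X.pathDensity X.exactRate l (X.jump y v, a))))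
      (hD.preimage hy1) (hQ.preimage hy2) hy ?_ ?_
    · rintro a l T f hD hal hf hi ⟨hq, hl⟩
      simp only at hq hl ⊢
      have ha0 : ∀ e ∈ a, 0 < e.1 := fun e he => (hq.2.2 e (List.mem_append_left _ he)).1
      obtain ⟨hai, -, -⟩ := increasing_append.1 hi
      have hmem : (v, y, a, l) ∈ boundaryDomain E V :=
        ⟨hl.1, hai, fun e he => ⟨ha0 e he, hal e he⟩⟩
      have hal' : ∀ e ∈ (0, v) :: a, e.1 < l := by
        intro e he
        rcases List.mem_cons.1 he with rfl | he
        · exact hl.1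
        · exact hal e he
      have hev := S.reversal.boundaryMap_mem_eventfulPaths hmem
      have h0 : (S.volumeChange l (S.reversal.boundaryMap (v, y, a, l)) : ℝ≥0∞) ≠ 0 :=
        Reversal.volumeChange_ne_zero hψ hev.2 (S.reversal.lastTime_boundaryMap (v, y, a, l)).le
      have hst : X.stateAt (y, (0, v) :: a) l = X.stateAt (X.jump y v, a) l := by
        rw [X.stateAt_eq, X.stateAt_eq]
        simp [PDMP.hop, X.flow_zero]
      have := weight_append_delay hX hY (T := T) hal' hf h0 (hD hmem)
      rw [startWith, ← List.cons_append, this, hst, mul_assoc, mul_assoc,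
        ← PDMP.pathDensity_exactRate_append (lastTime_le_of_forall hl.1.le fun e he => (hal e he).le)
          (sub_nonneg.2 hl.2.le) hf rfl, add_sub_cancel]
    · rintro q l hi ⟨hq, -⟩
      exact absurd hq.2.1 hi
  rw [ae_restrict_iff' measurableSet_boundaryDomain]
  filter_upwards [h2] with q hw hq
  rw [ae_restrict_iff' measurableSet_Ioo]
  filter_upwards [hw] with l h hl using h ⟨hq, hl⟩

end Sampler

end ConstantWeight

/-! ### Proposals are accepted with probability one. -/

section Acceptance

variable {E V Vr : Type*} [MeasurableSpace E] [MeasurableSpace V] [MeasurableSpace Vr]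
  {μE : Measure E} {μV : Measure V} {μVr : Measure Vr} {X : PDMP E V μV} {Y : PDMP E Vr μVr}

namespace Sampler

variable {S : Sampler X Y}

/-- The integral of the rejection probability over the offsets, up to the density of the
proposal. -/
def rejection (S : Sampler X Y) (p : Skeleton E V × ℝ × ℝ) : ℝ≥0∞ :=
  ∫⁻ l' in Icc 0 p.2.1, (1 - min 1 (S.weight p.1 p.2.1 l' / S.weight p.1 p.2.1 p.2.2))

theorem measurable_rejection (hS : S.IsMeasurable) : Measurable S.rejection := by
  unfold rejection
  simp_rw [← lintegral_indicator measurableSet_Icc]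
  refine Measurable.lintegral_prod_right' (f := fun q : (Skeleton E V × ℝ × ℝ) × ℝ =>
    (Icc 0 q.1.2.1).indicator (fun l' =>
      1 - min 1 (S.weight q.1.1 q.1.2.1 l' / S.weight q.1.1 q.1.2.1 q.1.2.2)) q.2) ?_
  have i1 : Measurable fun q : (Skeleton E V × ℝ × ℝ) × ℝ => (q.1.1, q.1.2.1, q.2) := by fun_prop
  have h1 := hS.weight.comp i1
  have i2 : Measurable fun q : (Skeleton E V × ℝ × ℝ) × ℝ => q.1 := measurable_fst
  have h2 := hS.weight.comp i2
  simp only [Function.comp_def] at h1 h2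
  have h3 : Measurable fun q : (Skeleton E V × ℝ × ℝ) × ℝ =>
      1 - min 1 (S.weight q.1.1 q.1.2.1 q.2 / S.weight q.1.1 q.1.2.1 q.1.2.2) := by fun_prop
  have hset : MeasurableSet {q : (Skeleton E V × ℝ × ℝ) × ℝ | q.2 ∈ Icc 0 q.1.2.1} :=
    (measurableSet_le measurable_const measurable_snd).inter
      (measurableSet_le measurable_snd (by fun_prop))
  exact h3.indicator hset

theorem rejection_eq_zero_iff (hS : S.IsMeasurable) (p : Skeleton E V × ℝ × ℝ) :
    S.rejection p = 0 ↔ ∀ᵐ l' ∂volume.restrict (Icc 0 p.2.1),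
      min 1 (S.weight p.1 p.2.1 l' / S.weight p.1 p.2.1 p.2.2) = 1 := by
  have hw := measurable_weight_apply hS p.1 p.2.1
  rw [rejection, lintegral_eq_zero_iff (by fun_prop)]
  refine Filter.eventually_congr (Filter.Eventually.of_forall fun l' => ?_)
  rw [Pi.zero_apply, tsub_eq_zero_iff_le]
  exact ⟨fun h => le_antisymm (min_le_left _ _) h, fun h => h.ge⟩

/-- If the constant c is nonzero, the ratio of weights is 1 for almost every proposal. If c = 0, the
ratio is not 1, but the weight in front is zero. -/
theorem lintegral_weight_rejection (hS : S.IsMeasurable) {w : Skeleton E V} {T : ℝ} {c : ℝ≥0∞}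
    (hc : c ≠ ∞) (h : ∀ᵐ l ∂volume.restrict (Ioo 0 T), S.weight w T l = c) (d : ℝ → ℝ≥0∞) :
    ∫⁻ l in Ioo 0 T, S.weight w T l * d l * S.rejection (w, T, l) = 0 := by
  have h' : ∀ᵐ l ∂volume.restrict (Icc 0 T), S.weight w T l = c := by
    rwa [← Measure.restrict_congr_set (μ := (volume : Measure ℝ)) Ioo_ae_eq_Icc]
  rw [← lintegral_zero (μ := volume.restrict (Ioo 0 T))]
  refine lintegral_congr_ae ?_
  filter_upwards [h] with l hl
  rw [hl]
  by_cases h0 : c = 0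
  · rw [h0, zero_mul, zero_mul]
  · have : S.rejection (w, T, l) = 0 := by
      rw [rejection_eq_zero_iff hS]
      filter_upwards [h'] with l' hl'
      simp only [hl', hl, ENNReal.div_self h0 hc, min_self]
    rw [this, mul_zero]

variable [SigmaFinite μV] [SigmaFinite μVr]

theorem acceptance_eq_one_of_rejection_eq_zero (hS : S.IsMeasurable) {s : Draw E V Vr}
    (hs : S.DownClosed s) (h : S.rejection (S.stopped s) = 0) :
    ∀ᵐ l' ∂S.proposal s, S.acceptance s l' = 1 := by
  rw [rejection_eq_zero_iff hS] at h
  rw [proposal]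
  refine (withDensity_absolutelyContinuous _ _).ae_le ?_
  rw [show (S.stopped s).2.1 = S.length s from (length_eq hs).symm] at h
  filter_upwards [h] with l' h
  rw [length_eq hs] at h
  rw [acceptance, path, offset, length_eq hs]
  exact h

variable [SigmaFinite μE]

theorem ae_indicator_eq_zero (hS : S.IsMeasurable) {A : Set (Draw E V Vr)} (hA : MeasurableSet A)
    (h : ∫⁻ z, S.target z * ∫⁻ s, A.indicator (fun s => S.rejection (S.stopped s)) s
      ∂S.drawLaw z ∂μE = 0) :
    ∀ᵐ z ∂(μE.withDensity fun z => (S.target z : ℝ≥0∞)), ∀ᵐ s ∂S.drawLaw z,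
      s ∈ A → S.rejection (S.stopped s) = 0 := by
  have hG : Measurable fun s => S.rejection (S.stopped s) :=
    (measurable_rejection hS).comp (measurable_stopped hS)
  have hI := hG.indicator hA
  have ht := hS.target.coe_nnreal_ennreal
  have hm : Measurable fun z => ∫⁻ s, A.indicator (fun s => S.rejection (S.stopped s)) s
      ∂S.drawLaw z := hI.lintegral_kernel
  rw [ae_withDensity_iff ht]
  filter_upwards [(lintegral_eq_zero_iff (ht.mul hm)).1 h] with z hz h0
  have h1 := (mul_eq_zero.1 hz).resolve_left h0
  filter_upwards [(lintegral_eq_zero_iff hI).1 h1] with s h2 hsA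
  rwa [Pi.zero_apply, indicator_of_mem hsA] at h2

/-- The law of the stopped path turns the expected rejection into an integral over whole paths,
where the weight is almost everywhere constant in the offset. -/
theorem ae_rejection_eq_zero (hS : S.IsMeasurable) (hc : X.IsConsistent S.criterion)
    (he : X.DependsOnlyOnEvents S.criterion)
    (hψ : ContinuousVolumeChange S.reversal μE S.volumeChange)
    (hR : S.reversal.IsTimeReversal (μE.withDensity fun z => (S.target z : ℝ≥0∞)))
    (hX : X.IsExact S.fwdRate) (hY : Y.IsExact S.bwdRate) :
    ∀ᵐ z ∂(μE.withDensity fun z => (S.target z : ℝ≥0∞)), ∀ᵐ s ∂S.drawLaw z,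
      S.Stops' s → S.rejection (S.stopped s) = 0 := by
  have hG := measurable_rejection hS
  have hs' := measurableSet_stops' hS
  have hh' := measurableSet_hitForward' hS
  have hF : ∫⁻ z, S.target z * ∫⁻ s, {s | S.Stops' s ∧ S.HitForward' s}.indicator
      (fun s => S.rejection (S.stopped s)) s ∂S.drawLaw z ∂μE = 0 := by
    rw [lintegral_stopped_forward hS hc he hψ hG]
    rw [← lintegral_zero (μ := (canonicalMeasure μE μV).restrict S.fwdStopped)]
    refine lintegral_congr_ae ?_
    filter_upwards [ae_mono (Measure.restrict_mono_set _ (s := S.fwdStopped)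
      (t := eventfulPaths E V) fun w hw => hw.1)
      (ae_weight_eventfulPaths hS hψ hR hX hY)] with w hw
    exact lintegral_weight_rejection hS
      (ENNReal.mul_ne_top ENNReal.coe_ne_top (X.pathDensity_ne_top _ _ _)) hw _
  have hB : ∫⁻ z, S.target z * ∫⁻ s, {s | S.Stops' s ∧ ¬ S.HitForward' s}.indicator
      (fun s => S.rejection (S.stopped s)) s ∂S.drawLaw z ∂μE = 0 := by
    rw [lintegral_stopped_backward hS hc he hψ hG]
    rw [← lintegral_zero (μ := (μV.prod (μE.prod ((listSum ((volume : Measure ℝ).prod μV)).prod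
      (volume : Measure ℝ)))).restrict S.bwdStopped)]
    refine lintegral_congr_ae ?_
    filter_upwards [ae_mono (Measure.restrict_mono_set _ (s := S.bwdStopped)
      (t := boundaryDomain E V) fun w hw => hw.1)
      (ae_weight_boundaryDomain hS hψ hR hX hY)] with q hq
    exact lintegral_weight_rejection hS (ENNReal.mul_ne_top ENNReal.coe_ne_top
      (ENNReal.mul_ne_top (ENNReal.mul_ne_top ENNReal.coe_ne_top ENNReal.coe_ne_top)
        (X.pathDensity_ne_top _ _ _))) hq _
  filter_upwards [ae_indicator_eq_zero hS (hs'.inter hh') hF,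
    ae_indicator_eq_zero hS (hs'.inter hh'.compl) hB] with z h1 h2
  filter_upwards [h1, h2] with s h1 h2 h
  by_cases hh : S.HitForward' s
  · exact h1 ⟨h, hh⟩
  · exact h2 ⟨h, hh⟩

/-- Passes from almost every refreshed state to almost every input state, by invariance of the
target under the refreshment. -/
theorem ae_acceptance_comp (hS : S.IsMeasurable) (hc : X.IsConsistent S.criterion)
    (he : X.DependsOnlyOnEvents S.criterion)
    (hψ : ContinuousVolumeChange S.reversal μE S.volumeChange)
    (hR : S.reversal.IsTimeReversal (μE.withDensity fun z => (S.target z : ℝ≥0∞)))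
    (hX : X.IsExact S.fwdRate) (hY : Y.IsExact S.bwdRate) {η : Kernel E E}
    (hη : η.Invariant (μE.withDensity fun z => (S.target z : ℝ≥0∞))) :
    ∀ᵐ z ∂(μE.withDensity fun z => (S.target z : ℝ≥0∞)), ∀ᵐ s ∂((S.drawLaw ∘ₖ η) z), S.Stops s →
      ∀ᵐ l' ∂(S.proposal s), S.acceptance s l' = 1 := by
  have hG : Measurable fun s => S.rejection (S.stopped s) :=
    (measurable_rejection hS).comp (measurable_stopped hS)
  have hB : MeasurableSet {s | ¬ (S.Stops' s → S.rejection (S.stopped s) = 0)} := by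
    have := (measurableSet_stops' hS).inter (hG (measurableSet_singleton (0 : ℝ≥0∞)).compl)
    refine (congrArg MeasurableSet (Set.ext fun s => ?_)).mp this
    simp only [mem_inter_iff, mem_ofPred_eq, mem_preimage, mem_compl_iff, mem_singleton_iff,
      Classical.not_imp]
  have h0 := ae_rejection_eq_zero hS hc he hψ hR hX hY
  have h1 : ∫⁻ z, S.drawLaw z {s | ¬ (S.Stops' s → S.rejection (S.stopped s) = 0)}
      ∂(μE.withDensity fun z => (S.target z : ℝ≥0∞)) = 0 := by
    rw [lintegral_eq_zero_iff (S.drawLaw.measurable_coe hB)]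
    exact h0
  -- The target is rewritten as its image by η, so the probability of a bad draw is averaged over
  -- refreshed states issued from inputs with law π.
  rw [← hη.def, Measure.lintegral_bind η.aemeasurable (S.drawLaw.measurable_coe hB).aemeasurable,
    lintegral_eq_zero_iff (S.drawLaw.measurable_coe hB).lintegral_kernel] at h1
  filter_upwards [h1] with z hz
  have h2 : ∀ᵐ s ∂((S.drawLaw ∘ₖ η) z), S.Stops' s → S.rejection (S.stopped s) = 0 := by
    rw [ae_iff, Kernel.comp_apply' _ _ _ hB]
    exact hz
  filter_upwards [h2, ae_downClosed (isDraw_bind S η z) hS hc] with s h3 h4 h5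
  exact acceptance_eq_one_of_rejection_eq_zero hS h4 (h3 ((stops_iff' h4).1 h5))

end Sampler

end Acceptance

end

end PathSampler

/-! ### The theorem. -/

open PathSampler in
theorem mainTheorem4
    {P U V Vr : Type*} [MeasurableSpace P] [MeasurableSpace U] [MeasurableSpace V]
    [MeasurableSpace Vr] [TopologicalSpace P] [TopologicalSpace U] [TopologicalSpace Vr]
    (μP : Measure P) (μU : Measure U) (μV : Measure V) (μVr : Measure Vr)
    [SigmaFinite μP] [SigmaFinite μU] [SigmaFinite μV] [SigmaFinite μVr]
    (X : PDMP (P × U) V μV) (Y : PDMP (P × U) Vr μVr) (S : Sampler X Y)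
    -- the reversal `R_t` is continuous in `t`
    (hR_cont : ∀ w ∈ pathsIn (P × U) V (Set.Ioi 0),
      ContinuousOn (fun t => S.reversal.toRev t w) (Set.Ici (lastTime w.2)))
    -- its volume change exists, and is continuous in `t`
    (hψ_meas : Measurable fun p : ℝ × Skeleton (P × U) Vr => S.volumeChange p.1 p.2)
    (hψ_pos : ∀ T, ∀ w ∈ pathsIn (P × U) Vr (Set.Ioc 0 T), 0 ≤ T → 0 < S.volumeChange T w)
    (hψ : S.reversal.IsVolumeChange (μP.prod μU) S.volumeChange)
    (hψ_cont : ∀ w ∈ pathsIn (P × U) Vr (Set.Ioi 0),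
      ContinuousOn (fun t => S.volumeChange t w) (Set.Ici (lastTime w.2)))
    -- the target distribution `π` has the density `S.target`
    (hπ_meas : Measurable S.target)
    (hπ_one : ∫⁻ z, (S.target z : ℝ≥0∞) ∂(μP.prod μU) = 1)
    (π : Measure (P × U))
    (hπ : π = (μP.prod μU).withDensity fun z => (S.target z : ℝ≥0∞))
    -- the stopping criterion
    (hcrit_meas : MeasurableSet {p : Skeleton (P × U) V × ℝ | S.criterion p.1 p.2})
    (hcrit_cons : X.IsConsistent S.criterion)
    (hcrit_events : X.DependsOnlyOnEvents S.criterion)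
    -- the refreshment of the velocity
    (ρ : Kernel (P × U) U) [IsMarkovKernel ρ] (hρ : IsRefreshment ρ π) :
    -- the algorithm defines a Markov chain that leaves `π` invariant
    (∃ K : Kernel (P × U) (P × U), IsMarkovKernel K ∧ (∀ z, K z = doublyAdaptive S ρ z) ∧
      K.Invariant π) ∧
    -- for the exact process with `π` invariant, the acceptance probability is one
    (X.IsInvariant π → S.reversal.IsTimeReversal π → X.IsExact S.fwdRate → Y.IsExact S.bwdRate →
      ∀ᵐ z ∂π, ∀ᵐ s ∂((S.drawLaw ∘ₖ refreshKernel ρ) z), S.Stops s →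
        ∀ᵐ l' ∂(S.proposal s), S.acceptance s l' = 1) := by
  subst hπ
  have hS : S.IsMeasurable := ⟨hψ_meas, hπ_meas, hcrit_meas⟩
  have hψ' : ContinuousVolumeChange S.reversal (μP.prod μU) S.volumeChange :=
    ⟨hψ_meas, hψ_pos, hψ, hψ_cont⟩
  have : IsMarkovKernel (refreshKernel ρ) := by unfold refreshKernel; infer_instance
  refine ⟨⟨S.outputKernel hS ∘ₖ (S.drawLaw ∘ₖ refreshKernel ρ), inferInstance, fun z => ?_, ?_⟩,
    fun _ hR hX hY => ?_⟩
  · rw [doublyAdaptive, Sampler.bind_outputLaw hS hcrit_cons (Sampler.isDraw_bind S (refreshKernel ρ) z),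
      Kernel.comp_apply]
  · rw [← Kernel.comp_assoc]
    exact (Sampler.invariant_outputKernel hS hcrit_cons hcrit_events hψ').comp hρ
  · exact Sampler.ae_acceptance_comp hS hcrit_cons hcrit_events hψ' hR hX hY hρ
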